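/- **Conventions.** A 2-category is strict, a 2-functor is strict, a pseudofunctor need not be strictly unital or strictly compatible with composition, and a pseudonatural transformation has invertible naturality 2-cells. $\mathrm{PsFun}(\mathcal C,\mathcal D)$ is the 2-category of pseudofunctors $\mathcal C\to\mathcal D$, pseudonatural transformations and modifications. An up-square in a 2-category consists of morphisms $j\colon X\to Y$ (top), $q\colon X\to Z$ (left), $i\colon Z\to W$ (bottom), $p\colon Y\to W$ (right) and a 2-cell $iq\Rightarrow pj$ (not necessarily invertible). **$n$-fold categories and $\mathbb Q^n\mathcal C$.** An $n$-fold category $\mathbb C$ consists of sets $\mathbb C(I)$ of $I$-morphisms for $I\subseteq\{1,\dots,n\}$, functorial on the $n$-th power of the category of $[0],[1]$ and order-preserving maps (so with faces and identities in each direction), with a composition in each direction $i\in I$ that is unital, associative, compatible with the functoriality, and such that compositions in different directions satisfy the interchange law. For $I=\emptyset,\{k\},\{k,l\}$ we speak of objects, morphisms in direction $k$, and squares. For a 2-category $\mathcal C$, the $I$-morphisms of $\mathbb Q^n\mathcal C$ are the $I$-hypercubes in $\mathcal C$ with 2-cells, i.e. the 2-functors $\gamma_I\to\mathcal C$, where $\gamma_I$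 has the subsets of $I$ as objects, the total orders on $b\setminus a$ as morphisms $a\to b$ if $a\subseteq b$ (and no morphisms otherwise), and a unique 2-cell $f\Rightarrow g$ exactly if every pair $i<j$ in $b\setminus a$ with $i>_fj$ satisfies $i>_gj$; in the composite of $f\colon a\to b$ and $g\colon b\to c$ every $i\in c\setminus b$ precedes every $j\in b\setminus a$. Equivalently, such a hypercube consists of its vertices, its edges, and an up-square for each two-dimensional face (with the smaller direction horizontal), such that all three-dimensional faces commute. Composition in direction $i$ is pasting. The objects of $\mathbb Q^n\mathcal C$ are the objects of $\mathcal C$ and its morphisms in each direction are the morphisms of $\mathcal C$. **Pseudofunctors on an $n$-fold category.** For an $n$-fold category $\mathbb C$ and a 2-category $\mathcal D$, the 2-category $\mathcal{P}s\mathrm{Fun}(\mathbb C,\mathcal D)$ is defined as follows. An object $F$ consists of pseudofunctors $F_k$ to $\mathcal D$ from the categories of objects and morphisms in direction $k$ of $\mathbb C$, $1\le k\le n$, that agree on objects, and for $k<l$ and every square $S$ in the directions $k$ (top $j$, bottom $i$) and $l$ (left $q$, right $p$), a 2-cell $G_S\colon F_k(i)F_l(q)\Rightarrow F_l(p)F_k(j)$,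 such that the six 2-cells of the faces of each three-dimensional cube of $\mathbb C$ form a commutative cube, $G_S$ is the 2-cell given by the unit constraints if $S$ is an identity square in direction $k$ or $l$, and $G$ is compatible with composition of squares in the directions $k$ and $l$ through the composition constraints of $F_k$ and $F_l$. A morphism $\mu\colon F\to F'$ consists of pseudonatural transformations $\mu_k\colon F_k\to F'_k$ with the same components $FX\to F'X$ on objects, such that for each square $S$ the cube with faces $G_S$, $G'_S$ and the naturality 2-cells at the four edges of $S$ commutes. A 2-cell is a family of 2-cells of $\mathcal D$, indexed by the objects of $\mathbb C$, that is a modification $\mu_k\Rightarrow\nu_k$ for every $k$. Composition is that of $\mathcal D$. **The functor $Q$.** The 2-functor $Q\colon\mathrm{PsFun}(\mathcal C,\mathcal D)\to\mathcal{P}s\mathrm{Fun}(\mathbb Q^n\mathcal C,\mathcal D)$ sends a pseudofunctor $F$ to the object with $F_k=F$ for all $k$ and with $G_S$, for an up-square $S=(\sigma\colon iq\Rightarrow pj)$, the composite $F(i)F(q)\simeq F(iq)\Rightarrow F(pj)\simeq F(p)F(j)$ of $F(\sigma)$ with the composition constraints; it sends a pseudonatural transformation $\mu$ to $(\mu,\dots,\mu)$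 and a modification to the same family of 2-cells. **Equivalences over a base.** Let $\mathcal E$ be a 2-category, and let $P\colon\mathcal A\to\mathcal E$ and $R\colon\mathcal B\to\mathcal E$ be 2-functors. An $\mathcal E$-functor $(\mathcal A,P)\to(\mathcal B,R)$ is a 2-functor $G\colon\mathcal A\to\mathcal B$ with $RG=P$. A pseudonatural transformation between $\mathcal E$-functors is an $\mathcal E$-natural transformation if the functor to $\mathcal E$ sends its components and its naturality 2-cells to identities; a modification between such transformations is an $\mathcal E$-modification if the functor to $\mathcal E$ sends its components to identities. An $\mathcal E$-natural equivalence is an $\mathcal E$-natural transformation $\alpha$ for which there are an $\mathcal E$-natural transformation $\beta$ in the other direction and invertible $\mathcal E$-modifications from $\alpha\beta$ and $\beta\alpha$ to the identities. An $\mathcal E$-functor $G\colon(\mathcal A,P)\to(\mathcal B,R)$ is an $\mathcal E$-equivalence if there are an $\mathcal E$-functor $H\colon(\mathcal B,R)\to(\mathcal A,P)$ and $\mathcal E$-natural equivalences $\mathbf 1_{\mathcal B}\Rightarrow GH$ and $HG\Rightarrow\mathbf 1_{\mathcal A}$. **Statement.** Let $\mathcal C$ and $\mathcal D$ be 2-categories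 and let $n\ge2$. Let $\mathcal D^{\mathrm{Ob}(\mathcal C)}$ be the power of $\mathcal D$, with pointwise structure, and view $\mathrm{PsFun}(\mathcal C,\mathcal D)$ and $\mathcal{P}s\mathrm{Fun}(\mathbb Q^n\mathcal C,\mathcal D)$ as 2-categories over it by restriction to objects. Then $$Q\colon\mathrm{PsFun}(\mathcal C,\mathcal D)\to\mathcal{P}s\mathrm{Fun}(\mathbb Q^n\mathcal C,\mathcal D)$$ is a $\mathcal D^{\mathrm{Ob}(\mathcal C)}$-equivalence. -/

import Mathlib

open CategoryTheory Bicategory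

universe w v u w₁ v₁ u₁ w₂ v₂ u₂ t

set_option linter.all false

section UpSquares

variable {C : Type u} [Bicategory.{w, v} C]

/-- An up-square in a 2-category: a square with edges `top`, `left`, `bottom`, `right` and a
2-cell `left ≫ bottom ⟶ top ≫ right` (composites in diagrammatic order). -/
structure UpSquare (X Y Z W : C) where
  top : X ⟶ Y
  left : X ⟶ Z
  bottom : Z ⟶ W
  right : Y ⟶ W
  cell : left ≫ bottom ⟶ top ≫ right

/-- Horizontal pasting of 2-cells of up-squares. -/
def pasteH {X Y Y' Z W W' : C} {q : X ⟶ Z} {i : Z ⟶ W} {j : X ⟶ Y} {p : Y ⟶ W}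
    {i' : W ⟶ W'} {j' : Y ⟶ Y'} {r : Y' ⟶ W'} (σ : q ≫ i ⟶ j ≫ p) (τ : p ≫ i' ⟶ j' ≫ r) :
    q ≫ i ≫ i' ⟶ (j ≫ j') ≫ r :=
  (α_ q i i').inv ≫ σ ▷ i' ≫ (α_ j p i').hom ≫ j ◁ τ ≫ (α_ j j' r).inv

/-- Vertical pasting of 2-cells of up-squares. -/
def pasteV {X Y Z W Z' W' : C} {q : X ⟶ Z} {i : Z ⟶ W} {j : X ⟶ Y} {p : Y ⟶ W}
    {q' : Z ⟶ Z'} {i' : Z' ⟶ W'} {p' : W ⟶ W'} (σ : q ≫ i ⟶ j ≫ p) (τ : q' ≫ i' ⟶ i ≫ p') :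
    (q ≫ q') ≫ i' ⟶ j ≫ p ≫ p' :=
  (α_ q q' i').hom ≫ q ◁ τ ≫ (α_ q i p').inv ≫ σ ▷ p' ≫ (α_ j p p').hom

namespace UpSquare

/-- Horizontal composition of up-squares. -/
def hcomp {X Y Y' Z W W' : C} (A : UpSquare X Y Z W) (B : UpSquare Y Y' W W')
    (h : B.left = A.right) : UpSquare X Y' Z W' where
  top := A.top ≫ B.top
  left := A.left
  bottom := A.bottom ≫ B.bottom
  right := B.right
  cell := pasteH A.cell (eqToHom (by rw [h]) ≫ B.cell)

/-- Vertical composition of up-squares. -/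
def vcomp {X Y Z W Z' W' : C} (A : UpSquare X Y Z W) (B : UpSquare Z W Z' W')
    (h : B.top = A.bottom) : UpSquare X Y Z' W' where
  top := A.top
  left := A.left ≫ B.left
  bottom := B.bottom
  right := A.right ≫ B.right
  cell := pasteV A.cell (B.cell ≫ eqToHom (by rw [h]))

/-- The identity up-square on a vertical edge. -/
def hid {X Z : C} (f : X ⟶ Z) : UpSquare X X Z Z where
  top := 𝟙 X
  left := f
  bottom := 𝟙 Z
  right := f
  cell := (ρ_ f).hom ≫ (λ_ f).inv

/-- The identity up-square on a horizontal edge. -/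
def vid {X Y : C} (f : X ⟶ Y) : UpSquare X Y X Y where
  top := f
  left := 𝟙 X
  bottom := f
  right := 𝟙 Y
  cell := (λ_ f).hom ≫ (ρ_ f).inv

theorem whiskerLeft_eq {X Y Z : C} (f : X ⟶ Y) {g h : Y ⟶ Z} {e : g ≅ h} {p : g = h}
    (he : e = eqToIso p) (q : f ≫ g = f ≫ h) : f ◁ e.hom = eqToHom q := by
  subst p
  simp [he]

theorem whiskerRight_eq {X Y Z : C} {g h : X ⟶ Y} {e : g ≅ h} {p : g = h}
    (he : e = eqToIso p) {f : Y ⟶ Z} (q : g ≫ f = h ≫ f) : e.hom ▷ f = eqToHom q := by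
  subst p
  simp [he]

theorem ext_cell {X Y Z W : C} {A B : UpSquare X Y Z W} (h₁ : A.top = B.top)
    (h₂ : A.left = B.left) (h₃ : A.bottom = B.bottom) (h₄ : A.right = B.right)
    (x : A.left ≫ A.bottom ⟶ B.left ≫ B.bottom) (y : A.top ≫ A.right ⟶ B.top ≫ B.right)
    (hx : x = eqToHom (by rw [h₂, h₃])) (hy : y = eqToHom (by rw [h₁, h₄]))
    (h : A.cell ≫ y = x ≫ B.cell) : A = B := by
  obtain ⟨t, l, b, r, c⟩ := A
  obtain ⟨t', l', b', r', c'⟩ := B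
  obtain rfl : t = t' := h₁
  obtain rfl : l = l' := h₂
  obtain rfl : b = b' := h₃
  obtain rfl : r = r' := h₄
  subst hx hy
  simp at h
  rw [h]

theorem interchange {X₁ X₂ X₃ Y₁ Y₂ Y₃ Z₁ Z₂ Z₃ : C} (A : UpSquare X₁ X₂ Y₁ Y₂)
    (A' : UpSquare X₂ X₃ Y₂ Y₃) (B : UpSquare Y₁ Y₂ Z₁ Z₂) (B' : UpSquare Y₂ Y₃ Z₂ Z₃)
    (h₁ : A'.left = A.right) (h₂ : B'.left = B.right) (h₃ : B.top = A.bottom)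
    (h₄ : B'.top = A'.bottom) (h₅ h₆) :
    (A.hcomp A' h₁).vcomp (B.hcomp B' h₂) h₅ = (A.vcomp B h₃).hcomp (A'.vcomp B' h₄) h₆ := by
  obtain ⟨a₁, a₂, a₃, a₄, a⟩ := A
  obtain ⟨b₁, b₂, b₃, b₄, b⟩ := A'
  obtain ⟨c₁, c₂, c₃, c₄, c⟩ := B
  obtain ⟨d₁, d₂, d₃, d₄, d⟩ := B'
  obtain rfl : b₂ = a₄ := h₁
  obtain rfl : d₂ = c₄ := h₂
  obtain rfl : c₁ = a₃ := h₃
  obtain rfl : d₁ = b₃ := h₄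
  refine ext_cell rfl rfl rfl rfl (𝟙 _) (𝟙 _) rfl rfl ?_
  simp only [hcomp, vcomp, pasteH, pasteV, eqToHom_refl, Category.comp_id, Category.id_comp]
  calc _ = 𝟙 _ ⊗≫ a₂ ◁ c ▷ d₃ ⊗≫ ((a₂ ≫ c₁) ◁ d ≫ a ▷ (d₁ ≫ d₄)) ⊗≫ a₁ ◁ b ▷ d₄ ⊗≫ 𝟙 _ := by
        bicategory
    _ = _ := by
        rw [whisker_exchange]
        bicategory

variable [Strict C]

theorem hcomp_hid {X Y Z W : C} (A : UpSquare X Y Z W) :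
    A.hcomp (hid A.right) rfl = A := by
  obtain ⟨t, l, b, r, c⟩ := A
  refine ext_cell (Strict.comp_id _) rfl (Strict.comp_id _) rfl (l ◁ (ρ_ b).hom)
    ((ρ_ t).hom ▷ r) (whiskerLeft_eq _ (Strict.rightUnitor_eqToIso _) _)
    (whiskerRight_eq (Strict.rightUnitor_eqToIso _) _) ?_
  simp [hcomp, hid, pasteH]

theorem hid_hcomp {X Y Z W : C} (A : UpSquare X Y Z W) :
    (hid A.left).hcomp A rfl = A := by
  obtain ⟨t, l, b, r, c⟩ := A
  refine ext_cell (Strict.id_comp _) rfl (Strict.id_comp _) rfl (l ◁ (λ_ b).hom)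
    ((λ_ t).hom ▷ r) (whiskerLeft_eq _ (Strict.leftUnitor_eqToIso _) _)
    (whiskerRight_eq (Strict.leftUnitor_eqToIso _) _) ?_
  simp [hcomp, hid, pasteH]

theorem vcomp_vid {X Y Z W : C} (A : UpSquare X Y Z W) :
    A.vcomp (vid A.bottom) rfl = A := by
  obtain ⟨t, l, b, r, c⟩ := A
  refine ext_cell rfl (Strict.comp_id _) rfl (Strict.comp_id _) ((ρ_ l).hom ▷ b)
    (t ◁ (ρ_ r).hom) (whiskerRight_eq (Strict.rightUnitor_eqToIso _) _)
    (whiskerLeft_eq _ (Strict.rightUnitor_eqToIso _) _) ?_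
  simp [vcomp, vid, pasteV]

theorem vid_vcomp {X Y Z W : C} (A : UpSquare X Y Z W) :
    (vid A.top).vcomp A rfl = A := by
  obtain ⟨t, l, b, r, c⟩ := A
  refine ext_cell rfl (Strict.id_comp _) rfl (Strict.id_comp _) ((λ_ l).hom ▷ b)
    (t ◁ (λ_ r).hom) (whiskerRight_eq (Strict.leftUnitor_eqToIso _) _)
    (whiskerLeft_eq _ (Strict.leftUnitor_eqToIso _) _) ?_
  simp [vcomp, vid, pasteV]

theorem hcomp_assoc {X Y Y' Y'' Z W W' W'' : C} (A : UpSquare X Y Z W)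
    (B : UpSquare Y Y' W W') (E : UpSquare Y' Y'' W' W'') (h : B.left = A.right)
    (h' : E.left = B.right) :
    (A.hcomp B h).hcomp E h' = A.hcomp (B.hcomp E h') h := by
  obtain ⟨t, l, b, r, c⟩ := A
  obtain ⟨t', l', b', r', c'⟩ := B
  obtain ⟨t'', l'', b'', r'', c''⟩ := E
  obtain rfl : l' = r := h
  obtain rfl : l'' = r' := h'
  refine ext_cell (Strict.assoc _ _ _) rfl (Strict.assoc _ _ _) rfl (l ◁ (α_ b b' b'').hom)
    ((α_ t t' t'').hom ▷ r'') (whiskerLeft_eq _ (Strict.associator_eqToIso _ _ _) _)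
    (whiskerRight_eq (Strict.associator_eqToIso _ _ _) _) ?_
  simp [hcomp, pasteH]

theorem vcomp_assoc {X Y Z W Z' W' Z'' W'' : C} (A : UpSquare X Y Z W)
    (B : UpSquare Z W Z' W') (E : UpSquare Z' W' Z'' W'') (h : B.top = A.bottom)
    (h' : E.top = B.bottom) :
    (A.vcomp B h).vcomp E h' = A.vcomp (B.vcomp E h') h := by
  obtain ⟨t, l, b, r, c⟩ := A
  obtain ⟨t', l', b', r', c'⟩ := B
  obtain ⟨t'', l'', b'', r'', c''⟩ := E
  obtain rfl : t' = b := h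
  obtain rfl : t'' = b' := h'
  refine ext_cell rfl (Strict.assoc _ _ _) rfl (Strict.assoc _ _ _) ((α_ l l' l'').hom ▷ b'')
    (t ◁ (α_ r r' r'').hom) (whiskerRight_eq (Strict.associator_eqToIso _ _ _) _)
    (whiskerLeft_eq _ (Strict.associator_eqToIso _ _ _) _) ?_
  simp [vcomp, pasteV]

end UpSquare

/-- 2-commutativity of a cube of up-squares. `K'`, `K` are the faces before and after the third
direction, `J'`, `J` those before and after the second, `I'`, `I` those before and after the first. -/
def CommCube {X' Y' Z' W' X Y Z W : C}
    {b' : X' ⟶ Y'} {q' : X' ⟶ Z'} {a' : Z' ⟶ W'} {p' : Y' ⟶ W'}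
    {b : X ⟶ Y} {q : X ⟶ Z} {a : Z ⟶ W} {p : Y ⟶ W}
    {x : X' ⟶ X} {y : Y' ⟶ Y} {z : Z' ⟶ Z} {w : W' ⟶ W}
    (K' : q' ≫ a' ⟶ b' ≫ p') (K : q ≫ a ⟶ b ≫ p)
    (J' : x ≫ b ⟶ b' ≫ y) (J : z ≫ a ⟶ a' ≫ w)
    (I' : x ≫ q ⟶ q' ≫ z) (I : y ≫ p ⟶ p' ≫ w) : Prop :=
  x ◁ K ≫ (α_ x b p).inv ≫ J' ▷ p ≫ (α_ b' y p).hom ≫ b' ◁ I =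
    (α_ x q a).inv ≫ I' ▷ a ≫ (α_ q' z a).hom ≫ q' ◁ J ≫ (α_ q' a' w).inv ≫ K' ▷ w ≫
      (α_ b' p' w).hom

theorem CommCube.paste₁ {X' Y' Z' W' X Y Z W Y₂ Y₂' W₂ W₂' : C}
    {b' : X' ⟶ Y'} {q' : X' ⟶ Z'} {a' : Z' ⟶ W'} {p' : Y' ⟶ W'}
    {b : X ⟶ Y} {q : X ⟶ Z} {a : Z ⟶ W} {p : Y ⟶ W}
    {x : X' ⟶ X} {y : Y' ⟶ Y} {z : Z' ⟶ Z} {w : W' ⟶ W}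
    {K' : q' ≫ a' ⟶ b' ≫ p'} {K : q ≫ a ⟶ b ≫ p}
    {J' : x ≫ b ⟶ b' ≫ y} {J : z ≫ a ⟶ a' ≫ w}
    {I' : x ≫ q ⟶ q' ≫ z} {I : y ≫ p ⟶ p' ≫ w}
    {b₂ : Y ⟶ Y₂} {a₂ : W ⟶ W₂} {b₂' : Y' ⟶ Y₂'} {a₂' : W' ⟶ W₂'}
    {p₂ : Y₂ ⟶ W₂} {p₂' : Y₂' ⟶ W₂'} {y₂ : Y₂' ⟶ Y₂} {w₂ : W₂' ⟶ W₂}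
    {K₂' : p' ≫ a₂' ⟶ b₂' ≫ p₂'} {K₂ : p ≫ a₂ ⟶ b₂ ≫ p₂}
    {J₂' : y ≫ b₂ ⟶ b₂' ≫ y₂} {J₂ : w ≫ a₂ ⟶ a₂' ≫ w₂} {I₂ : y₂ ≫ p₂ ⟶ p₂' ≫ w₂}
    (h₁ : CommCube K' K J' J I' I) (h₂ : CommCube K₂' K₂ J₂' J₂ I I₂) :
    CommCube (pasteH K' K₂') (pasteH K K₂) (pasteH J' J₂') (pasteH J J₂) I' I₂ := by
  unfold CommCube at *
  simp only [pasteH]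
  calc _ = 𝟙 _ ⊗≫ x ◁ K ▷ a₂ ⊗≫ ((x ≫ b) ◁ K₂ ≫ J' ▷ (b₂ ≫ p₂)) ⊗≫ b' ◁ J₂' ▷ p₂ ⊗≫
        b' ◁ b₂' ◁ I₂ ⊗≫ 𝟙 _ := by bicategory
    _ = 𝟙 _ ⊗≫ x ◁ K ▷ a₂ ⊗≫ J' ▷ p ▷ a₂ ⊗≫ b' ◁ (y ◁ K₂ ≫ (α_ y b₂ p₂).inv ≫
        J₂' ▷ p₂ ≫ (α_ b₂' y₂ p₂).hom ≫ b₂' ◁ I₂) ⊗≫ 𝟙 _ := by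
      rw [whisker_exchange]; bicategory
    _ = 𝟙 _ ⊗≫ (x ◁ K ≫ (α_ x b p).inv ≫ J' ▷ p ≫ (α_ b' y p).hom ≫ b' ◁ I) ▷ a₂ ⊗≫
        b' ◁ p' ◁ J₂ ⊗≫ b' ◁ K₂' ▷ w₂ ⊗≫ 𝟙 _ := by
      rw [h₂]; bicategory
    _ = 𝟙 _ ⊗≫ I' ▷ a ▷ a₂ ⊗≫ q' ◁ J ▷ a₂ ⊗≫ (K' ▷ (w ≫ a₂) ≫ (b' ≫ p') ◁ J₂) ⊗≫
        b' ◁ K₂' ▷ w₂ ⊗≫ 𝟙 _ := by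
      rw [h₁]; bicategory
    _ = _ := by
      rw [← whisker_exchange]; bicategory

theorem CommCube.paste₂ {X' Y' Z' W' X Y Z W Z₂ Z₂' W₂ W₂' : C}
    {b' : X' ⟶ Y'} {q' : X' ⟶ Z'} {a' : Z' ⟶ W'} {p' : Y' ⟶ W'}
    {b : X ⟶ Y} {q : X ⟶ Z} {a : Z ⟶ W} {p : Y ⟶ W}
    {x : X' ⟶ X} {y : Y' ⟶ Y} {z : Z' ⟶ Z} {w : W' ⟶ W}
    {K' : q' ≫ a' ⟶ b' ≫ p'} {K : q ≫ a ⟶ b ≫ p}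
    {J' : x ≫ b ⟶ b' ≫ y} {J : z ≫ a ⟶ a' ≫ w}
    {I' : x ≫ q ⟶ q' ≫ z} {I : y ≫ p ⟶ p' ≫ w}
    {q₂ : Z ⟶ Z₂} {p₂ : W ⟶ W₂} {q₂' : Z' ⟶ Z₂'} {p₂' : W' ⟶ W₂'}
    {a₂ : Z₂ ⟶ W₂} {a₂' : Z₂' ⟶ W₂'} {z₂ : Z₂' ⟶ Z₂} {w₂ : W₂' ⟶ W₂}
    {K₂' : q₂' ≫ a₂' ⟶ a' ≫ p₂'} {K₂ : q₂ ≫ a₂ ⟶ a ≫ p₂}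
    {J₂ : z₂ ≫ a₂ ⟶ a₂' ≫ w₂} {I₂' : z ≫ q₂ ⟶ q₂' ≫ z₂} {I₂ : w ≫ p₂ ⟶ p₂' ≫ w₂}
    (h₁ : CommCube K' K J' J I' I) (h₂ : CommCube K₂' K₂ J J₂ I₂' I₂) :
    CommCube (pasteV K' K₂') (pasteV K K₂) J' J₂ (pasteH I' I₂') (pasteH I I₂) := by
  unfold CommCube at *
  simp only [pasteH, pasteV]
  calc _ = 𝟙 _ ⊗≫ x ◁ q ◁ K₂ ⊗≫ (x ◁ K ≫ (α_ x b p).inv ≫ J' ▷ p ≫ (α_ b' y p).hom ≫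
        b' ◁ I) ▷ p₂ ⊗≫ b' ◁ p' ◁ I₂ ⊗≫ 𝟙 _ := by bicategory
    _ = 𝟙 _ ⊗≫ ((x ≫ q) ◁ K₂ ≫ I' ▷ (a ≫ p₂)) ⊗≫ q' ◁ J ▷ p₂ ⊗≫
        (K' ▷ (w ≫ p₂) ≫ (b' ≫ p') ◁ I₂) ⊗≫ 𝟙 _ := by
      rw [h₁]; bicategory
    _ = 𝟙 _ ⊗≫ I' ▷ q₂ ▷ a₂ ⊗≫ q' ◁ (z ◁ K₂ ≫ (α_ z a p₂).inv ≫ J ▷ p₂ ≫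
        (α_ a' w p₂).hom ≫ a' ◁ I₂) ⊗≫ K' ▷ p₂' ▷ w₂ ⊗≫ 𝟙 _ := by
      rw [whisker_exchange I' K₂, ← whisker_exchange K' I₂]; bicategory
    _ = _ := by
      rw [h₂]; bicategory

theorem CommCube.paste₃ {X' Y' Z' W' X Y Z W X₂ Y₂ Z₂ W₂ : C}
    {b' : X' ⟶ Y'} {q' : X' ⟶ Z'} {a' : Z' ⟶ W'} {p' : Y' ⟶ W'}
    {b : X ⟶ Y} {q : X ⟶ Z} {a : Z ⟶ W} {p : Y ⟶ W}
    {x : X' ⟶ X} {y : Y' ⟶ Y} {z : Z' ⟶ Z} {w : W' ⟶ W}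
    {K' : q' ≫ a' ⟶ b' ≫ p'} {K : q ≫ a ⟶ b ≫ p}
    {J' : x ≫ b ⟶ b' ≫ y} {J : z ≫ a ⟶ a' ≫ w}
    {I' : x ≫ q ⟶ q' ≫ z} {I : y ≫ p ⟶ p' ≫ w}
    {b₂ : X₂ ⟶ Y₂} {q₂ : X₂ ⟶ Z₂} {a₂ : Z₂ ⟶ W₂} {p₂ : Y₂ ⟶ W₂}
    {x₂ : X ⟶ X₂} {y₂ : Y ⟶ Y₂} {z₂ : Z ⟶ Z₂} {w₂ : W ⟶ W₂}
    {K₂ : q₂ ≫ a₂ ⟶ b₂ ≫ p₂} {J₂' : x₂ ≫ b₂ ⟶ b ≫ y₂} {J₂ : z₂ ≫ a₂ ⟶ a ≫ w₂}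
    {I₂' : x₂ ≫ q₂ ⟶ q ≫ z₂} {I₂ : y₂ ≫ p₂ ⟶ p ≫ w₂}
    (h₁ : CommCube K' K J' J I' I) (h₂ : CommCube K K₂ J₂' J₂ I₂' I₂) :
    CommCube K' K₂ (pasteV J' J₂') (pasteV J J₂) (pasteV I' I₂') (pasteV I I₂) := by
  unfold CommCube at *
  simp only [pasteV]
  calc _ = 𝟙 _ ⊗≫ x ◁ x₂ ◁ K₂ ⊗≫ x ◁ J₂' ▷ p₂ ⊗≫ (J' ▷ (y₂ ≫ p₂) ≫ (b' ≫ y) ◁ I₂) ⊗≫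
        b' ◁ I ▷ w₂ ⊗≫ 𝟙 _ := by bicategory
    _ = 𝟙 _ ⊗≫ x ◁ (x₂ ◁ K₂ ≫ (α_ x₂ b₂ p₂).inv ≫ J₂' ▷ p₂ ≫ (α_ b y₂ p₂).hom ≫ b ◁ I₂) ⊗≫
        J' ▷ p ▷ w₂ ⊗≫ b' ◁ I ▷ w₂ ⊗≫ 𝟙 _ := by
      rw [← whisker_exchange]; bicategory
    _ = 𝟙 _ ⊗≫ x ◁ I₂' ▷ a₂ ⊗≫ x ◁ q ◁ J₂ ⊗≫ (x ◁ K ≫ (α_ x b p).inv ≫ J' ▷ p ≫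
        (α_ b' y p).hom ≫ b' ◁ I) ▷ w₂ ⊗≫ 𝟙 _ := by
      rw [h₂]; bicategory
    _ = 𝟙 _ ⊗≫ x ◁ I₂' ▷ a₂ ⊗≫ ((x ≫ q) ◁ J₂ ≫ I' ▷ (a ≫ w₂)) ⊗≫ q' ◁ J ▷ w₂ ⊗≫
        K' ▷ w ▷ w₂ ⊗≫ 𝟙 _ := by
      rw [h₁]; bicategory
    _ = _ := by
      rw [whisker_exchange]; bicategory

end UpSquares
/-! ### Hypercubes in a 2-category -/

/-- A quasi-functor of `n` variables on a set `V` of vertices with steps in `n` directions: morphisms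
for the steps, which are functorial in each direction, and 2-cells for the squares of steps, which
are compatible with identities and pasting and such that the cubes of steps commute.
For a box `V` this is a strict 2-functor to `C` from the 2-category `γ` with object set `V` whose
morphisms `a ⟶ b` are the total orders on `{k | a k ≠ b k}` if `a ≤ b` (none otherwise), with a
unique 2-cell from one order to another if each inversion of the first is one of the second: `γ` is
generated by the steps and the squares, subject to the relations above. -/
structure QuasiFunctor {n : ℕ} {V : Type} (step : Fin n → V → V → Prop)
    (C : Type u) [Bicategory.{w, v} C] where
  obj : V → C
  map {k : Fin n} {a b : V} (h : step k a b) : obj a ⟶ obj b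
  map_id {k : Fin n} {a : V} (h : step k a a) : map h = 𝟙 (obj a)
  map_comp {k : Fin n} {a b c : V} (h₁ : step k a b) (h₂ : step k b c) (h : step k a c) :
    map h = map h₁ ≫ map h₂
  cell {k l : Fin n} (hkl : k < l) {a b c d : V} (t : step k a b) (e : step l a c)
    (m : step k c d) (r : step l b d) : map e ≫ map m ⟶ map t ≫ map r
  cell_hid {k l : Fin n} (hkl : k < l) {a c : V} (t : step k a a) (e : step l a c)
    (m : step k c c) (r : step l a c) :
    (⟨map t, map e, map m, map r, cell hkl t e m r⟩ : UpSquare _ _ _ _) = .hid (map e)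
  cell_vid {k l : Fin n} (hkl : k < l) {a b : V} (t : step k a b) (e : step l a a)
    (m : step k a b) (r : step l b b) :
    (⟨map t, map e, map m, map r, cell hkl t e m r⟩ : UpSquare _ _ _ _) = .vid (map t)
  cell_hcomp {k l : Fin n} (hkl : k < l) {a b b' c d d' : V} (t : step k a b) (e : step l a c)
    (m : step k c d) (r : step l b d) (t' : step k b b') (m' : step k d d') (r' : step l b' d')
    (t'' : step k a b') (m'' : step k c d') :
    (⟨map t'', map e, map m'', map r', cell hkl t'' e m'' r'⟩ : UpSquare _ _ _ _) =
      .hcomp ⟨map t, map e, map m, map r, cell hkl t e m r⟩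
        ⟨map t', map r, map m', map r', cell hkl t' r m' r'⟩ rfl
  cell_vcomp {k l : Fin n} (hkl : k < l) {a b c d c' d' : V} (t : step k a b) (e : step l a c)
    (m : step k c d) (r : step l b d) (e' : step l c c') (m' : step k c' d') (r' : step l d d')
    (e'' : step l a c') (r'' : step l b d') :
    (⟨map t, map e'', map m', map r'', cell hkl t e'' m' r''⟩ : UpSquare _ _ _ _) =
      .vcomp ⟨map t, map e, map m, map r, cell hkl t e m r⟩
        ⟨map m, map e', map m', map r', cell hkl m e' m' r'⟩ rfl
  cube {k l m : Fin n} (hkl : k < l) (hlm : l < m) {a b c d a' b' c' d' : V}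
    (t' : step k a' b') (e' : step l a' c') (m' : step k c' d') (r' : step l b' d')
    (t : step k a b) (e : step l a c) (m₀ : step k c d) (r : step l b d)
    (x : step m a' a) (y : step m b' b) (z : step m c' c) (w₀ : step m d' d) :
    CommCube (cell hkl t' e' m' r') (cell hkl t e m₀ r)
      (cell (hkl.trans hlm) t' x t y) (cell (hkl.trans hlm) m' z m₀ w₀)
      (cell hlm e' x e z) (cell hlm r' y r w₀)

namespace QuasiFunctor

variable {n : ℕ} {V V' : Type} {step : Fin n → V → V → Prop} {step' : Fin n → V' → V' → Prop}
  {C : Type u} [Bicategory.{w, v} C]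

/-- Restriction of a quasi-functor along a map preserving steps. -/
def pull (F : QuasiFunctor step C) (g : V' → V)
    (hg : ∀ k a b, step' k a b → step k (g a) (g b)) : QuasiFunctor step' C where
  obj a := F.obj (g a)
  map h := F.map (hg _ _ _ h)
  map_id _ := F.map_id _
  map_comp _ _ _ := F.map_comp _ _ _
  cell hkl _ _ _ _ _ _ _ _ := F.cell hkl _ _ _ _
  cell_hid hkl _ _ _ _ _ _ := F.cell_hid hkl _ _ _ _
  cell_vid hkl _ _ _ _ _ _ := F.cell_vid hkl _ _ _ _
  cell_hcomp hkl _ _ _ _ _ _ _ _ _ _ _ _ _ _ _ := F.cell_hcomp hkl _ _ _ _ _ _ _ _ _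
  cell_vcomp hkl _ _ _ _ _ _ _ _ _ _ _ _ _ _ _ := F.cell_vcomp hkl _ _ _ _ _ _ _ _ _
  cube hkl hlm _ _ _ _ _ _ _ _ _ _ _ _ _ _ _ _ _ _ _ _ := F.cube hkl hlm _ _ _ _ _ _ _ _ _ _ _ _

end QuasiFunctor

section Gluing

theorem UpSquare.exists_cell {C : Type u} [Bicategory.{w, v} C] {X Y Z W : C}
    (A : UpSquare X Y Z W) {t : X ⟶ Y} {e : X ⟶ Z} {m : Z ⟶ W} {r : Y ⟶ W} (h₁ : t = A.top)
    (h₂ : e = A.left) (h₃ : m = A.bottom) (h₄ : r = A.right) :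
    ∃ c, (⟨t, e, m, r, c⟩ : UpSquare X Y Z W) = A := by
  subst h₁ h₂ h₃ h₄
  exact ⟨_, rfl⟩

theorem CommCube.hcomp {C : Type u} [Bicategory.{w, v} C]
    {X' Y' Z' W' X Y Z W Y₂ Y₂' W₂ W₂' : C}
    {b' : X' ⟶ Y'} {q' : X' ⟶ Z'} {a' : Z' ⟶ W'} {p' : Y' ⟶ W'}
    {b : X ⟶ Y} {q : X ⟶ Z} {a : Z ⟶ W} {p : Y ⟶ W}
    {x : X' ⟶ X} {y : Y' ⟶ Y} {z : Z' ⟶ Z} {w : W' ⟶ W}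
    {K' : q' ≫ a' ⟶ b' ≫ p'} {K : q ≫ a ⟶ b ≫ p}
    {J' : x ≫ b ⟶ b' ≫ y} {J : z ≫ a ⟶ a' ≫ w}
    {I' : x ≫ q ⟶ q' ≫ z} {I : y ≫ p ⟶ p' ≫ w}
    {b₂ : Y ⟶ Y₂} {a₂ : W ⟶ W₂} {b₂' : Y' ⟶ Y₂'} {a₂' : W' ⟶ W₂'}
    {p₂ : Y₂ ⟶ W₂} {p₂' : Y₂' ⟶ W₂'} {y₂ : Y₂' ⟶ Y₂} {w₂ : W₂' ⟶ W₂}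
    {K₂' : p' ≫ a₂' ⟶ b₂' ≫ p₂'} {K₂ : p ≫ a₂ ⟶ b₂ ≫ p₂}
    {J₂' : y ≫ b₂ ⟶ b₂' ≫ y₂} {J₂ : w ≫ a₂ ⟶ a₂' ≫ w₂} {I₂ : y₂ ≫ p₂ ⟶ p₂' ≫ w₂}
    (h₁ : CommCube K' K J' J I' I) (h₂ : CommCube K₂' K₂ J₂' J₂ I I₂)
    {b₃ : X ⟶ Y₂} {a₃ : Z ⟶ W₂} {b₃' : X' ⟶ Y₂'} {a₃' : Z' ⟶ W₂'}
    {K₃' : q' ≫ a₃' ⟶ b₃' ≫ p₂'} {K₃ : q ≫ a₃ ⟶ b₃ ≫ p₂}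
    {J₃' : x ≫ b₃ ⟶ b₃' ≫ y₂} {J₃ : z ≫ a₃ ⟶ a₃' ≫ w₂}
    (hK' : (⟨b₃', q', a₃', p₂', K₃'⟩ : UpSquare _ _ _ _) =
      .hcomp ⟨b', q', a', p', K'⟩ ⟨b₂', p', a₂', p₂', K₂'⟩ rfl)
    (hK : (⟨b₃, q, a₃, p₂, K₃⟩ : UpSquare _ _ _ _) =
      .hcomp ⟨b, q, a, p, K⟩ ⟨b₂, p, a₂, p₂, K₂⟩ rfl)
    (hJ' : (⟨b₃', x, b₃, y₂, J₃'⟩ : UpSquare _ _ _ _) =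
      .hcomp ⟨b', x, b, y, J'⟩ ⟨b₂', y, b₂, y₂, J₂'⟩ rfl)
    (hJ : (⟨a₃', z, a₃, w₂, J₃⟩ : UpSquare _ _ _ _) =
      .hcomp ⟨a', z, a, w, J⟩ ⟨a₂', w, a₂, w₂, J₂⟩ rfl) :
    CommCube K₃' K₃ J₃' J₃ I' I₂ := by
  simp only [UpSquare.hcomp, UpSquare.mk.injEq, true_and, eqToHom_refl, Category.id_comp] at *
  obtain ⟨rfl, rfl, hK'⟩ := hK'
  obtain ⟨rfl, rfl, hK⟩ := hK
  simp only [heq_eq_eq, true_and] at *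
  subst hK hK' hJ hJ'
  exact h₁.paste₁ h₂

theorem CommCube.mixed {C : Type u} [Bicategory.{w, v} C]
    {X' Y' Z' W' X Y Z W Z₂ Z₂' W₂ W₂' : C}
    {b' : X' ⟶ Y'} {q' : X' ⟶ Z'} {a' : Z' ⟶ W'} {p' : Y' ⟶ W'}
    {b : X ⟶ Y} {q : X ⟶ Z} {a : Z ⟶ W} {p : Y ⟶ W}
    {x : X' ⟶ X} {y : Y' ⟶ Y} {z : Z' ⟶ Z} {w : W' ⟶ W}
    {K' : q' ≫ a' ⟶ b' ≫ p'} {K : q ≫ a ⟶ b ≫ p}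
    {J' : x ≫ b ⟶ b' ≫ y} {J : z ≫ a ⟶ a' ≫ w}
    {I' : x ≫ q ⟶ q' ≫ z} {I : y ≫ p ⟶ p' ≫ w}
    {q₂ : Z ⟶ Z₂} {p₂ : W ⟶ W₂} {q₂' : Z' ⟶ Z₂'} {p₂' : W' ⟶ W₂'}
    {a₂ : Z₂ ⟶ W₂} {a₂' : Z₂' ⟶ W₂'} {z₂ : Z₂' ⟶ Z₂} {w₂ : W₂' ⟶ W₂}
    {K₂' : q₂' ≫ a₂' ⟶ a' ≫ p₂'} {K₂ : q₂ ≫ a₂ ⟶ a ≫ p₂}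
    {J₂ : z₂ ≫ a₂ ⟶ a₂' ≫ w₂} {I₂' : z ≫ q₂ ⟶ q₂' ≫ z₂} {I₂ : w ≫ p₂ ⟶ p₂' ≫ w₂}
    (h₁ : CommCube K' K J' J I' I) (h₂ : CommCube K₂' K₂ J J₂ I₂' I₂)
    {q₃ : X ⟶ Z₂} {p₃ : Y ⟶ W₂} {q₃' : X' ⟶ Z₂'} {p₃' : Y' ⟶ W₂'}
    {K₃' : q₃' ≫ a₂' ⟶ b' ≫ p₃'} {K₃ : q₃ ≫ a₂ ⟶ b ≫ p₃}
    {I₃' : x ≫ q₃ ⟶ q₃' ≫ z₂} {I₃ : y ≫ p₃ ⟶ p₃' ≫ w₂}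
    (hK' : (⟨b', q₃', a₂', p₃', K₃'⟩ : UpSquare _ _ _ _) =
      .vcomp ⟨b', q', a', p', K'⟩ ⟨a', q₂', a₂', p₂', K₂'⟩ rfl)
    (hK : (⟨b, q₃, a₂, p₃, K₃⟩ : UpSquare _ _ _ _) =
      .vcomp ⟨b, q, a, p, K⟩ ⟨a, q₂, a₂, p₂, K₂⟩ rfl)
    (hI' : (⟨q₃', x, q₃, z₂, I₃'⟩ : UpSquare _ _ _ _) =
      .hcomp ⟨q', x, q, z, I'⟩ ⟨q₂', z, q₂, z₂, I₂'⟩ rfl)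
    (hI : (⟨p₃', y, p₃, w₂, I₃⟩ : UpSquare _ _ _ _) =
      .hcomp ⟨p', y, p, w, I⟩ ⟨p₂', w, p₂, w₂, I₂⟩ rfl) :
    CommCube K₃' K₃ J' J₂ I₃' I₃ := by
  simp only [UpSquare.hcomp, UpSquare.vcomp, UpSquare.mk.injEq, true_and, eqToHom_refl,
    Category.id_comp, Category.comp_id] at *
  obtain ⟨rfl, rfl, hK'⟩ := hK'
  obtain ⟨rfl, rfl, hK⟩ := hK
  simp only [heq_eq_eq, true_and] at *
  subst hK hK' hI hI'
  exact h₁.paste₂ h₂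

theorem CommCube.vcomp {C : Type u} [Bicategory.{w, v} C]
    {X' Y' Z' W' X Y Z W X₂ Y₂ Z₂ W₂ : C}
    {b' : X' ⟶ Y'} {q' : X' ⟶ Z'} {a' : Z' ⟶ W'} {p' : Y' ⟶ W'}
    {b : X ⟶ Y} {q : X ⟶ Z} {a : Z ⟶ W} {p : Y ⟶ W}
    {x : X' ⟶ X} {y : Y' ⟶ Y} {z : Z' ⟶ Z} {w : W' ⟶ W}
    {K' : q' ≫ a' ⟶ b' ≫ p'} {K : q ≫ a ⟶ b ≫ p}
    {J' : x ≫ b ⟶ b' ≫ y} {J : z ≫ a ⟶ a' ≫ w}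
    {I' : x ≫ q ⟶ q' ≫ z} {I : y ≫ p ⟶ p' ≫ w}
    {b₂ : X₂ ⟶ Y₂} {q₂ : X₂ ⟶ Z₂} {a₂ : Z₂ ⟶ W₂} {p₂ : Y₂ ⟶ W₂}
    {x₂ : X ⟶ X₂} {y₂ : Y ⟶ Y₂} {z₂ : Z ⟶ Z₂} {w₂ : W ⟶ W₂}
    {K₂ : q₂ ≫ a₂ ⟶ b₂ ≫ p₂} {J₂' : x₂ ≫ b₂ ⟶ b ≫ y₂} {J₂ : z₂ ≫ a₂ ⟶ a ≫ w₂}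
    {I₂' : x₂ ≫ q₂ ⟶ q ≫ z₂} {I₂ : y₂ ≫ p₂ ⟶ p ≫ w₂}
    (h₁ : CommCube K' K J' J I' I) (h₂ : CommCube K K₂ J₂' J₂ I₂' I₂)
    {x₃ : X' ⟶ X₂} {y₃ : Y' ⟶ Y₂} {z₃ : Z' ⟶ Z₂} {w₃ : W' ⟶ W₂}
    {J₃' : x₃ ≫ b₂ ⟶ b' ≫ y₃} {J₃ : z₃ ≫ a₂ ⟶ a' ≫ w₃}
    {I₃' : x₃ ≫ q₂ ⟶ q' ≫ z₃} {I₃ : y₃ ≫ p₂ ⟶ p' ≫ w₃}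
    (hJ' : (⟨b', x₃, b₂, y₃, J₃'⟩ : UpSquare _ _ _ _) =
      .vcomp ⟨b', x, b, y, J'⟩ ⟨b, x₂, b₂, y₂, J₂'⟩ rfl)
    (hJ : (⟨a', z₃, a₂, w₃, J₃⟩ : UpSquare _ _ _ _) =
      .vcomp ⟨a', z, a, w, J⟩ ⟨a, z₂, a₂, w₂, J₂⟩ rfl)
    (hI' : (⟨q', x₃, q₂, z₃, I₃'⟩ : UpSquare _ _ _ _) =
      .vcomp ⟨q', x, q, z, I'⟩ ⟨q, x₂, q₂, z₂, I₂'⟩ rfl)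
    (hI : (⟨p', y₃, p₂, w₃, I₃⟩ : UpSquare _ _ _ _) =
      .vcomp ⟨p', y, p, w, I⟩ ⟨p, y₂, p₂, w₂, I₂⟩ rfl) :
    CommCube K' K₂ J₃' J₃ I₃' I₃ := by
  simp only [UpSquare.vcomp, UpSquare.mk.injEq, true_and, eqToHom_refl, Category.comp_id] at *
  obtain ⟨rfl, rfl, hJ'⟩ := hJ'
  obtain ⟨rfl, rfl, hJ⟩ := hJ
  simp only [heq_eq_eq, true_and] at *
  subst hJ hJ' hI hI'
  exact h₁.paste₃ h₂

end Gluing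

namespace UpSquare

variable {C : Type u} [Bicategory.{w, v} C]

theorem hid_vcomp_hid {X Z Z' : C} (f : X ⟶ Z) (g : Z ⟶ Z') :
    (hid f).vcomp (hid g) rfl = hid (f ≫ g) := by
  refine ext_cell rfl rfl rfl rfl (𝟙 _) (𝟙 _) rfl rfl ?_
  simp only [vcomp, hid, pasteV]
  simp

theorem vid_hcomp_vid {X Y Y' : C} (f : X ⟶ Y) (g : Y ⟶ Y') :
    (vid f).hcomp (vid g) rfl = vid (f ≫ g) := by
  refine ext_cell rfl rfl rfl rfl (𝟙 _) (𝟙 _) rfl rfl ?_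
  simp only [hcomp, vid, pasteH]
  simp

theorem vcomp_eq_hid {X Z Z' : C} {f : X ⟶ Z} {g : Z ⟶ Z'} {e : X ⟶ Z'}
    {P : UpSquare X X Z' Z'} {A : UpSquare X X Z Z} {B : UpSquare Z Z Z' Z'} (h : B.top = A.bottom)
    (hP : P = A.vcomp B h) (hA : A = hid f) (hB : B = hid g) (he : e = f ≫ g) : P = hid e := by
  subst hA hB hP he
  exact hid_vcomp_hid f g

theorem hcomp_eq_vid {X Y Y' : C} {f : X ⟶ Y} {g : Y ⟶ Y'} {e : X ⟶ Y'}
    {P : UpSquare X Y' X Y'} {A : UpSquare X Y X Y} {B : UpSquare Y Y' Y Y'} (h : B.left = A.right)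
    (hP : P = A.hcomp B h) (hA : A = vid f) (hB : B = vid g) (he : e = f ≫ g) : P = vid e := by
  subst hA hB hP he
  exact vid_hcomp_vid f g

theorem interchange₁ {X₁ X₂ X₃ Y₁ Y₂ Y₃ Z₁ Z₂ Z₃ : C} {A : UpSquare X₁ X₂ Y₁ Y₂}
    {A' : UpSquare X₂ X₃ Y₂ Y₃} {B : UpSquare Y₁ Y₂ Z₁ Z₂} {B' : UpSquare Y₂ Y₃ Z₂ Z₃}
    {P : UpSquare X₁ X₃ Z₁ Z₃} {T : UpSquare X₁ X₃ Y₁ Y₃} {T' : UpSquare Y₁ Y₃ Z₁ Z₃}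
    {L : UpSquare X₁ X₂ Z₁ Z₂} {R : UpSquare X₂ X₃ Z₂ Z₃} {h₀ h₁ h₂ h₃ h₄ h₅}
    (hP : P = T.vcomp T' h₀) (hT : T = A.hcomp A' h₁) (hT' : T' = B.hcomp B' h₂)
    (hL : L = A.vcomp B h₃) (hR : R = A'.vcomp B' h₄) : P = L.hcomp R h₅ := by
  subst hP hT hT' hL hR
  exact interchange ..

theorem interchange₂ {X₁ X₂ X₃ Y₁ Y₂ Y₃ Z₁ Z₂ Z₃ : C} {A : UpSquare X₁ X₂ Y₁ Y₂}
    {A' : UpSquare X₂ X₃ Y₂ Y₃} {B : UpSquare Y₁ Y₂ Z₁ Z₂} {B' : UpSquare Y₂ Y₃ Z₂ Z₃}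
    {P : UpSquare X₁ X₃ Z₁ Z₃} {T : UpSquare X₁ X₃ Y₁ Y₃} {T' : UpSquare Y₁ Y₃ Z₁ Z₃}
    {L : UpSquare X₁ X₂ Z₁ Z₂} {R : UpSquare X₂ X₃ Z₂ Z₃} {h₀ h₁ h₂ h₃ h₄ h₅}
    (hP : P = L.hcomp R h₅) (hL : L = A.vcomp B h₃) (hR : R = A'.vcomp B' h₄)
    (hT : T = A.hcomp A' h₁) (hT' : T' = B.hcomp B' h₂) : P = T.vcomp T' h₀ := by
  subst hP hT hT' hL hR
  exact (interchange ..).symm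

variable [Strict C]

theorem eq_hcomp_hid {X Y Z W : C} {A : UpSquare X Y Z W} {B : UpSquare Y Y W W} (h)
    (hB : B = hid A.right) : A = A.hcomp B h := by
  subst hB
  exact (hcomp_hid A).symm

theorem eq_hid_hcomp {X Y Z W : C} {A : UpSquare X X Z Z} {B : UpSquare X Y Z W} (h)
    (hA : A = hid B.left) : B = A.hcomp B h := by
  subst hA
  exact (hid_hcomp B).symm

theorem eq_vcomp_vid {X Y Z W : C} {A : UpSquare X Y Z W} {B : UpSquare Z W Z W} (h)
    (hB : B = vid A.bottom) : A = A.vcomp B h := by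
  subst hB
  exact (vcomp_vid A).symm

theorem eq_vid_vcomp {X Y Z W : C} {A : UpSquare X Y X Y} {B : UpSquare X Y Z W} (h)
    (hA : A = vid B.top) : B = A.vcomp B h := by
  subst hA
  exact (vid_vcomp B).symm

theorem hassoc₁ {X Y Y' Y'' Z W W' W'' : C} {A : UpSquare X Y Z W}
    {B : UpSquare Y Y' W W'} {E : UpSquare Y' Y'' W' W''} {P : UpSquare X Y'' Z W''}
    {AB : UpSquare X Y' Z W'} {BE : UpSquare Y Y'' W W''} {h₁ h₂ h₃ h₄}
    (hP : P = AB.hcomp E h₁) (hAB : AB = A.hcomp B h₂) (hBE : BE = B.hcomp E h₃) :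
    P = A.hcomp BE h₄ := by
  subst hP hAB hBE
  exact hcomp_assoc ..

theorem hassoc₂ {X Y Y' Y'' Z W W' W'' : C} {A : UpSquare X Y Z W}
    {B : UpSquare Y Y' W W'} {E : UpSquare Y' Y'' W' W''} {P : UpSquare X Y'' Z W''}
    {AB : UpSquare X Y' Z W'} {BE : UpSquare Y Y'' W W''} {h₁ h₂ h₃ h₄}
    (hP : P = A.hcomp BE h₄) (hBE : BE = B.hcomp E h₃) (hAB : AB = A.hcomp B h₂) :
    P = AB.hcomp E h₁ := by
  subst hP hAB hBE
  exact (hcomp_assoc ..).symm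

theorem vassoc₁ {X Y Z W Z' W' Z'' W'' : C} {A : UpSquare X Y Z W}
    {B : UpSquare Z W Z' W'} {E : UpSquare Z' W' Z'' W''} {P : UpSquare X Y Z'' W''}
    {AB : UpSquare X Y Z' W'} {BE : UpSquare Z W Z'' W''} {h₁ h₂ h₃ h₄}
    (hP : P = AB.vcomp E h₁) (hAB : AB = A.vcomp B h₂) (hBE : BE = B.vcomp E h₃) :
    P = A.vcomp BE h₄ := by
  subst hP hAB hBE
  exact vcomp_assoc ..

theorem vassoc₂ {X Y Z W Z' W' Z'' W'' : C} {A : UpSquare X Y Z W}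
    {B : UpSquare Z W Z' W'} {E : UpSquare Z' W' Z'' W''} {P : UpSquare X Y Z'' W''}
    {AB : UpSquare X Y Z' W'} {BE : UpSquare Z W Z'' W''} {h₁ h₂ h₃ h₄}
    (hP : P = A.vcomp BE h₄) (hBE : BE = B.vcomp E h₃) (hAB : AB = A.vcomp B h₂) :
    P = AB.vcomp E h₁ := by
  subst hP hAB hBE
  exact (vcomp_assoc ..).symm

end UpSquare

/-- The vertices of the box `∏ j, {0, …, α j}`. -/
abbrev Box {n : ℕ} (α : Fin n → ℕ) : Type := ∀ j, Fin (α j + 1)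

/-- `a` and `b` agree except that the `k`-th coordinate may increase. -/
def boxStep {n : ℕ} (α : Fin n → ℕ) (k : Fin n) (a b : Box α) : Prop :=
  a k ≤ b k ∧ ∀ j, j ≠ k → a j = b j

section Glue

variable {n : ℕ} {α : Fin n → ℕ} {C : Type u} [Bicategory.{w, v} C]

theorem boxStep.le {k : Fin n} {a b : Box α} (h : boxStep α k a b) (j : Fin n) : a j ≤ b j := by
  by_cases hj : j = k
  · subst hj; exact h.1
  · exact (h.2 j hj).le

theorem boxStep.eq_of_crossing {k i : Fin n} {a b : Box α} {p : Fin (α i + 1)}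
    (h : boxStep α k a b) (ha : a i < p) (hb : p < b i) : k = i := by
  by_contra hk
  have := h.2 i (Ne.symm hk)
  exact absurd (ha.trans hb) (by rw [this]; exact lt_irrefl _)

theorem boxStep.to_mid {i : Fin n} {a : Box α} {p : Fin (α i + 1)} (h : a i ≤ p) :
    boxStep α i a (Function.update a i p) :=
  ⟨by simpa using h, fun j hj => by simp [hj]⟩

theorem boxStep.from_mid {i : Fin n} {a b : Box α} {p : Fin (α i + 1)} (h : boxStep α i a b)
    (hb : p ≤ b i) : boxStep α i (Function.update a i p) b :=
  ⟨by simpa using hb, fun j hj => by simp [hj, h.2 j hj]⟩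

theorem boxStep.mid {i k : Fin n} {a b : Box α} {p : Fin (α i + 1)} (h : boxStep α k a b)
    (hk : k ≠ i) : boxStep α k (Function.update a i p) (Function.update b i p) :=
  ⟨by simpa [hk] using h.1, fun j hj => by
    by_cases hj' : j = i
    · subst hj'; simp
    · simp [hj', h.2 j hj]⟩

theorem boxStep.eq_mid {i : Fin n} {a m : Box α} {p : Fin (α i + 1)} (h : boxStep α i a m)
    (hm : m i = p) : m = Function.update a i p := by
  funext j
  by_cases hj : j = i
  · subst hj; simp [hm]
  · simp [hj, h.2 j hj]

theorem boxStep.eq_left {i : Fin n} {a m : Box α} (h : boxStep α i a m)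
    (hm : m i ≤ a i) : m = a := by
  funext j
  by_cases hj : j = i
  · subst hj; exact le_antisymm hm h.1
  · exact (h.2 j hj).symm

namespace QuasiFunctor

theorem map_heq {V : Type} {step : Fin n → V → V → Prop} {F G : QuasiFunctor step C} (h : F = G)
    {k : Fin n} {a b : V} (s : step k a b) : HEq (F.map s) (G.map s) := by
  subst h; rfl

theorem cell_heq {V : Type} {step : Fin n → V → V → Prop} {F G : QuasiFunctor step C} (h : F = G)
    {k l : Fin n} (hkl : k < l) {a b c d : V} (t : step k a b) (e : step l a c)
    (m : step k c d) (r : step l b d) : HEq (F.cell hkl t e m r) (G.cell hkl t e m r) := by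
  subst h; rfl

/-- Steps between the vertices in a set of vertices of a box. -/
abbrev stepOn (S : Set (Box α)) (k : Fin n) (a b : S) : Prop := boxStep α k a.1 b.1

/-- Restriction to a set of vertices. -/
abbrev restr (F : QuasiFunctor (boxStep α) C) (S : Set (Box α)) : QuasiFunctor (stepOn S) C :=
  F.pull Subtype.val fun _ _ _ h => h

/-- Restriction to a smaller set of vertices. -/
abbrev restr' {S T : Set (Box α)} (F : QuasiFunctor (stepOn S) C) (h : T ⊆ S) :
    QuasiFunctor (stepOn T) C :=
  F.pull (fun a => ⟨a.1, h a.2⟩) fun _ _ _ h => h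

set_option maxHeartbeats 1000000 in
theorem exists_glue [Strict C] (i : Fin n) (p : Fin (α i + 1))
    (x : QuasiFunctor (stepOn {a : Box α | a i ≤ p}) C)
    (y : QuasiFunctor (stepOn {a : Box α | p ≤ a i}) C)
    (h : x.restr' (T := {a | a i = p}) (fun _ h => le_of_eq h) =
      y.restr' (T := {a | a i = p}) (fun _ h => ge_of_eq h)) :
    ∃ z : QuasiFunctor (boxStep α) C, z.restr _ = x ∧ z.restr _ = y := by
  obtain ⟨O, hxO, hyO⟩ : ∃ O : Box α → C, x.obj = (fun a => O a.1) ∧ y.obj = fun a => O a.1 := by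
    refine ⟨fun a => if h : a i ≤ p then x.obj ⟨a, h⟩ else y.obj ⟨a, (not_le.1 h).le⟩, ?_, ?_⟩
    · funext a
      have : a.1 i ≤ p := a.2
      simp [this]
    · funext a
      have ha : p ≤ a.1 i := a.2
      by_cases ha' : a.1 i ≤ p
      · have : a.1 i = p := le_antisymm ha' ha
        have := congrFun (congrArg QuasiFunctor.obj h) ⟨a.1, this⟩
        simp only [ha', dite_true]
        exact this.symm
      · simp [ha']
  have hm := fun k a b s => map_heq h (k := k) (a := a) (b := b) s
  have hc := fun k l hkl a b c d t e m r =>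
    cell_heq h (k := k) (l := l) hkl (a := a) (b := b) (c := c) (d := d) t e m r
  clear h
  obtain ⟨xo, xm, x_id, x_comp, xc, x_hid, x_vid, x_hcomp, x_vcomp, x_cube⟩ := x
  obtain ⟨yo, ym, y_id, y_comp, yc, y_hid, y_vid, y_hcomp, y_vcomp, y_cube⟩ := y
  subst hxO hyO
  replace hm : ∀ k (a b : {a : Box α | a i = p}) (s : boxStep α k a.1 b.1),
      xm (a := ⟨a.1, a.2.le⟩) (b := ⟨b.1, b.2.le⟩) s =
        ym (a := ⟨a.1, a.2.ge⟩) (b := ⟨b.1, b.2.ge⟩) s :=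
    fun k a b s => eq_of_heq (hm k a b s)
  -- edges
  have hM : ∀ (k : Fin n) (a b : Box α) (s : boxStep α k a b), ∃ f : O a ⟶ O b,
      (∀ (ha : a i ≤ p) (hb : b i ≤ p), f = xm (a := ⟨a, ha⟩) (b := ⟨b, hb⟩) s) ∧
      (∀ (ha : p ≤ a i) (hb : p ≤ b i), f = ym (a := ⟨a, ha⟩) (b := ⟨b, hb⟩) s) ∧
      (∀ (m : Box α) (s₁ : boxStep α i a m) (s₂ : boxStep α i m b) (hm : m i = p) (_ : k = i),
        f = xm (a := ⟨a, hm ▸ s₁.1⟩) (b := ⟨m, hm.le⟩) s₁ ≫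
          ym (a := ⟨m, hm.ge⟩) (b := ⟨b, hm ▸ s₂.1⟩) s₂) := by
    intro k a b s
    by_cases hb : b i ≤ p
    · have ha := (s.le i).trans hb
      refine ⟨xm (a := ⟨a, ha⟩) (b := ⟨b, hb⟩) s, fun _ _ => rfl, fun ha' hb' =>
        hm k ⟨a, le_antisymm ha ha'⟩ ⟨b, le_antisymm hb hb'⟩ s, ?_⟩
      rintro m s₁ s₂ hm' rfl
      obtain rfl : b = m := s₂.eq_left (hm' ▸ hb)
      rw [y_id, Strict.comp_id]
    · have hb' := (not_le.1 hb).le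
      by_cases ha : p ≤ a i
      · refine ⟨ym (a := ⟨a, ha⟩) (b := ⟨b, hb'⟩) s, fun _ h => absurd h hb, fun _ _ => rfl, ?_⟩
        rintro m s₁ s₂ hm' rfl
        obtain rfl : m = a := s₁.eq_left (hm' ▸ ha)
        rw [x_id, Strict.id_comp]
      · obtain rfl := s.eq_of_crossing (not_le.1 ha) (not_le.1 hb)
        have hmid : (Function.update a k p) k = p := Function.update_self ..
        refine ⟨xm (a := ⟨a, (not_le.1 ha).le⟩) (b := ⟨Function.update a k p, hmid.le⟩)
          (boxStep.to_mid (not_le.1 ha).le) ≫ ym (a := ⟨Function.update a k p, hmid.ge⟩)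
          (b := ⟨b, hb'⟩) (s.from_mid hb'), fun _ h => absurd h hb, fun h => absurd h ha, ?_⟩
        rintro m s₁ s₂ hm' -
        obtain rfl := s₁.eq_mid hm'
        rfl
  choose M hMx hMy hMm using hM
  obtain rfl : @xm = fun k (a b : {a : Box α | a i ≤ p}) s => M k a.1 b.1 s := by
    funext k a b s
    exact (hMx k a.1 b.1 s a.2 b.2).symm
  obtain rfl : @ym = fun k (a b : {a : Box α | p ≤ a i}) s => M k a.1 b.1 s := by
    funext k a b s
    exact (hMy k a.1 b.1 s a.2 b.2).symm
  clear hMx hMy hm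
  replace hc : ∀ k l hkl (a b c d : {a : Box α | a i = p}) (t : boxStep α k a.1 b.1)
      (e : boxStep α l a.1 c.1) (m : boxStep α k c.1 d.1) (r : boxStep α l b.1 d.1),
      xc hkl (a := ⟨a.1, a.2.le⟩) (b := ⟨b.1, b.2.le⟩) (c := ⟨c.1, c.2.le⟩) (d := ⟨d.1, d.2.le⟩)
        t e m r =
      yc hkl (a := ⟨a.1, a.2.ge⟩) (b := ⟨b.1, b.2.ge⟩) (c := ⟨c.1, c.2.ge⟩) (d := ⟨d.1, d.2.ge⟩)
        t e m r :=
    fun k l hkl a b c d t e m r => eq_of_heq (hc k l hkl a b c d t e m r)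
  dsimp only at *
  -- squares
  have hS : ∀ (k l : Fin n) (hkl : k < l) (a b c d : Box α) (t : boxStep α k a b)
      (e : boxStep α l a c) (m : boxStep α k c d) (r : boxStep α l b d),
      ∃ σ : M l a c e ≫ M k c d m ⟶ M k a b t ≫ M l b d r,
      (∀ ha hb hc hd, σ = xc hkl (a := ⟨a, ha⟩) (b := ⟨b, hb⟩) (c := ⟨c, hc⟩) (d := ⟨d, hd⟩)
        t e m r) ∧
      (∀ ha hb hc hd, σ = yc hkl (a := ⟨a, ha⟩) (b := ⟨b, hb⟩) (c := ⟨c, hc⟩) (d := ⟨d, hd⟩)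
        t e m r) ∧
      (∀ (u v : Box α) (t₁ : boxStep α k a u) (t₂ : boxStep α k u b) (m₁ : boxStep α k c v)
        (m₂ : boxStep α k v d) (f : boxStep α l u v) (hu : u i = p) (hv : v i = p) (_ : k = i)
        (ha hb hc hd),
        (⟨M k a b t, M l a c e, M k c d m, M l b d r, σ⟩ : UpSquare _ _ _ _) =
          .hcomp ⟨M k a u t₁, M l a c e, M k c v m₁, M l u v f, xc hkl (a := ⟨a, ha⟩)
            (b := ⟨u, hu.le⟩) (c := ⟨c, hc⟩) (d := ⟨v, hv.le⟩) t₁ e m₁ f⟩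
          ⟨M k u b t₂, M l u v f, M k v d m₂, M l b d r, yc hkl (a := ⟨u, hu.ge⟩)
            (b := ⟨b, hb⟩) (c := ⟨v, hv.ge⟩) (d := ⟨d, hd⟩) t₂ f m₂ r⟩ rfl) ∧
      (∀ (u v : Box α) (e₁ : boxStep α l a u) (e₂ : boxStep α l u c) (r₁ : boxStep α l b v)
        (r₂ : boxStep α l v d) (f : boxStep α k u v) (hu : u i = p) (hv : v i = p) (_ : l = i)
        (ha hb hc hd),
        (⟨M k a b t, M l a c e, M k c d m, M l b d r, σ⟩ : UpSquare _ _ _ _) =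
          .vcomp ⟨M k a b t, M l a u e₁, M k u v f, M l b v r₁, xc hkl (a := ⟨a, ha⟩)
            (b := ⟨b, hb⟩) (c := ⟨u, hu.le⟩) (d := ⟨v, hv.le⟩) t e₁ f r₁⟩
          ⟨M k u v f, M l u c e₂, M k c d m, M l v d r₂, yc hkl (a := ⟨u, hu.ge⟩)
            (b := ⟨v, hv.ge⟩) (c := ⟨c, hc⟩) (d := ⟨d, hd⟩) f e₂ m r₂⟩ rfl) := by
    intro k l hkl a b c d t e m r
    by_cases hd : d i ≤ p
    · have hb := (r.le i).trans hd
      have hc₀ := (m.le i).trans hd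
      have ha := (e.le i).trans hc₀
      refine ⟨xc hkl (a := ⟨a, ha⟩) (b := ⟨b, hb⟩) (c := ⟨c, hc₀⟩) (d := ⟨d, hd⟩) t e m r,
        fun _ _ _ _ => rfl, fun ha' hb' hc' hd' => ?_, ?_, ?_⟩
      · exact hc k l hkl ⟨a, le_antisymm ha ha'⟩ ⟨b, le_antisymm hb hb'⟩
          ⟨c, le_antisymm hc₀ hc'⟩ ⟨d, le_antisymm hd hd'⟩ t e m r
      · rintro u v t₁ t₂ m₁ m₂ f hu hv rfl - hb' - hd'
        obtain rfl : b = u := t₂.eq_left (hu ▸ hb)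
        obtain rfl : d = v := m₂.eq_left (hv ▸ hd)
        exact UpSquare.eq_hcomp_hid _ (y_hid (a := ⟨b, hb'⟩) (c := ⟨d, hd'⟩) hkl t₂ f m₂ r)
      · rintro u v e₁ e₂ r₁ r₂ f hu hv rfl - - hc' hd'
        obtain rfl : c = u := e₂.eq_left (hu ▸ hc₀)
        obtain rfl : d = v := r₂.eq_left (hv ▸ hd)
        exact UpSquare.eq_vcomp_vid _ (y_vid (a := ⟨c, hc'⟩) (b := ⟨d, hd'⟩) hkl f e₂ m r₂)
    by_cases ha : p ≤ a i
    · have hb := ha.trans (t.le i)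
      have hc₀ := ha.trans (e.le i)
      have hd' := hb.trans (r.le i)
      refine ⟨yc hkl (a := ⟨a, ha⟩) (b := ⟨b, hb⟩) (c := ⟨c, hc₀⟩) (d := ⟨d, hd'⟩) t e m r,
        fun _ _ _ h => absurd h hd, fun _ _ _ _ => rfl, ?_, ?_⟩
      · rintro u v t₁ t₂ m₁ m₂ f hu hv rfl ha' - hc' -
        obtain rfl : u = a := t₁.eq_left (hu ▸ ha)
        obtain rfl : v = c := m₁.eq_left (hv ▸ hc₀)
        exact UpSquare.eq_hid_hcomp _ (x_hid (a := ⟨u, ha'⟩) (c := ⟨v, hc'⟩) hkl t₁ e m₁ f)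
      · rintro u v e₁ e₂ r₁ r₂ f hu hv rfl ha' hb' - -
        obtain rfl : u = a := e₁.eq_left (hu ▸ ha)
        obtain rfl : v = b := r₁.eq_left (hv ▸ hb)
        exact UpSquare.eq_vid_vcomp _ (x_vid (a := ⟨u, ha'⟩) (b := ⟨v, hb'⟩) hkl t e₁ f r₁)
    have ha' := (not_le.1 ha).le
    have hd' := (not_le.1 hd).le
    by_cases hk : k = i
    · subst hk
      have hac : a k = c k := e.2 k hkl.ne
      have hbd : b k = d k := r.2 k hkl.ne
      have hc' : c k ≤ p := hac ▸ ha'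
      have hb' : p ≤ b k := hbd.symm ▸ hd'
      have hu : (Function.update a k p) k = p := Function.update_self ..
      have hv : (Function.update c k p) k = p := Function.update_self ..
      obtain ⟨σ, hσ⟩ := UpSquare.exists_cell
        (.hcomp ⟨M k a _ (.to_mid ha'), M l a c e, M k c _ (.to_mid hc'), M l _ _ (e.mid hkl.ne'),
            xc hkl (a := ⟨a, ha'⟩) (b := ⟨_, hu.le⟩) (c := ⟨c, hc'⟩) (d := ⟨_, hv.le⟩)
              (.to_mid ha') e (.to_mid hc') (e.mid hkl.ne')⟩
          ⟨M k _ b (t.from_mid hb'), M l _ _ (e.mid hkl.ne'), M k _ d (m.from_mid hd'), M l b d r,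
            yc hkl (a := ⟨_, hu.ge⟩) (b := ⟨b, hb'⟩) (c := ⟨_, hv.ge⟩) (d := ⟨d, hd'⟩)
              (t.from_mid hb') (e.mid hkl.ne') (m.from_mid hd') r⟩ rfl)
        (t := M k a b t) (e := M l a c e) (m := M k c d m) (r := M l b d r)
        (hMm k a b t _ _ _ hu rfl) rfl (hMm k c d m _ _ _ hv rfl) rfl
      refine ⟨σ, fun _ _ _ h => absurd h hd, fun h => absurd h ha, ?_,
        fun _ _ _ _ _ _ _ _ _ h => absurd h hkl.ne'⟩
      rintro u v t₁ t₂ m₁ m₂ f hu' hv' - _ _ _ _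
      obtain rfl := t₁.eq_mid hu'
      obtain rfl := m₁.eq_mid hv'
      exact hσ
    · have hab : a i = b i := t.2 i (Ne.symm hk)
      have hcd : c i = d i := m.2 i (Ne.symm hk)
      obtain rfl : l = i := e.eq_of_crossing (not_le.1 ha) (hcd ▸ not_le.1 hd)
      have hb' : b l ≤ p := hab ▸ ha'
      have hc' : p ≤ c l := hcd.symm ▸ hd'
      have hu : (Function.update a l p) l = p := Function.update_self ..
      have hv : (Function.update b l p) l = p := Function.update_self ..
      obtain ⟨σ, hσ⟩ := UpSquare.exists_cell
        (.vcomp ⟨M k a b t, M l a _ (.to_mid ha'), M k _ _ (t.mid hk), M l b _ (.to_mid hb'),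
            xc hkl (a := ⟨a, ha'⟩) (b := ⟨b, hb'⟩) (c := ⟨_, hu.le⟩) (d := ⟨_, hv.le⟩)
              t (.to_mid ha') (t.mid hk) (.to_mid hb')⟩
          ⟨M k _ _ (t.mid hk), M l _ c (e.from_mid hc'), M k c d m, M l _ d (r.from_mid hd'),
            yc hkl (a := ⟨_, hu.ge⟩) (b := ⟨_, hv.ge⟩) (c := ⟨c, hc'⟩) (d := ⟨d, hd'⟩)
              (t.mid hk) (e.from_mid hc') m (r.from_mid hd')⟩ rfl)
        (t := M k a b t) (e := M l a c e) (m := M k c d m) (r := M l b d r)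
        rfl (hMm l a c e _ _ _ hu rfl) rfl (hMm l b d r _ _ _ hv rfl)
      refine ⟨σ, fun _ _ _ h => absurd h hd, fun h => absurd h ha,
        fun _ _ _ _ _ _ _ _ _ h => absurd h hk, ?_⟩
      rintro u v e₁ e₂ r₁ r₂ f hu' hv' - _ _ _ _
      obtain rfl := e₁.eq_mid hu'
      obtain rfl := r₁.eq_mid hv'
      exact hσ
  choose S hSx hSy hSh hSv using hS
  obtain rfl : @xc = fun k l hkl (a b c d : {a : Box α | a i ≤ p}) t e m r => S k l hkl a.1 b.1 c.1 d.1 t e m r := by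
    funext k l hkl a b c d t e m r
    exact (hSx k l hkl a.1 b.1 c.1 d.1 t e m r a.2 b.2 c.2 d.2).symm
  obtain rfl : @yc = fun k l hkl (a b c d : {a : Box α | p ≤ a i}) t e m r => S k l hkl a.1 b.1 c.1 d.1 t e m r := by
    funext k l hkl a b c d t e m r
    exact (hSy k l hkl a.1 b.1 c.1 d.1 t e m r a.2 b.2 c.2 d.2).symm
  clear hSx hSy hc
  dsimp only at *
  have up : ∀ a : Box α, (Function.update a i p) i = p := fun a => Function.update_self ..
  refine ⟨⟨O, @M, ?_, ?_, @S, ?_, ?_, ?_, ?_, ?_⟩, rfl, rfl⟩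
  · intro k a h
    rcases le_total (a i) p with ha | ha
    · exact x_id (a := ⟨a, ha⟩) h
    · exact y_id (a := ⟨a, ha⟩) h
  · intro k a b c h₁ h₂ h
    by_cases hc : c i ≤ p
    · have hb := (h₂.le i).trans hc
      exact x_comp (a := ⟨a, (h₁.le i).trans hb⟩) (b := ⟨b, hb⟩) (c := ⟨c, hc⟩) h₁ h₂ h
    by_cases ha : p ≤ a i
    · have hb := ha.trans (h₁.le i)
      exact y_comp (a := ⟨a, ha⟩) (b := ⟨b, hb⟩) (c := ⟨c, hb.trans (h₂.le i)⟩) h₁ h₂ h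
    obtain rfl := h.eq_of_crossing (not_le.1 ha) (not_le.1 hc)
    have ha' := (not_le.1 ha).le
    have hc' := (not_le.1 hc).le
    have hm := up a
    rcases le_total (b k) p with hb | hb
    · have e : Function.update b k p = Function.update a k p :=
        (boxStep.eq_mid (a := a) ⟨by simpa using ha', fun j hj => by
          simp [hj, h₁.2 j hj]⟩ (Function.update_self ..))
      have s : boxStep α k b (Function.update a k p) := e ▸ .to_mid hb
      have hx : M k a _ (.to_mid ha') = M k a b h₁ ≫ M k b _ s :=
        x_comp (a := ⟨a, ha'⟩) (b := ⟨b, hb⟩) (c := ⟨_, hm.le⟩) h₁ s (.to_mid ha')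
      rw [hMm k a c h _ (.to_mid ha') (h.from_mid hc') hm rfl,
        hMm k b c h₂ _ s (h.from_mid hc') hm rfl, hx, Strict.assoc]
    · have hy : M k _ c (h.from_mid hc') = M k _ b (h₁.from_mid hb) ≫ M k b c h₂ :=
        y_comp (a := ⟨_, hm.ge⟩) (b := ⟨b, hb⟩) (c := ⟨c, hc'⟩) (h₁.from_mid hb) h₂ (h.from_mid hc')
      rw [hMm k a c h _ (.to_mid ha') (h.from_mid hc') hm rfl,
        hMm k a b h₁ _ (.to_mid ha') (h₁.from_mid hb) hm rfl, hy, Strict.assoc]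
  · intro k l hkl a c t e m r
    by_cases hc : c i ≤ p
    · exact x_hid (a := ⟨a, (e.le i).trans hc⟩) (c := ⟨c, hc⟩) hkl t e m r
    by_cases ha : p ≤ a i
    · exact y_hid (a := ⟨a, ha⟩) (c := ⟨c, ha.trans (e.le i)⟩) hkl t e m r
    obtain rfl := e.eq_of_crossing (not_le.1 ha) (not_le.1 hc)
    have ha' := (not_le.1 ha).le
    have hc' := (not_le.1 hc).le
    have hm := up a
    exact UpSquare.vcomp_eq_hid _
      (hSv k l hkl a a c c t e m r _ _ (.to_mid ha') (e.from_mid hc') (.to_mid ha')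
        (e.from_mid hc') (t.mid hkl.ne) hm hm rfl ha' ha' hc' hc')
      (x_hid (a := ⟨a, ha'⟩) (c := ⟨_, hm.le⟩) hkl t (.to_mid ha') (t.mid hkl.ne) (.to_mid ha'))
      (y_hid (a := ⟨_, hm.ge⟩) (c := ⟨c, hc'⟩) hkl (t.mid hkl.ne) (e.from_mid hc') m
        (e.from_mid hc'))
      (hMm l a c e _ (.to_mid ha') (e.from_mid hc') hm rfl)
  · intro k l hkl a b t e m r
    by_cases hb : b i ≤ p
    · exact x_vid (a := ⟨a, (t.le i).trans hb⟩) (b := ⟨b, hb⟩) hkl t e m r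
    by_cases ha : p ≤ a i
    · exact y_vid (a := ⟨a, ha⟩) (b := ⟨b, ha.trans (t.le i)⟩) hkl t e m r
    obtain rfl := t.eq_of_crossing (not_le.1 ha) (not_le.1 hb)
    have ha' := (not_le.1 ha).le
    have hb' := (not_le.1 hb).le
    have hm := up a
    exact UpSquare.hcomp_eq_vid _
      (hSh k l hkl a b a b t e m r _ _ (.to_mid ha') (t.from_mid hb') (.to_mid ha')
        (t.from_mid hb') (e.mid hkl.ne') hm hm rfl ha' hb' ha' hb')
      (x_vid (a := ⟨a, ha'⟩) (b := ⟨_, hm.le⟩) hkl (.to_mid ha') e (.to_mid ha') (e.mid hkl.ne'))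
      (y_vid (a := ⟨_, hm.ge⟩) (b := ⟨b, hb'⟩) hkl (t.from_mid hb') (e.mid hkl.ne')
        (t.from_mid hb') r)
      (hMm k a b t _ (.to_mid ha') (t.from_mid hb') hm rfl)
  · intro k l hkl a b b' c d d' t e m r t' m' r' t'' m''
    by_cases hd' : d' i ≤ p
    · have hd := (m'.le i).trans hd'
      have hb' := (r'.le i).trans hd'
      have hb := (r.le i).trans hd
      have hc := (m.le i).trans hd
      exact x_hcomp (a := ⟨a, (t.le i).trans hb⟩) (b := ⟨b, hb⟩) (b' := ⟨b', hb'⟩) (c := ⟨c, hc⟩)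
        (d := ⟨d, hd⟩) (d' := ⟨d', hd'⟩) hkl t e m r t' m' r' t'' m''
    by_cases ha : p ≤ a i
    · have hb := ha.trans (t.le i)
      have hb' := hb.trans (t'.le i)
      have hc := ha.trans (e.le i)
      have hd := hc.trans (m.le i)
      have hd' := hd.trans (m'.le i)
      exact y_hcomp (a := ⟨a, ha⟩) (b := ⟨b, hb⟩) (b' := ⟨b', hb'⟩) (c := ⟨c, hc⟩)
        (d := ⟨d, hd⟩) (d' := ⟨d', hd'⟩) hkl t e m r t' m' r' t'' m''
    have ha' := (not_le.1 ha).le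
    have hd'' := (not_le.1 hd').le
    by_cases hk : k = i
    · subst hk
      have hac : a k = c k := e.2 k hkl.ne
      have hbd : b k = d k := r.2 k hkl.ne
      have hbd' : b' k = d' k := r'.2 k hkl.ne
      have hc' : c k ≤ p := hac ▸ ha'
      have hb'' : p ≤ b' k := hbd'.symm ▸ hd''
      rcases le_total (b k) p with hb | hb
      · have hd : d k ≤ p := hbd ▸ hb
        have ub : Function.update b k p = Function.update a k p :=
          (boxStep.eq_mid (a := a) ⟨by simpa using ha', fun j hj => by
            simp [hj, t.2 j hj]⟩ (up b))
        have ud : Function.update d k p = Function.update c k p :=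
          (boxStep.eq_mid (a := c) ⟨by simpa using hc', fun j hj => by
            simp [hj, m.2 j hj]⟩ (up d))
        have sb : boxStep α k b (Function.update a k p) := ub ▸ .to_mid hb
        have sd : boxStep α k d (Function.update c k p) := ud ▸ .to_mid hd
        exact UpSquare.hassoc₁
          (hSh k l hkl a b' c d' t'' e m'' r' _ _ (.to_mid ha') (t''.from_mid hb'') (.to_mid hc')
            (m''.from_mid hd'') (e.mid hkl.ne') (up a) (up c) rfl ha' hb'' hc' hd'')
          (x_hcomp (a := ⟨a, ha'⟩) (b := ⟨b, hb⟩) (b' := ⟨_, (up a).le⟩) (c := ⟨c, hc'⟩)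
            (d := ⟨d, hd⟩) (d' := ⟨_, (up c).le⟩) hkl t e m r sb sd (e.mid hkl.ne')
            (.to_mid ha') (.to_mid hc'))
          (hSh k l hkl b b' d d' t' r m' r' _ _ sb (t''.from_mid hb'') sd
            (m''.from_mid hd'') (e.mid hkl.ne') (up a) (up c) rfl hb hb'' hd hd'')
      · have hd : p ≤ d k := hbd ▸ hb
        exact UpSquare.hassoc₂
          (hSh k l hkl a b' c d' t'' e m'' r' _ _ (.to_mid ha') (t''.from_mid hb'') (.to_mid hc')
            (m''.from_mid hd'') (e.mid hkl.ne') (up a) (up c) rfl ha' hb'' hc' hd'')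
          (y_hcomp (a := ⟨_, (up a).ge⟩) (b := ⟨b, hb⟩) (b' := ⟨b', hb''⟩) (c := ⟨_, (up c).ge⟩)
            (d := ⟨d, hd⟩) (d' := ⟨d', hd''⟩) hkl (t.from_mid hb) (e.mid hkl.ne') (m.from_mid hd)
            r t' m' r' (t''.from_mid hb'') (m''.from_mid hd''))
          (hSh k l hkl a b c d t e m r _ _ (.to_mid ha') (t.from_mid hb) (.to_mid hc')
            (m.from_mid hd) (e.mid hkl.ne') (up a) (up c) rfl ha' hb hc' hd)
    · have hab : a i = b i := t.2 i (Ne.symm hk)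
      have hbb : b i = b' i := t'.2 i (Ne.symm hk)
      have hcd : c i = d i := m.2 i (Ne.symm hk)
      have hdd : d i = d' i := m'.2 i (Ne.symm hk)
      have hd : p ≤ d i := hdd.symm ▸ hd''
      have hc : p ≤ c i := hcd.symm ▸ hd
      have hb : b i ≤ p := hab ▸ ha'
      have hb' : b' i ≤ p := hbb ▸ hb
      obtain rfl : l = i := e.eq_of_crossing (not_le.1 ha) (hcd ▸ hdd ▸ not_le.1 hd')
      exact UpSquare.interchange₁
        (hSv k l hkl a b' c d' t'' e m'' r' _ _ (.to_mid ha') (e.from_mid hc) (.to_mid hb')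
          (r'.from_mid hd'') (t''.mid hk) (up a) (up b') rfl ha' hb' hc hd'')
        (x_hcomp (a := ⟨a, ha'⟩) (b := ⟨b, hb⟩) (b' := ⟨b', hb'⟩) (c := ⟨_, (up a).le⟩)
          (d := ⟨_, (up b).le⟩) (d' := ⟨_, (up b').le⟩) hkl t (.to_mid ha') (t.mid hk)
          (.to_mid hb) t' (t'.mid hk) (.to_mid hb') t'' (t''.mid hk))
        (y_hcomp (a := ⟨_, (up a).ge⟩) (b := ⟨_, (up b).ge⟩) (b' := ⟨_, (up b').ge⟩) (c := ⟨c, hc⟩)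
          (d := ⟨d, hd⟩) (d' := ⟨d', hd''⟩) hkl (t.mid hk) (e.from_mid hc) m (r.from_mid hd)
          (t'.mid hk) m' (r'.from_mid hd'') (t''.mid hk) m'')
        (hSv k l hkl a b c d t e m r _ _ (.to_mid ha') (e.from_mid hc) (.to_mid hb)
          (r.from_mid hd) (t.mid hk) (up a) (up b) rfl ha' hb hc hd)
        (hSv k l hkl b b' d d' t' r m' r' _ _ (.to_mid hb) (r.from_mid hd) (.to_mid hb')
          (r'.from_mid hd'') (t'.mid hk) (up b) (up b') rfl hb hb' hd hd'')
  · intro k l hkl a b c d c' d' t e m r e' m' r' e'' r''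
    by_cases hd' : d' i ≤ p
    · have hd := (r'.le i).trans hd'
      have hc' := (m'.le i).trans hd'
      have hb := (r.le i).trans hd
      have hc := (m.le i).trans hd
      exact x_vcomp (a := ⟨a, (t.le i).trans hb⟩) (b := ⟨b, hb⟩) (c' := ⟨c', hc'⟩) (c := ⟨c, hc⟩)
        (d := ⟨d, hd⟩) (d' := ⟨d', hd'⟩) hkl t e m r e' m' r' e'' r''
    by_cases ha : p ≤ a i
    · have hb := ha.trans (t.le i)
      have hc := ha.trans (e.le i)
      have hc' := hc.trans (e'.le i)
      have hd := hc.trans (m.le i)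
      have hd' := hd.trans (r'.le i)
      exact y_vcomp (a := ⟨a, ha⟩) (b := ⟨b, hb⟩) (c' := ⟨c', hc'⟩) (c := ⟨c, hc⟩)
        (d := ⟨d, hd⟩) (d' := ⟨d', hd'⟩) hkl t e m r e' m' r' e'' r''
    have ha' := (not_le.1 ha).le
    have hd'' := (not_le.1 hd').le
    by_cases hl : l = i
    · subst hl
      have hab : a l = b l := t.2 l hkl.ne'
      have hcd : c l = d l := m.2 l hkl.ne'
      have hcd' : c' l = d' l := m'.2 l hkl.ne'
      have hb' : b l ≤ p := hab ▸ ha'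
      have hc'' : p ≤ c' l := hcd'.symm ▸ hd''
      rcases le_total (c l) p with hc | hc
      · have hd : d l ≤ p := hcd ▸ hc
        have uc : Function.update c l p = Function.update a l p :=
          (boxStep.eq_mid (a := a) ⟨by simpa using ha', fun j hj => by
            simp [hj, e.2 j hj]⟩ (up c))
        have ud : Function.update d l p = Function.update b l p :=
          (boxStep.eq_mid (a := b) ⟨by simpa using hb', fun j hj => by
            simp [hj, r.2 j hj]⟩ (up d))
        have sc : boxStep α l c (Function.update a l p) := uc ▸ .to_mid hc
        have sd : boxStep α l d (Function.update b l p) := ud ▸ .to_mid hd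
        exact UpSquare.vassoc₁
          (hSv k l hkl a b c' d' t e'' m' r'' _ _ (.to_mid ha') (e''.from_mid hc'') (.to_mid hb')
            (r''.from_mid hd'') (t.mid hkl.ne) (up a) (up b) rfl ha' hb' hc'' hd'')
          (x_vcomp (a := ⟨a, ha'⟩) (b := ⟨b, hb'⟩) (c' := ⟨_, (up a).le⟩) (c := ⟨c, hc⟩)
            (d := ⟨d, hd⟩) (d' := ⟨_, (up b).le⟩) hkl t e m r sc (t.mid hkl.ne) sd
            (.to_mid ha') (.to_mid hb'))
          (hSv k l hkl c d c' d' m e' m' r' _ _ sc (e''.from_mid hc'') sd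
            (r''.from_mid hd'') (t.mid hkl.ne) (up a) (up b) rfl hc hd hc'' hd'')
      · have hd : p ≤ d l := hcd ▸ hc
        exact UpSquare.vassoc₂
          (hSv k l hkl a b c' d' t e'' m' r'' _ _ (.to_mid ha') (e''.from_mid hc'') (.to_mid hb')
            (r''.from_mid hd'') (t.mid hkl.ne) (up a) (up b) rfl ha' hb' hc'' hd'')
          (y_vcomp (a := ⟨_, (up a).ge⟩) (b := ⟨_, (up b).ge⟩) (c' := ⟨c', hc''⟩) (c := ⟨c, hc⟩)
            (d := ⟨d, hd⟩) (d' := ⟨d', hd''⟩) hkl (t.mid hkl.ne) (e.from_mid hc) m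
            (r.from_mid hd) e' m' r' (e''.from_mid hc'') (r''.from_mid hd''))
          (hSv k l hkl a b c d t e m r _ _ (.to_mid ha') (e.from_mid hc) (.to_mid hb')
            (r.from_mid hd) (t.mid hkl.ne) (up a) (up b) rfl ha' hb' hc hd)
    · have hac : a i = c i := e.2 i (Ne.symm hl)
      have hcc : c i = c' i := e'.2 i (Ne.symm hl)
      have hbd : b i = d i := r.2 i (Ne.symm hl)
      have hdd : d i = d' i := r'.2 i (Ne.symm hl)
      have hd : p ≤ d i := hdd.symm ▸ hd''
      have hb : p ≤ b i := hbd.symm ▸ hd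
      have hc : c i ≤ p := hac ▸ ha'
      have hc' : c' i ≤ p := hcc ▸ hc
      obtain rfl : k = i := t.eq_of_crossing (not_le.1 ha) (hbd ▸ hdd ▸ not_le.1 hd')
      exact UpSquare.interchange₂
        (hSh k l hkl a b c' d' t e'' m' r'' _ _ (.to_mid ha') (t.from_mid hb) (.to_mid hc')
          (m'.from_mid hd'') (e''.mid hl) (up a) (up c') rfl ha' hb hc' hd'')
        (x_vcomp (a := ⟨a, ha'⟩) (b := ⟨_, (up a).le⟩) (c := ⟨c, hc⟩) (d := ⟨_, (up c).le⟩)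
          (c' := ⟨c', hc'⟩) (d' := ⟨_, (up c').le⟩) hkl (.to_mid ha') e (.to_mid hc)
          (e.mid hl) e' (.to_mid hc') (e'.mid hl) e'' (e''.mid hl))
        (y_vcomp (a := ⟨_, (up a).ge⟩) (b := ⟨b, hb⟩) (c := ⟨_, (up c).ge⟩) (d := ⟨d, hd⟩)
          (c' := ⟨_, (up c').ge⟩) (d' := ⟨d', hd''⟩) hkl (t.from_mid hb) (e.mid hl)
          (m.from_mid hd) r (e'.mid hl) (m'.from_mid hd'') r' (e''.mid hl) r'')
        (hSh k l hkl a b c d t e m r _ _ (.to_mid ha') (t.from_mid hb) (.to_mid hc)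
          (m.from_mid hd) (e.mid hl) (up a) (up c) rfl ha' hb hc hd)
        (hSh k l hkl c d c' d' m e' m' r' _ _ (.to_mid hc) (m.from_mid hd) (.to_mid hc')
          (m'.from_mid hd'') (e'.mid hl) (up c) (up c') rfl hc hd hc' hd'')
  · intro k l m hkl hlm a b c d a' b' c' d' t' e' m' r' t e m₀ r x y z w₀
    have hkm := hkl.trans hlm
    have hbd := r.le i
    have hcd := m₀.le i
    have hac := e.le i
    have hab := t.le i
    have ha'a := x.le i
    have hb'b := y.le i
    have hc'c := z.le i
    have hd'd := w₀.le i
    have ha'b' := t'.le i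
    have ha'c' := e'.le i
    have hb'd' := r'.le i
    by_cases hd : d i ≤ p
    · have hb := hbd.trans hd
      have hc := hcd.trans hd
      have ha := hab.trans hb
      have h := x_cube (a := ⟨a, ha⟩) (b := ⟨b, hb⟩) (c := ⟨c, hc⟩) (d := ⟨d, hd⟩)
        (a' := ⟨a', ha'a.trans ha⟩) (b' := ⟨b', hb'b.trans hb⟩) (c' := ⟨c', hc'c.trans hc⟩)
        (d' := ⟨d', hd'd.trans hd⟩) hkl hlm t' e' m' r' t e m₀ r x y z w₀
      exact h
    by_cases ha' : p ≤ a' i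
    · have hb' := ha'.trans ha'b'
      have hc' := ha'.trans ha'c'
      have hd' := hb'.trans hb'd'
      have h := y_cube (a := ⟨a, ha'.trans ha'a⟩) (b := ⟨b, hb'.trans hb'b⟩)
        (c := ⟨c, hc'.trans hc'c⟩) (d := ⟨d, hd'.trans hd'd⟩) (a' := ⟨a', ha'⟩) (b' := ⟨b', hb'⟩)
        (c' := ⟨c', hc'⟩) (d' := ⟨d', hd'⟩) hkl hlm t' e' m' r' t e m₀ r x y z w₀
      exact h
    have ha'' := (not_le.1 ha').le
    have hd'' := (not_le.1 hd).le
    by_cases hk : k = i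
    · subst hk
      have e₁ : a' k = c' k := e'.2 k hkl.ne
      have e₂ : a' k = a k := x.2 k hkm.ne
      have e₃ : a k = c k := e.2 k hkl.ne
      have e₄ : b' k = d' k := r'.2 k hkl.ne
      have e₅ : b' k = b k := y.2 k hkm.ne
      have e₆ : b k = d k := r.2 k hkl.ne
      have hc' : c' k ≤ p := e₁ ▸ ha''
      have ha : a k ≤ p := e₂ ▸ ha''
      have hc : c k ≤ p := e₃ ▸ ha
      have hb : p ≤ b k := e₆.symm ▸ hd''
      have hb' : p ≤ b' k := e₅.symm ▸ hb
      have hd' : p ≤ d' k := e₄ ▸ hb'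
      exact CommCube.hcomp
        (x_cube (a' := ⟨a', ha''⟩) (b' := ⟨_, (up a').le⟩) (c' := ⟨c', hc'⟩)
          (d' := ⟨_, (up c').le⟩) (a := ⟨a, ha⟩) (b := ⟨_, (up a).le⟩) (c := ⟨c, hc⟩)
          (d := ⟨_, (up c).le⟩) hkl hlm (.to_mid ha'') e' (.to_mid hc') (e'.mid hkl.ne')
          (.to_mid ha) e (.to_mid hc) (e.mid hkl.ne') x (x.mid hkm.ne') z (z.mid hkm.ne'))
        (y_cube (a' := ⟨_, (up a').ge⟩) (b' := ⟨b', hb'⟩) (c' := ⟨_, (up c').ge⟩)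
          (d' := ⟨d', hd'⟩) (a := ⟨_, (up a).ge⟩) (b := ⟨b, hb⟩) (c := ⟨_, (up c).ge⟩)
          (d := ⟨d, hd''⟩) hkl hlm (t'.from_mid hb') (e'.mid hkl.ne') (m'.from_mid hd') r'
          (t.from_mid hb) (e.mid hkl.ne') (m₀.from_mid hd'') r (x.mid hkm.ne') y
          (z.mid hkm.ne') w₀)
        (hSh _ _ hkl _ _ _ _ t' e' m' r' _ _ _ _ _ _ _ (up a') (up c') rfl ha'' hb' hc' hd')
        (hSh _ _ hkl _ _ _ _ t e m₀ r _ _ _ _ _ _ _ (up a) (up c) rfl ha hb hc hd'')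
        (hSh _ _ hkm _ _ _ _ t' x t y _ _ _ _ _ _ _ (up a') (up a) rfl ha'' hb' ha hb)
        (hSh _ _ hkm _ _ _ _ m' z m₀ w₀ _ _ _ _ _ _ _ (up c') (up c) rfl hc' hd' hc hd'')
    have e₁ : a' i = b' i := t'.2 i (Ne.symm hk)
    have e₂ : c' i = d' i := m'.2 i (Ne.symm hk)
    have e₃ : a i = b i := t.2 i (Ne.symm hk)
    have e₄ : c i = d i := m₀.2 i (Ne.symm hk)
    have hb' : b' i ≤ p := e₁ ▸ ha''
    have hc : p ≤ c i := e₄.symm ▸ hd''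
    by_cases hl : l = i
    · subst hl
      have e₅ : a' l = a l := x.2 l hlm.ne
      have e₆ : c' l = c l := z.2 l hlm.ne
      have ha : a l ≤ p := e₅ ▸ ha''
      have hb : b l ≤ p := e₃ ▸ ha
      have hc' : p ≤ c' l := e₆.symm ▸ hc
      have hd' : p ≤ d' l := e₂ ▸ hc'
      exact CommCube.mixed
        (x_cube (a' := ⟨a', ha''⟩) (b' := ⟨b', hb'⟩) (c' := ⟨_, (up a').le⟩)
          (d' := ⟨_, (up b').le⟩) (a := ⟨a, ha⟩) (b := ⟨b, hb⟩) (c := ⟨_, (up a).le⟩)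
          (d := ⟨_, (up b).le⟩) hkl hlm t' (.to_mid ha'') (t'.mid hk) (.to_mid hb')
          t (.to_mid ha) (t.mid hk) (.to_mid hb) x y (x.mid hlm.ne') (y.mid hlm.ne'))
        (y_cube (a' := ⟨_, (up a').ge⟩) (b' := ⟨_, (up b').ge⟩) (c' := ⟨c', hc'⟩)
          (d' := ⟨d', hd'⟩) (a := ⟨_, (up a).ge⟩) (b := ⟨_, (up b).ge⟩) (c := ⟨c, hc⟩)
          (d := ⟨d, hd''⟩) hkl hlm (t'.mid hk) (e'.from_mid hc') m' (r'.from_mid hd')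
          (t.mid hk) (e.from_mid hc) m₀ (r.from_mid hd'') (x.mid hlm.ne') (y.mid hlm.ne') z w₀)
        (hSv _ _ hkl _ _ _ _ t' e' m' r' _ _ _ _ _ _ _ (up a') (up b') rfl ha'' hb' hc' hd')
        (hSv _ _ hkl _ _ _ _ t e m₀ r _ _ _ _ _ _ _ (up a) (up b) rfl ha hb hc hd'')
        (hSh _ _ hlm _ _ _ _ e' x e z _ _ _ _ _ _ _ (up a') (up a) rfl ha'' hc' ha hc)
        (hSh _ _ hlm _ _ _ _ r' y r w₀ _ _ _ _ _ _ _ (up b') (up b) rfl hb' hd' hb hd'')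
    have e₅ : a' i = c' i := e'.2 i (Ne.symm hl)
    have e₆ : a i = c i := e.2 i (Ne.symm hl)
    have hc' : c' i ≤ p := e₅ ▸ ha''
    have hd' : d' i ≤ p := e₂ ▸ hc'
    have ha : p ≤ a i := e₆.symm ▸ hc
    have hb : p ≤ b i := e₃ ▸ ha
    obtain rfl : m = i := x.eq_of_crossing (not_le.1 ha') (by rw [e₆, e₄]; exact not_le.1 hd)
    exact CommCube.vcomp
      (x_cube (a' := ⟨a', ha''⟩) (b' := ⟨b', hb'⟩) (c' := ⟨c', hc'⟩) (d' := ⟨d', hd'⟩)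
        (a := ⟨_, (up a').le⟩) (b := ⟨_, (up b').le⟩) (c := ⟨_, (up c').le⟩)
        (d := ⟨_, (up d').le⟩) hkl hlm t' e' m' r' (t'.mid hk) (e'.mid hl) (m'.mid hk) (r'.mid hl)
        (.to_mid ha'') (.to_mid hb') (.to_mid hc') (.to_mid hd'))
      (y_cube (a' := ⟨_, (up a').ge⟩) (b' := ⟨_, (up b').ge⟩) (c' := ⟨_, (up c').ge⟩)
        (d' := ⟨_, (up d').ge⟩) (a := ⟨a, ha⟩) (b := ⟨b, hb⟩) (c := ⟨c, hc⟩) (d := ⟨d, hd''⟩)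
        hkl hlm (t'.mid hk) (e'.mid hl) (m'.mid hk) (r'.mid hl) t e m₀ r
        (x.from_mid ha) (y.from_mid hb) (z.from_mid hc) (w₀.from_mid hd''))
      (hSv _ _ hkm _ _ _ _ t' x t y _ _ _ _ _ _ _ (up a') (up b') rfl ha'' hb' ha hb)
      (hSv _ _ hkm _ _ _ _ m' z m₀ w₀ _ _ _ _ _ _ _ (up c') (up d') rfl hc' hd' hc hd'')
      (hSv _ _ hlm _ _ _ _ e' x e z _ _ _ _ _ _ _ (up a') (up c') rfl ha'' hc' ha hc)
      (hSv _ _ hlm _ _ _ _ r' y r w₀ _ _ _ _ _ _ _ (up b') (up d') rfl hb' hd' hb hd'')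

end QuasiFunctor
end Glue

section Unique

variable {n : ℕ} {α : Fin n → ℕ} {C : Type u} [Bicategory.{w, v} C]

namespace QuasiFunctor

theorem eq_of_restr_eq (i : Fin n) (p : Fin (α i + 1)) {F G : QuasiFunctor (boxStep α) C}
    (h₁ : F.restr {a | a i ≤ p} = G.restr {a | a i ≤ p})
    (h₂ : F.restr {a | p ≤ a i} = G.restr {a | p ≤ a i}) : F = G := by
  have hO : F.obj = G.obj := by
    funext a
    rcases le_total (a i) p with ha | ha
    · exact congrFun (congrArg QuasiFunctor.obj h₁) ⟨a, ha⟩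
    · exact congrFun (congrArg QuasiFunctor.obj h₂) ⟨a, ha⟩
  have hm₁ := fun k a b s => map_heq h₁ (k := k) (a := a) (b := b) s
  have hm₂ := fun k a b s => map_heq h₂ (k := k) (a := a) (b := b) s
  have hc₁ := fun k l hkl a b c d t e m r =>
    cell_heq h₁ (k := k) (l := l) hkl (a := a) (b := b) (c := c) (d := d) t e m r
  have hc₂ := fun k l hkl a b c d t e m r =>
    cell_heq h₂ (k := k) (l := l) hkl (a := a) (b := b) (c := c) (d := d) t e m r
  clear h₁ h₂
  obtain ⟨O, M, x_id, x_comp, S, x_hid, x_vid, x_hcomp, x_vcomp, x_cube⟩ := F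
  obtain ⟨O', M', y_id, y_comp, S', y_hid, y_vid, y_hcomp, y_vcomp, y_cube⟩ := G
  dsimp only at hO
  subst hO
  have up : ∀ a : Box α, (Function.update a i p) i = p := fun a => Function.update_self ..
  have hM : @M = @M' := by
    have h₁ : ∀ k (a b : Box α) (s : boxStep α k a b), b i ≤ p → M s = M' s := fun k a b s h =>
      eq_of_heq (hm₁ k ⟨a, (s.le i).trans h⟩ ⟨b, h⟩ s)
    have h₂ : ∀ k (a b : Box α) (s : boxStep α k a b), p ≤ a i → M s = M' s := fun k a b s h =>
      eq_of_heq (hm₂ k ⟨a, h⟩ ⟨b, h.trans (s.le i)⟩ s)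
    funext k a b s
    by_cases hb : b i ≤ p
    · exact h₁ k a b s hb
    by_cases ha : p ≤ a i
    · exact h₂ k a b s ha
    obtain rfl := s.eq_of_crossing (not_le.1 ha) (not_le.1 hb)
    have ha' := (not_le.1 ha).le
    have hb' := (not_le.1 hb).le
    rw [x_comp (.to_mid ha') (s.from_mid hb') s, y_comp (.to_mid ha') (s.from_mid hb') s,
      h₁ _ _ _ _ (up a).le, h₂ _ _ _ _ (up a).ge]
  subst hM
  have hS : @S = @S' := by
    have h₁ : ∀ k l hkl (a b c d : Box α) (t : boxStep α k a b) (e : boxStep α l a c)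
        (m : boxStep α k c d) (r : boxStep α l b d), d i ≤ p → S hkl t e m r = S' hkl t e m r :=
      fun k l hkl a b c d t e m r h => eq_of_heq (hc₁ k l hkl
        ⟨a, (t.le i).trans ((r.le i).trans h)⟩ ⟨b, (r.le i).trans h⟩ ⟨c, (m.le i).trans h⟩ ⟨d, h⟩
        t e m r)
    have h₂ : ∀ k l hkl (a b c d : Box α) (t : boxStep α k a b) (e : boxStep α l a c)
        (m : boxStep α k c d) (r : boxStep α l b d), p ≤ a i → S hkl t e m r = S' hkl t e m r :=
      fun k l hkl a b c d t e m r h => eq_of_heq (hc₂ k l hkl ⟨a, h⟩ ⟨b, h.trans (t.le i)⟩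
        ⟨c, h.trans (e.le i)⟩ ⟨d, h.trans ((t.le i).trans (r.le i))⟩ t e m r)
    funext k l hkl a b c d t e m r
    by_cases hd : d i ≤ p
    · exact h₁ k l hkl a b c d t e m r hd
    by_cases ha : p ≤ a i
    · exact h₂ k l hkl a b c d t e m r ha
    have ha' := (not_le.1 ha).le
    have hd' := (not_le.1 hd).le
    have key : ∀ σ τ : M e ≫ M m ⟶ M t ≫ M r,
        (⟨M t, M e, M m, M r, σ⟩ : UpSquare _ _ _ _) = ⟨M t, M e, M m, M r, τ⟩ → σ = τ := by
      intro σ τ h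
      simpa using h
    by_cases hk : k = i
    · subst hk
      have hac : a k = c k := e.2 k hkl.ne
      have hbd : b k = d k := r.2 k hkl.ne
      have hc' : c k ≤ p := hac ▸ ha'
      have hb' : p ≤ b k := hbd.symm ▸ hd'
      refine key _ _ ?_
      rw [x_hcomp hkl (.to_mid ha') e (.to_mid hc') (e.mid hkl.ne') (t.from_mid hb')
        (m.from_mid hd') r, y_hcomp hkl (.to_mid ha') e (.to_mid hc') (e.mid hkl.ne')
        (t.from_mid hb') (m.from_mid hd') r]
      congr 2
      · exact h₁ _ _ _ _ _ _ _ _ _ _ _ (up c).le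
      · exact h₂ _ _ _ _ _ _ _ _ _ _ _ (up a).ge
    · have hab : a i = b i := t.2 i (Ne.symm hk)
      have hcd : c i = d i := m.2 i (Ne.symm hk)
      obtain rfl : l = i := e.eq_of_crossing (not_le.1 ha) (hcd ▸ not_le.1 hd)
      have hb' : b l ≤ p := hab ▸ ha'
      have hc' : p ≤ c l := hcd.symm ▸ hd'
      refine key _ _ ?_
      rw [x_vcomp hkl t (.to_mid ha') (t.mid hk) (.to_mid hb') (e.from_mid hc') m
        (r.from_mid hd'), y_vcomp hkl t (.to_mid ha') (t.mid hk) (.to_mid hb') (e.from_mid hc') m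
        (r.from_mid hd')]
      congr 2
      · exact h₁ _ _ _ _ _ _ _ _ _ _ _ (up b).le
      · exact h₂ _ _ _ _ _ _ _ _ _ _ _ (up a).ge
  subst hS
  rfl

end QuasiFunctor
end Unique

/-! ### Boxes and their maps -/

section Boxes

variable {n : ℕ}

/-- Families of order-preserving maps `{0, …, α j} → {0, …, β j}`; between shapes with entries
`0` and `1` these are the morphisms of the `n`-th power of the category of `[0]` and `[1]`. -/
abbrev BoxHom (α β : Fin n → ℕ) : Type := ∀ j, Fin (α j + 1) →o Fin (β j + 1)

namespace BoxHom

variable {α β γ δ : Fin n → ℕ}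

def id (α : Fin n → ℕ) : BoxHom α α := fun _ => OrderHom.id

def comp (m : BoxHom α β) (m' : BoxHom β γ) : BoxHom α γ := fun j => (m' j).comp (m j)

/-- The induced map on vertices. -/
def app (m : BoxHom α β) (a : Box α) : Box β := fun j => m j (a j)

theorem app_step (m : BoxHom α β) (k : Fin n) (a b : Box α) (h : boxStep α k a b) :
    boxStep β k (m.app a) (m.app b) :=
  ⟨(m k).monotone h.1, fun j hj => congrArg (m j) (h.2 j hj)⟩

/-- `f` in direction `i` and the identity in the other directions (values that are too large
are replaced by the largest admissible one). -/
def along (i : Fin n) (f : ℕ →o ℕ) : BoxHom α β := fun j =>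
  { toFun := fun t => ⟨min (if j = i then f t else t) (β j), by omega⟩
    monotone' := by
      intro s t hst
      have h : (s : ℕ) ≤ t := hst
      have h' := f.monotone h
      simp only [Fin.mk_le_mk]
      split_ifs <;> omega }

theorem along_val (i : Fin n) (f : ℕ →o ℕ) (a : Box α) (j : Fin n) :
    ((along (β := β) i f).app a j : ℕ) = min (if j = i then f (a j) else a j) (β j) := rfl

end BoxHom

/-- The shape of an `I`-hypercube: `1` in the directions of `I`, `0` elsewhere. -/
def shape (I : Finset (Fin n)) (j : Fin n) : ℕ := if j ∈ I then 1 else 0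

/-- The inclusion of the face `t` of an `I`-hypercube in direction `i`. -/
def faceMap (I : Finset (Fin n)) (i : Fin n) (t : ℕ) : BoxHom (shape (I.erase i)) (shape I) :=
  .along i (OrderHom.const ℕ t)

/-- The projection along direction `i`. -/
def degenMap (I : Finset (Fin n)) (i : Fin n) : BoxHom (shape I) (shape (I.erase i)) :=
  .along i OrderHom.id

end Boxes

/-! ### `n`-fold categories -/

/-- An `n`-fold category: a presheaf of `I`-morphisms (`I` a set of directions) on the `n`-th power
of the category of `[0]` and `[1]`, with a composition `x` followed by `y` in each direction
`i ∈ I`. -/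
structure NFoldCat (n : ℕ) where
  cell : Finset (Fin n) → Type u
  act {I J : Finset (Fin n)} : BoxHom (shape I) (shape J) → cell J → cell I
  act_id {I : Finset (Fin n)} (x : cell I) : act (.id _) x = x
  act_comp {I J K : Finset (Fin n)} (m : BoxHom (shape I) (shape J))
    (m' : BoxHom (shape J) (shape K)) (x : cell K) : act (m.comp m') x = act m (act m' x)
  comp {I : Finset (Fin n)} (i : Fin n) (hi : i ∈ I) (x y : cell I)
    (h : act (faceMap I i 1) x = act (faceMap I i 0) y) : cell I
  source_comp {I : Finset (Fin n)} (i : Fin n) (hi : i ∈ I) (x y : cell I)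
    (h : act (faceMap I i 1) x = act (faceMap I i 0) y) :
    act (faceMap I i 0) (comp i hi x y h) = act (faceMap I i 0) x
  target_comp {I : Finset (Fin n)} (i : Fin n) (hi : i ∈ I) (x y : cell I)
    (h : act (faceMap I i 1) x = act (faceMap I i 0) y) :
    act (faceMap I i 1) (comp i hi x y h) = act (faceMap I i 1) y
  id_comp {I : Finset (Fin n)} (i : Fin n) (hi : i ∈ I) (x : cell I) (h) :
    comp i hi (act (degenMap I i) (act (faceMap I i 0) x)) x h = x
  comp_id {I : Finset (Fin n)} (i : Fin n) (hi : i ∈ I) (x : cell I) (h) :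
    comp i hi x (act (degenMap I i) (act (faceMap I i 1) x)) h = x
  assoc {I : Finset (Fin n)} (i : Fin n) (hi : i ∈ I) (x y z : cell I) (h₁ h₂ h₃ h₄) :
    comp i hi (comp i hi x y h₁) z h₂ = comp i hi x (comp i hi y z h₃) h₄
  act_comp' {I J : Finset (Fin n)} (i : Fin n) (hi : i ∈ I) (hi' : i ∈ J)
    (m : BoxHom (shape I) (shape J)) (hm : ∀ t, (m i t : ℕ) = t) (x y : cell J) (h h') :
    act m (comp i hi' x y h) = comp i hi (act m x) (act m y) h'
  interchange {I : Finset (Fin n)} (i j : Fin n) (hij : i < j) (hi : i ∈ I) (hj : j ∈ I)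
    (x y z w : cell I) (h₁ h₂ h₃ h₄ h₅ h₆) :
    comp j hj (comp i hi x y h₁) (comp i hi z w h₂) h₃ =
      comp i hi (comp j hj x z h₄) (comp j hj y w h₅) h₆

section Qn

variable {n : ℕ} {C : Type u} [Bicategory.{w, v} C]

namespace QuasiFunctor

variable {α β γ δ : Fin n → ℕ}

/-- Restriction of a quasi-functor along a map of boxes. -/
def act (m : BoxHom α β) (F : QuasiFunctor (boxStep β) C) : QuasiFunctor (boxStep α) C :=
  F.pull m.app m.app_step

theorem pull_congr {V V' : Type} {step : Fin n → V → V → Prop} {step' : Fin n → V' → V' → Prop}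
    (F : QuasiFunctor step C) {g g' : V' → V} (h : g = g') (hg hg') :
    F.pull (step' := step') g hg = F.pull g' hg' := by
  subst h; rfl

theorem act_act_congr {β' : Fin n → ℕ} (m : BoxHom α β) (m' : BoxHom β γ) (m₂ : BoxHom α β')
    (m₂' : BoxHom β' γ) (F : QuasiFunctor (boxStep γ) C)
    (h : ∀ a : Box α, ∀ j, (m' j (m j (a j)) : ℕ) = m₂' j (m₂ j (a j))) :
    act m (act m' F) = act m₂ (act m₂' F) :=
  pull_congr F (g := fun a => m'.app (m.app a)) (g' := fun a => m₂'.app (m₂.app a))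
    (by funext a j; exact Fin.ext (h a j)) (fun _ _ _ h => m'.app_step _ _ _ (m.app_step _ _ _ h))
    (fun _ _ _ h => m₂'.app_step _ _ _ (m₂.app_step _ _ _ h))

theorem act_congr (m : BoxHom α β) (m₂ : BoxHom β γ) (m₃ : BoxHom α γ)
    (F : QuasiFunctor (boxStep γ) C)
    (h : ∀ a : Box α, ∀ j, (m₂ j (m j (a j)) : ℕ) = m₃ j (a j)) :
    act m (act m₂ F) = act m₃ F :=
  pull_congr F (g := fun a => m₂.app (m.app a)) (g' := m₃.app)
    (by funext a j; exact Fin.ext (h a j)) (fun _ _ _ h => m₂.app_step _ _ _ (m.app_step _ _ _ h))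
    m₃.app_step

theorem act_eq_self (m : BoxHom α β) (m₂ : BoxHom β α) (F : QuasiFunctor (boxStep α) C)
    (h : ∀ a : Box α, ∀ j, (m₂ j (m j (a j)) : ℕ) = a j) : act m (act m₂ F) = F :=
  pull_congr (g' := _root_.id) _ (by funext a j; exact Fin.ext (h a j)) _ (fun _ _ _ h => h)

/-- `t ↦ t + p`. -/
def shift (p : ℕ) : ℕ →o ℕ := ⟨fun t => t + p, fun _ _ h => Nat.add_le_add_right h p⟩

/-- `t ↦ t - p`. -/
def unshift (p : ℕ) : ℕ →o ℕ := ⟨fun t => t - p, fun _ _ h => Nat.sub_le_sub_right h p⟩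

/-- `t ↦ p t`. -/
def scale (p : ℕ) : ℕ →o ℕ := ⟨fun t => p * t, fun _ _ h => Nat.mul_le_mul_left p h⟩

@[simp] theorem shift_apply (p t : ℕ) : shift p t = t + p := rfl

@[simp] theorem unshift_apply (p t : ℕ) : unshift p t = t - p := rfl

@[simp] theorem scale_apply (p t : ℕ) : scale p t = p * t := rfl

/-- The end `t` in direction `i`. -/
def endMap (i : Fin n) (t : ℕ) : BoxHom γ β := .along i (OrderHom.const ℕ t)

theorem restr_act (m : BoxHom α β) (m₂ : BoxHom β α) (S : Set (Box α))
    (F : QuasiFunctor (boxStep α) C)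
    (h : ∀ a ∈ S, ∀ j, (m₂ j (m j (a j)) : ℕ) = a j) :
    (act m (act m₂ F)).restr S = F.restr S :=
  pull_congr F (g := fun a : S => m₂.app (m.app a.1)) (g' := Subtype.val)
    (by funext a j; exact Fin.ext (h a.1 a.2 j))
    (fun _ _ _ h => m₂.app_step _ _ _ (m.app_step _ _ _ h)) (fun _ _ _ h => h)

theorem eq_of_act_eq (i : Fin n) {γ₁ γ₂ : Fin n → ℕ} {p q : ℕ} (hβ : β i = p + q)
    (hp : γ₁ i = p) (hq : γ₂ i = q) (h₁ : ∀ j, j ≠ i → γ₁ j = β j)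
    (h₂ : ∀ j, j ≠ i → γ₂ j = β j) {F G : QuasiFunctor (boxStep β) C}
    (h : act (.along (α := γ₁) i OrderHom.id) F = act (.along i OrderHom.id) G)
    (h' : act (.along (α := γ₂) i (shift p)) F = act (.along i (shift p)) G) : F = G := by
  let P : Fin (β i + 1) := ⟨p, by omega⟩
  have key₁ : ∀ a : Box β, a i ≤ P → ∀ j, ((BoxHom.along (α := γ₁) i OrderHom.id : BoxHom γ₁ β) j
      ((BoxHom.along i OrderHom.id : BoxHom β γ₁) j (a j)) : ℕ) = a j := by
    intro a ha j
    replace ha : (a i : ℕ) ≤ p := ha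
    have := (a j).isLt
    by_cases hj : j = i
    · subst hj; simp [BoxHom.along]; omega
    · have := h₁ j hj; simp [BoxHom.along]; omega
  have key₂ : ∀ a : Box β, P ≤ a i → ∀ j, ((BoxHom.along (α := γ₂) i (shift p) : BoxHom γ₂ β) j
      ((BoxHom.along i (unshift p) : BoxHom β γ₂) j (a j)) : ℕ) = a j := by
    intro a ha j
    replace ha : p ≤ (a i : ℕ) := ha
    have := (a j).isLt
    by_cases hj : j = i
    · subst hj; simp [BoxHom.along]; omega
    · have := h₂ j hj; simp [BoxHom.along, hj]; omega
  refine eq_of_restr_eq i P ?_ ?_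
  · exact (restr_act _ _ {a | a i ≤ P} F key₁).symm.trans ((congrArg (fun F => (act _ F).restr
      {a | a i ≤ P}) h).trans (restr_act _ _ {a | a i ≤ P} G key₁))
  · exact (restr_act _ _ {a | P ≤ a i} F key₂).symm.trans ((congrArg (fun F => (act _ F).restr
      {a | P ≤ a i}) h').trans (restr_act _ _ {a | P ≤ a i} G key₂))

/-- Existence of gluings of boxes in direction `i`. -/
theorem exists_act_eq [Strict C] (i : Fin n) {γ₀ γ₁ γ₂ : Fin n → ℕ} {p q : ℕ} (hβ : β i = p + q)
    (hp : γ₁ i = p) (hq : γ₂ i = q) (h₀ : ∀ j, j ≠ i → γ₀ j = β j)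
    (h₁ : ∀ j, j ≠ i → γ₁ j = β j) (h₂ : ∀ j, j ≠ i → γ₂ j = β j)
    (x : QuasiFunctor (boxStep γ₁) C) (y : QuasiFunctor (boxStep γ₂) C)
    (h : act (endMap (γ := γ₀) i p) x = act (endMap i 0) y) :
    ∃ z : QuasiFunctor (boxStep β) C,
      act (.along i OrderHom.id) z = x ∧ act (.along i (shift p)) z = y := by
  let P : Fin (β i + 1) := ⟨p, by omega⟩
  let x' := (act (.along (α := β) i OrderHom.id) x).restr {a | a i ≤ P}
  let y' := (act (.along (α := β) i (unshift p)) y).restr {a | P ≤ a i}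
  obtain ⟨z, hx, hy⟩ := exists_glue i P x' y' (by
    have e := congrArg (fun F : QuasiFunctor (boxStep γ₀) C =>
      (act (.along (α := β) i OrderHom.id) F).restr {a | a i = P}) h
    refine Eq.trans (pull_congr x ?_ _ _) (e.trans (pull_congr y ?_ _ _))
    · funext ⟨a, ha⟩ j
      replace ha : (a i : ℕ) = p := congrArg Fin.val ha
      apply Fin.ext
      simp only [BoxHom.app, BoxHom.along, endMap]
      have := (a j).isLt
      by_cases hj : j = i
      · subst hj; simp; omega
      · have := h₀ j hj; have := h₁ j hj; simp [hj]; omega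
    · funext ⟨a, ha⟩ j
      replace ha : (a i : ℕ) = p := congrArg Fin.val ha
      apply Fin.ext
      simp only [BoxHom.app, BoxHom.along, endMap]
      have := (a j).isLt
      by_cases hj : j = i
      · subst hj; simp; omega
      · have := h₀ j hj; have := h₂ j hj; simp [hj]; omega)
  refine ⟨z, ?_, ?_⟩
  · have key : ∀ a : Box γ₁, (BoxHom.along (β := β) i OrderHom.id).app a ∈ {a : Box β | a i ≤ P} := by
      intro a
      change min _ (β i) ≤ p
      have := (a i).isLt
      simp
      omega
    refine (congrArg (fun F => F.pull (step' := boxStep γ₁)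
      (fun a => ⟨(BoxHom.along i OrderHom.id).app a, key a⟩)
      (fun k a b h => BoxHom.app_step _ k a b h)) hx).trans (act_eq_self _ _ x ?_)
    intro a j
    have := (a j).isLt
    by_cases hj : j = i
    · subst hj; simp [BoxHom.along]; omega
    · have := h₁ j hj; simp [BoxHom.along]; omega
  · have key : ∀ a : Box γ₂, (BoxHom.along (β := β) i (shift p)).app a ∈ {a : Box β | P ≤ a i} := by
      intro a
      change p ≤ min _ (β i)
      have := (a i).isLt
      simp
      omega
    refine (congrArg (fun F => F.pull (step' := boxStep γ₂)
      (fun a => ⟨(BoxHom.along i (shift p)).app a, key a⟩)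
      (fun k a b h => BoxHom.app_step _ k a b h)) hy).trans (act_eq_self _ _ y ?_)
    intro a j
    have := (a j).isLt
    by_cases hj : j = i
    · subst hj; simp [BoxHom.along]; omega
    · have := h₂ j hj; simp [BoxHom.along, hj]; omega

end QuasiFunctor
end Qn

section QnComp

variable {n : ℕ} {C : Type u} [Bicategory.{w, v} C]

namespace QuasiFunctor

variable {α β γ δ : Fin n → ℕ}

/-- `w` is the composite of `x` and `y` in direction `i`: the three of them are the restrictions
of a quasi-functor on a box of length `2` in direction `i`. -/
def IsComp (i : Fin n) (x y w : QuasiFunctor (boxStep α) C) : Prop :=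
  ∃ z : QuasiFunctor (boxStep (Function.update α i 2)) C,
    act (.along i OrderHom.id) z = x ∧ act (.along i (shift 1)) z = y ∧
      act (.along i (scale 2)) z = w

theorem exists_isComp [Strict C] {i : Fin n} (hα : α i = 1) (h₀ : ∀ j, j ≠ i → γ j = α j)
    {x y : QuasiFunctor (boxStep α) C}
    (h : act (.along (α := γ) i (OrderHom.const ℕ 1)) x = act (.along i (OrderHom.const ℕ 0)) y) :
    ∃ w, IsComp i x y w := by
  obtain ⟨z, h₁, h₂⟩ := exists_act_eq (β := Function.update α i 2) (γ₀ := γ) i (p := 1) (q := 1)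
    (by simp) hα hα (by intro j hj; simp [hj, h₀]) (by intro j hj; simp [hj])
    (by intro j hj; simp [hj]) x y h
  exact ⟨_, z, h₁, h₂, rfl⟩

theorem IsComp.unique {i : Fin n} (hα : α i = 1) {x y w w' : QuasiFunctor (boxStep α) C}
    (h : IsComp i x y w) (h' : IsComp i x y w') : w = w' := by
  obtain ⟨z, h₁, h₂, rfl⟩ := h
  obtain ⟨z', h₁', h₂', rfl⟩ := h'
  have : z = z' := eq_of_act_eq i (p := 1) (q := 1) (by simp) hα hα
    (by intro j hj; simp [hj]) (by intro j hj; simp [hj]) (h₁.trans h₁'.symm) (h₂.trans h₂'.symm)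
  rw [this]

theorem IsComp.source {i : Fin n} {x y w : QuasiFunctor (boxStep α) C}
    (h : IsComp i x y w) : act (.along (α := γ) i (OrderHom.const ℕ 0)) w =
      act (.along i (OrderHom.const ℕ 0)) x := by
  obtain ⟨z, rfl, rfl, rfl⟩ := h
  refine act_act_congr _ _ _ _ z fun a j => ?_
  by_cases hj : j = i
  · subst hj; simp [BoxHom.along]
  · simp [BoxHom.along, hj]

theorem IsComp.target {i : Fin n} (hα : α i = 1) {x y w : QuasiFunctor (boxStep α) C}
    (h : IsComp i x y w) : act (.along (α := γ) i (OrderHom.const ℕ 1)) w =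
      act (.along i (OrderHom.const ℕ 1)) y := by
  obtain ⟨z, rfl, rfl, rfl⟩ := h
  refine act_act_congr _ _ _ _ z fun a j => ?_
  by_cases hj : j = i
  · subst hj; simp [BoxHom.along, hα]
  · simp [BoxHom.along, hj]

theorem isComp_id_left {i : Fin n} (hα : α i = 1) (hγ : γ i = 0) (h₀ : ∀ j, j ≠ i → γ j = α j)
    (x : QuasiFunctor (boxStep α) C) :
    IsComp i (act (.along i OrderHom.id) (act (.along (α := γ) i (OrderHom.const ℕ 0)) x)) x x := by
  refine ⟨act (.along i (unshift 1)) x, ?_, ?_, ?_⟩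
  · refine act_act_congr _ _ _ _ x fun a j => ?_
    have := (a j).isLt
    by_cases hj : j = i
    · subst hj; simp [BoxHom.along]; omega
    · have := h₀ j hj; simp [BoxHom.along, hj]; omega
  all_goals
    refine act_eq_self _ _ x fun a j => ?_
    have := (a j).isLt
    by_cases hj : j = i
    · subst hj; simp [BoxHom.along]; omega
    · simp [BoxHom.along, hj]; omega

theorem isComp_id_right {i : Fin n} (hα : α i = 1) (hγ : γ i = 0) (h₀ : ∀ j, j ≠ i → γ j = α j)
    (x : QuasiFunctor (boxStep α) C) :
    IsComp i x (act (.along i OrderHom.id) (act (.along (α := γ) i (OrderHom.const ℕ 1)) x)) x := by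
  refine ⟨act (.along i OrderHom.id) x, ?_, ?_, ?_⟩
  · refine act_eq_self _ _ x fun a j => ?_
    have := (a j).isLt
    by_cases hj : j = i
    · subst hj; simp [BoxHom.along]; omega
    · simp [BoxHom.along, hj]; omega
  · refine act_act_congr _ _ _ _ x fun a j => ?_
    have := (a j).isLt
    by_cases hj : j = i
    · subst hj; simp [BoxHom.along]; omega
    · have := h₀ j hj; simp [BoxHom.along, hj]; omega
  · refine act_eq_self _ _ x fun a j => ?_
    have := (a j).isLt
    by_cases hj : j = i
    · subst hj; simp [BoxHom.along]; omega
    · simp [BoxHom.along, hj]; omega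

theorem isComp_act {i : Fin n} (hα : α i = 1) (hβ : β i = 1) (m : BoxHom α β)
    (hm : ∀ t, (m i t : ℕ) = t) {x y w : QuasiFunctor (boxStep β) C} (h : IsComp i x y w) :
    IsComp i (act m x) (act m y) (act m w) := by
  obtain ⟨z, rfl, rfl, rfl⟩ := h
  let m' : BoxHom (Function.update α i 2) (Function.update β i 2) := fun j =>
    ⟨fun t => ⟨min (if j = i then t else m j ⟨min t (α j), by omega⟩) (Function.update β i 2 j),
      by omega⟩, by
      intro s t hst
      have h : (s : ℕ) ≤ t := hst
      have h' : m j ⟨min s (α j), by omega⟩ ≤ m j ⟨min t (α j), by omega⟩ :=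
        (m j).monotone (by simp only [Fin.mk_le_mk]; omega)
      have h'' : (m j ⟨min s (α j), by omega⟩ : ℕ) ≤ m j ⟨min t (α j), by omega⟩ := h'
      simp only [Fin.mk_le_mk]
      split_ifs <;> omega⟩
  refine ⟨QuasiFunctor.act m' z, ?_, ?_, ?_⟩
  all_goals
    refine act_act_congr _ _ _ _ z fun a j => ?_
    have := (a j).isLt
    by_cases hj : j = i
    · subst hj
      have := hm (a j)
      simp [BoxHom.along, m', hm]
    · have key : ∀ s h, s = (a j : ℕ) → (m j ⟨s, h⟩ : ℕ) = m j (a j) := by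
        rintro s h rfl; rfl
      simp only [BoxHom.along, m', hj, OrderHom.coe_mk, if_false]
      rw [key _ _ (by simp [hj]; omega)]
      try omega

theorem IsComp.compat {i : Fin n} {x y w : QuasiFunctor (boxStep α) C}
    (hα : α i = 1) (h : IsComp i x y w) : act (.along (α := γ) i (OrderHom.const ℕ 1)) x =
      act (.along i (OrderHom.const ℕ 0)) y := by
  obtain ⟨z, rfl, rfl, rfl⟩ := h
  refine act_act_congr _ _ _ _ z fun a j => ?_
  by_cases hj : j = i
  · subst hj; simp [BoxHom.along, hα]
  · simp [BoxHom.along, hj]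

/-- `0, 1, 2 ↦ 0, 2, 3`. -/
def skip₁ : ℕ →o ℕ :=
  ⟨fun t => if t = 0 then 0 else t + 1, fun s t h => by dsimp only; split_ifs <;> omega⟩

/-- `0, 1, 2 ↦ 0, 1, 3`. -/
def skip₂ : ℕ →o ℕ :=
  ⟨fun t => if t ≤ 1 then t else t + 1, fun s t h => by dsimp only; split_ifs <;> omega⟩

@[simp] theorem skip₁_apply (t : ℕ) : skip₁ t = if t = 0 then 0 else t + 1 := rfl

@[simp] theorem skip₂_apply (t : ℕ) : skip₂ t = if t ≤ 1 then t else t + 1 := rfl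

theorem IsComp.assoc [Strict C] {i : Fin n} (hα : α i = 1)
    {x y z xy yz w w' : QuasiFunctor (boxStep α) C} (h₁ : IsComp i x y xy) (h₂ : IsComp i xy z w)
    (h₃ : IsComp i y z yz) (h₄ : IsComp i x yz w') : w = w' := by
  have hz := h₂.compat (γ := Function.update α i 0) hα
  obtain ⟨f, rfl, rfl, rfl⟩ := h₁
  obtain ⟨t, rfl, rfl⟩ := exists_act_eq (β := Function.update α i 3)
    (γ₀ := Function.update α i 0) i (p := 2) (q := 1)
    (by simp) (by simp) hα (by intro j hj; simp [hj]) (by intro j hj; simp [hj])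
    (by intro j hj; simp [hj]) f z (by
      refine Eq.trans ?_ hz
      symm
      refine act_congr _ _ _ f fun a j => ?_
      by_cases hj : j = i
      · subst hj; simp [BoxHom.along, endMap, hα]
      · simp [BoxHom.along, endMap, hj])
  have h₃' := h₃.unique hα (w' := act (.along i (scale 2)) (act (.along (α := Function.update α i 2)
    i (shift 1)) t)) ⟨_, by
      refine act_act_congr _ _ _ _ t fun a j => ?_
      have := (a j).isLt
      by_cases hj : j = i
      · subst hj; simp [BoxHom.along]; omega
      · simp [BoxHom.along, hj], by
      refine act_congr _ _ _ t fun a j => ?_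
      have := (a j).isLt
      by_cases hj : j = i
      · subst hj; simp [BoxHom.along]; omega
      · simp [BoxHom.along, hj], rfl⟩
  subst h₃'
  have e₁ : w = act (.along i (scale 2)) (act (.along (α := Function.update α i 2) i skip₁) t) :=
    h₂.unique hα ⟨_, ?_, ?_, rfl⟩
  have e₂ : w' = act (.along i (scale 2)) (act (.along (α := Function.update α i 2) i skip₂) t) :=
    h₄.unique hα ⟨_, ?_, ?_, rfl⟩
  rw [e₁, e₂]
  all_goals
    first
      | refine act_act_congr _ _ _ _ t fun a k => ?_
      | refine act_congr _ _ _ t fun a k => ?_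
    have := (a k).isLt
    by_cases hk : k = i
    · subst hk
      have hv : (a k : ℕ) = 0 ∨ (a k : ℕ) = 1 := by omega
      rcases hv with h | h <;> simp [BoxHom.along, h]
    · simp [BoxHom.along, hk]

set_option maxHeartbeats 1000000 in
theorem IsComp.interchange [Strict C] {i j : Fin n} (hij : i ≠ j) (hi : α i = 1) (hj : α j = 1)
    {x y z w a b c d r r' : QuasiFunctor (boxStep α) C} (h₁ : IsComp i x y a)
    (h₂ : IsComp i z w b) (h₃ : IsComp j a b r) (h₄ : IsComp j x z c) (h₅ : IsComp j y w d)
    (h₆ : IsComp i c d r') : r = r' := by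
  have hxz := h₄.compat (γ := Function.update α j 0) hj
  have hyw := h₅.compat (γ := Function.update α j 0) hj
  obtain ⟨f, rfl, rfl, rfl⟩ := h₁
  obtain ⟨g, rfl, rfl, rfl⟩ := h₂
  obtain ⟨t, rfl, rfl⟩ := exists_act_eq (β := Function.update (Function.update α i 2) j 2)
    (γ₀ := Function.update (Function.update α i 2) j 0) j (p := 1) (q := 1)
    (by simp) (by simp [hij.symm, hj]) (by simp [hij.symm, hj]) (by intro k hk; simp [hk])
    (by intro k hk; simp [hk]) (by intro k hk; simp [hk]) f g (by
      refine eq_of_act_eq i (γ₁ := Function.update α j 0) (γ₂ := Function.update α j 0) (p := 1)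
        (q := 1) (by simp [hij]) (by simp [hij, hi]) (by simp [hij, hi])
        (by intro k hk; by_cases h : k = j <;> simp [hk, h])
        (by intro k hk; by_cases h : k = j <;> simp [hk, h]) ?_ ?_
      · refine Eq.trans ?_ (hxz.trans ?_)
        all_goals
          first
            | refine act_act_congr _ _ _ _ _ fun a k => ?_
            | refine act_congr _ _ _ _ fun a k => ?_
          have := (a k).isLt
          rcases eq_or_ne k i with rfl | hk
          · simp [hij, hi] at this
            simp [BoxHom.along, endMap, hij, hi] <;> omega
          · rcases eq_or_ne k j with rfl | hk'
            · simp [hij.symm, hj] at this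
              simp [BoxHom.along, endMap, hij.symm, hj] <;> omega
            · simp [hk, hk'] at this
              simp [BoxHom.along, endMap, hk, hk'] <;> omega
      · refine Eq.trans ?_ (hyw.trans ?_)
        all_goals
          first
            | refine act_act_congr _ _ _ _ _ fun a k => ?_
            | refine act_congr _ _ _ _ fun a k => ?_
          have := (a k).isLt
          rcases eq_or_ne k i with rfl | hk
          · simp [hij, hi] at this
            simp [BoxHom.along, endMap, hij, hi] <;> omega
          · rcases eq_or_ne k j with rfl | hk'
            · simp [hij.symm, hj] at this
              simp [BoxHom.along, endMap, hij.symm, hj] <;> omega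
            · simp [hk, hk'] at this
              simp [BoxHom.along, endMap, hk, hk'] <;> omega)
  have e₁ : r = act (.along j (scale 2)) (act (.along (α := Function.update α j 2) i (scale 2)) t) :=
    h₃.unique hj ⟨_, ?_, ?_, rfl⟩
  have e₂ : c = act (.along j (scale 2)) (act (.along (α := Function.update α j 2) i OrderHom.id) t) :=
    h₄.unique hj ⟨_, ?_, ?_, rfl⟩
  have e₃ : d = act (.along j (scale 2)) (act (.along (α := Function.update α j 2) i (shift 1)) t) :=
    h₅.unique hj ⟨_, ?_, ?_, rfl⟩
  have e₄ : r' = act (.along i (scale 2)) (act (.along (α := Function.update α i 2) j (scale 2)) t) :=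
    h₆.unique hi ⟨_, ?_, ?_, rfl⟩
  rw [e₁, e₄]
  all_goals
    try rw [e₂]
    try rw [e₃]
    first
      | refine act_act_congr _ _ _ _ t fun a k => ?_
      | refine act_congr _ _ _ t fun a k => ?_
    have := (a k).isLt
    rcases eq_or_ne k i with rfl | hk
    · simp [hij, hi] at this
      simp [BoxHom.along, endMap, hij, hi] <;> omega
    · rcases eq_or_ne k j with rfl | hk'
      · simp [hij.symm, hj] at this
        simp [BoxHom.along, endMap, hij.symm, hj] <;> omega
      · simp [hk, hk'] at this
        simp [BoxHom.along, endMap, hk, hk'] <;> omega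

end QuasiFunctor
end QnComp

section Qn

variable {n : ℕ}

theorem shape_mem {I : Finset (Fin n)} {i : Fin n} (hi : i ∈ I) : shape I i = 1 := by
  simp [shape, hi]

theorem shape_erase (I : Finset (Fin n)) (i : Fin n) : shape (I.erase i) i = 0 := by
  simp [shape]

theorem shape_erase_of_ne (I : Finset (Fin n)) (i j : Fin n) (h : j ≠ i) :
    shape (I.erase i) j = shape I j := by
  simp [shape, h]

variable {C : Type u} [Bicategory.{w, v} C] [Strict C]

namespace QuasiFunctor

/-- Composition of hypercubes in direction `i`: glue along the common face and restrict along
`0, 1 ↦ 0, 2`. -/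
noncomputable def comp {I : Finset (Fin n)} (i : Fin n) (hi : i ∈ I)
    (x y : QuasiFunctor (boxStep (shape I)) C)
    (h : act (faceMap I i 1) x = act (faceMap I i 0) y) : QuasiFunctor (boxStep (shape I)) C :=
  (exists_isComp (shape_mem hi) (shape_erase_of_ne I i) h).choose

theorem isComp_comp {I : Finset (Fin n)} (i : Fin n) (hi : i ∈ I)
    (x y : QuasiFunctor (boxStep (shape I)) C)
    (h : act (faceMap I i 1) x = act (faceMap I i 0) y) : IsComp i x y (comp i hi x y h) :=
  (exists_isComp (shape_mem hi) (shape_erase_of_ne I i) h).choose_spec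

end QuasiFunctor

open QuasiFunctor in
/-- The `n`-fold category `Qⁿ C` of hypercubes with 2-cells in the 2-category `C`. -/
noncomputable def Qn (n : ℕ) (C : Type u) [Bicategory.{w, v} C] [Strict C] :
    NFoldCat.{max u v w} n where
  cell I := QuasiFunctor (boxStep (shape I)) C
  act m := act m
  act_id _ := rfl
  act_comp _ _ _ := rfl
  comp i hi x y h := comp i hi x y h
  source_comp i hi x y h := (isComp_comp i hi x y h).source
  target_comp i hi x y h := (isComp_comp i hi x y h).target (shape_mem hi)
  id_comp {I} i hi x h := (isComp_comp i hi _ x h).unique (shape_mem hi)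
    (isComp_id_left (shape_mem hi) (shape_erase I i) (shape_erase_of_ne I i) x)
  comp_id {I} i hi x h := (isComp_comp i hi x _ h).unique (shape_mem hi)
    (isComp_id_right (shape_mem hi) (shape_erase I i) (shape_erase_of_ne I i) x)
  assoc i hi x y z h₁ h₂ h₃ h₄ := (isComp_comp i hi x y h₁).assoc (shape_mem hi)
    (isComp_comp i hi _ z h₂) (isComp_comp i hi y z h₃) (isComp_comp i hi x _ h₄)
  act_comp' i hi hi' m hm x y h h' := (isComp_act (shape_mem hi) (shape_mem hi') m hm
    (isComp_comp i hi' x y h)).unique (shape_mem hi) (isComp_comp i hi _ _ h')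
  interchange i j hij hi hj x y z w h₁ h₂ h₃ h₄ h₅ h₆ := IsComp.interchange hij.ne
    (shape_mem hi) (shape_mem hj) (isComp_comp i hi x y h₁) (isComp_comp i hi z w h₂)
    (isComp_comp j hj _ _ h₃) (isComp_comp j hj x z h₄) (isComp_comp j hj y w h₅)
    (isComp_comp i hi _ _ h₆)

end Qn

/-! ### Edges, squares and cubes of an `n`-fold category -/

section Lines

variable {n : ℕ}

/-- For `I ⊆ J`, the inclusion of the `I`-face at which the other coordinates in `J` are `t`; for
`J ⊆ I`, the projection from `I`-hypercubes to `J`-hypercubes. -/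
def sub (I J : Finset (Fin n)) (t : ℕ) : BoxHom (shape I) (shape J) := fun j =>
  { toFun := fun a => ⟨min (if j ∈ I then a.1 else t) (shape J j), by omega⟩
    monotone' := by
      intro a b hab
      have h : (a : ℕ) ≤ b := hab
      simp only [Fin.mk_le_mk]
      split_ifs <;> omega }

theorem sub_val (I J : Finset (Fin n)) (t : ℕ) (j : Fin n) (a : Fin (shape I j + 1)) :
    (sub I J t j a : ℕ) = min (if j ∈ I then a.1 else t) (shape J j) := rfl

theorem BoxHom.ext_val {α β : Fin n → ℕ} {m m' : BoxHom α β}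
    (h : ∀ j t, (m j t : ℕ) = m' j t) : m = m' := by
  funext j
  ext t
  exact h j t

theorem BoxHom.to_empty {α : Fin n → ℕ} (m m' : BoxHom α (shape ∅)) : m = m' :=
  BoxHom.ext_val fun j t => by
    have h₁ := (m j t).isLt
    have h₂ := (m' j t).isLt
    simp only [shape, Finset.notMem_empty, if_false] at h₁ h₂
    omega

theorem faceMap_singleton (k : Fin n) (t : ℕ) :
    faceMap {k} k t = (sub _ ∅ 0).comp (sub ∅ {k} t) := by
  refine BoxHom.ext_val fun j a => ?_
  change min _ _ = min (if j ∈ (∅ : Finset (Fin n)) then _ else t) _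
  by_cases hj : j = k
  · simp [hj]
  · simp [hj, shape]

theorem sub_singleton (k : Fin n) (t : ℕ) :
    sub ∅ {k} t = (sub ∅ (({k} : Finset (Fin n)).erase k) 0).comp (faceMap {k} k t) := by
  refine BoxHom.ext_val fun j a => ?_
  change min (if j ∈ (∅ : Finset (Fin n)) then _ else t) _ = min (if j = k then t else _) _
  by_cases hj : j = k
  · simp [hj]
  · simp [hj, shape]

namespace NFoldCat

variable (dC : NFoldCat.{t} n)

/-- The objects of an `n`-fold category. -/
abbrev Ob : Type t := dC.cell ∅

/-- The morphisms in direction `k` from `X` to `Y`. -/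
@[ext]
structure Edge (k : Fin n) (X Y : dC.Ob) : Type t where
  cell : dC.cell {k}
  source : dC.act (sub ∅ {k} 0) cell = X
  target : dC.act (sub ∅ {k} 1) cell = Y

variable {dC}

theorem Edge.comp_aux {k : Fin n} {X Y Z : dC.Ob} (f : dC.Edge k X Y) (g : dC.Edge k Y Z) :
    dC.act (faceMap {k} k 1) f.cell = dC.act (faceMap {k} k 0) g.cell := by
  rw [faceMap_singleton, faceMap_singleton, dC.act_comp, dC.act_comp, f.target, g.source]

theorem act_point {I : Finset (Fin n)} (m : BoxHom (shape ∅) (shape I))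
    (m' : BoxHom (shape I) (shape ∅)) (X : dC.Ob) : dC.act m (dC.act m' X) = X := by
  rw [← dC.act_comp, BoxHom.to_empty (m.comp m') (.id _), dC.act_id]

theorem source_comp_edge {k : Fin n} (x y : dC.cell {k}) (h) :
    dC.act (sub ∅ {k} 0) (dC.comp k (Finset.mem_singleton_self k) x y h) =
      dC.act (sub ∅ {k} 0) x := by
  rw [sub_singleton, dC.act_comp, dC.source_comp, ← dC.act_comp]

theorem target_comp_edge {k : Fin n} (x y : dC.cell {k}) (h) :
    dC.act (sub ∅ {k} 1) (dC.comp k (Finset.mem_singleton_self k) x y h) =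
      dC.act (sub ∅ {k} 1) y := by
  rw [sub_singleton, dC.act_comp, dC.target_comp, ← dC.act_comp]

/-- The identity in direction `k`. -/
def Edge.id (k : Fin n) (X : dC.Ob) : dC.Edge k X X :=
  ⟨dC.act (sub {k} ∅ 0) X, act_point _ _ X, act_point _ _ X⟩

/-- Composition in direction `k`. -/
def Edge.comp {k : Fin n} {X Y Z : dC.Ob} (f : dC.Edge k X Y) (g : dC.Edge k Y Z) :
    dC.Edge k X Z :=
  ⟨dC.comp k (Finset.mem_singleton_self k) f.cell g.cell (f.comp_aux g),
    (source_comp_edge _ _ _).trans f.source, (target_comp_edge _ _ _).trans g.target⟩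

variable (dC) in
/-- The objects of `dC`, with the morphisms in direction `k` as morphisms. -/
def Line (_ : Fin n) : Type t := dC.Ob

theorem act_degen_face (k : Fin n) (t : ℕ) (f : dC.cell {k}) :
    dC.act (degenMap {k} k) (dC.act (faceMap {k} k t) f) =
      dC.act (sub {k} ∅ 0) (dC.act (sub ∅ {k} t) f) := by
  rw [faceMap_singleton, dC.act_comp, ← dC.act_comp (degenMap {k} k)]
  exact congrArg (fun m => dC.act m _) (BoxHom.to_empty _ _)

theorem comp_congr {I : Finset (Fin n)} (i : Fin n) (hi : i ∈ I) {x x' y y' : dC.cell I}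
    (hx : x = x') (hy : y = y') (h h') : dC.comp i hi x y h = dC.comp i hi x' y' h' := by
  subst hx hy; rfl

instance (k : Fin n) : Category (dC.Line k) where
  Hom X Y := dC.Edge k X Y
  id X := Edge.id k X
  comp f g := Edge.comp f g
  id_comp {X Y} f := Edge.ext (by
    have h : (Edge.id k X).cell = dC.act (degenMap {k} k) (dC.act (faceMap {k} k 0) f.cell) := by
      rw [act_degen_face, f.source]; rfl
    exact (dC.comp_congr k _ h rfl _ (h ▸ (Edge.id k X).comp_aux f)).trans
      (dC.id_comp k _ f.cell _))
  comp_id {X Y} f := Edge.ext (by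
    have h : (Edge.id k Y).cell = dC.act (degenMap {k} k) (dC.act (faceMap {k} k 1) f.cell) := by
      rw [act_degen_face, f.target]; rfl
    exact (dC.comp_congr k _ rfl h _ (h ▸ f.comp_aux (Edge.id k Y))).trans
      (dC.comp_id k _ f.cell _))
  assoc f g h := Edge.ext (dC.assoc k _ f.cell g.cell h.cell _ _ _ _)

/-- `s` is a square with the given edges in the directions `k` (`top` and `bottom`) and `l`
(`left` and `right`). -/
structure IsSquare (k l : Fin n) {X Y Z W : dC.Ob} (top : dC.Edge k X Y) (left : dC.Edge l X Z)
    (bottom : dC.Edge k Z W) (right : dC.Edge l Y W) (s : dC.cell {k, l}) : Prop where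
  top : dC.act (sub {k} {k, l} 0) s = top.cell
  left : dC.act (sub {l} {k, l} 0) s = left.cell
  bottom : dC.act (sub {k} {k, l} 1) s = bottom.cell
  right : dC.act (sub {l} {k, l} 1) s = right.cell

end NFoldCat
end Lines

/-! ### Pseudofunctors from an `n`-fold category to a 2-category -/

section Mixed

variable {n : ℕ}

namespace NFoldCat

variable {dC : NFoldCat.{t} n}

theorem Edge.id_comp {k : Fin n} {X Y : dC.Ob} (f : dC.Edge k X Y) : (Edge.id k X).comp f = f :=
  Category.id_comp (obj := dC.Line k) f

theorem Edge.comp_id {k : Fin n} {X Y : dC.Ob} (f : dC.Edge k X Y) : f.comp (Edge.id k Y) = f :=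
  Category.comp_id (obj := dC.Line k) f

theorem Edge.comp_assoc {k : Fin n} {X Y Z W : dC.Ob} (f : dC.Edge k X Y) (g : dC.Edge k Y Z)
    (h : dC.Edge k Z W) : (f.comp g).comp h = f.comp (g.comp h) :=
  Category.assoc (obj := dC.Line k) f g h

end NFoldCat

open NFoldCat

/-- A pseudofunctor from an `n`-fold category to a 2-category. It consists of pseudofunctors on the
categories `dC.Line k` that agree on objects, and a 2-cell for each square, such that the 2-cells
of the faces of each cube in `dC` form a commutative cube (that is, a map of presheaves without
degeneracies from `dC` to the hypercubes in `D`), and such that the 2-cells of squares are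
compatible with identity squares and with pasting. -/
structure MixedPseudofunctor (dC : NFoldCat.{t} n) (D : Type u₂) [Bicategory.{w₂, v₂} D] where
  obj : dC.Ob → D
  map {k : Fin n} {X Y : dC.Ob} (f : dC.Edge k X Y) : obj X ⟶ obj Y
  mapId (k : Fin n) (X : dC.Ob) : map (Edge.id k X) ≅ 𝟙 (obj X)
  mapComp {k : Fin n} {X Y Z : dC.Ob} (f : dC.Edge k X Y) (g : dC.Edge k Y Z) :
    map (f.comp g) ≅ map f ≫ map g
  mapComp_assoc {k : Fin n} {X Y Z W : dC.Ob} (f : dC.Edge k X Y) (g : dC.Edge k Y Z)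
    (h : dC.Edge k Z W) :
    (mapComp (f.comp g) h).hom ≫ (mapComp f g).hom ▷ map h ≫ (α_ _ _ _).hom =
      eqToHom (by rw [Edge.comp_assoc]) ≫ (mapComp f (g.comp h)).hom ≫ map f ◁ (mapComp g h).hom
  mapComp_id_left {k : Fin n} {X Y : dC.Ob} (f : dC.Edge k X Y) :
    (mapComp (Edge.id k X) f).hom ≫ (mapId k X).hom ▷ map f ≫ (λ_ (map f)).hom =
      eqToHom (by rw [Edge.id_comp])
  mapComp_id_right {k : Fin n} {X Y : dC.Ob} (f : dC.Edge k X Y) :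
    (mapComp f (Edge.id k Y)).hom ≫ map f ◁ (mapId k Y).hom ≫ (ρ_ (map f)).hom =
      eqToHom (by rw [Edge.comp_id])
  sq {k l : Fin n} (hkl : k < l) {X Y Z W : dC.Ob} {top : dC.Edge k X Y} {left : dC.Edge l X Z}
    {bottom : dC.Edge k Z W} {right : dC.Edge l Y W} {s : dC.cell {k, l}}
    (hs : IsSquare k l top left bottom right s) : map left ≫ map bottom ⟶ map top ≫ map right
  cube {k l m : Fin n} (hkl : k < l) (hlm : l < m) (c : dC.cell {k, l, m})
    {X' Y' Z' W' X Y Z W : dC.Ob}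
    {b' : dC.Edge k X' Y'} {q' : dC.Edge l X' Z'} {a' : dC.Edge k Z' W'} {p' : dC.Edge l Y' W'}
    {b : dC.Edge k X Y} {q : dC.Edge l X Z} {a : dC.Edge k Z W} {p : dC.Edge l Y W}
    {x : dC.Edge m X' X} {y : dC.Edge m Y' Y} {z : dC.Edge m Z' Z} {w : dC.Edge m W' W}
    (hK' : IsSquare k l b' q' a' p' (dC.act (sub {k, l} {k, l, m} 0) c))
    (hK : IsSquare k l b q a p (dC.act (sub {k, l} {k, l, m} 1) c))
    (hJ' : IsSquare k m b' x b y (dC.act (sub {k, m} {k, l, m} 0) c))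
    (hJ : IsSquare k m a' z a w (dC.act (sub {k, m} {k, l, m} 1) c))
    (hI' : IsSquare l m q' x q z (dC.act (sub {l, m} {k, l, m} 0) c))
    (hI : IsSquare l m p' y p w (dC.act (sub {l, m} {k, l, m} 1) c)) :
    CommCube (sq hkl hK') (sq hkl hK) (sq (hkl.trans hlm) hJ') (sq (hkl.trans hlm) hJ)
      (sq hlm hI') (sq hlm hI)
  sq_vid {k l : Fin n} (hkl : k < l) {X Y : dC.Ob} (f : dC.Edge k X Y)
    (hs : IsSquare k l f (Edge.id l X) f (Edge.id l Y) (dC.act (sub {k, l} {k} 0) f.cell)) :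
    sq hkl hs = (mapId l X).hom ▷ map f ≫ (λ_ (map f)).hom ≫ (ρ_ (map f)).inv ≫
      map f ◁ (mapId l Y).inv
  sq_hid {k l : Fin n} (hkl : k < l) {X Z : dC.Ob} (f : dC.Edge l X Z)
    (hs : IsSquare k l (Edge.id k X) f (Edge.id k Z) f (dC.act (sub {k, l} {l} 0) f.cell)) :
    sq hkl hs = map f ◁ (mapId k Z).hom ≫ (ρ_ (map f)).hom ≫ (λ_ (map f)).inv ≫
      (mapId k X).inv ▷ map f
  sq_hcomp {k l : Fin n} (hkl : k < l) {X₁ X₂ X₃ Y₁ Y₂ Y₃ : dC.Ob}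
    {j : dC.Edge k X₁ X₂} {j' : dC.Edge k X₂ X₃} {i : dC.Edge k Y₁ Y₂} {i' : dC.Edge k Y₂ Y₃}
    {p₁ : dC.Edge l X₁ Y₁} {p₂ : dC.Edge l X₂ Y₂} {p₃ : dC.Edge l X₃ Y₃}
    {s s' : dC.cell {k, l}} (hs : IsSquare k l j p₁ i p₂ s) (hs' : IsSquare k l j' p₂ i' p₃ s')
    (h : dC.act (faceMap {k, l} k 1) s = dC.act (faceMap {k, l} k 0) s')
    (hs'' : IsSquare k l (j.comp j') p₁ (i.comp i') p₃ (dC.comp k (by simp) s s' h)) :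
    map p₁ ◁ (mapComp i i').hom ≫ pasteH (sq hkl hs) (sq hkl hs') =
      sq hkl hs'' ≫ (mapComp j j').hom ▷ map p₃
  sq_vcomp {k l : Fin n} (hkl : k < l) {X₁ X₂ X₃ Y₁ Y₂ Y₃ : dC.Ob}
    {q : dC.Edge l X₁ X₂} {q' : dC.Edge l X₂ X₃} {p : dC.Edge l Y₁ Y₂} {p' : dC.Edge l Y₂ Y₃}
    {j₁ : dC.Edge k X₁ Y₁} {j₂ : dC.Edge k X₂ Y₂} {j₃ : dC.Edge k X₃ Y₃}
    {s s' : dC.cell {k, l}} (hs : IsSquare k l j₁ q j₂ p s) (hs' : IsSquare k l j₂ q' j₃ p' s')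
    (h : dC.act (faceMap {k, l} l 1) s = dC.act (faceMap {k, l} l 0) s')
    (hs'' : IsSquare k l j₁ (q.comp q') j₃ (p.comp p') (dC.comp l (by simp) s s' h)) :
    (mapComp q q').hom ▷ map j₃ ≫ pasteV (sq hkl hs) (sq hkl hs') =
      sq hkl hs'' ≫ map j₁ ◁ (mapComp p p').hom

namespace MixedPseudofunctor

variable {dC : NFoldCat.{t} n} {D : Type u₂} [Bicategory.{w₂, v₂} D]

theorem mapComp_assoc_eq (F : MixedPseudofunctor dC D) {k : Fin n} {X Y Z W : dC.Ob}
    (f : dC.Edge k X Y) (g : dC.Edge k Y Z) (h : dC.Edge k Z W) :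
    (F.mapComp (f.comp g) h).hom ≫ (F.mapComp f g).hom ▷ F.map h ≫ (α_ _ _ _).hom ≫
      F.map f ◁ (F.mapComp g h).inv ≫ (F.mapComp f (g.comp h)).inv =
        eqToHom (by rw [Edge.comp_assoc]) := by
  have := congrArg (fun x => x ≫ F.map f ◁ (F.mapComp g h).inv ≫ (F.mapComp f (g.comp h)).inv)
    (F.mapComp_assoc f g h)
  simpa using this

/-- The underlying pseudofunctor in direction `k`. -/
def line (F : MixedPseudofunctor dC D) (k : Fin n) :
    Pseudofunctor (LocallyDiscrete (dC.Line k)) D :=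
  LocallyDiscrete.mkPseudofunctor F.obj (fun f => F.map (k := k) f) (fun X => F.mapId k X)
    (fun f g => F.mapComp (k := k) f g)
    (fun f g h => F.mapComp_assoc_eq (k := k) f g h)
    (fun f => F.mapComp_id_left (k := k) f) (fun f => F.mapComp_id_right (k := k) f)

/-- A pseudonatural transformation of pseudofunctors from an `n`-fold category: a pseudonatural
transformation in each direction, with common components on objects, such that the cube on each
square of `dC` commutes. -/
structure Trans (F G : MixedPseudofunctor dC D) where
  app (X : dC.Ob) : F.obj X ⟶ G.obj X
  naturality {k : Fin n} {X Y : dC.Ob} (f : dC.Edge k X Y) :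
    F.map f ≫ app Y ≅ app X ≫ G.map f
  naturality_id (k : Fin n) (X : dC.Ob) :
    (naturality (Edge.id k X)).hom ≫ app X ◁ (G.mapId k X).hom =
      (F.mapId k X).hom ▷ app X ≫ (λ_ (app X)).hom ≫ (ρ_ (app X)).inv
  naturality_comp {k : Fin n} {X Y Z : dC.Ob} (f : dC.Edge k X Y) (g : dC.Edge k Y Z) :
    (naturality (f.comp g)).hom ≫ app X ◁ (G.mapComp f g).hom =
      (F.mapComp f g).hom ▷ app Z ≫ (α_ _ _ _).hom ≫ F.map f ◁ (naturality g).hom ≫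
        (α_ _ _ _).inv ≫ (naturality f).hom ▷ G.map g ≫ (α_ _ _ _).hom
  naturality_sq {k l : Fin n} (hkl : k < l) {X Y Z W : dC.Ob} {top : dC.Edge k X Y}
    {left : dC.Edge l X Z} {bottom : dC.Edge k Z W} {right : dC.Edge l Y W} {s : dC.cell {k, l}}
    (hs : IsSquare k l top left bottom right s) :
    CommCube (F.sq hkl hs) (G.sq hkl hs) (naturality top).inv (naturality bottom).inv
      (naturality left).inv (naturality right).inv

open scoped Pseudofunctor.StrongTrans

variable {F G H K : MixedPseudofunctor dC D}

/-- The underlying pseudonatural transformation in direction `k`. -/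
def Trans.line (μ : Trans F G) (k : Fin n) : F.line k ⟶ G.line k where
  app X := μ.app X.as
  naturality f := μ.naturality f.as
  naturality_naturality {X Y f g} η := by
    obtain rfl := LocallyDiscrete.eq_of_hom η
    obtain rfl : η = 𝟙 _ := Subsingleton.elim _ _
    rw [(F.line k).map₂_id, (G.line k).map₂_id]
    exact (congrArg (fun x => x ≫ _) (id_whiskerRight _ _)).trans ((Category.id_comp _).trans
      ((Category.comp_id _).symm.trans (congrArg (fun x => _ ≫ x) (whiskerLeft_id _ _).symm)))
  naturality_id X := μ.naturality_id k X.as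
  naturality_comp f g := μ.naturality_comp f.as g.as

/-- A modification: it is a modification in each direction at the same time. -/
@[ext]
structure Modif (μ ν : Trans F G) where
  app (X : dC.Ob) : μ.app X ⟶ ν.app X
  naturality {k : Fin n} {X Y : dC.Ob} (f : dC.Edge k X Y) :
    F.map f ◁ app Y ≫ (ν.naturality f).hom = (μ.naturality f).hom ≫ app X ▷ G.map f

/-- The underlying modification in direction `k`. -/
def Modif.line {μ ν : Trans F G} (Γ : Modif μ ν) (k : Fin n) : μ.line k ⟶ ν.line k where
  as := { app := fun X => Γ.app X.as, naturality := fun f => Γ.naturality f.as }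

/-- The identity transformation, with the structure 2-cells of `D`. -/
def Trans.id (F : MixedPseudofunctor dC D) : Trans F F where
  app X := 𝟙 (F.obj X)
  naturality f := (ρ_ (F.map f)) ≪≫ (λ_ (F.map f)).symm
  naturality_id k X := (𝟙 (F.line k) : _ ⟶ F.line k).naturality_id ⟨X⟩
  naturality_comp {k _ _ _} f g := (𝟙 (F.line k) : _ ⟶ F.line k).naturality_comp ⟨f⟩ ⟨g⟩
  naturality_sq hkl _ _ _ _ _ _ _ _ _ hs := by
    simp [CommCube]

/-- Composition of transformations, by pasting in `D`. -/
def Trans.comp (μ : Trans F G) (ν : Trans G H) : Trans F H where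
  app X := μ.app X ≫ ν.app X
  naturality {k X Y} f := (α_ _ _ _).symm ≪≫ whiskerRightIso (μ.naturality f) (ν.app Y) ≪≫
    α_ _ _ _ ≪≫ whiskerLeftIso (μ.app X) (ν.naturality f) ≪≫ (α_ _ _ _).symm
  naturality_id k X := (μ.line k ≫ ν.line k).naturality_id ⟨X⟩
  naturality_comp {k _ _ _} f g := (μ.line k ≫ ν.line k).naturality_comp ⟨f⟩ ⟨g⟩
  naturality_sq hkl _ _ _ _ _ _ _ _ _ hs := by
    have := (μ.naturality_sq hkl hs).paste₃ (ν.naturality_sq hkl hs)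
    simpa [pasteV] using this

/-- Vertical composition of modifications. -/
def Modif.comp {μ ν ξ : Trans F G} (Γ : Modif μ ν) (Γ' : Modif ν ξ) : Modif μ ξ where
  app X := Γ.app X ≫ Γ'.app X
  naturality f := by
    rw [whiskerLeft_comp, Category.assoc, Γ'.naturality f, ← Category.assoc, Γ.naturality f,
      Category.assoc, comp_whiskerRight]

def Modif.id (μ : Trans F G) : Modif μ μ where
  app X := 𝟙 _
  naturality f := by simp

instance : CategoryStruct (MixedPseudofunctor dC D) where
  Hom F G := Trans F G
  id F := Trans.id F
  comp μ ν := Trans.comp μ ν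

instance : Category (F ⟶ G) where
  Hom μ ν := Modif μ ν
  id μ := Modif.id μ
  comp Γ Γ' := Modif.comp Γ Γ'
  id_comp Γ := Modif.ext (funext fun X => Category.id_comp (Γ.app X))
  comp_id Γ := Modif.ext (funext fun X => Category.comp_id (Γ.app X))
  assoc Γ Γ' Γ'' := Modif.ext (funext fun X =>
    Category.assoc (Γ.app X) (Γ'.app X) (Γ''.app X))

def Modif.whiskerLeft (μ : Trans F G) {ν ξ : Trans G H} (Γ : Modif ν ξ) :
    Modif (μ.comp ν) (μ.comp ξ) where
  app X := μ.app X ◁ Γ.app X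
  naturality {k _ _} f :=
    (Pseudofunctor.StrongTrans.whiskerLeft (μ.line k) (Γ.line k)).as.naturality ⟨f⟩

def Modif.whiskerRight {μ ν : Trans F G} (Γ : Modif μ ν) (ξ : Trans G H) :
    Modif (μ.comp ξ) (ν.comp ξ) where
  app X := Γ.app X ▷ ξ.app X
  naturality {k _ _} f :=
    (Pseudofunctor.StrongTrans.whiskerRight (Γ.line k) (ξ.line k)).as.naturality ⟨f⟩

/-- An invertible modification from a family of invertible 2-cells. -/
def isoMk {μ ν : F ⟶ G} (e : ∀ X, μ.app X ≅ ν.app X)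
    (h : ∀ {k : Fin n} {X Y : dC.Ob} (f : dC.Edge k X Y),
      F.map f ◁ (e Y).hom ≫ (ν.naturality f).hom =
        (μ.naturality f).hom ≫ (e X).hom ▷ G.map f) : μ ≅ ν where
  hom :=
    { app := fun X => (e X).hom
      naturality := fun f => h f }
  inv :=
    { app := fun X => (e X).inv
      naturality := fun {k X Y} f => by
        simpa using _ ◁ (e Y).inv ≫= (h f).symm =≫ (e X).inv ▷ _ }
  hom_inv_id := Modif.ext (funext fun X => (e X).hom_inv_id)
  inv_hom_id := Modif.ext (funext fun X => (e X).inv_hom_id)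

/-- The 2-category of pseudofunctors from an `n`-fold category to a 2-category. All compositions
are given by those of `D`. -/
instance : Bicategory (MixedPseudofunctor dC D) where
  whiskerLeft μ _ _ Γ := Modif.whiskerLeft μ Γ
  whiskerRight Γ ξ := Modif.whiskerRight Γ ξ
  associator {F G H K} μ ν ξ := isoMk (fun X => α_ (μ.app X) (ν.app X) (ξ.app X))
    (fun {k X Y} f => (Pseudofunctor.StrongTrans.associator (μ.line k) (ν.line k)
      (ξ.line k)).hom.as.naturality ⟨f⟩)
  leftUnitor {F G} μ := isoMk (fun X => λ_ (μ.app X))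
    (fun {k X Y} f => (Pseudofunctor.StrongTrans.leftUnitor (μ.line k)).hom.as.naturality ⟨f⟩)
  rightUnitor {F G} μ := isoMk (fun X => ρ_ (μ.app X))
    (fun {k X Y} f => (Pseudofunctor.StrongTrans.rightUnitor (μ.line k)).hom.as.naturality ⟨f⟩)
  whiskerLeft_id _ _ := Modif.ext (funext fun _ => whiskerLeft_id _ _)
  whiskerLeft_comp _ _ _ _ _ _ := Modif.ext (funext fun _ => whiskerLeft_comp _ _ _)
  id_whiskerLeft _ := Modif.ext (funext fun _ => id_whiskerLeft _)
  comp_whiskerLeft _ _ _ _ _ := Modif.ext (funext fun _ => comp_whiskerLeft _ _ _)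
  id_whiskerRight _ _ := Modif.ext (funext fun _ => id_whiskerRight _ _)
  comp_whiskerRight _ _ _ := Modif.ext (funext fun _ => comp_whiskerRight _ _ _)
  whiskerRight_id _ := Modif.ext (funext fun _ => whiskerRight_id _)
  whiskerRight_comp _ _ _ := Modif.ext (funext fun _ => whiskerRight_comp _ _ _)
  whisker_assoc _ _ _ _ _ := Modif.ext (funext fun _ => whisker_assoc _ _ _)
  whisker_exchange _ _ := Modif.ext (funext fun _ => whisker_exchange _ _)
  pentagon _ _ _ _ := Modif.ext (funext fun _ => pentagon _ _ _ _)
  triangle _ _ := Modif.ext (funext fun _ => triangle _ _)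

end MixedPseudofunctor
end Mixed

/-! ### Edges, squares and cubes of `Qⁿ C` -/

section QnEdges

variable {n : ℕ}

/-- The vertex with coordinates `p` (those that are too large are cut down). -/
def vtx (α : Fin n → ℕ) (p : Fin n → ℕ) : Box α := fun j => ⟨min (p j) (α j), by omega⟩

theorem vtx_step {α : Fin n → ℕ} {k : Fin n} {p q : Fin n → ℕ} (h : p k ≤ q k)
    (h' : ∀ j, j ≠ k → min (p j) (α j) = min (q j) (α j)) : boxStep α k (vtx α p) (vtx α q) :=
  ⟨by change min (p k) _ ≤ min (q k) _; omega, fun j hj => Fin.ext (h' j hj)⟩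

theorem Box.ext_val {α : Fin n → ℕ} {a b : Box α} (h : ∀ j, (a j : ℕ) = b j) : a = b :=
  funext fun j => Fin.ext (h j)

theorem edge_step (k : Fin n) :
    boxStep (shape {k}) k ((sub ∅ {k} 0).app 0) ((sub ∅ {k} 1).app 0) := by
  refine ⟨?_, fun j hj => ?_⟩
  · change (min _ _ : ℕ) ≤ min _ _
    simp
  · apply Fin.ext
    change min _ _ = min _ _
    simp [shape, hj]

/-- The coordinates of the neighbour of the initial vertex in direction `k`. -/
def ind (k : Fin n) (j : Fin n) : ℕ := if j = k then 1 else 0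

variable (k l : Fin n)

theorem sq_top : boxStep (shape {k, l}) k (vtx _ 0) (vtx _ (ind k)) :=
  vtx_step (by simp) fun j hj => by simp [ind, hj]

theorem sq_left : boxStep (shape {k, l}) l (vtx _ 0) (vtx _ (ind l)) :=
  vtx_step (by simp) fun j hj => by simp [ind, hj]

theorem sq_bottom : boxStep (shape {k, l}) k (vtx _ (ind l)) (vtx _ 1) :=
  vtx_step (by simp [ind]; split_ifs <;> simp) fun j hj => by
    by_cases h : j = l <;> simp [ind, shape, hj, h]

theorem sq_right : boxStep (shape {k, l}) l (vtx _ (ind k)) (vtx _ 1) :=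
  vtx_step (by simp [ind]; split_ifs <;> simp) fun j hj => by
    by_cases h : j = k <;> simp [ind, shape, hj, h]

variable {C : Type u} [Bicategory.{w, v} C]

namespace QuasiFunctor

variable {k l} {V : Type} {step : Fin n → V → V → Prop}

theorem map_heq_map (z : QuasiFunctor step C) {a b a' b' : V} (ha : a = a') (hb : b = b')
    (s : step k a b) (s' : step k a' b') : HEq (z.map s) (z.map s') := by
  subst ha hb; rfl

theorem cell_heq_cell (z : QuasiFunctor step C) (hkl : k < l) {a b c d a' b' c' d' : V}
    (ha : a = a') (hb : b = b') (hc : c = c') (hd : d = d')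
    (t : step k a b) (e : step l a c) (m : step k c d) (r : step l b d)
    (t' : step k a' b') (e' : step l a' c') (m' : step k c' d') (r' : step l b' d') :
    HEq (z.cell hkl t e m r) (z.cell hkl t' e' m' r') := by
  subst ha hb hc hd; rfl

end QuasiFunctor

open NFoldCat

variable [Strict C] {k l}

/-- The morphism of `C` that underlies a morphism of `Qⁿ C` in direction `k`. -/
def edgeHom : ∀ {X Y : (Qn n C).Ob}, (Qn n C).Edge k X Y →
    ((X : QuasiFunctor (boxStep (shape ∅)) C).obj 0 ⟶
      (Y : QuasiFunctor (boxStep (shape ∅)) C).obj 0)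
  | _, _, ⟨c, rfl, rfl⟩ => QuasiFunctor.map (C := C) (step := boxStep (shape {k})) c (edge_step k)

/-- The object of `C` that underlies an object of `Qⁿ C`. -/
abbrev pointObj (X : (Qn n C).Ob) : C := (X : QuasiFunctor (boxStep (shape ∅)) C).obj 0

variable {α : Fin n → ℕ} {z : QuasiFunctor (boxStep α) C} {a b c d : Box α}

theorem edge_facts {X Y : (Qn n C).Ob} (f : (Qn n C).Edge k X Y) (m : BoxHom (shape {k}) α)
    (hf : f.cell = QuasiFunctor.act m z) (ha : m.app ((sub ∅ {k} 0).app 0) = a)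
    (hb : m.app ((sub ∅ {k} 1).app 0) = b) (s : boxStep α k a b) :
    pointObj X = z.obj a ∧ pointObj Y = z.obj b ∧ HEq (edgeHom f) (z.map s) := by
  subst ha hb
  obtain ⟨x, rfl, rfl⟩ := f
  dsimp only at hf
  subst hf
  exact ⟨rfl, rfl, HEq.rfl⟩

theorem box_empty (a b : Box (shape (∅ : Finset (Fin n)))) : a = b :=
  Box.ext_val fun j => by
    have h₁ := (a j).isLt
    have h₂ := (b j).isLt
    simp only [shape, Finset.notMem_empty, if_false] at h₁ h₂
    omega

theorem boxStep_refl (k : Fin n) (a : Box α) : boxStep α k a a := ⟨le_rfl, fun _ _ => rfl⟩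

theorem edgeHom_id (X : (Qn n C).Ob) : edgeHom (Edge.id k X) = 𝟙 (pointObj X) := by
  have h := (edge_facts (z := X) (Edge.id k X) (sub {k} ∅ 0) rfl (box_empty _ 0) (box_empty _ 0)
    (boxStep_refl k 0)).2.2
  exact eq_of_heq (h.trans (heq_of_eq (QuasiFunctor.map_id (C := C) X _)))

theorem comp_heq {X Y Z X' Y' Z' : C} (hX : X = X') (hY : Y = Y') (hZ : Z = Z') {f : X ⟶ Y}
    {f' : X' ⟶ Y'} (hf : HEq f f') {g : Y ⟶ Z} {g' : Y' ⟶ Z'} (hg : HEq g g') :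
    HEq (f ≫ g) (f' ≫ g') := by
  subst hX hY hZ; cases hf; cases hg; rfl

theorem edgeHom_comp {X Y Z : (Qn n C).Ob} (f : (Qn n C).Edge k X Y) (g : (Qn n C).Edge k Y Z) :
    edgeHom (f.comp g) = edgeHom f ≫ edgeHom g := by
  obtain ⟨z, h₁, h₂, h₃⟩ := QuasiFunctor.isComp_comp k (Finset.mem_singleton_self k) f.cell g.cell
    (f.comp_aux g)
  let A : Fin n → ℕ := Function.update (shape {k}) k 2
  have hA : A k = 2 := by simp [A]
  have hA' : ∀ j, j ≠ k → A j = 0 := fun j hj => by simp [A, hj, shape]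
  have s₁ : boxStep A k (vtx A 0) (vtx A 1) := vtx_step (by simp) fun j hj => by simp [hA' j hj]
  have s₂ : boxStep A k (vtx A 1) (vtx A 2) := vtx_step (by simp) fun j hj => by simp [hA' j hj]
  have s₃ : boxStep A k (vtx A 0) (vtx A 2) := vtx_step (by simp) fun j hj => by simp [hA' j hj]
  have key : ∀ (u : ℕ →o ℕ) (t : ℕ) (q : Fin n → ℕ), t ≤ 1 → q k ≤ 2 → u t = q k →
      (BoxHom.along (β := A) k u).app ((sub ∅ {k} t).app 0) = vtx A q := by
    intro u t q ht hq hu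
    refine Box.ext_val fun j => ?_
    change min (if j = k then u (min (if j ∈ (∅ : Finset (Fin n)) then _ else t) (shape {k} j))
      else (min (if j ∈ (∅ : Finset (Fin n)) then _ else t) (shape {k} j))) (A j) = min (q j) (A j)
    by_cases hj : j = k
    · subst hj
      have : min t 1 = t := by omega
      simp [shape, this, hu]
    · simp [hA' j hj]
  obtain ⟨hX, hY, hf⟩ := edge_facts f _ h₁.symm (key _ 0 0 (by simp) (by simp) (by simp))
    (key _ 1 1 (by simp) (by simp) (by simp)) s₁
  obtain ⟨_, hZ, hg⟩ := edge_facts g _ h₂.symm (key _ 0 1 (by simp) (by simp) (by simp))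
    (key _ 1 2 (by simp) (by simp) (by simp)) s₂
  obtain ⟨_, _, hfg⟩ := edge_facts (f.comp g) _ h₃.symm (key _ 0 0 (by simp) (by simp) (by simp))
    (key _ 1 2 (by simp) (by simp) (by simp)) s₃
  refine eq_of_heq (hfg.trans ?_)
  rw [z.map_comp s₁ s₂ s₃]
  exact (comp_heq hX hY hZ hf hg).symm

theorem hom_type_eq {X Y Z W X' Y' Z' W' : C} (hX : X = X') (hY : Y = Y') (hZ : Z = Z')
    (hW : W = W') {t : X ⟶ Y} {l : X ⟶ Z} {b : Z ⟶ W} {r : Y ⟶ W} {t' : X' ⟶ Y'} {l' : X' ⟶ Z'}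
    {b' : Z' ⟶ W'} {r' : Y' ⟶ W'} (ht : HEq t t') (hl : HEq l l') (hb : HEq b b') (hr : HEq r r') :
    (l ≫ b ⟶ t ≫ r) = (l' ≫ b' ⟶ t' ≫ r') := by
  subst hX hY hZ hW; cases ht; cases hl; cases hb; cases hr; rfl

section Square

variable {X Y Z W : (Qn n C).Ob} {top : (Qn n C).Edge k X Y} {left : (Qn n C).Edge l X Z}
  {bottom : (Qn n C).Edge k Z W} {right : (Qn n C).Edge l Y W} {s : (Qn n C).cell {k, l}}

theorem corner {i : Fin n} (hi : i = k ∨ i = l) (t u : ℕ) (p : Fin n → ℕ)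
    (h : p i = u) (h' : ∀ j, j = k ∨ j = l → j ≠ i → p j = t) :
    (sub {i} {k, l} t).app ((sub ∅ {i} u).app 0) = vtx (shape {k, l}) p := by
  refine Box.ext_val fun j => ?_
  change min (if j ∈ ({i} : Finset (Fin n)) then min (if j ∈ (∅ : Finset (Fin n)) then _ else u)
    (shape {i} j) else t) (shape {k, l} j) = min (p j) (shape {k, l} j)
  by_cases hj : j = i
  · subst hj
    have : j ∈ ({k, l} : Finset (Fin n)) := by simpa using hi
    simp [shape_mem this, shape_mem (Finset.mem_singleton_self j), h]
  · by_cases hj' : j = k ∨ j = l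
    · simp [hj, h' j hj' hj]
    · simp [hj, shape, hj']

theorem sqFacts (hkl : k < l) (hs : IsSquare k l top left bottom right s)
    (m : BoxHom (shape {k, l}) α) (hm : s = QuasiFunctor.act m z)
    (ha : m.app (vtx _ 0) = a) (hb : m.app (vtx _ (ind k)) = b) (hc : m.app (vtx _ (ind l)) = c)
    (hd : m.app (vtx _ 1) = d) (s₁ : boxStep α k a b) (s₂ : boxStep α l a c) (s₃ : boxStep α k c d)
    (s₄ : boxStep α l b d) :
    (pointObj X = z.obj a ∧ pointObj Y = z.obj b ∧ pointObj Z = z.obj c ∧ pointObj W = z.obj d) ∧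
    HEq (edgeHom top) (z.map s₁) ∧ HEq (edgeHom left) (z.map s₂) ∧
      HEq (edgeHom bottom) (z.map s₃) ∧ HEq (edgeHom right) (z.map s₄) := by
  subst hm
  have hne := hkl.ne
  have e₁ := edge_facts (z := z) top ((sub {k} {k, l} 0).comp m) hs.top.symm
    ((congrArg m.app (corner (Or.inl rfl) 0 0 0 (by simp) (fun _ _ _ => rfl))).trans ha)
    ((congrArg m.app (corner (Or.inl rfl) 0 1 (ind k) (by simp [ind]) (by rintro _ (rfl | rfl) h <;> simp_all [ind]))).trans hb) s₁
  have e₂ := edge_facts (z := z) left ((sub {l} {k, l} 0).comp m) hs.left.symm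
    ((congrArg m.app (corner (Or.inr rfl) 0 0 0 (by simp) (fun _ _ _ => rfl))).trans ha)
    ((congrArg m.app (corner (Or.inr rfl) 0 1 (ind l) (by simp [ind]) (by rintro _ (rfl | rfl) h <;> simp_all [ind]))).trans hc) s₂
  have e₃ := edge_facts (z := z) bottom ((sub {k} {k, l} 1).comp m) hs.bottom.symm
    ((congrArg m.app (corner (Or.inl rfl) 1 0 (ind l) (by simp [ind, hkl.ne]) (by rintro _ (rfl | rfl) h <;> simp_all [ind]))).trans hc)
    ((congrArg m.app (corner (Or.inl rfl) 1 1 1 (by simp) (fun _ _ _ => rfl))).trans hd) s₃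
  have e₄ := edge_facts (z := z) right ((sub {l} {k, l} 1).comp m) hs.right.symm
    ((congrArg m.app (corner (Or.inr rfl) 1 0 (ind k) (by simp [ind, hkl.ne']) (by rintro _ (rfl | rfl) h <;> simp_all [ind]))).trans hb)
    ((congrArg m.app (corner (Or.inr rfl) 1 1 1 (by simp) (fun _ _ _ => rfl))).trans hd) s₄
  exact ⟨⟨e₁.1, e₁.2.1, e₂.2.1, e₃.2.1⟩, e₁.2.2, e₂.2.2, e₃.2.2, e₄.2.2⟩

/-- The 2-cell of `C` that underlies a square of `Qⁿ C`. -/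
def sqCell (hkl : k < l) (hs : IsSquare k l top left bottom right s) :
    edgeHom left ≫ edgeHom bottom ⟶ edgeHom top ≫ edgeHom right :=
  cast (by
    obtain ⟨⟨h₁, h₂, h₃, h₄⟩, h₅, h₆, h₇, h₈⟩ := sqFacts (z := s) hkl hs (.id _) rfl rfl rfl rfl rfl
      (sq_top k l) (sq_left k l) (sq_bottom k l) (sq_right k l)
    exact (hom_type_eq h₁ h₂ h₃ h₄ h₅ h₆ h₇ h₈).symm)
    (QuasiFunctor.cell (C := C) s hkl (sq_top k l) (sq_left k l) (sq_bottom k l) (sq_right k l))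

theorem sqCell_heq (hkl : k < l) (hs : IsSquare k l top left bottom right s)
    (m : BoxHom (shape {k, l}) α) (hm : s = QuasiFunctor.act m z)
    (ha : m.app (vtx _ 0) = a) (hb : m.app (vtx _ (ind k)) = b) (hc : m.app (vtx _ (ind l)) = c)
    (hd : m.app (vtx _ 1) = d) (s₁ : boxStep α k a b) (s₂ : boxStep α l a c) (s₃ : boxStep α k c d)
    (s₄ : boxStep α l b d) : HEq (sqCell hkl hs) (z.cell hkl s₁ s₂ s₃ s₄) := by
  subst hm ha hb hc hd
  exact cast_heq _ _

end Square

theorem mk_heq {X Y Z W X' Y' Z' W' : C} (hX : X = X') (hY : Y = Y') (hZ : Z = Z')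
    (hW : W = W') {t : X ⟶ Y} {l : X ⟶ Z} {b : Z ⟶ W} {r : Y ⟶ W} {t' : X' ⟶ Y'} {l' : X' ⟶ Z'}
    {b' : Z' ⟶ W'} {r' : Y' ⟶ W'} (ht : HEq t t') (hl : HEq l l') (hb : HEq b b') (hr : HEq r r')
    {σ : l ≫ b ⟶ t ≫ r} {σ' : l' ≫ b' ⟶ t' ≫ r'} (hσ : HEq σ σ') :
    HEq (⟨t, l, b, r, σ⟩ : UpSquare X Y Z W) (⟨t', l', b', r', σ'⟩ : UpSquare X' Y' Z' W') := by
  subst hX hY hZ hW; cases ht; cases hl; cases hb; cases hr; cases hσ; rfl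

theorem vid_heq {X Y X' Y' : C} (hX : X = X') (hY : Y = Y') {f : X ⟶ Y} {f' : X' ⟶ Y'}
    (hf : HEq f f') : HEq (UpSquare.vid f) (UpSquare.vid f') := by
  subst hX hY; cases hf; rfl

theorem hid_heq {X Y X' Y' : C} (hX : X = X') (hY : Y = Y') {f : X ⟶ Y} {f' : X' ⟶ Y'}
    (hf : HEq f f') : HEq (UpSquare.hid f) (UpSquare.hid f') := by
  subst hX hY; cases hf; rfl

theorem hcomp_heq {X Y V Z W U X' Y' V' Z' W' U' : C} (hX : X = X') (hY : Y = Y') (hV : V = V')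
    (hZ : Z = Z') (hW : W = W') (hU : U = U') {A : UpSquare X Y Z W} {B : UpSquare Y V W U}
    {A' : UpSquare X' Y' Z' W'} {B' : UpSquare Y' V' W' U'} (hA : HEq A A') (hB : HEq B B') (h h') :
    HEq (A.hcomp B h) (A'.hcomp B' h') := by
  subst hX hY hV hZ hW hU; cases hA; cases hB; rfl

theorem vcomp_heq {X Y V Z W U X' Y' V' Z' W' U' : C} (hX : X = X') (hY : Y = Y') (hV : V = V')
    (hZ : Z = Z') (hW : W = W') (hU : U = U') {A : UpSquare X Y Z W} {B : UpSquare Z W V U}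
    {A' : UpSquare X' Y' Z' W'} {B' : UpSquare Z' W' V' U'} (hA : HEq A A') (hB : HEq B B') (h h') :
    HEq (A.vcomp B h) (A'.vcomp B' h') := by
  subst hX hY hV hZ hW hU; cases hA; cases hB; rfl

theorem sub_vtx (I J : Finset (Fin n)) (p q : Fin n → ℕ) (h : ∀ j ∈ J, j ∈ I → p j = q j)
    (h' : ∀ j ∈ J, j ∉ I → q j = 0) :
    (sub I J 0).app (vtx _ p) = vtx (shape J) q := by
  refine Box.ext_val fun j => ?_
  change min (if j ∈ I then min (p j) (shape I j) else 0) (shape J j) = min (q j) (shape J j)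
  by_cases hj : j ∈ J
  · by_cases hi : j ∈ I
    · simp [hi, h j hj hi, shape, hj]
    · simp [hi, h' j hj hi]
  · simp [shape, hj]

/-- The up-square of `C` that underlies a square of `Qⁿ C`. -/
abbrev sqUp {X Y Z W : (Qn n C).Ob} {top : (Qn n C).Edge k X Y} {left : (Qn n C).Edge l X Z}
    {bottom : (Qn n C).Edge k Z W} {right : (Qn n C).Edge l Y W} {s : (Qn n C).cell {k, l}}
    (hkl : k < l) (hs : IsSquare k l top left bottom right s) :
    UpSquare (pointObj X) (pointObj Y) (pointObj Z) (pointObj W) :=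
  ⟨edgeHom top, edgeHom left, edgeHom bottom, edgeHom right, sqCell hkl hs⟩

theorem sqUp_heq {X Y Z W : (Qn n C).Ob} {top : (Qn n C).Edge k X Y} {left : (Qn n C).Edge l X Z}
    {bottom : (Qn n C).Edge k Z W} {right : (Qn n C).Edge l Y W} {s : (Qn n C).cell {k, l}}
    (hkl : k < l) (hs : IsSquare k l top left bottom right s)
    (m : BoxHom (shape {k, l}) α) (hm : s = QuasiFunctor.act m z)
    (ha : m.app (vtx _ 0) = a) (hb : m.app (vtx _ (ind k)) = b) (hc : m.app (vtx _ (ind l)) = c)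
    (hd : m.app (vtx _ 1) = d) (s₁ : boxStep α k a b) (s₂ : boxStep α l a c) (s₃ : boxStep α k c d)
    (s₄ : boxStep α l b d) : HEq (sqUp hkl hs)
      (⟨z.map s₁, z.map s₂, z.map s₃, z.map s₄, z.cell hkl s₁ s₂ s₃ s₄⟩ : UpSquare _ _ _ _) := by
  obtain ⟨⟨h₁, h₂, h₃, h₄⟩, h₅, h₆, h₇, h₈⟩ := sqFacts hkl hs m hm ha hb hc hd s₁ s₂ s₃ s₄
  exact mk_heq h₁ h₂ h₃ h₄ h₅ h₆ h₇ h₈ (sqCell_heq hkl hs m hm ha hb hc hd s₁ s₂ s₃ s₄)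

theorem sqUp_vid (hkl : k < l) {X Y : (Qn n C).Ob} (f : (Qn n C).Edge k X Y)
    (hs : IsSquare k l f (Edge.id l X) f (Edge.id l Y)
      ((Qn n C).act (sub {k, l} {k} 0) f.cell)) : sqUp hkl hs = .vid (edgeHom f) := by
  have hne := hkl.ne'
  have e : boxStep (shape {k}) k (vtx _ 0) (vtx _ 1) :=
    vtx_step (by simp) fun j hj => by simp [shape, hj]
  have ha := sub_vtx {k, l} {k} 0 0 (by simp) (by simp)
  have hb := sub_vtx {k, l} {k} (ind k) 1 (by simp [ind]) (by simp)
  have hc := sub_vtx {k, l} {k} (ind l) 0 (by simp [ind, hkl.ne]) (by simp)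
  have hd := sub_vtx {k, l} {k} 1 1 (by simp) (by simp)
  have h := sqUp_heq (z := f.cell) hkl hs _ rfl ha hb hc hd e (boxStep_refl l _) e (boxStep_refl l _)
  have h' := sqFacts (z := f.cell) hkl hs _ rfl ha hb hc hd e (boxStep_refl l _) e (boxStep_refl l _)
  exact eq_of_heq (h.trans ((heq_of_eq (QuasiFunctor.cell_vid (C := C) f.cell _ _ _ _ _)).trans
    (vid_heq h'.1.1 h'.1.2.1 h'.2.1).symm))

theorem sqUp_hid (hkl : k < l) {X Y : (Qn n C).Ob} (f : (Qn n C).Edge l X Y)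
    (hs : IsSquare k l (Edge.id k X) f (Edge.id k Y) f
      ((Qn n C).act (sub {k, l} {l} 0) f.cell)) : sqUp hkl hs = .hid (edgeHom f) := by
  have e : boxStep (shape {l}) l (vtx _ 0) (vtx _ 1) :=
    vtx_step (by simp) fun j hj => by simp [shape, hj]
  have ha := sub_vtx {k, l} {l} 0 0 (by simp) (by simp)
  have hb := sub_vtx {k, l} {l} (ind k) 0 (by simp [ind, hkl.ne']) (by simp)
  have hc := sub_vtx {k, l} {l} (ind l) 1 (by simp [ind]) (by simp)
  have hd := sub_vtx {k, l} {l} 1 1 (by simp) (by simp)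
  have h := sqUp_heq (z := f.cell) hkl hs _ rfl ha hb hc hd (boxStep_refl k _) e (boxStep_refl k _) e
  have h' := sqFacts (z := f.cell) hkl hs _ rfl ha hb hc hd (boxStep_refl k _) e (boxStep_refl k _) e
  exact eq_of_heq (h.trans ((heq_of_eq (QuasiFunctor.cell_hid (C := C) f.cell _ _ _ _ _)).trans
    (hid_heq h'.1.1 h'.1.2.2.1 h'.2.2.1).symm))

theorem along_vtx {β : Fin n → ℕ} (i : Fin n) (u : ℕ →o ℕ) (p q : Fin n → ℕ)
    (h : ∀ j, min (if j = i then u (min (p j) (α j)) else min (p j) (α j)) (β j) =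
      min (q j) (β j)) : (BoxHom.along (β := β) i u).app (vtx α p) = vtx β q :=
  Box.ext_val h

/-- Coordinates `x` in direction `k`, `y` in direction `l`, and `0` otherwise. -/
def gv (k l : Fin n) (x y : ℕ) (j : Fin n) : ℕ := if j = k then x else if j = l then y else 0

theorem gv_step_fst (hα : ∀ j, j ≠ k → j ≠ l → α j = 0) {x x' y : ℕ} (h : x ≤ x') :
    boxStep α k (vtx α (gv k l x y)) (vtx α (gv k l x' y)) :=
  vtx_step (by simpa [gv] using h) fun j hj => by simp [gv, hj]

theorem gv_step_snd (hα : ∀ j, j ≠ k → j ≠ l → α j = 0) {x y y' : ℕ} (h : y ≤ y') :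
    boxStep α l (vtx α (gv k l x y)) (vtx α (gv k l x y')) :=
  vtx_step (by simp only [gv]; split_ifs <;> omega) fun j hj => by simp [gv, hj]

theorem gv_along_fst (hne : k ≠ l) (hα : ∀ j, j ≠ k → j ≠ l → α j = 0) (hl₁ : α l = 1) {u : ℕ →o ℕ}
    {p q p' q' : ℕ} (hp : p ≤ 1) (hq : q ≤ 1) (h : u p = p') (h' : q = q') :
    (BoxHom.along (β := α) k u).app (vtx (shape {k, l}) (gv k l p q)) = vtx α (gv k l p' q') :=
  along_vtx _ _ _ _ fun j => by
    have e₁ : min p 1 = p := by omega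
    have e₂ : min q 1 = q := by omega
    by_cases hk : j = k
    · subst hk; simp [gv, shape, e₁, h]
    · by_cases hl : j = l
      · subst hl; simp [gv, shape, e₂, h', hk, hl₁]
      · simp [hα j hk hl]

theorem gv_along_snd (hne : k ≠ l) (hα : ∀ j, j ≠ k → j ≠ l → α j = 0) (hk₁ : α k = 1) {u : ℕ →o ℕ}
    {p q p' q' : ℕ} (hp : p ≤ 1) (hq : q ≤ 1) (h : p = p') (h' : u q = q') :
    (BoxHom.along (β := α) l u).app (vtx (shape {k, l}) (gv k l p q)) = vtx α (gv k l p' q') :=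
  along_vtx _ _ _ _ fun j => by
    have e₁ : min p 1 = p := by omega
    have e₂ : min q 1 = q := by omega
    by_cases hk : j = k
    · subst hk; simp [gv, shape, e₁, h, hne, hk₁]
    · by_cases hl : j = l
      · subst hl; simp [gv, shape, e₂, h', hk]
      · simp [hα j hk hl]

theorem vtx_congr {p q : Fin n → ℕ} (h : ∀ j, α j ≠ 0 → p j = q j) : vtx α p = vtx α q :=
  Box.ext_val fun j => by
    change min (p j) (α j) = min (q j) (α j)
    by_cases hj : α j = 0
    · simp [hj]
    · rw [h j hj]

theorem vtx_pair {p q : Fin n → ℕ} (hk : p k = q k) (hl : p l = q l) :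
    vtx (shape {k, l}) p = vtx (shape {k, l}) q :=
  vtx_congr fun j hj => by
    by_cases h : j ∈ ({k, l} : Finset (Fin n))
    · simp only [Finset.mem_insert, Finset.mem_singleton] at h
      rcases h with rfl | rfl <;> assumption
    · exact absurd (by simp [shape, h]) hj

section

variable {X Y Z W : (Qn n C).Ob} {top : (Qn n C).Edge k X Y} {left : (Qn n C).Edge l X Z}
  {bottom : (Qn n C).Edge k Z W} {right : (Qn n C).Edge l Y W} {s : (Qn n C).cell {k, l}}

theorem sqFacts' (hkl : k < l) (hs : IsSquare k l top left bottom right s)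
    (m : BoxHom (shape {k, l}) α) (hm : s = QuasiFunctor.act m z)
    (ha : m.app (vtx _ (gv k l 0 0)) = a) (hb : m.app (vtx _ (gv k l 1 0)) = b)
    (hc : m.app (vtx _ (gv k l 0 1)) = c) (hd : m.app (vtx _ (gv k l 1 1)) = d)
    (s₁ : boxStep α k a b) (s₂ : boxStep α l a c) (s₃ : boxStep α k c d) (s₄ : boxStep α l b d) :
    (pointObj X = z.obj a ∧ pointObj Y = z.obj b ∧ pointObj Z = z.obj c ∧ pointObj W = z.obj d) ∧
    HEq (edgeHom top) (z.map s₁) ∧ HEq (edgeHom left) (z.map s₂) ∧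
      HEq (edgeHom bottom) (z.map s₃) ∧ HEq (edgeHom right) (z.map s₄) :=
  sqFacts hkl hs m hm
    ((congrArg m.app (vtx_pair (by simp [gv]) (by simp [gv]))).trans ha)
    ((congrArg m.app (vtx_pair (by simp [gv, ind]) (by simp [gv, ind, hkl.ne']))).trans hb)
    ((congrArg m.app (vtx_pair (by simp [gv, ind, hkl.ne]) (by simp [gv, ind, hkl.ne']))).trans hc)
    ((congrArg m.app (vtx_pair (by simp [gv]) (by simp [gv]))).trans hd) s₁ s₂ s₃ s₄

theorem sqUp_heq' (hkl : k < l) (hs : IsSquare k l top left bottom right s)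
    (m : BoxHom (shape {k, l}) α) (hm : s = QuasiFunctor.act m z)
    (ha : m.app (vtx _ (gv k l 0 0)) = a) (hb : m.app (vtx _ (gv k l 1 0)) = b)
    (hc : m.app (vtx _ (gv k l 0 1)) = c) (hd : m.app (vtx _ (gv k l 1 1)) = d)
    (s₁ : boxStep α k a b) (s₂ : boxStep α l a c) (s₃ : boxStep α k c d) (s₄ : boxStep α l b d) :
    HEq (sqUp hkl hs)
      (⟨z.map s₁, z.map s₂, z.map s₃, z.map s₄, z.cell hkl s₁ s₂ s₃ s₄⟩ : UpSquare _ _ _ _) :=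
  sqUp_heq hkl hs m hm
    ((congrArg m.app (vtx_pair (by simp [gv]) (by simp [gv]))).trans ha)
    ((congrArg m.app (vtx_pair (by simp [gv, ind]) (by simp [gv, ind, hkl.ne']))).trans hb)
    ((congrArg m.app (vtx_pair (by simp [gv, ind, hkl.ne]) (by simp [gv, ind, hkl.ne']))).trans hc)
    ((congrArg m.app (vtx_pair (by simp [gv]) (by simp [gv]))).trans hd) s₁ s₂ s₃ s₄

theorem sqCell_heq' (hkl : k < l) (hs : IsSquare k l top left bottom right s)
    (m : BoxHom (shape {k, l}) α) (hm : s = QuasiFunctor.act m z)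
    (ha : m.app (vtx _ (gv k l 0 0)) = a) (hb : m.app (vtx _ (gv k l 1 0)) = b)
    (hc : m.app (vtx _ (gv k l 0 1)) = c) (hd : m.app (vtx _ (gv k l 1 1)) = d)
    (s₁ : boxStep α k a b) (s₂ : boxStep α l a c) (s₃ : boxStep α k c d) (s₄ : boxStep α l b d) :
    HEq (sqCell hkl hs) (z.cell hkl s₁ s₂ s₃ s₄) :=
  sqCell_heq hkl hs m hm
    ((congrArg m.app (vtx_pair (by simp [gv]) (by simp [gv]))).trans ha)
    ((congrArg m.app (vtx_pair (by simp [gv, ind]) (by simp [gv, ind, hkl.ne']))).trans hb)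
    ((congrArg m.app (vtx_pair (by simp [gv, ind, hkl.ne]) (by simp [gv, ind, hkl.ne']))).trans hc)
    ((congrArg m.app (vtx_pair (by simp [gv]) (by simp [gv]))).trans hd) s₁ s₂ s₃ s₄

end

theorem sqUp_hcomp (hkl : k < l) {X₁ X₂ X₃ Y₁ Y₂ Y₃ : (Qn n C).Ob}
    {j : (Qn n C).Edge k X₁ X₂} {j' : (Qn n C).Edge k X₂ X₃} {i : (Qn n C).Edge k Y₁ Y₂}
    {i' : (Qn n C).Edge k Y₂ Y₃} {p₁ : (Qn n C).Edge l X₁ Y₁} {p₂ : (Qn n C).Edge l X₂ Y₂}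
    {p₃ : (Qn n C).Edge l X₃ Y₃} {s s' : (Qn n C).cell {k, l}} (hs : IsSquare k l j p₁ i p₂ s)
    (hs' : IsSquare k l j' p₂ i' p₃ s')
    (h : (Qn n C).act (faceMap {k, l} k 1) s = (Qn n C).act (faceMap {k, l} k 0) s')
    (hs'' : IsSquare k l (j.comp j') p₁ (i.comp i') p₃ ((Qn n C).comp k (by simp) s s' h)) :
    sqUp hkl hs'' = (sqUp hkl hs).hcomp (sqUp hkl hs') rfl := by
  obtain ⟨z, h₁, h₂, h₃⟩ := QuasiFunctor.isComp_comp k (by simp) s s' h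
  have hne := hkl.ne
  have hA : ∀ j, j ≠ k → j ≠ l → Function.update (shape {k, l}) k 2 j = 0 := fun j h h' => by
    simp [shape, h, h']
  have S := fun x x' y => gv_step_fst (k := k) (l := l) hA (x := x) (x' := x') (y := y)
  have S' := fun x y y' => gv_step_snd (k := k) (l := l) hA (x := x) (y := y) (y' := y')
  have K := fun u p q p' q' => gv_along_fst hne hA (by simp [shape, hne.symm]) (u := u) (p := p) (q := q) (p' := p') (q' := q')
  have e₁ := sqUp_heq' hkl hs _ h₁.symm
    (K _ 0 0 0 0 (by simp) (by simp) (by simp) (by simp))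
    (K _ 1 0 1 0 (by simp) (by simp) (by simp) (by simp))
    (K _ 0 1 0 1 (by simp) (by simp) (by simp) (by simp))
    (K _ 1 1 1 1 (by simp) (by simp) (by simp) (by simp))
    (S 0 1 0 (by simp)) (S' 0 0 1 (by simp)) (S 0 1 1 (by simp))
    (S' 1 0 1 (by simp))
  have fe₁ := sqFacts' hkl hs _ h₁.symm
    (K _ 0 0 0 0 (by simp) (by simp) (by simp) (by simp))
    (K _ 1 0 1 0 (by simp) (by simp) (by simp) (by simp))
    (K _ 0 1 0 1 (by simp) (by simp) (by simp) (by simp))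
    (K _ 1 1 1 1 (by simp) (by simp) (by simp) (by simp))
    (S 0 1 0 (by simp)) (S' 0 0 1 (by simp)) (S 0 1 1 (by simp))
    (S' 1 0 1 (by simp))
  have e₂ := sqUp_heq' hkl hs' _ h₂.symm
    (K _ 0 0 1 0 (by simp) (by simp) (by simp) (by simp))
    (K _ 1 0 2 0 (by simp) (by simp) (by simp) (by simp))
    (K _ 0 1 1 1 (by simp) (by simp) (by simp) (by simp))
    (K _ 1 1 2 1 (by simp) (by simp) (by simp) (by simp))
    (S 1 2 0 (by simp)) (S' 1 0 1 (by simp)) (S 1 2 1 (by simp))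
    (S' 2 0 1 (by simp))
  have fe₂ := sqFacts' hkl hs' _ h₂.symm
    (K _ 0 0 1 0 (by simp) (by simp) (by simp) (by simp))
    (K _ 1 0 2 0 (by simp) (by simp) (by simp) (by simp))
    (K _ 0 1 1 1 (by simp) (by simp) (by simp) (by simp))
    (K _ 1 1 2 1 (by simp) (by simp) (by simp) (by simp))
    (S 1 2 0 (by simp)) (S' 1 0 1 (by simp)) (S 1 2 1 (by simp))
    (S' 2 0 1 (by simp))
  have e₃ := sqUp_heq' hkl hs'' _ h₃.symm
    (K _ 0 0 0 0 (by simp) (by simp) (by simp) (by simp))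
    (K _ 1 0 2 0 (by simp) (by simp) (by simp) (by simp))
    (K _ 0 1 0 1 (by simp) (by simp) (by simp) (by simp))
    (K _ 1 1 2 1 (by simp) (by simp) (by simp) (by simp))
    (S 0 2 0 (by simp)) (S' 0 0 1 (by simp)) (S 0 2 1 (by simp))
    (S' 2 0 1 (by simp))
  have fe₃ := sqFacts' hkl hs'' _ h₃.symm
    (K _ 0 0 0 0 (by simp) (by simp) (by simp) (by simp))
    (K _ 1 0 2 0 (by simp) (by simp) (by simp) (by simp))
    (K _ 0 1 0 1 (by simp) (by simp) (by simp) (by simp))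
    (K _ 1 1 2 1 (by simp) (by simp) (by simp) (by simp))
    (S 0 2 0 (by simp)) (S' 0 0 1 (by simp)) (S 0 2 1 (by simp))
    (S' 2 0 1 (by simp))
  refine eq_of_heq (e₃.trans ((heq_of_eq (z.cell_hcomp hkl (S 0 1 0 (by simp)) (S' 0 0 1 (by simp)) (S 0 1 1 (by simp)) (S' 1 0 1 (by simp)) (S 1 2 0 (by simp)) (S 1 2 1 (by simp)) (S' 2 0 1 (by simp)) (S 0 2 0 (by simp)) (S 0 2 1 (by simp)))).trans ?_))
  exact (hcomp_heq fe₁.1.1 fe₁.1.2.1 fe₂.1.2.1 fe₁.1.2.2.1 fe₁.1.2.2.2 fe₂.1.2.2.2 e₁ e₂ _ _).symm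

theorem sqUp_vcomp (hkl : k < l) {X₁ X₂ X₃ Y₁ Y₂ Y₃ : (Qn n C).Ob}
    {q : (Qn n C).Edge l X₁ X₂} {q' : (Qn n C).Edge l X₂ X₃} {p : (Qn n C).Edge l Y₁ Y₂}
    {p' : (Qn n C).Edge l Y₂ Y₃} {j₁ : (Qn n C).Edge k X₁ Y₁} {j₂ : (Qn n C).Edge k X₂ Y₂}
    {j₃ : (Qn n C).Edge k X₃ Y₃} {s s' : (Qn n C).cell {k, l}} (hs : IsSquare k l j₁ q j₂ p s)
    (hs' : IsSquare k l j₂ q' j₃ p' s')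
    (h : (Qn n C).act (faceMap {k, l} l 1) s = (Qn n C).act (faceMap {k, l} l 0) s')
    (hs'' : IsSquare k l j₁ (q.comp q') j₃ (p.comp p') ((Qn n C).comp l (by simp) s s' h)) :
    sqUp hkl hs'' = (sqUp hkl hs).vcomp (sqUp hkl hs') rfl := by
  obtain ⟨z, h₁, h₂, h₃⟩ := QuasiFunctor.isComp_comp l (by simp) s s' h
  have hne := hkl.ne
  have hA : ∀ j, j ≠ k → j ≠ l → Function.update (shape {k, l}) l 2 j = 0 := fun j h h' => by
    simp [shape, h, h']
  have S := fun x x' y => gv_step_fst (k := k) (l := l) hA (x := x) (x' := x') (y := y)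
  have S' := fun x y y' => gv_step_snd (k := k) (l := l) hA (x := x) (y := y) (y' := y')
  have K := fun u p q p' q' => gv_along_snd hne hA (by simp [shape, hne]) (u := u) (p := p) (q := q) (p' := p') (q' := q')
  have e₁ := sqUp_heq' hkl hs _ h₁.symm
    (K _ 0 0 0 0 (by simp) (by simp) (by simp) (by simp))
    (K _ 1 0 1 0 (by simp) (by simp) (by simp) (by simp))
    (K _ 0 1 0 1 (by simp) (by simp) (by simp) (by simp))
    (K _ 1 1 1 1 (by simp) (by simp) (by simp) (by simp))
    (S 0 1 0 (by simp)) (S' 0 0 1 (by simp)) (S 0 1 1 (by simp))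
    (S' 1 0 1 (by simp))
  have fe₁ := sqFacts' hkl hs _ h₁.symm
    (K _ 0 0 0 0 (by simp) (by simp) (by simp) (by simp))
    (K _ 1 0 1 0 (by simp) (by simp) (by simp) (by simp))
    (K _ 0 1 0 1 (by simp) (by simp) (by simp) (by simp))
    (K _ 1 1 1 1 (by simp) (by simp) (by simp) (by simp))
    (S 0 1 0 (by simp)) (S' 0 0 1 (by simp)) (S 0 1 1 (by simp))
    (S' 1 0 1 (by simp))
  have e₂ := sqUp_heq' hkl hs' _ h₂.symm
    (K _ 0 0 0 1 (by simp) (by simp) (by simp) (by simp))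
    (K _ 1 0 1 1 (by simp) (by simp) (by simp) (by simp))
    (K _ 0 1 0 2 (by simp) (by simp) (by simp) (by simp))
    (K _ 1 1 1 2 (by simp) (by simp) (by simp) (by simp))
    (S 0 1 1 (by simp)) (S' 0 1 2 (by simp)) (S 0 1 2 (by simp))
    (S' 1 1 2 (by simp))
  have fe₂ := sqFacts' hkl hs' _ h₂.symm
    (K _ 0 0 0 1 (by simp) (by simp) (by simp) (by simp))
    (K _ 1 0 1 1 (by simp) (by simp) (by simp) (by simp))
    (K _ 0 1 0 2 (by simp) (by simp) (by simp) (by simp))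
    (K _ 1 1 1 2 (by simp) (by simp) (by simp) (by simp))
    (S 0 1 1 (by simp)) (S' 0 1 2 (by simp)) (S 0 1 2 (by simp))
    (S' 1 1 2 (by simp))
  have e₃ := sqUp_heq' hkl hs'' _ h₃.symm
    (K _ 0 0 0 0 (by simp) (by simp) (by simp) (by simp))
    (K _ 1 0 1 0 (by simp) (by simp) (by simp) (by simp))
    (K _ 0 1 0 2 (by simp) (by simp) (by simp) (by simp))
    (K _ 1 1 1 2 (by simp) (by simp) (by simp) (by simp))
    (S 0 1 0 (by simp)) (S' 0 0 2 (by simp)) (S 0 1 2 (by simp))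
    (S' 1 0 2 (by simp))
  have fe₃ := sqFacts' hkl hs'' _ h₃.symm
    (K _ 0 0 0 0 (by simp) (by simp) (by simp) (by simp))
    (K _ 1 0 1 0 (by simp) (by simp) (by simp) (by simp))
    (K _ 0 1 0 2 (by simp) (by simp) (by simp) (by simp))
    (K _ 1 1 1 2 (by simp) (by simp) (by simp) (by simp))
    (S 0 1 0 (by simp)) (S' 0 0 2 (by simp)) (S 0 1 2 (by simp))
    (S' 1 0 2 (by simp))
  refine eq_of_heq (e₃.trans ((heq_of_eq (z.cell_vcomp hkl (S 0 1 0 (by simp)) (S' 0 0 1 (by simp)) (S 0 1 1 (by simp)) (S' 1 0 1 (by simp)) (S' 0 1 2 (by simp)) (S 0 1 2 (by simp)) (S' 1 1 2 (by simp)) (S' 0 0 2 (by simp)) (S' 1 0 2 (by simp)))).trans ?_))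
  exact (vcomp_heq fe₁.1.1 fe₁.1.2.1 fe₂.1.2.2.1 fe₁.1.2.2.1 fe₁.1.2.2.2 fe₂.1.2.2.2 e₁ e₂ _ _).symm

theorem commCube_of_heq {X' Y' Z' W' X Y Z W A' B' E' G' A B E G : C}
    (hX' : X' = A') (hY' : Y' = B') (hZ' : Z' = E') (hW' : W' = G')
    (hX : X = A) (hY : Y = B) (hZ : Z = E) (hW : W = G)
    {b' : X' ⟶ Y'} {q' : X' ⟶ Z'} {a' : Z' ⟶ W'} {p' : Y' ⟶ W'}
    {b : X ⟶ Y} {q : X ⟶ Z} {a : Z ⟶ W} {p : Y ⟶ W}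
    {x : X' ⟶ X} {y : Y' ⟶ Y} {z : Z' ⟶ Z} {w : W' ⟶ W}
    {K' : q' ≫ a' ⟶ b' ≫ p'} {K : q ≫ a ⟶ b ≫ p} {J' : x ≫ b ⟶ b' ≫ y} {J : z ≫ a ⟶ a' ≫ w}
    {I' : x ≫ q ⟶ q' ≫ z} {I : y ≫ p ⟶ p' ≫ w}
    {b₁' : A' ⟶ B'} {q₁' : A' ⟶ E'} {a₁' : E' ⟶ G'} {p₁' : B' ⟶ G'}
    {b₁ : A ⟶ B} {q₁ : A ⟶ E} {a₁ : E ⟶ G} {p₁ : B ⟶ G}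
    {x₁ : A' ⟶ A} {y₁ : B' ⟶ B} {z₁ : E' ⟶ E} {w₁ : G' ⟶ G}
    {K₁' : q₁' ≫ a₁' ⟶ b₁' ≫ p₁'} {K₁ : q₁ ≫ a₁ ⟶ b₁ ≫ p₁} {J₁' : x₁ ≫ b₁ ⟶ b₁' ≫ y₁}
    {J₁ : z₁ ≫ a₁ ⟶ a₁' ≫ w₁} {I₁' : x₁ ≫ q₁ ⟶ q₁' ≫ z₁} {I₁ : y₁ ≫ p₁ ⟶ p₁' ≫ w₁}
    (hb' : HEq b' b₁') (hq' : HEq q' q₁') (ha' : HEq a' a₁') (hp' : HEq p' p₁')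
    (hb : HEq b b₁) (hq : HEq q q₁) (ha : HEq a a₁) (hp : HEq p p₁)
    (hx : HEq x x₁) (hy : HEq y y₁) (hz : HEq z z₁) (hw : HEq w w₁)
    (hK' : HEq K' K₁') (hK : HEq K K₁) (hJ' : HEq J' J₁') (hJ : HEq J J₁)
    (hI' : HEq I' I₁') (hI : HEq I I₁) (h : CommCube K₁' K₁ J₁' J₁ I₁' I₁) :
    CommCube K' K J' J I' I := by
  subst hX' hY' hZ' hW' hX hY hZ hW
  cases hb'; cases hq'; cases ha'; cases hp'; cases hb; cases hq; cases ha; cases hp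
  cases hx; cases hy; cases hz; cases hw; cases hK'; cases hK; cases hJ'; cases hJ
  cases hI'; cases hI
  exact h

/-- Coordinates `x`, `y`, `z` in the directions `k`, `l`, `m`, and `0` otherwise. -/
def gv₃ (k l m : Fin n) (x y z : ℕ) (j : Fin n) : ℕ :=
  if j = k then x else if j = l then y else if j = m then z else 0

theorem sqCell_cube {m : Fin n} (hkl : k < l) (hlm : l < m) (c : (Qn n C).cell {k, l, m})
    {X' Y' Z' W' X Y Z W : (Qn n C).Ob}
    {b' : (Qn n C).Edge k X' Y'} {q' : (Qn n C).Edge l X' Z'} {a' : (Qn n C).Edge k Z' W'}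
    {p' : (Qn n C).Edge l Y' W'} {b : (Qn n C).Edge k X Y} {q : (Qn n C).Edge l X Z}
    {a : (Qn n C).Edge k Z W} {p : (Qn n C).Edge l Y W} {x : (Qn n C).Edge m X' X}
    {y : (Qn n C).Edge m Y' Y} {z : (Qn n C).Edge m Z' Z} {w : (Qn n C).Edge m W' W}
    (hK' : IsSquare k l b' q' a' p' ((Qn n C).act (sub {k, l} {k, l, m} 0) c))
    (hK : IsSquare k l b q a p ((Qn n C).act (sub {k, l} {k, l, m} 1) c))
    (hJ' : IsSquare k m b' x b y ((Qn n C).act (sub {k, m} {k, l, m} 0) c))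
    (hJ : IsSquare k m a' z a w ((Qn n C).act (sub {k, m} {k, l, m} 1) c))
    (hI' : IsSquare l m q' x q z ((Qn n C).act (sub {l, m} {k, l, m} 0) c))
    (hI : IsSquare l m p' y p w ((Qn n C).act (sub {l, m} {k, l, m} 1) c)) :
    CommCube (sqCell hkl hK') (sqCell hkl hK) (sqCell (hkl.trans hlm) hJ')
      (sqCell (hkl.trans hlm) hJ) (sqCell hlm hI') (sqCell hlm hI) := by
  have hkm := hkl.trans hlm
  have key : ∀ (i i' : Fin n) (t u u' : ℕ) (p : Fin n → ℕ), i ≠ i' → i = k ∨ i = l ∨ i = m →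
      i' = k ∨ i' = l ∨ i' = m → u ≤ 1 → u' ≤ 1 → p i = u → p i' = u' →
      (∀ j, j = k ∨ j = l ∨ j = m → j ≠ i → j ≠ i' → p j = t) →
      (sub {i, i'} {k, l, m} t).app (vtx _ (gv i i' u u')) = vtx (shape {k, l, m}) p := by
    intro i i' t u u' p hii hi hi' hu hu' h₁ h₂ h₃
    refine Box.ext_val fun j => ?_
    change min (if j ∈ ({i, i'} : Finset (Fin n)) then min (gv i i' u u' j) (shape {i, i'} j)
      else t) (shape {k, l, m} j) = min (p j) (shape {k, l, m} j)
    by_cases hj : j = i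
    · subst hj
      have : min u 1 = u := by omega
      simp [shape, gv, h₁, hi, this]
    · by_cases hj' : j = i'
      · subst hj'
        have : min u' 1 = u' := by omega
        simp [shape, gv, h₂, hi', this, hj]
      · by_cases hm : j = k ∨ j = l ∨ j = m
        · simp [hj, hj', h₃ j hm hj hj']
        · simp [shape, hm]
  have hkl₁ := hkl.ne
  have hkl₂ := hkl.ne'
  have hkm₁ := hkm.ne
  have hkm₂ := hkm.ne'
  have hlm₁ := hlm.ne
  have hlm₂ := hlm.ne'
  let v (r s t : ℕ) : Box (shape {k, l, m}) := vtx _ (gv₃ k l m r s t)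
  have S₁ : ∀ s t, boxStep (shape {k, l, m}) k (v 0 s t) (v 1 s t) := fun s t =>
    vtx_step (by simp [gv₃]) fun j hj => by simp [gv₃, hj]
  have S₂ : ∀ s t, boxStep (shape {k, l, m}) l (v s 0 t) (v s 1 t) := fun s t =>
    vtx_step (by simp [gv₃]; split_ifs <;> simp) fun j hj => by simp [gv₃, hj]
  have S₃ : ∀ s t, boxStep (shape {k, l, m}) m (v s t 0) (v s t 1) := fun s t =>
    vtx_step (by simp [gv₃]; split_ifs <;> simp) fun j hj => by simp [gv₃, hj]
  have KL : ∀ t u u', u ≤ 1 → u' ≤ 1 → (sub {k, l} {k, l, m} t).app (vtx _ (gv k l u u')) =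
      v u u' t := fun t u u' h h' => key k l t u u' _ hkl₁ (by simp) (by simp) h h' (by simp [gv₃])
        (by simp [gv₃, hkl₂]) (by rintro _ (rfl | rfl | rfl) <;> simp [gv₃, *])
  have KM : ∀ t u u', u ≤ 1 → u' ≤ 1 → (sub {k, m} {k, l, m} t).app (vtx _ (gv k m u u')) =
      v u t u' := fun t u u' h h' => key k m t u u' _ hkm₁ (by simp) (by simp) h h' (by simp [gv₃])
        (by simp [gv₃, hkm₂, hlm₂]) (by rintro _ (rfl | rfl | rfl) <;> simp [gv₃, *])
  have LM : ∀ t u u', u ≤ 1 → u' ≤ 1 → (sub {l, m} {k, l, m} t).app (vtx _ (gv l m u u')) =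
      v t u u' := fun t u u' h h' => key l m t u u' _ hlm₁ (by simp) (by simp) h h'
        (by simp [gv₃, hkl₂]) (by simp [gv₃, hkm₂, hlm₂])
        (by rintro _ (rfl | rfl | rfl) <;> simp [gv₃, *])
  have e₁ := sqFacts' hkl hK' _ rfl (KL 0 0 0 (by simp) (by simp)) (KL 0 1 0 (by simp) (by simp))
    (KL 0 0 1 (by simp) (by simp)) (KL 0 1 1 (by simp) (by simp))
    (S₁ _ _) (S₂ _ _) (S₁ _ _) (S₂ _ _)
  have g₁ := sqCell_heq' hkl hK' _ rfl (KL 0 0 0 (by simp) (by simp)) (KL 0 1 0 (by simp) (by simp))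
    (KL 0 0 1 (by simp) (by simp)) (KL 0 1 1 (by simp) (by simp))
    (S₁ _ _) (S₂ _ _) (S₁ _ _) (S₂ _ _)
  have e₂ := sqFacts' hkl hK _ rfl (KL 1 0 0 (by simp) (by simp)) (KL 1 1 0 (by simp) (by simp))
    (KL 1 0 1 (by simp) (by simp)) (KL 1 1 1 (by simp) (by simp))
    (S₁ _ _) (S₂ _ _) (S₁ _ _) (S₂ _ _)
  have g₂ := sqCell_heq' hkl hK _ rfl (KL 1 0 0 (by simp) (by simp)) (KL 1 1 0 (by simp) (by simp))
    (KL 1 0 1 (by simp) (by simp)) (KL 1 1 1 (by simp) (by simp))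
    (S₁ _ _) (S₂ _ _) (S₁ _ _) (S₂ _ _)
  have e₃ := sqFacts' hkm hJ' _ rfl (KM 0 0 0 (by simp) (by simp)) (KM 0 1 0 (by simp) (by simp))
    (KM 0 0 1 (by simp) (by simp)) (KM 0 1 1 (by simp) (by simp))
    (S₁ _ _) (S₃ _ _) (S₁ _ _) (S₃ _ _)
  have g₃ := sqCell_heq' hkm hJ' _ rfl (KM 0 0 0 (by simp) (by simp)) (KM 0 1 0 (by simp) (by simp))
    (KM 0 0 1 (by simp) (by simp)) (KM 0 1 1 (by simp) (by simp))
    (S₁ _ _) (S₃ _ _) (S₁ _ _) (S₃ _ _)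
  have e₄ := sqFacts' hkm hJ _ rfl (KM 1 0 0 (by simp) (by simp)) (KM 1 1 0 (by simp) (by simp))
    (KM 1 0 1 (by simp) (by simp)) (KM 1 1 1 (by simp) (by simp))
    (S₁ _ _) (S₃ _ _) (S₁ _ _) (S₃ _ _)
  have g₄ := sqCell_heq' hkm hJ _ rfl (KM 1 0 0 (by simp) (by simp)) (KM 1 1 0 (by simp) (by simp))
    (KM 1 0 1 (by simp) (by simp)) (KM 1 1 1 (by simp) (by simp))
    (S₁ _ _) (S₃ _ _) (S₁ _ _) (S₃ _ _)
  have e₅ := sqFacts' hlm hI' _ rfl (LM 0 0 0 (by simp) (by simp)) (LM 0 1 0 (by simp) (by simp))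
    (LM 0 0 1 (by simp) (by simp)) (LM 0 1 1 (by simp) (by simp))
    (S₂ _ _) (S₃ _ _) (S₂ _ _) (S₃ _ _)
  have g₅ := sqCell_heq' hlm hI' _ rfl (LM 0 0 0 (by simp) (by simp)) (LM 0 1 0 (by simp) (by simp))
    (LM 0 0 1 (by simp) (by simp)) (LM 0 1 1 (by simp) (by simp))
    (S₂ _ _) (S₃ _ _) (S₂ _ _) (S₃ _ _)
  have e₆ := sqFacts' hlm hI _ rfl (LM 1 0 0 (by simp) (by simp)) (LM 1 1 0 (by simp) (by simp))
    (LM 1 0 1 (by simp) (by simp)) (LM 1 1 1 (by simp) (by simp))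
    (S₂ _ _) (S₃ _ _) (S₂ _ _) (S₃ _ _)
  have g₆ := sqCell_heq' hlm hI _ rfl (LM 1 0 0 (by simp) (by simp)) (LM 1 1 0 (by simp) (by simp))
    (LM 1 0 1 (by simp) (by simp)) (LM 1 1 1 (by simp) (by simp))
    (S₂ _ _) (S₃ _ _) (S₂ _ _) (S₃ _ _)
  exact commCube_of_heq e₁.1.1 e₁.1.2.1 e₁.1.2.2.1 e₁.1.2.2.2 e₂.1.1 e₂.1.2.1 e₂.1.2.2.1
    e₂.1.2.2.2 e₁.2.1 e₁.2.2.1 e₁.2.2.2.1 e₁.2.2.2.2 e₂.2.1 e₂.2.2.1 e₂.2.2.2.1 e₂.2.2.2.2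
    e₃.2.2.1 e₃.2.2.2.2 e₄.2.2.1 e₄.2.2.2.2 g₁ g₂ g₃ g₄ g₅ g₆
    (QuasiFunctor.cube c hkl hlm _ _ _ _ _ _ _ _ _ _ _ _)

end QnEdges

/-! ### The 2-functor `Q` -/

section QFunctor

variable {C : Type u₁} [Bicategory.{w₁, v₁} C] {D : Type u₂} [Bicategory.{w₂, v₂} D]

/-- The image of a 2-cell `left ≫ bottom ⟶ top ≫ right` under a pseudofunctor. -/
def mapSq (F : Pseudofunctor C D) {X Y Z W : C} {t : X ⟶ Y} {l : X ⟶ Z} {b : Z ⟶ W} {r : Y ⟶ W}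
    (σ : l ≫ b ⟶ t ≫ r) : F.map l ≫ F.map b ⟶ F.map t ≫ F.map r :=
  (F.mapComp l b).inv ≫ F.map₂ σ ≫ (F.mapComp t r).hom

section

variable (F : Pseudofunctor C D)

theorem map₂_assoc_inv {X Y Z W : C} (f : X ⟶ Y) (g : Y ⟶ Z) (h : Z ⟶ W) :
    F.map₂ (α_ f g h).inv = (F.mapComp f (g ≫ h)).hom ≫ F.map f ◁ (F.mapComp g h).hom ≫
      (α_ _ _ _).inv ≫ (F.mapComp f g).inv ▷ F.map h ≫ (F.mapComp (f ≫ g) h).inv := by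
  rw [F.mapComp_assoc_right_hom_assoc]
  simp

theorem map₂_left_inv {X Y : C} (f : X ⟶ Y) :
    F.map₂ (λ_ f).inv = (λ_ (F.map f)).inv ≫ (F.mapId X).inv ▷ F.map f ≫
      (F.mapComp (𝟙 X) f).inv := by
  rw [← cancel_mono (F.map₂ (λ_ f).hom), ← F.map₂_comp]
  simp

theorem map₂_right_inv {X Y : C} (f : X ⟶ Y) :
    F.map₂ (ρ_ f).inv = (ρ_ (F.map f)).inv ≫ F.map f ◁ (F.mapId Y).inv ≫
      (F.mapComp f (𝟙 Y)).inv := by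
  rw [← cancel_mono (F.map₂ (ρ_ f).hom), ← F.map₂_comp]
  simp

theorem mapSq_pasteH {X Y Y' Z W W' : C} {q : X ⟶ Z} {i : Z ⟶ W} {j : X ⟶ Y} {p : Y ⟶ W}
    {i' : W ⟶ W'} {j' : Y ⟶ Y'} {r : Y' ⟶ W'} (σ : q ≫ i ⟶ j ≫ p) (τ : p ≫ i' ⟶ j' ≫ r) :
    F.map q ◁ (F.mapComp i i').hom ≫ pasteH (mapSq F σ) (mapSq F τ) =
      mapSq F (pasteH σ τ) ≫ (F.mapComp j j').hom ▷ F.map r := by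
  simp [pasteH, mapSq, map₂_assoc_inv]

theorem mapSq_pasteV {X Y Z W Z' W' : C} {q : X ⟶ Z} {i : Z ⟶ W} {j : X ⟶ Y} {p : Y ⟶ W}
    {q' : Z ⟶ Z'} {i' : Z' ⟶ W'} {p' : W ⟶ W'} (σ : q ≫ i ⟶ j ≫ p) (τ : q' ≫ i' ⟶ i ≫ p') :
    (F.mapComp q q').hom ▷ F.map i' ≫ pasteV (mapSq F σ) (mapSq F τ) =
      mapSq F (pasteV σ τ) ≫ F.map j ◁ (F.mapComp p p').hom := by
  simp [pasteV, mapSq, map₂_assoc_inv]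

theorem mapSq_hid {X Z : C} (f : X ⟶ Z) :
    mapSq F (UpSquare.hid f).cell = F.map f ◁ (F.mapId Z).hom ≫ (ρ_ (F.map f)).hom ≫
      (λ_ (F.map f)).inv ≫ (F.mapId X).inv ▷ F.map f := by
  simp [UpSquare.hid, mapSq, map₂_left_inv]

theorem mapSq_vid {X Y : C} (f : X ⟶ Y) :
    mapSq F (UpSquare.vid f).cell = (F.mapId X).hom ▷ F.map f ≫ (λ_ (F.map f)).hom ≫
      (ρ_ (F.map f)).inv ≫ F.map f ◁ (F.mapId Y).inv := by
  simp [UpSquare.vid, mapSq, map₂_right_inv]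

theorem mapSq_cube {X' Y' Z' W' X Y Z W : C}
    {b' : X' ⟶ Y'} {q' : X' ⟶ Z'} {a' : Z' ⟶ W'} {p' : Y' ⟶ W'}
    {b : X ⟶ Y} {q : X ⟶ Z} {a : Z ⟶ W} {p : Y ⟶ W}
    {x : X' ⟶ X} {y : Y' ⟶ Y} {z : Z' ⟶ Z} {w : W' ⟶ W}
    {K' : q' ≫ a' ⟶ b' ≫ p'} {K : q ≫ a ⟶ b ≫ p}
    {J' : x ≫ b ⟶ b' ≫ y} {J : z ≫ a ⟶ a' ≫ w}
    {I' : x ≫ q ⟶ q' ≫ z} {I : y ≫ p ⟶ p' ≫ w} (h : CommCube K' K J' J I' I) :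
    CommCube (mapSq F K') (mapSq F K) (mapSq F J') (mapSq F J) (mapSq F I') (mapSq F I) := by
  unfold CommCube at h
  have key := congrArg (fun s => s ≫ F.map b' ◁ (F.mapComp p' w).hom)
    (congrArg (fun s => F.map x ◁ (F.mapComp q a).inv ≫ (F.mapComp x (q ≫ a)).inv ≫
    F.map₂ s ≫ (F.mapComp b' (p' ≫ w)).hom) h)
  simp [map₂_assoc_inv] at key
  simp [CommCube, mapSq, key]

variable {F} {G : Pseudofunctor C D}

open scoped Pseudofunctor.StrongTrans in
theorem mapSq_trans (μ : F ⟶ G) {X Y Z W : C} {t : X ⟶ Y} {l : X ⟶ Z} {b : Z ⟶ W} {r : Y ⟶ W}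
    (σ : l ≫ b ⟶ t ≫ r) :
    CommCube (mapSq F σ) (mapSq G σ) (μ.naturality t).inv (μ.naturality b).inv
      (μ.naturality l).inv (μ.naturality r).inv := by
  have key : μ.app X ◁ G.map₂ σ ≫ (μ.naturality (t ≫ r)).inv =
      (μ.naturality (l ≫ b)).inv ≫ F.map₂ σ ▷ μ.app W := by
    rw [Iso.comp_inv_eq, Category.assoc, Iso.eq_inv_comp, μ.naturality_naturality]
  rw [Pseudofunctor.StrongTrans.naturality_comp_inv,
    Pseudofunctor.StrongTrans.naturality_comp_inv] at key
  have key := congrArg (fun s => μ.app X ◁ (G.mapComp l b).inv ≫ s ≫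
    (F.mapComp t r).hom ▷ μ.app W ≫ (α_ _ _ _).hom) key
  simp at key
  simp [CommCube, mapSq, key]

end
end QFunctor

section QFunctor

variable {C : Type u₁} [Bicategory.{w₁, v₁} C] {D : Type u₂} [Bicategory.{w₂, v₂} D]

/-- The unit constraint at a morphism that is equal to an identity. -/
def mapIdOf (F : Pseudofunctor C D) {X : C} {e : X ⟶ X} (h : e = 𝟙 X) : F.map e ≅ 𝟙 (F.obj X) :=
  eqToIso (by rw [h]) ≪≫ F.mapId X

/-- The composition constraint at a morphism that is equal to a composite. -/
def mapCompOf (F : Pseudofunctor C D) {X Y Z : C} {f : X ⟶ Y} {g : Y ⟶ Z} {e : X ⟶ Z}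
    (h : e = f ≫ g) : F.map e ≅ F.map f ≫ F.map g :=
  eqToIso (by rw [h]) ≪≫ F.mapComp f g

theorem mapIdOf_rfl (F : Pseudofunctor C D) (X : C) (h : 𝟙 X = 𝟙 X) :
    mapIdOf F h = F.mapId X := by
  simp [mapIdOf]

theorem mapCompOf_rfl (F : Pseudofunctor C D) {X Y Z : C} (f : X ⟶ Y) (g : Y ⟶ Z)
    (h : f ≫ g = f ≫ g) : mapCompOf F h = F.mapComp f g := by
  simp [mapCompOf]

theorem mapCompOf_hom (F : Pseudofunctor C D) {X Y Z : C} {f : X ⟶ Y} {g : Y ⟶ Z} {e : X ⟶ Z}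
    (h : e = f ≫ g) {i : e ≅ f ≫ g} (hi : i = eqToIso h) :
    (mapCompOf F h).hom = F.map₂ i.hom ≫ (F.mapComp f g).hom := by
  subst h hi
  simp [mapCompOf]

theorem eq_eqToHom_comp {E : Type u} [Category.{v} E] {a b : E} (x : a ⟶ b) (h : a = a) :
    x = eqToHom h ≫ x := by
  simp

theorem eq_conj {E : Type u} [Category.{v} E] {a b : E} (x : a ⟶ b) (h : a = a) (h' : b = b) :
    x = eqToHom h ≫ x ≫ eqToHom h' := by
  simp

theorem mapSq_eq_pasteH (F : Pseudofunctor C D) {X Y Y' Z W W' : C} {A : UpSquare X Y Z W}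
    {B : UpSquare Y Y' W W'} {P : UpSquare X Y' Z W'} (h : B.left = A.right)
    (hP : P = A.hcomp B h) (hi : P.bottom = A.bottom ≫ B.bottom) (hj : P.top = A.top ≫ B.top)
    (hl : P.left = A.left) (hr : P.right = B.right)
    (c : P.left ≫ P.bottom ⟶ P.top ≫ P.right) (hc : c = P.cell) :
    F.map P.left ◁ (mapCompOf F hi).hom ≫
      eqToHom (by rw [hl]) ≫
      pasteH (mapSq F A.cell) (eqToHom (by rw [h]) ≫ mapSq F B.cell) ≫ eqToHom (by rw [hr]) =
      mapSq F c ≫ (mapCompOf F hj).hom ▷ F.map P.right := by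
  subst hP hc
  obtain ⟨a₁, a₂, a₃, a₄, a⟩ := A
  obtain ⟨b₁, b₂, b₃, b₄, b⟩ := B
  obtain rfl : b₂ = a₄ := h
  have h₁ : mapCompOf F hi = F.mapComp a₃ b₃ := mapCompOf_rfl F a₃ b₃ rfl
  have h₂ : mapCompOf F hj = F.mapComp a₁ b₁ := mapCompOf_rfl F a₁ b₁ rfl
  dsimp only [UpSquare.hcomp] at h₁ h₂ ⊢
  rw [h₁, h₂]
  simpa using mapSq_pasteH F a b

theorem mapSq_eq_pasteV (F : Pseudofunctor C D) {X Y Z W Z' W' : C} {A : UpSquare X Y Z W}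
    {B : UpSquare Z W Z' W'} {P : UpSquare X Y Z' W'} (h : B.top = A.bottom)
    (hP : P = A.vcomp B h) (hi : P.left = A.left ≫ B.left) (hj : P.right = A.right ≫ B.right)
    (ht : P.top = A.top) (hb : P.bottom = B.bottom)
    (c : P.left ≫ P.bottom ⟶ P.top ≫ P.right) (hc : c = P.cell) :
    (mapCompOf F hi).hom ▷ F.map P.bottom ≫
      eqToHom (by rw [hb]) ≫
      pasteV (mapSq F A.cell) (mapSq F B.cell ≫ eqToHom (by rw [h])) ≫ eqToHom (by rw [ht]) =
      mapSq F c ≫ F.map P.top ◁ (mapCompOf F hj).hom := by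
  subst hP hc
  obtain ⟨a₁, a₂, a₃, a₄, a⟩ := A
  obtain ⟨b₁, b₂, b₃, b₄, b⟩ := B
  obtain rfl : b₁ = a₃ := h
  have h₁ : mapCompOf F hi = F.mapComp a₂ b₂ := mapCompOf_rfl F a₂ b₂ rfl
  have h₂ : mapCompOf F hj = F.mapComp a₄ b₄ := mapCompOf_rfl F a₄ b₄ rfl
  dsimp only [UpSquare.vcomp] at h₁ h₂ ⊢
  rw [h₁, h₂]
  simpa using mapSq_pasteV F a b

theorem mapSq_eq_vid (F : Pseudofunctor C D) {X Y : C} {f : X ⟶ Y} {e : X ⟶ X} {e' : Y ⟶ Y}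
    (he : e = 𝟙 X) (he' : e' = 𝟙 Y) (c : e ≫ f ⟶ f ≫ e')
    (h : (⟨f, e, f, e', c⟩ : UpSquare X Y X Y) = .vid f) :
    mapSq F c = (mapIdOf F he).hom ▷ F.map f ≫ (λ_ (F.map f)).hom ≫
      (ρ_ (F.map f)).inv ≫ F.map f ◁ (mapIdOf F he').inv := by
  subst he he'
  obtain rfl : c = (UpSquare.vid f).cell := by
    injection h
  simp only [mapIdOf_rfl]
  exact mapSq_vid F f

theorem mapSq_eq_hid (F : Pseudofunctor C D) {X Y : C} {f : X ⟶ Y} {e : X ⟶ X} {e' : Y ⟶ Y}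
    (he : e = 𝟙 X) (he' : e' = 𝟙 Y) (c : f ≫ e' ⟶ e ≫ f)
    (h : (⟨e, f, e', f, c⟩ : UpSquare X X Y Y) = .hid f) :
    mapSq F c = F.map f ◁ (mapIdOf F he').hom ≫ (ρ_ (F.map f)).hom ≫
      (λ_ (F.map f)).inv ≫ (mapIdOf F he).inv ▷ F.map f := by
  subst he he'
  obtain rfl : c = (UpSquare.hid f).cell := by
    injection h
  simp only [mapIdOf_rfl]
  exact mapSq_hid F f

section

variable [Strict C] (F : Pseudofunctor C D)

theorem mapComp_assoc_aux {X Y Z W : C} {f : X ⟶ Y} {g : Y ⟶ Z} {h : Z ⟶ W} {fg : X ⟶ Z}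
    {gh : Y ⟶ W} {a b : X ⟶ W} (e₁ : fg = f ≫ g) (e₂ : gh = g ≫ h) (e₃ : a = fg ≫ h)
    (e₄ : b = f ≫ gh) (e : a = b) :
    (mapCompOf F e₃).hom ≫
      (mapCompOf F e₁).hom ▷ F.map h ≫ (α_ _ _ _).hom =
        eqToHom (by rw [e]) ≫ (mapCompOf F e₄).hom ≫
          F.map f ◁ (mapCompOf F e₂).hom := by
  subst e₁ e₂ e₄ e
  have h₁ := F.mapComp_assoc_left_hom_assoc f g h (α_ _ _ _).hom
  have h₂ : (α_ f g h).symm = eqToIso e₃ := by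
    rw [Strict.associator_eqToIso]; rfl
  rw [mapCompOf_hom F e₃ h₂]
  simp only [mapCompOf_rfl, Category.assoc]
  simp only [Iso.symm_hom]
  rw [h₁, ← F.map₂_comp_assoc]
  simp

theorem mapComp_id_left_aux {X Y : C} {e : X ⟶ X} {f a : X ⟶ Y} (e₁ : e = 𝟙 X) (e₂ : a = e ≫ f)
    (e₃ : a = f) :
    (mapCompOf F e₂).hom ≫
      (mapIdOf F e₁).hom ▷ F.map f ≫ (λ_ (F.map f)).hom =
        eqToHom (by rw [e₃]) := by
  subst e₁ e₃
  have h₂ : (λ_ a).symm = eqToIso e₂ := by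
    rw [Strict.leftUnitor_eqToIso]; rfl
  rw [mapCompOf_hom F e₂ h₂]
  simp [mapIdOf_rfl, map₂_left_inv]

theorem mapComp_id_right_aux {X Y : C} {e : Y ⟶ Y} {f a : X ⟶ Y} (e₁ : e = 𝟙 Y) (e₂ : a = f ≫ e)
    (e₃ : a = f) :
    (mapCompOf F e₂).hom ≫
      F.map f ◁ (mapIdOf F e₁).hom ≫ (ρ_ (F.map f)).hom =
        eqToHom (by rw [e₃]) := by
  subst e₁ e₃
  have h₂ : (ρ_ a).symm = eqToIso e₂ := by
    rw [Strict.rightUnitor_eqToIso]; rfl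
  rw [mapCompOf_hom F e₂ h₂]
  simp [mapIdOf_rfl, map₂_right_inv]

open NFoldCat

variable (n : ℕ)

/-- The pseudofunctor on `Qⁿ C` induced by a pseudofunctor on `C`: it applies the pseudofunctor to
the objects, morphisms and 2-cells of `C` that underlie the objects, morphisms and squares of
`Qⁿ C`. -/
noncomputable def qObj : MixedPseudofunctor (Qn n C) D where
  obj X := F.obj (pointObj X)
  map f := F.map (edgeHom f)
  mapId k X := mapIdOf F (edgeHom_id X)
  mapComp f g := mapCompOf F (edgeHom_comp f g)
  mapComp_assoc f g h := mapComp_assoc_aux F _ _ _ _ (by rw [Edge.comp_assoc])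
  mapComp_id_left f := mapComp_id_left_aux F _ _ (by rw [Edge.id_comp])
  mapComp_id_right f := mapComp_id_right_aux F _ _ (by rw [Edge.comp_id])
  sq hkl _ _ _ _ _ _ _ _ _ hs := mapSq F (sqCell hkl hs)
  cube hkl hlm c _ _ _ _ _ _ _ _ _ _ _ _ _ _ _ _ _ _ _ _ hK' hK hJ' hJ hI' hI :=
    mapSq_cube F (sqCell_cube hkl hlm c hK' hK hJ' hJ hI' hI)
  sq_vid {k l} hkl X Y f hs := mapSq_eq_vid F (edgeHom_id X) (edgeHom_id Y) _ (sqUp_vid hkl f hs)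
  sq_hid {k l} hkl X Z f hs := mapSq_eq_hid F (edgeHom_id X) (edgeHom_id Z) _ (sqUp_hid hkl f hs)
  sq_hcomp hkl _ _ _ _ _ _ j j' i i' p₁ p₂ p₃ s s' hs hs' h hs'' := by
    simpa using mapSq_eq_pasteH F rfl (sqUp_hcomp hkl hs hs' h hs'') (edgeHom_comp i i')
      (edgeHom_comp j j') rfl rfl _ rfl
  sq_vcomp hkl _ _ _ _ _ _ q q' p p' j₁ j₂ j₃ s s' hs hs' h hs'' := by
    simpa using mapSq_eq_pasteV F rfl (sqUp_vcomp hkl hs hs' h hs'') (edgeHom_comp q q')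
      (edgeHom_comp p p') rfl rfl _ rfl

variable {F} {G H : Pseudofunctor C D}

open scoped Pseudofunctor.StrongTrans

theorem naturality_id_aux (μ : F ⟶ G) {X : C} {e : X ⟶ X} (h : e = 𝟙 X) :
    (μ.naturality e).hom ≫ μ.app X ◁ (mapIdOf G h).hom =
      (mapIdOf F h).hom ▷ μ.app X ≫ (λ_ (μ.app X)).hom ≫
        (ρ_ (μ.app X)).inv := by
  subst h
  simpa only [mapIdOf_rfl] using μ.naturality_id X

theorem naturality_comp_aux (μ : F ⟶ G) {X Y Z : C} {f : X ⟶ Y} {g : Y ⟶ Z} {e : X ⟶ Z}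
    (h : e = f ≫ g) :
    (μ.naturality e).hom ≫ μ.app X ◁ (mapCompOf G h).hom =
      (mapCompOf F h).hom ▷ μ.app Z ≫ (α_ _ _ _).hom ≫
        F.map f ◁ (μ.naturality g).hom ≫ (α_ _ _ _).inv ≫ (μ.naturality f).hom ▷ G.map g ≫
          (α_ _ _ _).hom := by
  subst h
  simpa only [mapCompOf_rfl] using μ.naturality_comp f g

/-- The action of `Q` on pseudonatural transformations. -/
noncomputable def qMap (μ : F ⟶ G) : qObj F n ⟶ qObj G n where
  app X := μ.app (pointObj X)
  naturality f := μ.naturality (edgeHom f)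
  naturality_id _ X := naturality_id_aux μ (edgeHom_id X)
  naturality_comp f g := naturality_comp_aux μ (edgeHom_comp f g)
  naturality_sq hkl _ _ _ _ _ _ _ _ _ hs := mapSq_trans μ (sqCell hkl hs)

/-- The action of `Q` on modifications. -/
noncomputable def qMap₂ {μ ν : F ⟶ G} (Γ : μ ⟶ ν) : qMap n μ ⟶ qMap n ν where
  app X := Γ.as.app (pointObj X)
  naturality f := Γ.as.naturality (edgeHom f)

variable (C D)

/-- The 2-functor `Q` from pseudofunctors on `C` to pseudofunctors on `Qⁿ C`. -/
noncomputable def qFunctor : StrictPseudofunctor (Pseudofunctor C D) (MixedPseudofunctor (Qn n C) D) :=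
  .mk'
    { obj := fun F => qObj F n
      map := fun μ => qMap n μ
      map₂ := fun Γ => qMap₂ n Γ
      map₂_id := fun _ => rfl
      map₂_comp := fun _ _ => rfl
      map_id := fun _ => rfl
      map_comp := fun _ _ => rfl
      map₂_whisker_left := fun _ _ _ _ => eq_conj _ rfl rfl
      map₂_whisker_right := fun _ _ => eq_conj _ rfl rfl
      map₂_left_unitor := fun _ => eq_eqToHom_comp _ rfl
      map₂_right_unitor := fun _ => eq_eqToHom_comp _ rfl
      map₂_associator := fun _ _ _ => eq_conj _ rfl rfl }

end
end QFunctor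

/-! ### 2-categories over a base, and equivalences over it -/

section Base

/-- The power `D^ι` of a 2-category, with pointwise structure. -/
def Power (ι : Type t) (D : Type u₂) : Type max t u₂ := ι → D

namespace Power

/-- A family of objects as an object of the power. -/
abbrev of {ι : Type t} {D : Type u₂} (X : ι → D) : Power ι D := X

variable {ι : Type t} {D : Type u₂} [Bicategory.{w₂, v₂} D]

instance : CategoryStruct.{max t v₂} (Power ι D) where
  Hom X Y := ∀ i, X i ⟶ Y i
  id X := fun i => 𝟙 (X i)
  comp f g := fun i => f i ≫ g i

instance (X Y : Power ι D) : Category.{max t w₂} (X ⟶ Y) where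
  Hom f g := ∀ i, f i ⟶ g i
  id f := fun i => 𝟙 (f i)
  comp a b := fun i => a i ≫ b i
  id_comp _ := funext fun _ => Category.id_comp _
  comp_id _ := funext fun _ => Category.comp_id _
  assoc _ _ _ := funext fun _ => Category.assoc _ _ _

/-- Left whiskering, defined pointwise. -/
def whiskerLeft {X Y Z : Power ι D} (f : X ⟶ Y) {g h : Y ⟶ Z} (a : g ⟶ h) : f ≫ g ⟶ f ≫ h :=
  fun i => f i ◁ a i

/-- Right whiskering, defined pointwise. -/
def whiskerRight {X Y Z : Power ι D} {f g : X ⟶ Y} (a : f ⟶ g) (h : Y ⟶ Z) : f ≫ h ⟶ g ≫ h :=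
  fun i => a i ▷ h i

/-- A family of invertible 2-cells as an invertible 2-cell. -/
def isoMk {X Y : Power ι D} {f g : X ⟶ Y} (e : ∀ i, f i ≅ g i) : f ≅ g where
  hom := fun i => (e i).hom
  inv := fun i => (e i).inv
  hom_inv_id := funext fun i => (e i).hom_inv_id
  inv_hom_id := funext fun i => (e i).inv_hom_id

instance : Bicategory.{max t w₂, max t v₂} (Power ι D) where
  whiskerLeft f _ _ a := whiskerLeft f a
  whiskerRight a f := whiskerRight a f
  associator f g h := isoMk fun i => α_ (f i) (g i) (h i)
  leftUnitor f := isoMk fun i => λ_ (f i)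
  rightUnitor f := isoMk fun i => ρ_ (f i)
  whiskerLeft_id _ _ := funext fun _ => Bicategory.whiskerLeft_id _ _
  whiskerLeft_comp _ _ _ _ _ _ := funext fun _ => Bicategory.whiskerLeft_comp _ _ _
  id_whiskerLeft _ := funext fun _ => id_whiskerLeft _
  comp_whiskerLeft _ _ _ _ _ := funext fun _ => comp_whiskerLeft _ _ _
  id_whiskerRight _ _ := funext fun _ => id_whiskerRight _ _
  comp_whiskerRight _ _ _ := funext fun _ => comp_whiskerRight _ _ _
  whiskerRight_id _ := funext fun _ => Bicategory.whiskerRight_id _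
  whiskerRight_comp _ _ _ := funext fun _ => Bicategory.whiskerRight_comp _ _ _
  whisker_assoc _ _ _ _ _ := funext fun _ => whisker_assoc _ _ _
  whisker_exchange _ _ := funext fun _ => whisker_exchange _ _
  pentagon _ _ _ _ := funext fun _ => pentagon _ _ _ _
  triangle _ _ := funext fun _ => triangle _ _

end Power

open scoped Pseudofunctor.StrongTrans

variable (C : Type u₁) [Bicategory.{w₁, v₁} C] (D : Type u₂) [Bicategory.{w₂, v₂} D]

variable {C D} in
/-- The components of a pseudonatural transformation. -/
def powerMap {F G : Pseudofunctor C D} (μ : F ⟶ G) :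
    Power.of (fun c => F.obj c) ⟶ Power.of (fun c => G.obj c) := fun c => μ.app c

variable {C D} in
/-- The components of a modification. -/
def powerMap₂ {F G : Pseudofunctor C D} {μ ν : F ⟶ G} (Γ : μ ⟶ ν) :
    powerMap μ ⟶ powerMap ν := fun c => Γ.as.app c

/-- Restriction of pseudofunctors, pseudonatural transformations and modifications to objects. -/
def toPower : StrictPseudofunctor (Pseudofunctor C D) (Power C D) :=
  .mk'
    { obj := fun F c => F.obj c
      map := fun μ => powerMap μ
      map₂ := fun Γ => powerMap₂ Γ
      map₂_id := fun _ => rfl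
      map₂_comp := fun _ _ => rfl
      map_id := fun _ => rfl
      map_comp := fun _ _ => rfl
      map₂_whisker_left := fun μ _ _ Γ => eq_conj (powerMap μ ◁ powerMap₂ Γ) rfl rfl
      map₂_whisker_right := fun Γ μ => eq_conj (powerMap₂ Γ ▷ powerMap μ) rfl rfl
      map₂_left_unitor := fun μ => eq_eqToHom_comp (λ_ (powerMap μ)).hom rfl
      map₂_right_unitor := fun μ => eq_eqToHom_comp (ρ_ (powerMap μ)).hom rfl
      map₂_associator := fun μ ν ξ =>
        eq_conj (α_ (powerMap μ) (powerMap ν) (powerMap ξ)).hom rfl rfl }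

namespace MixedPseudofunctor

variable {D}
variable {n : ℕ} {dC : NFoldCat.{t} n} {ι : Type u} (p : ι → dC.Ob)

/-- The components at a family of objects of a pseudonatural transformation. -/
def powerMap {F G : MixedPseudofunctor dC D} (μ : F ⟶ G) :
    Power.of (fun i => F.obj (p i)) ⟶ Power.of (fun i => G.obj (p i)) := fun i => μ.app (p i)

/-- The components at a family of objects of a modification. -/
def powerMap₂ {F G : MixedPseudofunctor dC D} {μ ν : F ⟶ G} (Γ : μ ⟶ ν) :
    powerMap p μ ⟶ powerMap p ν := fun i => Γ.app (p i)

/-- Restriction of pseudofunctors on an `n`-fold category to a family of objects. -/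
def toPower : StrictPseudofunctor (MixedPseudofunctor dC D) (Power ι D) :=
  .mk'
    { obj := fun F i => F.obj (p i)
      map := fun μ => powerMap p μ
      map₂ := fun Γ => powerMap₂ p Γ
      map₂_id := fun _ => rfl
      map₂_comp := fun _ _ => rfl
      map_id := fun _ => rfl
      map_comp := fun _ _ => rfl
      map₂_whisker_left := fun μ _ _ Γ => eq_conj (powerMap p μ ◁ powerMap₂ p Γ) rfl rfl
      map₂_whisker_right := fun Γ μ => eq_conj (powerMap₂ p Γ ▷ powerMap p μ) rfl rfl
      map₂_left_unitor := fun μ => eq_eqToHom_comp (λ_ (powerMap p μ)).hom rfl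
      map₂_right_unitor := fun μ => eq_eqToHom_comp (ρ_ (powerMap p μ)).hom rfl
      map₂_associator := fun μ ν ξ =>
        eq_conj (α_ (powerMap p μ) (powerMap p ν) (powerMap p ξ)).hom rfl rfl }

end MixedPseudofunctor

variable {C}

theorem commCube_hid (c : C) : CommCube (UpSquare.hid (𝟙 c)).cell (UpSquare.hid (𝟙 c)).cell
    (UpSquare.hid (𝟙 c)).cell (UpSquare.hid (𝟙 c)).cell (UpSquare.hid (𝟙 c)).cell
    (UpSquare.hid (𝟙 c)).cell := by
  simp [CommCube, UpSquare.hid]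

theorem hid_eq_vid (c : C) : UpSquare.hid (𝟙 c) = UpSquare.vid (𝟙 c) := by
  simp [UpSquare.hid, UpSquare.vid, unitors_equal]

variable [Strict C]

theorem hid_vcomp_self (c : C) (h) :
    UpSquare.hid (𝟙 c) = (UpSquare.hid (𝟙 c)).vcomp (UpSquare.hid (𝟙 c)) h :=
  UpSquare.eq_vcomp_vid _ (hid_eq_vid c)

/-- The hypercube of shape `∅` at an object of `C`. -/
def QuasiFunctor.point (n : ℕ) (c : C) :
    QuasiFunctor (boxStep (shape (∅ : Finset (Fin n)))) C where
  obj _ := c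
  map _ := 𝟙 c
  map_id _ := rfl
  map_comp _ _ _ := (Strict.id_comp _).symm
  cell _ _ _ _ _ _ _ _ _ := (UpSquare.hid (𝟙 c)).cell
  cell_hid _ _ _ _ _ _ _ := rfl
  cell_vid _ _ _ _ _ _ _ := hid_eq_vid c
  cell_hcomp _ _ _ _ _ _ _ _ _ _ _ _ _ _ _ _ := UpSquare.eq_hcomp_hid _ rfl
  cell_vcomp _ _ _ _ _ _ _ _ _ _ _ _ _ _ _ _ := hid_vcomp_self c _
  cube _ _ _ _ _ _ _ _ _ _ _ _ _ _ _ _ _ _ _ _ _ _ := commCube_hid c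

/-- An object of `C` as an object of `Qⁿ C`. -/
noncomputable abbrev qPoint (n : ℕ) (c : C) : (Qn n C).Ob := QuasiFunctor.point n c

theorem pointObj_qPoint (n : ℕ) (c : C) : pointObj (qPoint n c) = c := rfl

theorem qPoint_pointObj (n : ℕ) (X : (Qn n C).Ob) : qPoint n (pointObj X) = X := by
  change QuasiFunctor (boxStep (shape ∅)) C at X
  have he : ∀ a : Box (shape (∅ : Finset (Fin n))), a = 0 := fun a => box_empty _ _
  change QuasiFunctor.point n (X.obj 0) = X
  obtain ⟨O, M, M1, M2, S, S1, S2, S3, S4, S5⟩ := X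
  obtain ⟨c, rfl⟩ : ∃ c, O = fun _ => c := ⟨O 0, funext fun a => by rw [he a]⟩
  obtain rfl : @M = fun _ _ _ _ => 𝟙 c := by
    funext k a b s
    obtain rfl := (he a).trans (he b).symm
    exact M1 _
  have : @S = fun _ _ _ _ _ _ _ _ _ _ _ => (UpSquare.hid (𝟙 c)).cell := by
    funext k l hkl a b c' d t e m r
    obtain rfl := (he a)
    obtain rfl := (he b)
    obtain rfl := (he c')
    obtain rfl := (he d)
    have := S1 hkl t e m r
    injection this
  subst this
  rfl

section OverEquivalence

variable {A : Type u} [Bicategory.{w, v} A] {B : Type u₁} [Bicategory.{w₁, v₁} B]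
  {E : Type u₂} [Bicategory.{w₂, v₂} E]

/-- A pseudonatural transformation `α` is vertical with respect to `P` if `P` sends its components
and its naturality 2-cells to identities. -/
def IsVertical (P : StrictPseudofunctor B E) {F G : Pseudofunctor A B} (α : F ⟶ G) : Prop :=
  (∀ X, ∃ h, P.map (α.app X) = eqToHom h) ∧
    ∀ ⦃X Y : A⦄ (f : X ⟶ Y), ∃ h, P.map₂ (α.naturality f).hom = eqToHom h

/-- A modification is vertical with respect to `P` if `P` sends its components to identities. -/
def IsVerticalModif (P : StrictPseudofunctor B E) {F G : Pseudofunctor A B} {α β : F ⟶ G}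
    (Γ : α ⟶ β) : Prop :=
  ∀ X, ∃ h, P.map₂ (Γ.as.app X) = eqToHom h

/-- A vertical pseudonatural transformation that has an inverse, up to invertible vertical
modifications, among the vertical pseudonatural transformations. -/
def IsVerticalEquivalence (P : StrictPseudofunctor B E) {F G : Pseudofunctor A B} (α : F ⟶ G) :
    Prop :=
  IsVertical P α ∧ ∃ β : G ⟶ F, IsVertical P β ∧
    (∃ Γ : α ≫ β ≅ 𝟙 F, IsVerticalModif P Γ.hom) ∧ ∃ Γ : β ≫ α ≅ 𝟙 G, IsVerticalModif P Γ.hom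

/-- For 2-functors `P : A ⥤ E` and `R : B ⥤ E`, a 2-functor `G : A ⥤ B` is an `E`-equivalence if it
is a 2-functor over `E` and there is a 2-functor `H : B ⥤ A` over `E` with vertical equivalences
from the identity of `B` to `H ⋙ G` and from `G ⋙ H` to the identity of `A`. -/
def IsOverEquivalence (P : StrictPseudofunctor A E) (R : StrictPseudofunctor B E)
    (G : StrictPseudofunctor A B) : Prop :=
  G.comp R = P ∧ ∃ H : StrictPseudofunctor B A, H.comp P = R ∧
    (∃ η : (StrictPseudofunctor.id B).toPseudofunctor ⟶ (H.comp G).toPseudofunctor,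
      IsVerticalEquivalence R η) ∧
    ∃ θ : (G.comp H).toPseudofunctor ⟶ (StrictPseudofunctor.id A).toPseudofunctor,
      IsVerticalEquivalence P θ

end OverEquivalence

end Base

open scoped Pseudofunctor.StrongTrans

/-! For `f : X ⟶ Y` and directions `k < l`, the `n`-fold category `Qⁿ C` contains two squares with
identity 2-cell: one with left and top edge `f` and identities as bottom and right edge, the other
with bottom and right edge `f` and identities as left and top edge. Their horizontal and vertical
pastings are identity squares, so they exhibit `f` in direction `k` as a companion of `f` in
direction `l`. A pseudofunctor `F` on `Qⁿ C` respects pasting and identity squares up to its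
constraints. Hence the images of the two squares are mutually inverse 2-cells between the values of
`F` at `f` in the two directions (`Cubical.theta`, `Cubical.thetaInv_theta`,
`Cubical.theta_thetaInv`), and all directions of `F` carry the same information on morphisms.

A square whose vertical edges are identities is the same thing as a 2-cell of `C`. Its image defines
an action of direction `k` on 2-cells, and the pasting laws make this direction a pseudofunctor on
`C` (`Cubical.map₂_comp`, `Cubical.map₂_hcomp`). An arbitrary square is obtained by pasting such a
square with companion squares, so its image is recovered from this pseudofunctor and the comparison
of directions (`Cubical.sq_theta`).

With more than two directions, the choices are compared by cubes that come from a single up-square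
by merging two adjacent directions. Merging the last two directions shows that the action on 2-cells
does not depend on the vertical direction (`Cubical.map₂_eq_map₂`). Merging the first two shows that
the comparison carries squares in the directions `l, m` to squares in the directions `k, m`
(`Cubical.sq_theta_trans`). Together these say that, after comparison with direction `0`, the 2-cell
of every square is the one prescribed by `Q` of the restriction of `F` to direction `0`
(`Cubical.cmp_sq`).

So restriction to direction `0` is inverse to `Q`. The unit has identity components, and the
comparison of directions as its naturality constraints. The counit has identity components too, and
its constraints are transports along the equation `edgeHom (mkEdge k f) = f`. Inverses arise by
inverting these constraints. What remains on objects of `C` are unitors of `D`, which are identities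
since `D` is strict, and therefore everything lies over the power of `D`.

The argument needs enough hypercubes and control over them. Objects, morphisms and squares of `Qⁿ C`
are determined by their underlying data in `C` (`point_ext`, `edgeHom_injective`, `square_ext`).
Each up-square yields hypercubes by a monotone assignment of the `n` directions to its two
directions (`UpSquare.hyper`); among three directions two adjacent ones are then merged, which makes
the cubes commute. -/

/-! ### Hypercubes generated by a single up-square -/

section Hyper

variable {C : Type u} [Bicategory.{w, v} C]

namespace UpSquare

variable {X Y Z W : C}

/-- The corners of an up-square. -/
@[reducible] def vertex (_ : UpSquare X Y Z W) : Bool × Bool → C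
  | (false, false) => X
  | (true, false) => Y
  | (false, true) => Z
  | (true, true) => W

/-- Steps in the two directions of a square. -/
def step (i : Fin 2) (a b : Bool × Bool) : Prop :=
  (i = 0 → a.1 ≤ b.1 ∧ a.2 = b.2) ∧ (i = 1 → a.1 = b.1 ∧ a.2 ≤ b.2)

instance (i : Fin 2) (a b : Bool × Bool) : Decidable (step i a b) := by
  unfold step; infer_instance

theorem step_trans : ∀ {i : Fin 2} {a b c : Bool × Bool}, step i a b → step i b c → step i a c := by
  decide

/-- A strictly increasing chain in `Bool` has at most two elements. Thus a composite of steps in one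
direction involves an identity, and the composition laws below reduce to unit laws. -/
theorem step_eq_or_eq : ∀ {i : Fin 2} {a b c : Bool × Bool}, step i a b → step i b c →
    a = b ∨ b = c := by
  decide

set_option synthInstance.maxSize 2000 in
set_option synthInstance.maxHeartbeats 400000 in
-- The two directions change different coordinates, so opposite edges of a square in distinct
-- directions make the same change.
theorem step_degenerate : ∀ {i j : Fin 2} {a b c d : Bool × Bool}, step i a b → step j a c →
    step i c d → step j b d → i ≠ j → (a = b → c = d) ∧ (a = c → b = d) := by
  decide

set_option synthInstance.maxSize 2000 in
set_option synthInstance.maxHeartbeats 400000 in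
-- With `i ≤ j` and `i ≠ j`, the first direction is horizontal and the second vertical. Strict
-- increase in both coordinates leaves only the full square.
theorem step_nondegenerate : ∀ {i j : Fin 2} {a b c d : Bool × Bool}, step i a b → step j a c →
    step i c d → step j b d → i ≤ j → i ≠ j ∧ a ≠ b ∧ a ≠ c →
    a = (false, false) ∧ b = (true, false) ∧ c = (false, true) ∧ d = (true, true) := by
  decide

/-- The edges of an up-square, and the identities of its corners. -/
def edge (A : UpSquare X Y Z W) : ∀ {i : Fin 2} {a b : Bool × Bool}, step i a b →
    (A.vertex a ⟶ A.vertex b)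
  | _, (false, false), (false, false), _ => 𝟙 X
  | _, (true, false), (true, false), _ => 𝟙 Y
  | _, (false, true), (false, true), _ => 𝟙 Z
  | _, (true, true), (true, true), _ => 𝟙 W
  | _, (false, false), (true, false), _ => A.top
  | _, (false, false), (false, true), _ => A.left
  | _, (false, true), (true, true), _ => A.bottom
  | _, (true, false), (true, true), _ => A.right
  -- In the remaining cases a coordinate decreases or both change, which no step does, whatever its
  -- direction.
  | i, (false, false), (true, true), h => absurd h (by revert i; decide)
  | i, (true, true), (false, false), h => absurd h (by revert i; decide)
  | i, (true, false), (false, true), h => absurd h (by revert i; decide)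
  | i, (false, true), (true, false), h => absurd h (by revert i; decide)
  | i, (true, false), (false, false), h => absurd h (by revert i; decide)
  | i, (false, true), (false, false), h => absurd h (by revert i; decide)
  | i, (true, true), (false, true), h => absurd h (by revert i; decide)
  | i, (true, true), (true, false), h => absurd h (by revert i; decide)

theorem edge_id (A : UpSquare X Y Z W) {i : Fin 2} {a : Bool × Bool} (h : step i a a) :
    A.edge h = 𝟙 (A.vertex a) := by
  obtain ⟨_ | _, _ | _⟩ := a <;> rfl

variable [Strict C]

theorem edge_comp (A : UpSquare X Y Z W) {i : Fin 2} {a b c : Bool × Bool} (h : step i a b)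
    (h' : step i b c) (h'' : step i a c) : A.edge h'' = A.edge h ≫ A.edge h' := by
  rcases step_eq_or_eq h h' with rfl | rfl
  · rw [edge_id, Strict.id_comp]
  · rw [edge_id, Strict.comp_id]

/-- If the directions agree, both paths compose to the same step from `a` to `d`. Otherwise one pair
of opposite edges consists of identities, and both paths reduce to the other edge. -/
theorem edge_comm (A : UpSquare X Y Z W) {i j : Fin 2} {a b c d : Bool × Bool} (t : step i a b)
    (e : step j a c) (m : step i c d) (r : step j b d)
    (hn : ¬ (i ≠ j ∧ a ≠ b ∧ a ≠ c)) : A.edge e ≫ A.edge m = A.edge t ≫ A.edge r := by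
  by_cases hij : i = j
  · subst hij
    rw [← edge_comp A e m (step_trans e m), ← edge_comp A t r (step_trans t r)]
  · obtain ⟨h₁, h₂⟩ := step_degenerate t e m r hij
    by_cases hab : a = b
    · obtain rfl := hab
      obtain rfl := h₁ rfl
      rw [edge_id, edge_id, Strict.id_comp, Strict.comp_id]
    · obtain rfl : a = c := by tauto
      obtain rfl := h₂ rfl
      rw [edge_id, edge_id, Strict.id_comp, Strict.comp_id]

/-- The cell of an up-square, and the identity 2-cells of the other squares of its edges. -/
def face (A : UpSquare X Y Z W) {i j : Fin 2} (hij : i ≤ j) {a b c d : Bool × Bool} (t : step i a b)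
    (e : step j a c) (m : step i c d) (r : step j b d) :
    A.edge e ≫ A.edge m ⟶ A.edge t ≫ A.edge r :=
  -- In this case the vertices are forced to be the four corners in order, and `A.cell` has the
  -- required type after substitution.
  if h : i ≠ j ∧ a ≠ b ∧ a ≠ c then by
    have h' := step_nondegenerate t e m r hij h
    have h₁ := h'.1
    have h₂ := h'.2.1
    have h₃ := h'.2.2.1
    have h₄ := h'.2.2.2
    subst h₁ h₂ h₃ h₄
    exact A.cell
  else eqToHom (A.edge_comm t e m r h)

theorem face_thin (A : UpSquare X Y Z W) {i j : Fin 2} (hij : i ≤ j) {a b c d : Bool × Bool}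
    (t : step i a b) (e : step j a c) (m : step i c d) (r : step j b d)
    (hn : ¬ (i ≠ j ∧ a ≠ b ∧ a ≠ c)) : A.face hij t e m r = eqToHom (A.edge_comm t e m r hn) :=
  dif_neg hn

theorem face_cell (A : UpSquare X Y Z W) {i j : Fin 2} (hij : i ≤ j) (h : i ≠ j)
    (t : step i (false, false) (true, false)) (e : step j (false, false) (false, true))
    (m : step i (false, true) (true, true)) (r : step j (true, false) (true, true)) :
    A.face hij t e m r = A.cell := by
  have h' : i ≠ j ∧ (false, false) ≠ (true, false) ∧ (false, false) ≠ (false, true) :=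
    ⟨h, by decide, by decide⟩
  unfold face
  rw [dif_pos h']

/-- In a strict bicategory the unitors that form the cell of `hid f` are transports as well, and
parallel transports agree. -/
theorem mk_eq_hid {f f' : X ⟶ Z} {t : X ⟶ X} {m : Z ⟶ Z} {c : f ≫ m ⟶ t ≫ f'} (ht : t = 𝟙 X)
    (hm : m = 𝟙 Z) (hf : f' = f) (h : f ≫ m = t ≫ f') (hc : c = eqToHom h) :
    (⟨t, f, m, f', c⟩ : UpSquare X X Z Z) = .hid f := by
  subst ht hm hf hc
  simp [hid, Strict.leftUnitor_eqToIso, Strict.rightUnitor_eqToIso]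

theorem mk_eq_vid {f f' : X ⟶ Y} {e : X ⟶ X} {r : Y ⟶ Y} {c : e ≫ f' ⟶ f ≫ r} (he : e = 𝟙 X)
    (hr : r = 𝟙 Y) (hf : f' = f) (h : e ≫ f' = f ≫ r) (hc : c = eqToHom h) :
    (⟨f, e, f', r, c⟩ : UpSquare X Y X Y) = .vid f := by
  subst he hr hf hc
  simp [vid, Strict.leftUnitor_eqToIso, Strict.rightUnitor_eqToIso]

/-- Extracts an equation of 2-cells from an equation of squares when the boundaries are equal only
propositionally. -/
theorem cell_eq_of_mk_eq {t t' : X ⟶ Y} {l l' : X ⟶ Z} {b b' : Z ⟶ W} {r r' : Y ⟶ W}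
    {c : l ≫ b ⟶ t ≫ r} {c' : l' ≫ b' ⟶ t' ≫ r'}
    (h : (⟨t, l, b, r, c⟩ : UpSquare X Y Z W) = ⟨t', l', b', r', c'⟩) (h₁ : l ≫ b = l' ≫ b')
    (h₂ : t' ≫ r' = t ≫ r) : c = eqToHom h₁ ≫ c' ≫ eqToHom h₂ := by
  cases h
  simp

/-- A pasting of transports is a transport, and there is at most one between given 1-cells. -/
theorem hcomp_thin {Y' W' : C} {A : UpSquare X Y Z W} {B : UpSquare Y Y' W W'}
    {P : UpSquare X Y' Z W'} (h : B.left = A.right) (ht : P.top = A.top ≫ B.top)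
    (hl : P.left = A.left) (hb : P.bottom = A.bottom ≫ B.bottom) (hr : P.right = B.right)
    (hA hB hP) (hA' : A.cell = eqToHom hA) (hB' : B.cell = eqToHom hB)
    (hP' : P.cell = eqToHom hP) : P = A.hcomp B h := by
  refine ext_cell ht hl hb hr _ _ rfl rfl ?_
  simp [hcomp, pasteH, hA', hB', hP', Strict.associator_eqToIso]
  exact (eqToHom_trans _ _).trans (eqToHom_trans _ _).symm

theorem vcomp_thin {Z' W' : C} {A : UpSquare X Y Z W} {B : UpSquare Z W Z' W'}
    {P : UpSquare X Y Z' W'} (h : B.top = A.bottom) (ht : P.top = A.top)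
    (hl : P.left = A.left ≫ B.left) (hb : P.bottom = B.bottom) (hr : P.right = A.right ≫ B.right)
    (hA hB hP) (hA' : A.cell = eqToHom hA) (hB' : B.cell = eqToHom hB)
    (hP' : P.cell = eqToHom hP) : P = A.vcomp B h := by
  refine ext_cell ht hl hb hr _ _ rfl rfl ?_
  simp [vcomp, pasteV, hA', hB', hP', Strict.associator_eqToIso]
  exact (eqToHom_trans _ _).trans (eqToHom_trans _ _).symm

section

variable {X' Y' Z' W' : C} {b' : X' ⟶ Y'} {q' : X' ⟶ Z'} {a' : Z' ⟶ W'} {p' : Y' ⟶ W'}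
    {b : X ⟶ Y} {q : X ⟶ Z} {a : Z ⟶ W} {p : Y ⟶ W}
    {x : X' ⟶ X} {y : Y' ⟶ Y} {z : Z' ⟶ Z} {w : W' ⟶ W}
    {K' : q' ≫ a' ⟶ b' ≫ p'} {K : q ≫ a ⟶ b ≫ p}
    {J' : x ≫ b ⟶ b' ≫ y} {J : z ≫ a ⟶ a' ≫ w}
    {I' : x ≫ q ⟶ q' ≫ z} {I : y ≫ p ⟶ p' ≫ w}

/-- When the two faces in the first two directions are thin, each side of the cube is a horizontal
pasting of the other two faces on it, up to transport. -/
theorem commCube_of_hcomp_eq (hK hK') (h₁ : K = eqToHom hK) (h₂ : K' = eqToHom hK')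
    (h : hcomp ⟨b', x, b, y, J'⟩ ⟨p', y, p, w, I⟩ rfl =
      hcomp ⟨q', x, q, z, I'⟩ ⟨a', z, a, w, J⟩ rfl) : CommCube K' K J' J I' I := by
  have := cell_eq_of_mk_eq h (show x ≫ b ≫ p = x ≫ q ≫ a by rw [hK])
    (show (q' ≫ a') ≫ w = (b' ≫ p') ≫ w by rw [hK'])
  simp only [pasteH, eqToHom_refl, Category.id_comp] at this
  simp [Strict.associator_eqToIso] at this
  simp [CommCube, h₁, h₂, Strict.associator_eqToIso]
  have h₃ : x ≫ q ≫ a = x ≫ b ≫ p := by rw [hK]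
  simpa using eqToHom h₃ ≫= this =≫ eqToHom (Strict.assoc b' p' w)

/-- When the two faces in the last two directions are thin, each side of the cube is a vertical
pasting of the other two faces on it, up to transport. -/
theorem commCube_of_vcomp_eq (hI hI') (h₁ : I = eqToHom hI) (h₂ : I' = eqToHom hI')
    (h : vcomp ⟨b', x, b, y, J'⟩ ⟨b, q, a, p, K⟩ rfl =
      vcomp ⟨b', q', a', p', K'⟩ ⟨a', z, a, w, J⟩ rfl) : CommCube K' K J' J I' I := by
  have := cell_eq_of_mk_eq h (show (x ≫ q) ≫ a = (q' ≫ z) ≫ a by rw [hI'])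
    (show b' ≫ p' ≫ w = b' ≫ y ≫ p by rw [hI])
  simp only [pasteV, eqToHom_refl, Category.comp_id] at this
  simp [Strict.associator_eqToIso] at this
  simp [CommCube, h₁, h₂, Strict.associator_eqToIso]
  have h₃ : b' ≫ y ≫ p = b' ≫ p' ≫ w := by rw [hI]
  simpa using eqToHom (Strict.assoc x q a).symm ≫= this =≫ eqToHom h₃

end

section

variable (A : UpSquare X Y Z W) {i j : Fin 2} (hij : i ≤ j)

/-- A square of edges of an up-square. -/
abbrev sub {a b c d : Bool × Bool} (t : step i a b) (e : step j a c) (m : step i c d)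
    (r : step j b d) : UpSquare (A.vertex a) (A.vertex b) (A.vertex c) (A.vertex d) :=
  ⟨A.edge t, A.edge e, A.edge m, A.edge r, A.face hij t e m r⟩

theorem sub_hid {a c : Bool × Bool} (t : step i a a) (e : step j a c) (m : step i c c)
    (r : step j a c) : A.sub hij t e m r = .hid (A.edge e) :=
  mk_eq_hid (A.edge_id t) (A.edge_id m) rfl _ (A.face_thin hij t e m r (by simp))

theorem sub_vid {a b : Bool × Bool} (t : step i a b) (e : step j a a) (m : step i a b)
    (r : step j b b) : A.sub hij t e m r = .vid (A.edge t) :=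
  mk_eq_vid (A.edge_id e) (A.edge_id r) rfl _ (A.face_thin hij t e m r (by simp))

/-- If the directions agree, all three squares are thin. Otherwise one of the two factors has
identities as horizontal edges, so that it is an identity square and can be dropped. -/
theorem sub_hcomp {a b b' c d d' : Bool × Bool} (t : step i a b) (e : step j a c)
    (m : step i c d) (r : step j b d) (t' : step i b b') (m' : step i d d') (r' : step j b' d')
    (t'' : step i a b') (m'' : step i c d') :
    A.sub hij t'' e m'' r' = (A.sub hij t e m r).hcomp (A.sub hij t' r m' r') rfl := by
  by_cases h : i = j
  · exact hcomp_thin rfl (A.edge_comp _ _ _) rfl (A.edge_comp _ _ _) rfl _ _ _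
      (A.face_thin hij t e m r (by simp [h])) (A.face_thin hij t' r m' r' (by simp [h]))
      (A.face_thin hij t'' e m'' r' (by simp [h]))
  · obtain ⟨h₁, -⟩ := step_degenerate t e m r h
    obtain ⟨h₂, -⟩ := step_degenerate t' r m' r' h
    rcases step_eq_or_eq t t' with rfl | rfl
    · obtain rfl := h₁ rfl
      exact eq_hid_hcomp _ (A.sub_hid hij _ _ _ _)
    · obtain rfl := h₂ rfl
      exact eq_hcomp_hid _ (A.sub_hid hij _ _ _ _)

theorem sub_vcomp {a b c d c' d' : Bool × Bool} (t : step i a b) (e : step j a c)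
    (m : step i c d) (r : step j b d) (e' : step j c c') (m' : step i c' d') (r' : step j d d')
    (e'' : step j a c') (r'' : step j b d') :
    A.sub hij t e'' m' r'' = (A.sub hij t e m r).vcomp (A.sub hij m e' m' r') rfl := by
  by_cases h : i = j
  · exact vcomp_thin rfl rfl (A.edge_comp _ _ _) rfl (A.edge_comp _ _ _) _ _ _
      (A.face_thin hij t e m r (by simp [h])) (A.face_thin hij m e' m' r' (by simp [h]))
      (A.face_thin hij t e'' m' r'' (by simp [h]))
  · obtain ⟨-, h₁⟩ := step_degenerate t e m r h
    obtain ⟨-, h₂⟩ := step_degenerate m e' m' r' h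
    rcases step_eq_or_eq e e' with rfl | rfl
    · obtain rfl := h₁ rfl
      exact eq_vid_vcomp _ (A.sub_vid hij _ _ _ _)
    · obtain rfl := h₂ rfl
      exact eq_vcomp_vid _ (A.sub_vid hij _ _ _ _)

/-- Three directions with only two values have two adjacent ones in common. The faces in these two
directions are thin, and both pastings of the remaining faces compute the same square of edges of
`A`. -/
theorem sub_cube {k : Fin 2} (hjk : j ≤ k) {a b c d a' b' c' d' : Bool × Bool}
    (t' : step i a' b') (e' : step j a' c') (m' : step i c' d') (r' : step j b' d')
    (t : step i a b) (e : step j a c) (m : step i c d) (r : step j b d)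
    (x : step k a' a) (y : step k b' b) (z : step k c' c) (w : step k d' d) :
    CommCube (A.face hij t' e' m' r') (A.face hij t e m r)
      (A.face (hij.trans hjk) t' x t y) (A.face (hij.trans hjk) m' z m w)
      (A.face hjk e' x e z) (A.face hjk r' y r w) := by
  by_cases h : i = j
  · subst h
    refine commCube_of_hcomp_eq _ _ (A.face_thin hij t e m r (by simp))
      (A.face_thin hij t' e' m' r' (by simp)) ?_
    exact (A.sub_hcomp hjk t' x t y r' r w (step_trans t' r') (step_trans t r)).symm.trans
      (A.sub_hcomp hjk e' x e z m' m w _ _)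
  -- In `Fin 2`, the relations `i ≤ j ≤ k` and `i ≠ j` force `i = 0` and `j = k = 1`.
  · obtain rfl : j = k := by omega
    refine commCube_of_vcomp_eq _ _ (A.face_thin hjk r' y r w (by simp))
      (A.face_thin hjk e' x e z (by simp)) ?_
    exact (A.sub_vcomp hij t' x t y e m r (step_trans x e) (step_trans y r)).symm.trans
      (A.sub_vcomp hij t' e' m' r' z m w _ _)

end

/-- The quasi-functor that takes the corners, edges and cells of an up-square as values, along a
map of directions and a map of vertices. -/
def hyper {n : ℕ} {V : Type} {s : Fin n → V → V → Prop} (A : UpSquare X Y Z W) (ρ : Fin n →o Fin 2)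
    (g : V → Bool × Bool) (hg : ∀ k a b, s k a b → step (ρ k) (g a) (g b)) : QuasiFunctor s C where
  obj a := A.vertex (g a)
  map h := A.edge (hg _ _ _ h)
  map_id h := A.edge_id _
  map_comp _ _ _ := A.edge_comp _ _ _
  cell hkl _ _ _ _ t e m r := A.face (ρ.monotone hkl.le) (hg _ _ _ t) (hg _ _ _ e) (hg _ _ _ m)
    (hg _ _ _ r)
  cell_hid _ _ _ _ _ _ _ := A.sub_hid _ _ _ _ _
  cell_vid _ _ _ _ _ _ _ := A.sub_vid _ _ _ _ _
  cell_hcomp _ _ _ _ _ _ _ _ _ _ _ _ _ _ _ _ := A.sub_hcomp _ _ _ _ _ _ _ _ _ _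
  cell_vcomp _ _ _ _ _ _ _ _ _ _ _ _ _ _ _ _ := A.sub_vcomp _ _ _ _ _ _ _ _ _ _
  cube _ _ _ _ _ _ _ _ _ _ _ _ _ _ _ _ _ _ _ _ _ _ := A.sub_cube _ _ _ _ _ _ _ _ _ _ _ _ _ _

end UpSquare
end Hyper

/-! ### Morphisms and squares of `Qⁿ C` are determined by, and can be built from, data of `C` -/

section Uniqueness

variable {n : ℕ} {C : Type u} [Bicategory.{w, v} C]

theorem UpSquare.cell_heq_of_eq {X Y Z W : C} {A B : UpSquare X Y Z W} (h : A = B) :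
    HEq A.cell B.cell := by
  subst h; rfl

namespace QuasiFunctor

variable {α : Fin n → ℕ}

/-- Quasi-functors on a box are equal if they agree on objects and on nondegenerate steps and
squares. -/
theorem ext_of_nondegenerate {F G : QuasiFunctor (boxStep α) C} (ho : ∀ a, F.obj a = G.obj a)
    (hm : ∀ (i : Fin n) (a b : Box α) (s : boxStep α i a b), a i < b i → HEq (F.map s) (G.map s))
    (hc : ∀ (i j : Fin n) (hij : i < j) (a b c d : Box α) (t : boxStep α i a b)
      (e : boxStep α j a c) (m : boxStep α i c d) (r : boxStep α j b d), a i < b i → a j < c j →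
      HEq (F.cell hij t e m r) (G.cell hij t e m r)) : F = G := by
  obtain ⟨O, M, M1, M2, S, S1, S2, S3, S4, S5⟩ := F
  obtain ⟨O', M', M1', M2', S', S1', S2', S3', S4', S5'⟩ := G
  obtain rfl : O = O' := funext ho
  have eq_of_le : ∀ {i : Fin n} {a b : Box α}, boxStep α i a b → ¬ a i < b i → b = a :=
    fun s h => s.eq_left (not_lt.1 h)
  obtain rfl : @M = @M' := by
    funext i a b s
    by_cases h : a i < b i
    · exact eq_of_heq (hm i a b s h)
    · obtain rfl := eq_of_le s h
      exact (M1 s).trans (M1' s).symm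
  obtain rfl : @S = @S' := by
    funext i j hij a b c d t e m r
    by_cases h : a i < b i
    · by_cases h' : a j < c j
      · exact eq_of_heq (hc i j hij a b c d t e m r h h')
      -- Both vertical edges are degenerate, so `cell_vid` prescribes the cell for both
      -- quasi-functors. The case of degenerate horizontal edges below uses `cell_hid`.
      · obtain rfl := eq_of_le e h'
        have : ¬ b j < d j := by rwa [← t.2 j hij.ne', ← m.2 j hij.ne']
        obtain rfl := eq_of_le r this
        exact eq_of_heq (UpSquare.cell_heq_of_eq ((S2 hij t e m r).trans (S2' hij t e m r).symm))
    · obtain rfl := eq_of_le t h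
      have : ¬ c i < d i := by rwa [← e.2 i hij.ne, ← r.2 i hij.ne]
      obtain rfl := eq_of_le m this
      exact eq_of_heq (UpSquare.cell_heq_of_eq ((S1 hij t e m r).trans (S1' hij t e m r).symm))
  rfl

end QuasiFunctor

open NFoldCat

variable [Strict C] {k l : Fin n}

theorem point_ext {X Y : (Qn n C).Ob} (h : pointObj X = pointObj Y) : X = Y := by
  rw [← qPoint_pointObj n X, ← qPoint_pointObj n Y, h]

theorem coord_le_one {I : Finset (Fin n)} (c : Box (shape I)) (i : Fin n) : (c i : ℕ) ≤ 1 := by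
  have h := (c i).isLt
  have : shape I i ≤ 1 := by unfold shape; split_ifs <;> simp
  omega

theorem coord_mem {I : Finset (Fin n)} {c : Box (shape I)} {i : Fin n} (h : (c i : ℕ) ≠ 0) :
    i ∈ I := by
  by_contra hi
  have := (c i).isLt
  simp only [shape, hi, if_false] at this
  omega

theorem box_singleton (c : Box (shape {k})) :
    c = (sub ∅ {k} (c k : ℕ)).app 0 := by
  refine Box.ext_val fun j => ?_
  change _ = min (if j ∈ (∅ : Finset (Fin n)) then _ else (c k : ℕ)) (shape {k} j)
  have h := (c j).isLt
  by_cases hj : j = k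
  · subst hj
    have := coord_le_one c j
    simp [shape]; omega
  · have hs : shape {k} j = 0 := by simp [shape, hj]
    omega

theorem edge_nondegenerate {i : Fin n} {a b : Box (shape {k})} (h : a i < b i) :
    i = k ∧ (a i : ℕ) = 0 ∧ (b i : ℕ) = 1 := by
  have h' : (a i : ℕ) < b i := h
  have hb := coord_le_one b i
  have hi := coord_mem (c := b) (i := i) (by omega)
  exact ⟨Finset.mem_singleton.1 hi, by omega, by omega⟩

variable {α : Fin n → ℕ} {z : QuasiFunctor (boxStep α) C} {a b c d : Box α}

/-- A converse of `edge_facts`: an edge box has two vertices, one nondegenerate step and no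
nondegenerate square, so the underlying objects and morphism leave no further freedom. -/
theorem act_eq_edge {X Y : (Qn n C).Ob} (f : (Qn n C).Edge k X Y) (m : BoxHom (shape {k}) α)
    (ha : m.app ((sub ∅ {k} 0).app 0) = a) (hb : m.app ((sub ∅ {k} 1).app 0) = b)
    (s : boxStep α k a b) (hX : pointObj X = z.obj a) (hY : pointObj Y = z.obj b)
    (hf : HEq (edgeHom f) (z.map s)) : QuasiFunctor.act m z = f.cell := by
  subst ha hb
  obtain ⟨x, rfl, rfl⟩ := f
  refine (QuasiFunctor.ext_of_nondegenerate (F := (x : QuasiFunctor (boxStep (shape {k})) C))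
    (G := QuasiFunctor.act m z) ?_ ?_ ?_).symm
  · intro c
    have hc := coord_le_one c k
    rw [box_singleton c]
    have : (c k : ℕ) = 0 ∨ (c k : ℕ) = 1 := by omega
    rcases this with h | h
    · rw [h]; exact hX
    · rw [h]; exact hY
  · intro i a b s h
    obtain ⟨rfl, ha, hb⟩ := edge_nondegenerate h
    obtain rfl : a = (sub ∅ {i} 0).app 0 := by rw [box_singleton a, ha]
    obtain rfl : b = (sub ∅ {i} 1).app 0 := by rw [box_singleton b, hb]
    exact hf
  -- A nondegenerate square would need two distinct directions in `{k}`.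
  · intro i j hij a b c d t e m r h h'
    exact absurd ((edge_nondegenerate h).1.trans (edge_nondegenerate h').1.symm) hij.ne

/-- Lets equations between morphisms of `Qⁿ C`, including the functoriality of `mkEdge`, be checked
in `C`. -/
theorem edgeHom_injective {X Y : (Qn n C).Ob} {f g : (Qn n C).Edge k X Y}
    (h : edgeHom f = edgeHom g) : f = g := by
  refine Edge.ext ?_
  obtain ⟨h₁, h₂, h₃⟩ := edge_facts (z := g.cell) g (BoxHom.id _) rfl rfl rfl (edge_step k)
  exact (act_eq_edge (z := g.cell) f (BoxHom.id _) rfl rfl (edge_step k) h₁ h₂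
    ((heq_of_eq h).trans h₃)).symm

section

variable {X Y Z W : (Qn n C).Ob} {top : (Qn n C).Edge k X Y} {left : (Qn n C).Edge l X Z}
  {bottom : (Qn n C).Edge k Z W} {right : (Qn n C).Edge l Y W}

/-- A converse of `sqFacts`: each of the four conditions concerns one edge of the square and is
settled by `act_eq_edge`. -/
theorem isSquare_act (hkl : k < l) (m : BoxHom (shape {k, l}) α)
    (ha : m.app (vtx _ 0) = a) (hb : m.app (vtx _ (ind k)) = b) (hc : m.app (vtx _ (ind l)) = c)
    (hd : m.app (vtx _ 1) = d) (s₁ : boxStep α k a b) (s₂ : boxStep α l a c) (s₃ : boxStep α k c d)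
    (s₄ : boxStep α l b d) (hX : pointObj X = z.obj a) (hY : pointObj Y = z.obj b)
    (hZ : pointObj Z = z.obj c) (hW : pointObj W = z.obj d) (h₁ : HEq (edgeHom top) (z.map s₁))
    (h₂ : HEq (edgeHom left) (z.map s₂)) (h₃ : HEq (edgeHom bottom) (z.map s₃))
    (h₄ : HEq (edgeHom right) (z.map s₄)) :
    IsSquare k l top left bottom right (QuasiFunctor.act m z : (Qn n C).cell {k, l}) := by
  have hne := hkl.ne
  exact
  { top := act_eq_edge (z := z) top ((sub {k} {k, l} 0).comp m)
      ((congrArg m.app (corner (Or.inl rfl) 0 0 0 (by simp) (fun _ _ _ => rfl))).trans ha)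
      ((congrArg m.app (corner (Or.inl rfl) 0 1 (ind k) (by simp [ind])
        (by rintro _ (rfl | rfl) h <;> simp_all [ind]))).trans hb) s₁ hX hY h₁
    left := act_eq_edge (z := z) left ((sub {l} {k, l} 0).comp m)
      ((congrArg m.app (corner (Or.inr rfl) 0 0 0 (by simp) (fun _ _ _ => rfl))).trans ha)
      ((congrArg m.app (corner (Or.inr rfl) 0 1 (ind l) (by simp [ind])
        (by rintro _ (rfl | rfl) h <;> simp_all [ind]))).trans hc) s₂ hX hZ h₂
    bottom := act_eq_edge (z := z) bottom ((sub {k} {k, l} 1).comp m)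
      ((congrArg m.app (corner (Or.inl rfl) 1 0 (ind l) (by simp [ind, hkl.ne])
        (by rintro _ (rfl | rfl) h <;> simp_all [ind]))).trans hc)
      ((congrArg m.app (corner (Or.inl rfl) 1 1 1 (by simp) (fun _ _ _ => rfl))).trans hd)
      s₃ hZ hW h₃
    right := act_eq_edge (z := z) right ((sub {l} {k, l} 1).comp m)
      ((congrArg m.app (corner (Or.inr rfl) 1 0 (ind k) (by simp [ind, hkl.ne'])
        (by rintro _ (rfl | rfl) h <;> simp_all [ind]))).trans hb)
      ((congrArg m.app (corner (Or.inr rfl) 1 1 1 (by simp) (fun _ _ _ => rfl))).trans hd)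
      s₄ hY hW h₄ }

theorem box_pair (c : Box (shape {k, l})) : c = vtx _ (gv k l (c k) (c l)) := by
  refine Box.ext_val fun j => ?_
  change _ = min (gv k l (c k) (c l) j) (shape {k, l} j)
  have h := (c j).isLt
  have h' := coord_le_one c j
  by_cases hj : j = k
  · subst hj
    simp [gv, shape]; omega
  · by_cases hj' : j = l
    · subst hj'
      simp [gv, hj, shape]; omega
    · have hs : shape {k, l} j = 0 := by simp [shape, hj, hj']
      omega

/-- The box has four vertices, four nondegenerate steps and one nondegenerate square. The boundary
fixes the vertices and steps, and the underlying 2-cell fixes the square. -/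
theorem square_ext (hkl : k < l) {s s' : (Qn n C).cell {k, l}}
    (hs : IsSquare k l top left bottom right s) (hs' : IsSquare k l top left bottom right s')
    (h : sqCell hkl hs = sqCell hkl hs') : s = s' := by
  have hne := hkl.ne'
  have S := fun x x' y => gv_step_fst (k := k) (l := l) (α := shape {k, l})
    (fun j h h' => by simp [shape, h, h']) (x := x) (x' := x') (y := y)
  have S' := fun x y y' => gv_step_snd (k := k) (l := l) (α := shape {k, l})
    (fun j h h' => by simp [shape, h, h']) (x := x) (y := y) (y' := y')
  obtain ⟨⟨o₁, o₂, o₃, o₄⟩, m₁, m₂, m₃, m₄⟩ := sqFacts' (z := s) hkl hs (.id _) rfl rfl rfl rfl rfl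
    (S 0 1 0 (by simp)) (S' 0 0 1 (by simp)) (S 0 1 1 (by simp)) (S' 1 0 1 (by simp))
  obtain ⟨⟨o₁', o₂', o₃', o₄'⟩, m₁', m₂', m₃', m₄'⟩ := sqFacts' (z := s') hkl hs' (.id _)
    rfl rfl rfl rfl rfl
    (S 0 1 0 (by simp)) (S' 0 0 1 (by simp)) (S 0 1 1 (by simp)) (S' 1 0 1 (by simp))
  have c₁ := sqCell_heq' (z := s) hkl hs (.id _) rfl rfl rfl rfl rfl
    (S 0 1 0 (by simp)) (S' 0 0 1 (by simp)) (S 0 1 1 (by simp)) (S' 1 0 1 (by simp))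
  have c₁' := sqCell_heq' (z := s') hkl hs' (.id _) rfl rfl rfl rfl rfl
    (S 0 1 0 (by simp)) (S' 0 0 1 (by simp)) (S 0 1 1 (by simp)) (S' 1 0 1 (by simp))
  -- A nondegenerate step runs from `0` to `1` in direction `k` or `l` and keeps the other
  -- coordinate, which singles out one of the four edges.
  have key : ∀ {i : Fin n} {a b : Box (shape {k, l})}, boxStep _ i a b → a i < b i →
      (i = k ∧ (a k : ℕ) = 0 ∧ (b k : ℕ) = 1 ∧ (a l : ℕ) = b l) ∨
      (i = l ∧ (a l : ℕ) = 0 ∧ (b l : ℕ) = 1 ∧ (a k : ℕ) = b k) := by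
    intro i a b s h
    replace h : (a i : ℕ) < b i := h
    have hb := coord_le_one b i
    have hi := coord_mem (c := b) (i := i) (by omega)
    simp only [Finset.mem_insert, Finset.mem_singleton] at hi
    rcases hi with rfl | rfl
    · exact Or.inl ⟨rfl, by omega, by omega, congrArg Fin.val (s.2 l hne)⟩
    · exact Or.inr ⟨rfl, by omega, by omega, congrArg Fin.val (s.2 k hkl.ne)⟩
  refine QuasiFunctor.ext_of_nondegenerate (F := (s : QuasiFunctor (boxStep (shape {k, l})) C))
    (G := (s' : QuasiFunctor (boxStep (shape {k, l})) C)) ?_ ?_ ?_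
  · intro a
    have h₁ := coord_le_one a k
    have h₂ := coord_le_one a l
    rw [box_pair a]
    have h₁ : (a k : ℕ) = 0 ∨ (a k : ℕ) = 1 := by omega
    have h₂ : (a l : ℕ) = 0 ∨ (a l : ℕ) = 1 := by omega
    rcases h₁ with h₁ | h₁ <;> rcases h₂ with h₂ | h₂ <;> rw [h₁, h₂]
    · exact o₁.symm.trans o₁'
    · exact o₃.symm.trans o₃'
    · exact o₂.symm.trans o₂'
    · exact o₄.symm.trans o₄'
  · intro i a b u h
    have hl := coord_le_one a l
    have hk := coord_le_one a k
    have ha := box_pair a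
    have hb := box_pair b
    rcases key u h with ⟨rfl, h₁, h₂, h₃⟩ | ⟨rfl, h₁, h₂, h₃⟩
    · rw [h₂, ← h₃] at hb
      rw [h₁] at ha
      have : (a l : ℕ) = 0 ∨ (a l : ℕ) = 1 := by omega
      rcases this with h₄ | h₄ <;> rw [h₄] at ha hb <;> subst ha hb
      · exact m₁.symm.trans m₁'
      · exact m₃.symm.trans m₃'
    · rw [h₂, ← h₃] at hb
      rw [h₁] at ha
      have : (a k : ℕ) = 0 ∨ (a k : ℕ) = 1 := by omega
      rcases this with h₄ | h₄ <;> rw [h₄] at ha hb <;> subst ha hb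
      · exact m₂.symm.trans m₂'
      · exact m₄.symm.trans m₄'
  · intro i j hij a b c d t e m r h₁ h₂
    have ha := box_pair a
    have hb := box_pair b
    have hc := box_pair c
    have hd := box_pair d
    -- Both directions lie in `{k, l}`, and `i < j` together with `k < l` leaves only this
    -- assignment.
    obtain ⟨rfl, rfl⟩ : i = k ∧ j = l := by
      rcases key t h₁ with ⟨rfl, -⟩ | ⟨rfl, -⟩ <;> rcases key e h₂ with ⟨rfl, -⟩ | ⟨rfl, -⟩
      · exact absurd hij (lt_irrefl _)
      · exact ⟨rfl, rfl⟩
      · exact absurd hij (lt_asymm hkl)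
      · exact absurd hij (lt_irrefl _)
    obtain ⟨-, t₁, t₂, t₃⟩ := (key t h₁).resolve_right fun h => hkl.ne h.1
    obtain ⟨-, e₁, e₂, e₃⟩ := (key e h₂).resolve_left fun h => hne h.1
    have hd₁ : (d i : ℕ) = 1 := by rw [← congrArg Fin.val (r.2 i hkl.ne), t₂]
    have hd₂ : (d j : ℕ) = 1 := by rw [← congrArg Fin.val (m.2 j hne), e₂]
    rw [t₁, e₁] at ha
    rw [t₂, ← t₃, e₁] at hb
    rw [e₂, ← e₃, t₁] at hc
    rw [hd₁, hd₂] at hd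
    subst ha hb hc hd
    exact c₁.symm.trans ((heq_of_eq h).trans c₁')

end

/-- Whether some coordinate in `S` is nonzero. -/
def meets (S : Finset (Fin n)) (a : Box α) : Bool := decide (∃ j ∈ S, (a j : ℕ) ≠ 0)

theorem meets_le {S : Finset (Fin n)} (h : ∀ j ∈ S, (a j : ℕ) ≤ b j) : meets S a ≤ meets S b := by
  unfold meets
  intro h'
  simp only [decide_eq_true_eq] at h' ⊢
  obtain ⟨j, hj, hj'⟩ := h'
  have := h j hj
  exact ⟨j, hj, by omega⟩

theorem meets_congr {S : Finset (Fin n)} (h : ∀ j ∈ S, a j = b j) : meets S a = meets S b :=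
  le_antisymm (meets_le fun j hj => by rw [h j hj]) (meets_le fun j hj => by rw [h j hj])

theorem meets_vtx {I S : Finset (Fin n)} (h : S ⊆ I) (p : Fin n → ℕ) :
    meets S (vtx (shape I) p) = decide (∃ j ∈ S, p j ≠ 0) := by
  unfold meets
  congr 1
  refine propext (exists_congr fun j => and_congr_right fun hj => ?_)
  change min (p j) (shape I j) ≠ 0 ↔ _
  rw [shape_mem (h hj)]
  omega

namespace UpSquare

variable {X Y Z W : C}

/-- The hypercube of an up-square, in which the directions up to `κ` are horizontal and those in `S`
and `T` are nontrivial. -/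
def spread (A : UpSquare X Y Z W) (α : Fin n → ℕ) (κ : Fin n) {S T : Finset (Fin n)}
    (hS : ∀ j ∈ S, j ≤ κ) (hT : ∀ j ∈ T, κ < j) : QuasiFunctor (boxStep α) C :=
  -- The horizontal directions form an initial segment, so the assignment of directions is monotone,
  -- as `hyper` demands.
  A.hyper ⟨fun i => if i ≤ κ then 0 else 1, fun i j hij => by
      dsimp only
      split_ifs with h h'
      · exact le_rfl
      · exact Fin.zero_le _
      · exact absurd (hij.trans (by assumption)) h
      · exact le_rfl⟩
    (fun a => (meets S a, meets T a)) (fun i a b s => by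
      refine ⟨fun h => ?_, fun h => ?_⟩
      -- A horizontal step leaves all coordinates in `T` unchanged, since these lie strictly above
      -- `κ`. The vertical case is symmetric.
      · have hi : i ≤ κ := by
          by_contra hi
          exact absurd ((if_neg hi).symm.trans h) (by decide)
        exact ⟨meets_le fun j _ => s.le j, meets_congr fun j hj => s.2 j (hi.trans_lt (hT j hj)).ne'⟩
      · have hi : ¬ i ≤ κ := by
          intro hi
          exact absurd ((if_pos hi).symm.trans h) (by decide)
        exact ⟨meets_congr fun j hj => s.2 j ((hS j hj).trans_lt (not_le.1 hi)).ne,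
          meets_le fun j _ => s.le j⟩)

/-- The value depends only on the two corners; the direction serves to exclude impossible pairs.
This allows a direction computed from `κ` to be replaced by any direction that admits the step. -/
theorem edge_congr (A : UpSquare X Y Z W) {i j : Fin 2} : ∀ {a b : Bool × Bool} (h : step i a b)
    (h' : step j a b), A.edge h = A.edge h'
  | (false, false), (false, false), _, _ => rfl
  | (true, false), (true, false), _, _ => rfl
  | (false, true), (false, true), _, _ => rfl
  | (true, true), (true, true), _, _ => rfl
  | (false, false), (true, false), _, _ => rfl
  | (false, false), (false, true), _, _ => rfl
  | (false, true), (true, true), _, _ => rfl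
  | (true, false), (true, true), _, _ => rfl
  | (false, false), (true, true), h, _ => absurd h (by revert i; decide)
  | (true, true), (false, false), h, _ => absurd h (by revert i; decide)
  | (true, false), (false, true), h, _ => absurd h (by revert i; decide)
  | (false, true), (true, false), h, _ => absurd h (by revert i; decide)
  | (true, false), (false, false), h, _ => absurd h (by revert i; decide)
  | (false, true), (false, false), h, _ => absurd h (by revert i; decide)
  | (true, true), (false, true), h, _ => absurd h (by revert i; decide)
  | (true, true), (true, false), h, _ => absurd h (by revert i; decide)

variable (A : UpSquare X Y Z W) {κ : Fin n} {S T : Finset (Fin n)}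
  (hS : ∀ j ∈ S, j ≤ κ) (hT : ∀ j ∈ T, κ < j) {x y z w : Bool × Bool}

theorem spread_obj (ha : (meets S a, meets T a) = x) :
    (A.spread α κ hS hT).obj a = A.vertex x := by
  subst ha; rfl

theorem spread_map {i : Fin n} (ha : (meets S a, meets T a) = x) (hb : (meets S b, meets T b) = y)
    (s : boxStep α i a b) {j : Fin 2} (h : step j x y) :
    HEq ((A.spread α κ hS hT).map s) (A.edge h) := by
  subst ha hb
  exact heq_of_eq (A.edge_congr _ _)

end UpSquare

theorem meets_singleton_sub (t : ℕ) :
    meets {k} ((sub ∅ {k} t).app 0) = decide (t ≠ 0) := by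
  unfold meets
  congr 1
  have : ((sub ∅ {k} t).app 0 k : ℕ) = min t 1 := by
    change min (if k ∈ (∅ : Finset (Fin n)) then _ else t) (shape {k} k) = _
    simp [shape]
  simp only [Finset.mem_singleton, exists_eq_left]
  rw [this]
  exact propext (by omega)

section

variable {c d : C}

/-- The hypercube of a morphism in direction `k`. -/
def edgeCell (k : Fin n) {c d : C} (f : c ⟶ d) : QuasiFunctor (boxStep (shape {k})) C :=
  -- With `T = ∅` no vertex has a nonzero second coordinate, so only the top edge of the square is
  -- used. Any square with top edge `f` would give the same hypercube.
  (UpSquare.vid f).spread (shape {k}) k (S := {k}) (T := ∅) (by simp) (by simp)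

theorem edgeCell_vertex (t : ℕ) : (meets {k} ((sub ∅ {k} t).app 0),
    meets ∅ ((sub ∅ {k} t).app 0)) = (decide (t ≠ 0), false) := by
  rw [meets_singleton_sub]
  simp [meets]

/-- A morphism of `C` as a morphism of `Qⁿ C` in direction `k`. -/
noncomputable def mkEdge (k : Fin n) {c d : C} (f : c ⟶ d) :
    (Qn n C).Edge k (qPoint n c) (qPoint n d) where
  cell := edgeCell k f
  source := point_ext (UpSquare.spread_obj (.vid f) (κ := k) (S := {k}) (T := ∅) (by simp) (by simp)
    (edgeCell_vertex 0))
  target := point_ext (UpSquare.spread_obj (.vid f) (κ := k) (S := {k}) (T := ∅) (by simp) (by simp)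
    (edgeCell_vertex 1))

theorem edgeHom_mkEdge (k : Fin n) (f : c ⟶ d) : edgeHom (mkEdge k f) = f :=
  eq_of_heq ((edge_facts (z := edgeCell k f) (mkEdge k f) (.id _) rfl rfl rfl
    (edge_step k)).2.2.trans (UpSquare.spread_map (.vid f) (κ := k) (S := {k}) (T := ∅) (by simp)
      (by simp) (edgeCell_vertex 0) (edgeCell_vertex 1) (edge_step k) (j := 0) (by decide)))

theorem mkEdge_id (k : Fin n) (c : C) : mkEdge k (𝟙 c) = Edge.id k (qPoint n c) :=
  edgeHom_injective (by rw [edgeHom_mkEdge, edgeHom_id]; rfl)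

/-- Composition in `Qⁿ C` comes from gluing hypercubes, so this holds only propositionally. It is
the reason why constraints are later indexed by equations between morphisms. -/
theorem mkEdge_comp (k : Fin n) {c d e : C} (f : c ⟶ d) (g : d ⟶ e) :
    mkEdge k (f ≫ g) = (mkEdge k f).comp (mkEdge k g) :=
  edgeHom_injective (by rw [edgeHom_comp]; simp only [edgeHom_mkEdge]; rfl)

/-- The ends are taken of the form `qPoint` so that both sides have the same type. General edges are
brought to this form by eliminating their ends. -/
theorem mkEdge_edgeHom (f : (Qn n C).Edge k (qPoint n c) (qPoint n d)) :
    mkEdge k (edgeHom f) = f :=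
  edgeHom_injective (edgeHom_mkEdge _ _)

theorem isSquare_mkEdge (z : QuasiFunctor (boxStep α) C) {a b c d : Box α} (hkl : k < l)
    (m : BoxHom (shape {k, l}) α)
    (ha : m.app (vtx _ (gv k l 0 0)) = a) (hb : m.app (vtx _ (gv k l 1 0)) = b)
    (hc : m.app (vtx _ (gv k l 0 1)) = c) (hd : m.app (vtx _ (gv k l 1 1)) = d)
    (s₁ : boxStep α k a b) (s₂ : boxStep α l a c) (s₃ : boxStep α k c d) (s₄ : boxStep α l b d) :
    IsSquare k l (mkEdge k (z.map s₁)) (mkEdge l (z.map s₂)) (mkEdge k (z.map s₃))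
      (mkEdge l (z.map s₄)) (QuasiFunctor.act m z : (Qn n C).cell {k, l}) :=
  isSquare_act hkl m
    ((congrArg m.app (vtx_pair (by simp [gv]) (by simp [gv]))).trans ha)
    ((congrArg m.app (vtx_pair (by simp [gv, ind]) (by simp [gv, ind, hkl.ne']))).trans hb)
    ((congrArg m.app (vtx_pair (by simp [gv, ind, hkl.ne]) (by simp [gv, ind, hkl.ne']))).trans hc)
    ((congrArg m.app (vtx_pair (by simp [gv]) (by simp [gv]))).trans hd) s₁ s₂ s₃ s₄
    rfl rfl rfl rfl (heq_of_eq (edgeHom_mkEdge _ _)) (heq_of_eq (edgeHom_mkEdge _ _))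
    (heq_of_eq (edgeHom_mkEdge _ _)) (heq_of_eq (edgeHom_mkEdge _ _))

theorem gv_vertex (hkl : k < l) : ∀ p q : ℕ,
    (meets {k} (vtx (shape {k, l}) (gv k l p q)), meets {l} (vtx (shape {k, l}) (gv k l p q))) =
      (decide (p ≠ 0), decide (q ≠ 0)) := fun p q => by
  rw [meets_vtx (by simp), meets_vtx (by simp)]
  simp [gv, hkl.ne']

variable {X Y Z W : C}

/-- Identifies the two-dimensional faces of a spread hypercube with squares of edges of `A`. The
corners and directions are variables constrained by equations, so that they can be instantiated with
closed values on which `decide` works. -/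
theorem spread_square (A : UpSquare X Y Z W) {α : Fin n → ℕ} {κ : Fin n} {S T : Finset (Fin n)}
    (hS : ∀ j ∈ S, j ≤ κ) (hT : ∀ j ∈ T, κ < j) {a b c d : Box α} {x y z w : Bool × Bool}
    (hx : (meets S a, meets T a) = x) (hy : (meets S b, meets T b) = y)
    (hz : (meets S c, meets T c) = z) (hw : (meets S d, meets T d) = w)
    (hkl : k < l) {i j : Fin 2} (hij : i ≤ j) (hi : (if k ≤ κ then 0 else 1) = i)
    (hj : (if l ≤ κ then 0 else 1) = j) (m : BoxHom (shape {k, l}) α)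
    (ha : m.app (vtx _ (gv k l 0 0)) = a) (hb : m.app (vtx _ (gv k l 1 0)) = b)
    (hc : m.app (vtx _ (gv k l 0 1)) = c) (hd : m.app (vtx _ (gv k l 1 1)) = d)
    (s₁ : boxStep α k a b) (s₂ : boxStep α l a c) (s₃ : boxStep α k c d) (s₄ : boxStep α l b d)
    (t : UpSquare.step i x y) (e : UpSquare.step j x z) (g : UpSquare.step i z w)
    (r : UpSquare.step j y w) :
    ∃ hs : IsSquare k l (mkEdge k (A.edge t)) (mkEdge l (A.edge e)) (mkEdge k (A.edge g))
      (mkEdge l (A.edge r)) (QuasiFunctor.act m (A.spread α κ hS hT) : (Qn n C).cell {k, l}),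
    HEq (sqCell hkl hs) (A.face hij t e g r) := by
  subst hx hy hz hw hi hj
  exact ⟨isSquare_mkEdge (A.spread α κ hS hT) hkl m ha hb hc hd s₁ s₂ s₃ s₄,
    sqCell_heq' hkl (isSquare_mkEdge (A.spread α κ hS hT) hkl m ha hb hc hd s₁ s₂ s₃ s₄)
      m rfl ha hb hc hd s₁ s₂ s₃ s₄⟩

/-- The hypercube of an up-square in the directions `k` and `l`. -/
def squareCell (hkl : k < l) (A : UpSquare X Y Z W) : QuasiFunctor (boxStep (shape {k, l})) C :=
  A.spread _ k (S := {k}) (T := {l}) (by simp) (by simpa using hkl)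

/-- Every up-square occurs in every pair of directions: take the face that is the whole of
`squareCell`. With `square_ext`, this makes squares of `Qⁿ C` with given edges the same as 2-cells
of `C`. -/
theorem exists_isSquare (hkl : k < l) (A : UpSquare X Y Z W) :
    ∃ hs : IsSquare k l (mkEdge k A.top) (mkEdge l A.left) (mkEdge k A.bottom) (mkEdge l A.right)
      (squareCell hkl A : (Qn n C).cell {k, l}), HEq (sqCell hkl hs) A.cell := by
  have h := fun s₁ s₂ s₃ s₄ => spread_square A (S := {k}) (T := {l}) (κ := k) (by simp)
    (by simpa using hkl)
    (gv_vertex hkl 0 0) (gv_vertex hkl 1 0) (gv_vertex hkl 0 1) (gv_vertex hkl 1 1) hkl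
    (i := 0) (j := 1) (by decide) (if_pos le_rfl) (if_neg hkl.not_ge) (.id _) rfl rfl rfl rfl
    s₁ s₂ s₃ s₄ (by decide) (by decide) (by decide) (by decide)
  obtain ⟨hs, h⟩ := h (gv_step_fst (fun j h h' => by simp [shape, h, h']) (by simp))
    (gv_step_snd (fun j h h' => by simp [shape, h, h']) (by simp))
    (gv_step_fst (fun j h h' => by simp [shape, h, h']) (by simp))
    (gv_step_snd (fun j h h' => by simp [shape, h, h']) (by simp))
  exact ⟨hs, h.trans (heq_of_eq (A.face_cell _ (by decide) _ _ _ _))⟩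

end

section Cubes

variable {X Y Z W : C}

/-- Reduces the corner at which a vertex of the cube lies to a decidable condition on its three
coordinates, as the explicit cubes below require. -/
theorem gv₃_vertex {m : Fin n} (hkl : k < l) (hlm : l < m) {S T : Finset (Fin n)}
    (hS : S ⊆ {k, l, m}) (hT : T ⊆ {k, l, m}) (p q r : ℕ) :
    (meets S (vtx (shape {k, l, m}) (gv₃ k l m p q r)),
      meets T (vtx (shape {k, l, m}) (gv₃ k l m p q r))) =
      (decide (k ∈ S ∧ p ≠ 0 ∨ l ∈ S ∧ q ≠ 0 ∨ m ∈ S ∧ r ≠ 0),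
        decide (k ∈ T ∧ p ≠ 0 ∨ l ∈ T ∧ q ≠ 0 ∨ m ∈ T ∧ r ≠ 0)) := by
  have hk : gv₃ k l m p q r k = p := by simp [gv₃]
  have hl : gv₃ k l m p q r l = q := by simp [gv₃, hkl.ne']
  have hm : gv₃ k l m p q r m = r := by simp [gv₃, hlm.ne', (hkl.trans hlm).ne']
  have key : ∀ {S : Finset (Fin n)}, S ⊆ {k, l, m} → ((∃ j ∈ S, gv₃ k l m p q r j ≠ 0) ↔
      (k ∈ S ∧ p ≠ 0 ∨ l ∈ S ∧ q ≠ 0 ∨ m ∈ S ∧ r ≠ 0)) := by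
    intro S hS
    constructor
    · rintro ⟨j, hj, h⟩
      have := hS hj
      simp only [Finset.mem_insert, Finset.mem_singleton] at this
      rcases this with rfl | rfl | rfl
      · exact Or.inl ⟨hj, hk ▸ h⟩
      · exact Or.inr (Or.inl ⟨hj, hl ▸ h⟩)
      · exact Or.inr (Or.inr ⟨hj, hm ▸ h⟩)
    · rintro (⟨h, h'⟩ | ⟨h, h'⟩ | ⟨h, h'⟩)
      · exact ⟨k, h, hk.symm ▸ h'⟩
      · exact ⟨l, h, hl.symm ▸ h'⟩
      · exact ⟨m, h, hm.symm ▸ h'⟩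
  rw [meets_vtx hS, meets_vtx hT]
  simp only [key hS, key hT]

theorem sub_gv₃ {m i i' : Fin n} (t u u' : ℕ) (p : Fin n → ℕ) (hii : i ≠ i')
    (hi : i = k ∨ i = l ∨ i = m) (hi' : i' = k ∨ i' = l ∨ i' = m) (hu : u ≤ 1) (hu' : u' ≤ 1)
    (h₁ : p i = u) (h₂ : p i' = u') 
    (h₃ : ∀ j, j = k ∨ j = l ∨ j = m → j ≠ i → j ≠ i' → p j = t) :
    (sub {i, i'} {k, l, m} t).app (vtx _ (gv i i' u u')) = vtx (shape {k, l, m}) p := by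
  refine Box.ext_val fun j => ?_
  change min (if j ∈ ({i, i'} : Finset (Fin n)) then min (gv i i' u u' j) (shape {i, i'} j)
    else t) (shape {k, l, m} j) = min (p j) (shape {k, l, m} j)
  by_cases hj : j = i
  · subst hj
    have : min u 1 = u := by omega
    simp [shape, gv, h₁, hi, this]
  · by_cases hj' : j = i'
    · subst hj'
      have : min u' 1 = u' := by omega
      simp [shape, gv, h₂, hi', this, hj]
    · by_cases hm : j = k ∨ j = l ∨ j = m
      · simp [hj, hj', h₃ j hm hj hj']
      · simp [shape, hm]

end Cubes

end Uniqueness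

/-! ### Pasting of squares in an `n`-fold category -/

section CompSquares

namespace NFoldCat

variable {n : ℕ} {dC : NFoldCat.{t} n} {k l : Fin n}

/-- The shapes of `{k, l}.erase k` and `{l}` agree only propositionally. The maps `sub` between them
mediate between faces used for composition and the edges that occur in `IsSquare`. -/
theorem faceMap_fst (hne : k ≠ l) (t : ℕ) :
    faceMap {k, l} k t = (sub (({k, l} : Finset (Fin n)).erase k) {l} 0).comp (sub {l} {k, l} t) := by
  refine BoxHom.ext_val fun j a => ?_
  change min (if j = k then t else (a : ℕ)) _ = min (if j ∈ ({l} : Finset (Fin n)) then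
    min (if j ∈ ({k, l} : Finset (Fin n)).erase k then (a : ℕ) else 0) (shape {l} j) else t) _
  by_cases hj : j = k
  · subst hj; simp [hne]
  · by_cases hj' : j = l
    · subst hj'; simp [hj, shape]
    · simp [hj, hj', shape]

theorem sub_fst (hne : k ≠ l) (t : ℕ) :
    sub {l} {k, l} t = (sub {l} (({k, l} : Finset (Fin n)).erase k) 0).comp (faceMap {k, l} k t) := by
  refine BoxHom.ext_val fun j a => ?_
  change min (if j ∈ ({l} : Finset (Fin n)) then (a : ℕ) else t) _ = min (if j = k then t else
    min (if j ∈ ({l} : Finset (Fin n)) then (a : ℕ) else 0) (shape (Finset.erase {k, l} k) j)) _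
  by_cases hj : j = k
  · subst hj; simp [hne]
  · by_cases hj' : j = l
    · subst hj'; simp [hj, shape]
    · simp [hj, hj', shape]

theorem faceMap_snd (hne : k ≠ l) (t : ℕ) :
    faceMap {k, l} l t = (sub (({k, l} : Finset (Fin n)).erase l) {k} 0).comp (sub {k} {k, l} t) := by
  refine BoxHom.ext_val fun j a => ?_
  change min (if j = l then t else (a : ℕ)) _ = min (if j ∈ ({k} : Finset (Fin n)) then
    min (if j ∈ ({k, l} : Finset (Fin n)).erase l then (a : ℕ) else 0) (shape {k} j) else t) _
  by_cases hj : j = l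
  · subst hj; simp [hne.symm]
  · by_cases hj' : j = k
    · subst hj'; simp [hj, shape]
    · simp [hj, hj', shape]

theorem sub_snd (hne : k ≠ l) (t : ℕ) :
    sub {k} {k, l} t = (sub {k} (({k, l} : Finset (Fin n)).erase l) 0).comp (faceMap {k, l} l t) := by
  refine BoxHom.ext_val fun j a => ?_
  change min (if j ∈ ({k} : Finset (Fin n)) then (a : ℕ) else t) _ = min (if j = l then t else
    min (if j ∈ ({k} : Finset (Fin n)) then (a : ℕ) else 0) (shape (Finset.erase {k, l} l) j)) _
  by_cases hj : j = l
  · subst hj; simp [hne.symm]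
  · by_cases hj' : j = k
    · subst hj'; simp [hj, shape]
    · simp [hj, hj', shape]

theorem sub_apply {I J : Finset (Fin n)} {i : Fin n} (hi : i ∈ I) (hJ : i ∈ J) (t : ℕ)
    (a : Fin (shape I i + 1)) : (sub I J t i a : ℕ) = a := by
  have := a.isLt
  have h : shape I i = 1 := shape_mem hi
  rw [sub_val, if_pos hi, shape_mem hJ]
  omega

/-- The vertical edges of the composite are its source and target. The horizontal ones are
composites because composition in direction `k` commutes with taking faces in direction `l`. -/
theorem IsSquare.hcomp (hne : k ≠ l) {X₁ X₂ X₃ Y₁ Y₂ Y₃ : dC.Ob}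
    {j : dC.Edge k X₁ X₂} {j' : dC.Edge k X₂ X₃} {i : dC.Edge k Y₁ Y₂} {i' : dC.Edge k Y₂ Y₃}
    {p₁ : dC.Edge l X₁ Y₁} {p₂ : dC.Edge l X₂ Y₂} {p₃ : dC.Edge l X₃ Y₃}
    {s s' : dC.cell {k, l}} (hs : IsSquare k l j p₁ i p₂ s) (hs' : IsSquare k l j' p₂ i' p₃ s') :
    ∃ h, IsSquare k l (j.comp j') p₁ (i.comp i') p₃ (dC.comp k (by simp) s s' h) := by
  -- Both faces are images of the common edge `p₂` under the same change of shape.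
  have h : dC.act (faceMap {k, l} k 1) s = dC.act (faceMap {k, l} k 0) s' := by
    rw [faceMap_fst hne, faceMap_fst hne, dC.act_comp, dC.act_comp, hs.right, hs'.left]
  have h₀ : dC.act (faceMap {k} k 1) (dC.act (sub {k} {k, l} 0) s) =
      dC.act (faceMap {k} k 0) (dC.act (sub {k} {k, l} 0) s') := by
    rw [hs.top, hs'.top]
    exact j.comp_aux j'
  have h₁ : dC.act (faceMap {k} k 1) (dC.act (sub {k} {k, l} 1) s) =
      dC.act (faceMap {k} k 0) (dC.act (sub {k} {k, l} 1) s') := by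
    rw [hs.bottom, hs'.bottom]
    exact i.comp_aux i'
  refine ⟨h, ?_, ?_, ?_, ?_⟩
  · rw [dC.act_comp' k (by simp) (by simp) _ (sub_apply (by simp) (by simp) 0) s s' h h₀]
    exact dC.comp_congr k (by simp) hs.top hs'.top _ _
  · rw [sub_fst hne, dC.act_comp, dC.source_comp, ← dC.act_comp, ← sub_fst hne, hs.left]
  · rw [dC.act_comp' k (by simp) (by simp) _ (sub_apply (by simp) (by simp) 1) s s' h h₁]
    exact dC.comp_congr k (by simp) hs.bottom hs'.bottom _ _
  · rw [sub_fst hne, dC.act_comp, dC.target_comp, ← dC.act_comp, ← sub_fst hne, hs'.right]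

theorem IsSquare.vcomp (hne : k ≠ l) {X₁ X₂ X₃ Y₁ Y₂ Y₃ : dC.Ob}
    {q : dC.Edge l X₁ X₂} {q' : dC.Edge l X₂ X₃} {p : dC.Edge l Y₁ Y₂} {p' : dC.Edge l Y₂ Y₃}
    {j₁ : dC.Edge k X₁ Y₁} {j₂ : dC.Edge k X₂ Y₂} {j₃ : dC.Edge k X₃ Y₃}
    {s s' : dC.cell {k, l}} (hs : IsSquare k l j₁ q j₂ p s) (hs' : IsSquare k l j₂ q' j₃ p' s') :
    ∃ h, IsSquare k l j₁ (q.comp q') j₃ (p.comp p') (dC.comp l (by simp) s s' h) := by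
  have h : dC.act (faceMap {k, l} l 1) s = dC.act (faceMap {k, l} l 0) s' := by
    rw [faceMap_snd hne, faceMap_snd hne, dC.act_comp, dC.act_comp, hs.bottom, hs'.top]
  have h₀ : dC.act (faceMap {l} l 1) (dC.act (sub {l} {k, l} 0) s) =
      dC.act (faceMap {l} l 0) (dC.act (sub {l} {k, l} 0) s') := by
    rw [hs.left, hs'.left]
    exact q.comp_aux q'
  have h₁ : dC.act (faceMap {l} l 1) (dC.act (sub {l} {k, l} 1) s) =
      dC.act (faceMap {l} l 0) (dC.act (sub {l} {k, l} 1) s') := by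
    rw [hs.right, hs'.right]
    exact p.comp_aux p'
  refine ⟨h, ?_, ?_, ?_, ?_⟩
  · rw [sub_snd hne, dC.act_comp, dC.source_comp, ← dC.act_comp, ← sub_snd hne, hs.top]
  · rw [dC.act_comp' l (by simp) (by simp) _ (sub_apply (by simp) (by simp) 0) s s' h h₀]
    exact dC.comp_congr l (by simp) hs.left hs'.left _ _
  · rw [sub_snd hne, dC.act_comp, dC.target_comp, ← dC.act_comp, ← sub_snd hne, hs'.bottom]
  · rw [dC.act_comp' l (by simp) (by simp) _ (sub_apply (by simp) (by simp) 1) s s' h h₁]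
    exact dC.comp_congr l (by simp) hs.right hs'.right _ _

end NFoldCat

end CompSquares

/-! ### The 2-cells of squares as functions of the 2-cells of `C` -/

section Strictified

open NFoldCat

variable {n : ℕ} {C : Type u₁} [Bicategory.{w₁, v₁} C] [Strict C]
  {D : Type u₂} [Bicategory.{w₂, v₂} D]

namespace UpSquare

theorem hcomp_congr {X Y Y' Z W W' : C} {A A' : UpSquare X Y Z W} {B B' : UpSquare Y Y' W W'}
    (hA : A = A') (hB : B = B') (h h') : A.hcomp B h = A'.hcomp B' h' := by
  subst hA hB; rfl

theorem vcomp_congr {X Y Z W Z' W' : C} {A A' : UpSquare X Y Z W} {B B' : UpSquare Z W Z' W'}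
    (hA : A = A') (hB : B = B') (h h') : A.vcomp B h = A'.vcomp B' h' := by
  subst hA hB; rfl

theorem hid_cell {X Z : C} (f : X ⟶ Z) :
    (hid f).cell = eqToHom (by change f ≫ 𝟙 Z = 𝟙 X ≫ f; rw [Strict.comp_id, Strict.id_comp]) := by
  simp [hid, Strict.leftUnitor_eqToIso, Strict.rightUnitor_eqToIso]

theorem vid_cell {X Z : C} (f : X ⟶ Z) :
    (vid f).cell = eqToHom (by change 𝟙 X ≫ f = f ≫ 𝟙 Z; rw [Strict.comp_id, Strict.id_comp]) := by
  simp [vid, Strict.leftUnitor_eqToIso, Strict.rightUnitor_eqToIso]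

theorem mk_hcomp_mk {X Y Y' Z W W' : C} {q : X ⟶ Z} {i : Z ⟶ W} {j : X ⟶ Y} {p : Y ⟶ W}
    {i' : W ⟶ W'} {j' : Y ⟶ Y'} {r : Y' ⟶ W'} (σ : q ≫ i ⟶ j ≫ p) (τ : p ≫ i' ⟶ j' ≫ r) :
    (⟨j, q, i, p, σ⟩ : UpSquare _ _ _ _).hcomp ⟨j', p, i', r, τ⟩ rfl =
      ⟨j ≫ j', q, i ≫ i', r, pasteH σ τ⟩ := by
  simp [hcomp]

theorem mk_vcomp_mk {X Y Z W Z' W' : C} {q : X ⟶ Z} {i : Z ⟶ W} {j : X ⟶ Y} {p : Y ⟶ W}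
    {q' : Z ⟶ Z'} {i' : Z' ⟶ W'} {p' : W ⟶ W'} (σ : q ≫ i ⟶ j ≫ p) (τ : q' ≫ i' ⟶ i ≫ p') :
    (⟨j, q, i, p, σ⟩ : UpSquare _ _ _ _).vcomp ⟨i, q', i', p', τ⟩ rfl =
      ⟨j, q ≫ q', i', p ≫ p', pasteV σ τ⟩ := by
  simp [vcomp]

end UpSquare

theorem CommCube.congr {X' Y' Z' W' X Y Z W : D}
    {b' : X' ⟶ Y'} {q' : X' ⟶ Z'} {a' : Z' ⟶ W'} {p' : Y' ⟶ W'}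
    {b : X ⟶ Y} {q : X ⟶ Z} {a : Z ⟶ W} {p : Y ⟶ W}
    {x : X' ⟶ X} {y : Y' ⟶ Y} {z : Z' ⟶ Z} {w : W' ⟶ W}
    {K' K₁' : q' ≫ a' ⟶ b' ≫ p'} {K K₁ : q ≫ a ⟶ b ≫ p}
    {J' J₁' : x ≫ b ⟶ b' ≫ y} {J J₁ : z ≫ a ⟶ a' ≫ w}
    {I' I₁' : x ≫ q ⟶ q' ≫ z} {I I₁ : y ≫ p ⟶ p' ≫ w} (h : CommCube K' K J' J I' I)
    (h₁ : K' = K₁') (h₂ : K = K₁) (h₃ : J' = J₁') (h₄ : J = J₁) (h₅ : I' = I₁') (h₆ : I = I₁) :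
    CommCube K₁' K₁ J₁' J₁ I₁' I₁ := by
  subst h₁ h₂ h₃ h₄ h₅ h₆
  exact h

namespace NFoldCat

variable {dC : NFoldCat.{t} n} {k l : Fin n}

/-- Composed with the projection along direction `l`, the faces in direction `k` become the identity
of the edge box. Those in direction `l` factor through the two end points and give identity edges.
-/
theorem IsSquare.vid (hne : k ≠ l) {X Y : dC.Ob} (f : dC.Edge k X Y) :
    IsSquare k l f (Edge.id l X) f (Edge.id l Y) (dC.act (sub {k, l} {k} 0) f.cell) := by
  have h₁ : ∀ t : ℕ, (sub {k} {k, l} t).comp (sub {k, l} {k} 0) = .id _ := fun t =>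
    BoxHom.ext_val fun j a => by
      have ha := a.isLt
      change min (if j ∈ ({k, l} : Finset (Fin n)) then
        min (if j ∈ ({k} : Finset (Fin n)) then (a : ℕ) else t) _ else 0) (shape {k} j) = a
      by_cases hj : j = k
      · have : shape {k} j = 1 := by simp [shape, hj]
        simp [hj, shape]; omega
      · have : shape {k} j = 0 := by simp [shape, hj]
        omega
  have h₂ : ∀ t : ℕ, (sub {l} {k, l} t).comp (sub {k, l} {k} 0) =
      (sub {l} ∅ 0).comp (sub ∅ {k} t) := fun t =>
    BoxHom.ext_val fun j a => by
      change min (if j ∈ ({k, l} : Finset (Fin n)) then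
        min (if j ∈ ({l} : Finset (Fin n)) then (a : ℕ) else t) (shape {k, l} j) else 0)
        (shape {k} j) = min (if j ∈ (∅ : Finset (Fin n)) then _ else t) (shape {k} j)
      by_cases hj : j = k
      · simp [hj, shape, hne]
      · have : shape {k} j = 0 := by simp [shape, hj]
        omega
  refine ⟨?_, ?_, ?_, ?_⟩
  · rw [← dC.act_comp, h₁, dC.act_id]
  · rw [← dC.act_comp, h₂, dC.act_comp, f.source]; rfl
  · rw [← dC.act_comp, h₁, dC.act_id]
  · rw [← dC.act_comp, h₂, dC.act_comp, f.target]; rfl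

theorem IsSquare.hid (hne : k ≠ l) {X Y : dC.Ob} (f : dC.Edge l X Y) :
    IsSquare k l (Edge.id k X) f (Edge.id k Y) f (dC.act (sub {k, l} {l} 0) f.cell) := by
  have h₁ : ∀ t : ℕ, (sub {l} {k, l} t).comp (sub {k, l} {l} 0) = .id _ := fun t =>
    BoxHom.ext_val fun j a => by
      have ha := a.isLt
      change min (if j ∈ ({k, l} : Finset (Fin n)) then
        min (if j ∈ ({l} : Finset (Fin n)) then (a : ℕ) else t) _ else 0) (shape {l} j) = a
      by_cases hj : j = l
      · have : shape {l} j = 1 := by simp [shape, hj]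
        simp [hj, shape]; omega
      · have : shape {l} j = 0 := by simp [shape, hj]
        omega
  have h₂ : ∀ t : ℕ, (sub {k} {k, l} t).comp (sub {k, l} {l} 0) =
      (sub {k} ∅ 0).comp (sub ∅ {l} t) := fun t =>
    BoxHom.ext_val fun j a => by
      change min (if j ∈ ({k, l} : Finset (Fin n)) then
        min (if j ∈ ({k} : Finset (Fin n)) then (a : ℕ) else t) (shape {k, l} j) else 0)
        (shape {l} j) = min (if j ∈ (∅ : Finset (Fin n)) then _ else t) (shape {l} j)
      by_cases hj : j = l
      · simp [hj, shape, hne.symm]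
      · have : shape {l} j = 0 := by simp [shape, hj]
        omega
  refine ⟨?_, ?_, ?_, ?_⟩
  · rw [← dC.act_comp, h₂, dC.act_comp, f.source]; rfl
  · rw [← dC.act_comp, h₁, dC.act_id]
  · rw [← dC.act_comp, h₂, dC.act_comp, f.target]; rfl
  · rw [← dC.act_comp, h₁, dC.act_id]

end NFoldCat

namespace MixedPseudofunctor

variable (F : MixedPseudofunctor (Qn n C) D)

/-- The 2-cell of the square of an up-square. -/
noncomputable def sqOf {k l : Fin n} (hkl : k < l) {X Y Z W : C} {q : X ⟶ Z} {i : Z ⟶ W}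
    {j : X ⟶ Y} {p : Y ⟶ W} (σ : q ≫ i ⟶ j ≫ p) :
    F.map (mkEdge l q) ≫ F.map (mkEdge k i) ⟶ F.map (mkEdge k j) ≫ F.map (mkEdge l p) :=
  F.sq hkl (exists_isSquare hkl ⟨j, q, i, p, σ⟩).1

variable {k l : Fin n} (hkl : k < l) 

/-- By `square_ext` the square itself is determined by `σ`, so it is the one chosen in `sqOf`. This
identifies faces of arbitrary hypercubes with values of `sqOf`. -/
theorem sq_eq_sqOf {X Y Z W : C} {q : X ⟶ Z} {i : Z ⟶ W} {j : X ⟶ Y} {p : Y ⟶ W}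
    {σ : q ≫ i ⟶ j ≫ p} {s : (Qn n C).cell {k, l}}
    (hs : IsSquare k l (mkEdge k j) (mkEdge l q) (mkEdge k i) (mkEdge l p) s)
    (h : HEq (sqCell hkl hs) σ) : F.sq hkl hs = F.sqOf hkl σ := by
  obtain rfl := square_ext hkl hs (exists_isSquare hkl ⟨j, q, i, p, σ⟩).1
    (eq_of_heq (h.trans (exists_isSquare hkl ⟨j, q, i, p, σ⟩).2.symm))
  rfl

/-- The edges are determined by their underlying morphisms and the square by its underlying 2-cell.
Since the edges are only propositionally equal, the conclusion is heterogeneous. -/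
theorem sq_congr {X Y Z W : (Qn n C).Ob} {j j' : (Qn n C).Edge k X Y} {q q' : (Qn n C).Edge l X Z}
    {i i' : (Qn n C).Edge k Z W} {p p' : (Qn n C).Edge l Y W} {s s' : (Qn n C).cell {k, l}}
    (hs : IsSquare k l j q i p s) (hs' : IsSquare k l j' q' i' p' s')
    (h : sqUp hkl hs = sqUp hkl hs') : HEq (F.sq hkl hs) (F.sq hkl hs') := by
  simp only [UpSquare.mk.injEq] at h
  obtain ⟨h₁, h₂, h₃, h₄, h₅⟩ := h
  obtain rfl := edgeHom_injective h₁
  obtain rfl := edgeHom_injective h₂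
  obtain rfl := edgeHom_injective h₃
  obtain rfl := edgeHom_injective h₄
  obtain rfl := square_ext hkl hs hs' (eq_of_heq h₅)
  rfl

theorem sqUp_of {X Y Z W : C} {A : UpSquare X Y Z W} {s : (Qn n C).cell {k, l}}
    (hs : IsSquare k l (mkEdge k A.top) (mkEdge l A.left) (mkEdge k A.bottom) (mkEdge l A.right) s)
    (h : HEq (sqCell hkl hs) A.cell) : sqUp hkl hs = A :=
  eq_of_heq (mk_heq rfl rfl rfl rfl (heq_of_eq (edgeHom_mkEdge _ _))
    (heq_of_eq (edgeHom_mkEdge _ _)) (heq_of_eq (edgeHom_mkEdge _ _))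
    (heq_of_eq (edgeHom_mkEdge _ _)) h)

/-- The unit constraint at a morphism that is equal to an identity. -/
noncomputable def mapIdOf {k : Fin n} {X : (Qn n C).Ob} {e : (Qn n C).Edge k X X} (h : e = Edge.id k X) :
    F.map e ≅ 𝟙 (F.obj X) :=
  eqToIso (by rw [h]) ≪≫ F.mapId k X

/-- The composition constraint at a morphism that is equal to a composite. -/
noncomputable def mapCompOf {k : Fin n} {X Y Z : (Qn n C).Ob} {f : (Qn n C).Edge k X Y}
    {g : (Qn n C).Edge k Y Z} {e : (Qn n C).Edge k X Z} (h : e = f.comp g) :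
    F.map e ≅ F.map f ≫ F.map g :=
  eqToIso (by rw [h]) ≪≫ F.mapComp f g

theorem mapIdOf_rfl {k : Fin n} (X : (Qn n C).Ob) (h : Edge.id k X = Edge.id k X) :
    F.mapIdOf h = F.mapId k X := by
  simp [mapIdOf]

theorem mapCompOf_rfl {k : Fin n} {X Y Z : (Qn n C).Ob} (f : (Qn n C).Edge k X Y)
    (g : (Qn n C).Edge k Y Z) (h : f.comp g = f.comp g) : F.mapCompOf h = F.mapComp f g := by
  simp [mapCompOf]

theorem mapCompOf_assoc {k : Fin n} {X Y Z W : (Qn n C).Ob} {f : (Qn n C).Edge k X Y}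
    {g : (Qn n C).Edge k Y Z} {h : (Qn n C).Edge k Z W} {fg : (Qn n C).Edge k X Z}
    {gh : (Qn n C).Edge k Y W} {a b : (Qn n C).Edge k X W} (e₁ : fg = f.comp g)
    (e₂ : gh = g.comp h) (e₃ : a = fg.comp h) (e₄ : b = f.comp gh) (e : a = b) :
    (F.mapCompOf e₃).hom ≫ (F.mapCompOf e₁).hom ▷ F.map h ≫ (α_ _ _ _).hom =
      eqToHom (by rw [e]) ≫ (F.mapCompOf e₄).hom ≫ F.map f ◁ (F.mapCompOf e₂).hom := by
  subst e₁ e₂ e₃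
  rw [mapCompOf_rfl, mapCompOf_rfl, mapCompOf_rfl, F.mapComp_assoc]
  simp [mapCompOf]

theorem mapCompOf_id_left {k : Fin n} {X Y : (Qn n C).Ob} {i : (Qn n C).Edge k X X}
    {f a : (Qn n C).Edge k X Y} (e₁ : i = Edge.id k X) (e₂ : a = i.comp f) (e : a = f) :
    (F.mapCompOf e₂).hom ≫ (F.mapIdOf e₁).hom ▷ F.map f ≫ (λ_ (F.map f)).hom =
      eqToHom (by rw [e]) := by
  subst e₁ e₂
  rw [mapCompOf_rfl, mapIdOf_rfl, F.mapComp_id_left]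

theorem mapCompOf_id_right {k : Fin n} {X Y : (Qn n C).Ob} {i : (Qn n C).Edge k Y Y}
    {f a : (Qn n C).Edge k X Y} (e₁ : i = Edge.id k Y) (e₂ : a = f.comp i) (e : a = f) :
    (F.mapCompOf e₂).hom ≫ F.map f ◁ (F.mapIdOf e₁).hom ≫ (ρ_ (F.map f)).hom =
      eqToHom (by rw [e]) := by
  subst e₁ e₂
  rw [mapCompOf_rfl, mapIdOf_rfl, F.mapComp_id_right]

/-- The square need not be presented as a degenerate one, nor its vertical edges as identity edges:
an underlying identity up-square is enough. The same freedom is provided for `hid` and for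
composites below. -/
theorem sq_eq_vid {X Y : (Qn n C).Ob} {f : (Qn n C).Edge k X Y} {e : (Qn n C).Edge l X X}
    {e' : (Qn n C).Edge l Y Y} {s : (Qn n C).cell {k, l}} (hs : IsSquare k l f e f e' s)
    (he : e = Edge.id l X) (he' : e' = Edge.id l Y) (h : sqUp hkl hs = .vid (edgeHom f)) :
    F.sq hkl hs = (F.mapIdOf he).hom ▷ F.map f ≫ (λ_ _).hom ≫ (ρ_ _).inv ≫
      F.map f ◁ (F.mapIdOf he').inv := by
  subst he he'
  rw [mapIdOf_rfl, mapIdOf_rfl]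
  have hs' := IsSquare.vid hkl.ne f
  have := F.sq_vid hkl f hs'
  rw [← this]
  exact eq_of_heq (F.sq_congr hkl hs hs' (h.trans (sqUp_vid hkl f hs').symm))

theorem sq_eq_hid {X Y : (Qn n C).Ob} {f : (Qn n C).Edge l X Y} {e : (Qn n C).Edge k X X}
    {e' : (Qn n C).Edge k Y Y} {s : (Qn n C).cell {k, l}} (hs : IsSquare k l e f e' f s)
    (he : e = Edge.id k X) (he' : e' = Edge.id k Y) (h : sqUp hkl hs = .hid (edgeHom f)) :
    F.sq hkl hs = F.map f ◁ (F.mapIdOf he').hom ≫ (ρ_ _).hom ≫ (λ_ _).inv ≫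
      (F.mapIdOf he).inv ▷ F.map f := by
  subst he he'
  rw [mapIdOf_rfl, mapIdOf_rfl]
  have hs' := IsSquare.hid hkl.ne f
  have := F.sq_hid hkl f hs'
  rw [← this]
  exact eq_of_heq (F.sq_congr hkl hs hs' (h.trans (sqUp_hid hkl f hs').symm))

/-- The composite in `Qⁿ C` has the same underlying up-square as `t`, so `sq_congr` moves the axiom
for the composite to `t`. Thus pasting may be tested in `C`. -/
theorem sq_eq_hcomp {X₁ X₂ X₃ Y₁ Y₂ Y₃ : (Qn n C).Ob}
    {j : (Qn n C).Edge k X₁ X₂} {j' : (Qn n C).Edge k X₂ X₃} {i : (Qn n C).Edge k Y₁ Y₂}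
    {i' : (Qn n C).Edge k Y₂ Y₃} {p₁ : (Qn n C).Edge l X₁ Y₁} {p₂ : (Qn n C).Edge l X₂ Y₂}
    {p₃ : (Qn n C).Edge l X₃ Y₃} {s s' t : (Qn n C).cell {k, l}} (hs : IsSquare k l j p₁ i p₂ s)
    (hs' : IsSquare k l j' p₂ i' p₃ s') {j₃ : (Qn n C).Edge k X₁ X₃} {i₃ : (Qn n C).Edge k Y₁ Y₃}
    (ht : IsSquare k l j₃ p₁ i₃ p₃ t) (hj : j₃ = j.comp j') (hi : i₃ = i.comp i')
    (h : sqUp hkl ht = (sqUp hkl hs).hcomp (sqUp hkl hs') rfl) :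
    F.map p₁ ◁ (F.mapCompOf hi).hom ≫ pasteH (F.sq hkl hs) (F.sq hkl hs') =
      F.sq hkl ht ≫ (F.mapCompOf hj).hom ▷ F.map p₃ := by
  subst hj hi
  rw [mapCompOf_rfl, mapCompOf_rfl]
  obtain ⟨hm, hs''⟩ := hs.hcomp hkl.ne hs'
  rw [F.sq_hcomp hkl hs hs' hm hs'']
  congr 1
  exact eq_of_heq (F.sq_congr hkl hs'' ht ((sqUp_hcomp hkl hs hs' hm hs'').trans h.symm))

theorem sq_eq_vcomp {X₁ X₂ X₃ Y₁ Y₂ Y₃ : (Qn n C).Ob}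
    {q : (Qn n C).Edge l X₁ X₂} {q' : (Qn n C).Edge l X₂ X₃} {p : (Qn n C).Edge l Y₁ Y₂}
    {p' : (Qn n C).Edge l Y₂ Y₃} {j₁ : (Qn n C).Edge k X₁ Y₁} {j₂ : (Qn n C).Edge k X₂ Y₂}
    {j₃ : (Qn n C).Edge k X₃ Y₃} {s s' t : (Qn n C).cell {k, l}} (hs : IsSquare k l j₁ q j₂ p s)
    (hs' : IsSquare k l j₂ q' j₃ p' s') {q₃ : (Qn n C).Edge l X₁ X₃} {p₃ : (Qn n C).Edge l Y₁ Y₃}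
    (ht : IsSquare k l j₁ q₃ j₃ p₃ t) (hq : q₃ = q.comp q') (hp : p₃ = p.comp p')
    (h : sqUp hkl ht = (sqUp hkl hs).vcomp (sqUp hkl hs') rfl) :
    (F.mapCompOf hq).hom ▷ F.map j₃ ≫ pasteV (F.sq hkl hs) (F.sq hkl hs') =
      F.sq hkl ht ≫ F.map j₁ ◁ (F.mapCompOf hp).hom := by
  subst hq hp
  rw [mapCompOf_rfl, mapCompOf_rfl]
  obtain ⟨hm, hs''⟩ := hs.vcomp hkl.ne hs'
  rw [F.sq_vcomp hkl hs hs' hm hs'']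
  congr 1
  exact eq_of_heq (F.sq_congr hkl hs'' ht ((sqUp_vcomp hkl hs hs' hm hs'').trans h.symm))

section

variable {X Y Z W : C} {q : X ⟶ Z} {i : Z ⟶ W} {j : X ⟶ Y} {p : Y ⟶ W} (σ : q ≫ i ⟶ j ≫ p)

theorem sqUp_exists : sqUp hkl (exists_isSquare hkl ⟨j, q, i, p, σ⟩).1 = ⟨j, q, i, p, σ⟩ :=
  sqUp_of hkl _ (exists_isSquare hkl _).2

end

theorem sqOf_vid {X Y : C} (f : X ⟶ Y) :
    F.sqOf hkl (UpSquare.vid f).cell = (F.mapIdOf (mkEdge_id l X)).hom ▷ F.map (mkEdge k f) ≫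
      (λ_ _).hom ≫ (ρ_ _).inv ≫ F.map (mkEdge k f) ◁ (F.mapIdOf (mkEdge_id l Y)).inv :=
  F.sq_eq_vid hkl _ _ _ ((sqUp_exists hkl _).trans
    (congrArg UpSquare.vid (edgeHom_mkEdge k f).symm))

theorem sqOf_hid {X Y : C} (f : X ⟶ Y) :
    F.sqOf hkl (UpSquare.hid f).cell = F.map (mkEdge l f) ◁ (F.mapIdOf (mkEdge_id k Y)).hom ≫
      (ρ_ _).hom ≫ (λ_ _).inv ≫ (F.mapIdOf (mkEdge_id k X)).inv ▷ F.map (mkEdge l f) :=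
  F.sq_eq_hid hkl _ _ _ ((sqUp_exists hkl _).trans
    (congrArg UpSquare.hid (edgeHom_mkEdge l f).symm))

theorem sqOf_hcomp {X₁ X₂ X₃ Y₁ Y₂ Y₃ : C} {j : X₁ ⟶ X₂} {j' : X₂ ⟶ X₃} {i : Y₁ ⟶ Y₂}
    {i' : Y₂ ⟶ Y₃} {p₁ : X₁ ⟶ Y₁} {p₂ : X₂ ⟶ Y₂} {p₃ : X₃ ⟶ Y₃} (σ : p₁ ≫ i ⟶ j ≫ p₂)
    (τ : p₂ ≫ i' ⟶ j' ≫ p₃) :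
    F.map (mkEdge l p₁) ◁ (F.mapCompOf (mkEdge_comp k i i')).hom ≫
      pasteH (F.sqOf hkl σ) (F.sqOf hkl τ) =
    F.sqOf hkl (pasteH σ τ) ≫ (F.mapCompOf (mkEdge_comp k j j')).hom ▷ F.map (mkEdge l p₃) :=
  F.sq_eq_hcomp hkl _ _ _ _ _ ((sqUp_exists hkl _).trans (by
    rw [UpSquare.hcomp_congr (sqUp_exists hkl σ) (sqUp_exists hkl τ) _ rfl]
    exact (UpSquare.mk_hcomp_mk σ τ).symm))

theorem sqOf_vcomp {X₁ X₂ X₃ Y₁ Y₂ Y₃ : C} {q : X₁ ⟶ X₂} {q' : X₂ ⟶ X₃} {p : Y₁ ⟶ Y₂}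
    {p' : Y₂ ⟶ Y₃} {j₁ : X₁ ⟶ Y₁} {j₂ : X₂ ⟶ Y₂} {j₃ : X₃ ⟶ Y₃} (σ : q ≫ j₂ ⟶ j₁ ≫ p)
    (τ : q' ≫ j₃ ⟶ j₂ ≫ p') :
    (F.mapCompOf (mkEdge_comp l q q')).hom ▷ F.map (mkEdge k j₃) ≫
      pasteV (F.sqOf hkl σ) (F.sqOf hkl τ) =
    F.sqOf hkl (pasteV σ τ) ≫ F.map (mkEdge k j₁) ◁ (F.mapCompOf (mkEdge_comp l p p')).hom :=
  F.sq_eq_vcomp hkl _ _ _ _ _ ((sqUp_exists hkl _).trans (by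
    rw [UpSquare.vcomp_congr (sqUp_exists hkl σ) (sqUp_exists hkl τ) _ rfl]
    exact (UpSquare.mk_vcomp_mk σ τ).symm))

variable {m : Fin n} (hlm : l < m)

/-- The cube axiom for `F` at a spread hypercube, with each face expressed by a face of `A`. The
function `x` records to which corner of `A` each of the eight vertices is sent. -/
theorem sqOf_spread_cube {X Y Z W : C} (A : UpSquare X Y Z W) {κ : Fin n} {S T : Finset (Fin n)}
    (hS : ∀ j ∈ S, j ≤ κ) (hT : ∀ j ∈ T, κ < j) {i j o : Fin 2} (hij : i ≤ j) (hjo : j ≤ o)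
    (hi : (if k ≤ κ then 0 else 1) = i) (hj : (if l ≤ κ then 0 else 1) = j)
    (ho : (if m ≤ κ then 0 else 1) = o) {x : ℕ → ℕ → ℕ → Bool × Bool}
    (hx : ∀ r s t, (meets S (vtx (shape {k, l, m}) (gv₃ k l m r s t)),
      meets T (vtx (shape {k, l, m}) (gv₃ k l m r s t))) = x r s t)
    (k₀₀ : UpSquare.step i (x 0 0 0) (x 1 0 0)) (k₁₀ : UpSquare.step i (x 0 1 0) (x 1 1 0))
    (k₀₁ : UpSquare.step i (x 0 0 1) (x 1 0 1)) (k₁₁ : UpSquare.step i (x 0 1 1) (x 1 1 1))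
    (l₀₀ : UpSquare.step j (x 0 0 0) (x 0 1 0)) (l₁₀ : UpSquare.step j (x 1 0 0) (x 1 1 0))
    (l₀₁ : UpSquare.step j (x 0 0 1) (x 0 1 1)) (l₁₁ : UpSquare.step j (x 1 0 1) (x 1 1 1))
    (m₀₀ : UpSquare.step o (x 0 0 0) (x 0 0 1)) (m₁₀ : UpSquare.step o (x 1 0 0) (x 1 0 1))
    (m₀₁ : UpSquare.step o (x 0 1 0) (x 0 1 1)) (m₁₁ : UpSquare.step o (x 1 1 0) (x 1 1 1)) :
    CommCube (F.sqOf hkl (A.face hij k₀₀ l₀₀ k₁₀ l₁₀)) (F.sqOf hkl (A.face hij k₀₁ l₀₁ k₁₁ l₁₁))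
      (F.sqOf (hkl.trans hlm) (A.face (hij.trans hjo) k₀₀ m₀₀ k₀₁ m₁₀))
      (F.sqOf (hkl.trans hlm) (A.face (hij.trans hjo) k₁₀ m₀₁ k₁₁ m₁₁))
      (F.sqOf hlm (A.face hjo l₀₀ m₀₀ l₀₁ m₀₁)) (F.sqOf hlm (A.face hjo l₁₀ m₁₀ l₁₁ m₁₁)) := by
  have hkm := hkl.trans hlm
  have hkl₁ := hkl.ne
  have hkl₂ := hkl.ne'
  have hkm₁ := hkm.ne
  have hkm₂ := hkm.ne'
  have hlm₁ := hlm.ne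
  have hlm₂ := hlm.ne'
  let v (r s t : ℕ) : Box (shape {k, l, m}) := vtx _ (gv₃ k l m r s t)
  have S₁ : ∀ s t, boxStep (shape {k, l, m}) k (v 0 s t) (v 1 s t) := fun s t =>
    vtx_step (by simp [gv₃]) fun j hj => by simp [gv₃, hj]
  have S₂ : ∀ s t, boxStep (shape {k, l, m}) l (v s 0 t) (v s 1 t) := fun s t =>
    vtx_step (by simp [gv₃]; split_ifs <;> simp) fun j hj => by simp [gv₃, hj]
  have S₃ : ∀ s t, boxStep (shape {k, l, m}) m (v s t 0) (v s t 1) := fun s t =>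
    vtx_step (by simp [gv₃]; split_ifs <;> simp) fun j hj => by simp [gv₃, hj]
  have KL : ∀ t u u', u ≤ 1 → u' ≤ 1 → (sub {k, l} {k, l, m} t).app (vtx _ (gv k l u u')) =
      v u u' t := fun t u u' h h' => sub_gv₃ t u u' _ hkl₁ (by simp) (by simp) h h' (by simp [gv₃])
        (by simp [gv₃, hkl₂]) (by rintro _ (rfl | rfl | rfl) <;> simp [gv₃, *])
  have KM : ∀ t u u', u ≤ 1 → u' ≤ 1 → (sub {k, m} {k, l, m} t).app (vtx _ (gv k m u u')) =
      v u t u' := fun t u u' h h' => sub_gv₃ t u u' _ hkm₁ (by simp) (by simp) h h' (by simp [gv₃])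
        (by simp [gv₃, hkm₂, hlm₂]) (by rintro _ (rfl | rfl | rfl) <;> simp [gv₃, *])
  have LM : ∀ t u u', u ≤ 1 → u' ≤ 1 → (sub {l, m} {k, l, m} t).app (vtx _ (gv l m u u')) =
      v t u u' := fun t u u' h h' => sub_gv₃ t u u' _ hlm₁ (by simp) (by simp) h h'
        (by simp [gv₃, hkl₂]) (by simp [gv₃, hkm₂, hlm₂])
        (by rintro _ (rfl | rfl | rfl) <;> simp [gv₃, *])
  obtain ⟨K', hK'⟩ := spread_square A hS hT (hx 0 0 0) (hx 1 0 0) (hx 0 1 0) (hx 1 1 0) hkl hij hi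
    hj _ (KL 0 0 0 (by simp) (by simp)) (KL 0 1 0 (by simp) (by simp)) (KL 0 0 1 (by simp) (by simp))
    (KL 0 1 1 (by simp) (by simp)) (S₁ _ _) (S₂ _ _) (S₁ _ _) (S₂ _ _) k₀₀ l₀₀ k₁₀ l₁₀
  obtain ⟨K, hK⟩ := spread_square A hS hT (hx 0 0 1) (hx 1 0 1) (hx 0 1 1) (hx 1 1 1) hkl hij hi
    hj _ (KL 1 0 0 (by simp) (by simp)) (KL 1 1 0 (by simp) (by simp)) (KL 1 0 1 (by simp) (by simp))
    (KL 1 1 1 (by simp) (by simp)) (S₁ _ _) (S₂ _ _) (S₁ _ _) (S₂ _ _) k₀₁ l₀₁ k₁₁ l₁₁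
  obtain ⟨J', hJ'⟩ := spread_square A hS hT (hx 0 0 0) (hx 1 0 0) (hx 0 0 1) (hx 1 0 1) hkm
    (hij.trans hjo) hi ho _ (KM 0 0 0 (by simp) (by simp)) (KM 0 1 0 (by simp) (by simp))
    (KM 0 0 1 (by simp) (by simp)) (KM 0 1 1 (by simp) (by simp)) (S₁ _ _) (S₃ _ _) (S₁ _ _)
    (S₃ _ _) k₀₀ m₀₀ k₀₁ m₁₀
  obtain ⟨J, hJ⟩ := spread_square A hS hT (hx 0 1 0) (hx 1 1 0) (hx 0 1 1) (hx 1 1 1) hkm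
    (hij.trans hjo) hi ho _ (KM 1 0 0 (by simp) (by simp)) (KM 1 1 0 (by simp) (by simp))
    (KM 1 0 1 (by simp) (by simp)) (KM 1 1 1 (by simp) (by simp)) (S₁ _ _) (S₃ _ _) (S₁ _ _)
    (S₃ _ _) k₁₀ m₀₁ k₁₁ m₁₁
  obtain ⟨I', hI'⟩ := spread_square A hS hT (hx 0 0 0) (hx 0 1 0) (hx 0 0 1) (hx 0 1 1) hlm
    hjo hj ho _ (LM 0 0 0 (by simp) (by simp)) (LM 0 1 0 (by simp) (by simp))
    (LM 0 0 1 (by simp) (by simp)) (LM 0 1 1 (by simp) (by simp)) (S₂ _ _) (S₃ _ _) (S₂ _ _)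
    (S₃ _ _) l₀₀ m₀₀ l₀₁ m₀₁
  obtain ⟨I, hI⟩ := spread_square A hS hT (hx 1 0 0) (hx 1 1 0) (hx 1 0 1) (hx 1 1 1) hlm
    hjo hj ho _ (LM 1 0 0 (by simp) (by simp)) (LM 1 1 0 (by simp) (by simp))
    (LM 1 0 1 (by simp) (by simp)) (LM 1 1 1 (by simp) (by simp)) (S₂ _ _) (S₃ _ _) (S₂ _ _)
    (S₃ _ _) l₁₀ m₁₀ l₁₁ m₁₁
  exact (F.cube hkl hlm _ K' K J' J I' I).congr (F.sq_eq_sqOf hkl K' hK') (F.sq_eq_sqOf hkl K hK)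
    (F.sq_eq_sqOf hkm J' hJ') (F.sq_eq_sqOf hkm J hJ) (F.sq_eq_sqOf hlm I' hI')
    (F.sq_eq_sqOf hlm I hI)

section

variable {X Y Z W : C} {f : X ⟶ Y} {g : X ⟶ Z} {h : Z ⟶ W} {e : Y ⟶ W}

/-- The cube of an up-square in which the first two directions are merged. -/
theorem sqOf_cube₁ (σ : g ≫ h ⟶ f ≫ e) :
    CommCube (F.sqOf hkl (𝟙 (f ≫ 𝟙 Y))) (F.sqOf hkl (𝟙 (h ≫ 𝟙 W)))
      (F.sqOf (hkl.trans hlm) σ) (F.sqOf (hkl.trans hlm) (UpSquare.hid e).cell)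
      (F.sqOf hlm σ) (F.sqOf hlm (UpSquare.hid e).cell) := by
  -- The directions `k` and `l` are both horizontal, and a vertex lies on the right as soon as
  -- either coordinate is `1`. This is a connection in the directions `k` and `l`.
  have key := F.sqOf_spread_cube hkl hlm ⟨f, g, h, e, σ⟩ (κ := l) (S := {k, l}) (T := {m})
    (i := 0) (j := 0) (o := 1) (by simp [hkl.le]) (by simpa using hlm) (by decide) (by decide)
    (if_pos hkl.le) (if_pos le_rfl) (if_neg hlm.not_ge)
    (x := fun r s t => (decide (r ≠ 0 ∨ s ≠ 0), decide (t ≠ 0)))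
    (fun r s t => (gv₃_vertex hkl hlm (by simp [Finset.subset_iff]) (by simp) r s t).trans (by
      have := hkl.ne; have := hlm.ne; have := hlm.ne'; have := (hkl.trans hlm).ne
      have := (hkl.trans hlm).ne'
      simp [*])) (by decide) (by decide) (by decide) (by decide) (by decide) (by decide)
      (by decide) (by decide) (by decide) (by decide) (by decide) (by decide)
  -- The faces in the directions `k, l` are the companion squares of `f` and `h`. The faces through
  -- the initial vertex in the other pairs of directions are both `σ`, and their opposites are
  -- identity squares on `e`.
  exact key.congr (congrArg _ (UpSquare.face_thin _ _ _ _ _ _ (by decide)))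
    (congrArg _ (UpSquare.face_thin _ _ _ _ _ _ (by decide)))
    (congrArg _ (UpSquare.face_cell _ _ (by decide) _ _ _ _))
    (congrArg _ ((UpSquare.face_thin _ _ _ _ _ _ (by decide)).trans (UpSquare.hid_cell e).symm))
    (congrArg _ (UpSquare.face_cell _ _ (by decide) _ _ _ _))
    (congrArg _ ((UpSquare.face_thin _ _ _ _ _ _ (by decide)).trans (UpSquare.hid_cell e).symm))

/-- The cube of an up-square in which the last two directions are merged. -/
theorem sqOf_cube₂ (σ : g ≫ h ⟶ f ≫ e) :
    CommCube (F.sqOf hkl σ) (F.sqOf hkl (UpSquare.vid h).cell)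
      (F.sqOf (hkl.trans hlm) σ) (F.sqOf (hkl.trans hlm) (UpSquare.vid h).cell)
      (F.sqOf hlm (𝟙 (g ≫ 𝟙 Z))) (F.sqOf hlm (𝟙 (e ≫ 𝟙 W))) := by
  -- Now `l` and `m` are both vertical. The faces `l, m` are companion squares of `g` and `e`, and
  -- the faces opposite to `σ` are identity squares on `h`.
  have key := F.sqOf_spread_cube hkl hlm ⟨f, g, h, e, σ⟩ (κ := k) (S := {k}) (T := {l, m})
    (i := 0) (j := 1) (o := 1) (by simp) (by simpa using ⟨hkl, hkl.trans hlm⟩) (by decide)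
    (by decide) (if_pos le_rfl) (if_neg hkl.not_ge) (if_neg (hkl.trans hlm).not_ge)
    (x := fun r s t => (decide (r ≠ 0), decide (s ≠ 0 ∨ t ≠ 0)))
    (fun r s t => (gv₃_vertex hkl hlm (by simp) (by simp [Finset.subset_iff]) r s t).trans (by
      have := hkl.ne; have := hlm.ne; have := hlm.ne'; have := (hkl.trans hlm).ne
      have := (hkl.trans hlm).ne'; have := hkl.ne'
      simp [*])) (by decide) (by decide) (by decide) (by decide) (by decide) (by decide)
      (by decide) (by decide) (by decide) (by decide) (by decide) (by decide)
  exact key.congr (congrArg _ (UpSquare.face_cell _ _ (by decide) _ _ _ _))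
    (congrArg _ ((UpSquare.face_thin _ _ _ _ _ _ (by decide)).trans (UpSquare.vid_cell h).symm))
    (congrArg _ (UpSquare.face_cell _ _ (by decide) _ _ _ _))
    (congrArg _ ((UpSquare.face_thin _ _ _ _ _ _ (by decide)).trans (UpSquare.vid_cell h).symm))
    (congrArg _ (UpSquare.face_thin _ _ _ _ _ _ (by decide)))
    (congrArg _ (UpSquare.face_thin _ _ _ _ _ _ (by decide)))

end

end MixedPseudofunctor

end Strictified

/-! ### Companions, the action on 2-cells, and the comparison of directions -/

section Cubical

/-- A pseudofunctor on `Qⁿ C` in terms of the objects, morphisms and 2-cells of `C`. The unit and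
composition constraints are indexed by equations between morphisms of `C`, so that they absorb the
strict unit and associativity laws of `C`. -/
structure Cubical (n : ℕ) (C : Type u₁) [Bicategory.{w₁, v₁} C] (D : Type u₂)
    [Bicategory.{w₂, v₂} D] where
  obj : C → D
  map (k : Fin n) {X Y : C} (f : X ⟶ Y) : obj X ⟶ obj Y
  mapId (k : Fin n) {X : C} {e : X ⟶ X} (h : e = 𝟙 X) : map k e ≅ 𝟙 (obj X)
  mapComp (k : Fin n) {X Y Z : C} {f : X ⟶ Y} {g : Y ⟶ Z} {e : X ⟶ Z} (h : e = f ≫ g) :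
    map k e ≅ map k f ≫ map k g
  mapComp_assoc (k : Fin n) {X Y Z W : C} {f : X ⟶ Y} {g : Y ⟶ Z} {h : Z ⟶ W} {fg : X ⟶ Z}
    {gh : Y ⟶ W} {e e' : X ⟶ W} (h₁ : fg = f ≫ g) (h₂ : gh = g ≫ h) (h₃ : e = fg ≫ h)
    (h₄ : e' = f ≫ gh) (h₅ : e = e') :
    (mapComp k h₃).hom ≫ (mapComp k h₁).hom ▷ map k h ≫ (α_ _ _ _).hom =
      eqToHom (by rw [h₅]) ≫ (mapComp k h₄).hom ≫ map k f ◁ (mapComp k h₂).hom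
  mapComp_id_left (k : Fin n) {X Y : C} {i : X ⟶ X} {f f' : X ⟶ Y} (h : i = 𝟙 X)
    (h' : f' = i ≫ f) (h'' : f' = f) :
    (mapComp k h').hom ≫ (mapId k h).hom ▷ map k f ≫ (λ_ (map k f)).hom = eqToHom (by rw [h''])
  mapComp_id_right (k : Fin n) {X Y : C} {i : Y ⟶ Y} {f f' : X ⟶ Y} (h : i = 𝟙 Y)
    (h' : f' = f ≫ i) (h'' : f' = f) :
    (mapComp k h').hom ≫ map k f ◁ (mapId k h).hom ≫ (ρ_ (map k f)).hom = eqToHom (by rw [h''])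
  sq {k l : Fin n} (hkl : k < l) {X Y Z W : C} {q : X ⟶ Z} {i : Z ⟶ W} {j : X ⟶ Y} {p : Y ⟶ W}
    (σ : q ≫ i ⟶ j ≫ p) : map l q ≫ map k i ⟶ map k j ≫ map l p
  sq_vid {k l : Fin n} (hkl : k < l) {X Y : C} (f : X ⟶ Y) :
    sq hkl (UpSquare.vid f).cell = (mapId l rfl).hom ▷ map k f ≫ (λ_ _).hom ≫ (ρ_ _).inv ≫
      map k f ◁ (mapId l rfl).inv
  sq_hid {k l : Fin n} (hkl : k < l) {X Y : C} (f : X ⟶ Y) :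
    sq hkl (UpSquare.hid f).cell = map l f ◁ (mapId k rfl).hom ≫ (ρ_ _).hom ≫ (λ_ _).inv ≫
      (mapId k rfl).inv ▷ map l f
  sq_hcomp {k l : Fin n} (hkl : k < l) {X₁ X₂ X₃ Y₁ Y₂ Y₃ : C} {j : X₁ ⟶ X₂} {j' : X₂ ⟶ X₃}
    {i : Y₁ ⟶ Y₂} {i' : Y₂ ⟶ Y₃} {p₁ : X₁ ⟶ Y₁} {p₂ : X₂ ⟶ Y₂} {p₃ : X₃ ⟶ Y₃} {j₃ : X₁ ⟶ X₃}
    {i₃ : Y₁ ⟶ Y₃} (σ : p₁ ≫ i ⟶ j ≫ p₂) (τ : p₂ ≫ i' ⟶ j' ≫ p₃) (υ : p₁ ≫ i₃ ⟶ j₃ ≫ p₃)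
    (hi : i₃ = i ≫ i') (hj : j₃ = j ≫ j')
    (h : υ = eqToHom (by rw [hi]) ≫ pasteH σ τ ≫ eqToHom (by rw [hj])) :
    map l p₁ ◁ (mapComp k hi).hom ≫ pasteH (sq hkl σ) (sq hkl τ) =
      sq hkl υ ≫ (mapComp k hj).hom ▷ map l p₃
  sq_vcomp {k l : Fin n} (hkl : k < l) {X₁ X₂ X₃ Y₁ Y₂ Y₃ : C} {q : X₁ ⟶ X₂} {q' : X₂ ⟶ X₃}
    {p : Y₁ ⟶ Y₂} {p' : Y₂ ⟶ Y₃} {j₁ : X₁ ⟶ Y₁} {j₂ : X₂ ⟶ Y₂} {j₃ : X₃ ⟶ Y₃} {q₃ : X₁ ⟶ X₃}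
    {p₃ : Y₁ ⟶ Y₃} (σ : q ≫ j₂ ⟶ j₁ ≫ p) (τ : q' ≫ j₃ ⟶ j₂ ≫ p') (υ : q₃ ≫ j₃ ⟶ j₁ ≫ p₃)
    (hq : q₃ = q ≫ q') (hp : p₃ = p ≫ p')
    (h : υ = eqToHom (by rw [hq]) ≫ pasteV σ τ ≫ eqToHom (by rw [hp])) :
    (mapComp l hq).hom ▷ map k j₃ ≫ pasteV (sq hkl σ) (sq hkl τ) =
      sq hkl υ ≫ map k j₁ ◁ (mapComp l hp).hom
  -- Of the cube axiom only the cubes with two merged directions are retained; they suffice to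
  -- compare the choices of directions.
  cube₁ {k l m : Fin n} (hkl : k < l) (hlm : l < m) {X Y Z W : C} {q : X ⟶ Z} {i : Z ⟶ W}
    {j : X ⟶ Y} {p : Y ⟶ W} (σ : q ≫ i ⟶ j ≫ p) :
    CommCube (sq hkl (𝟙 (j ≫ 𝟙 Y))) (sq hkl (𝟙 (i ≫ 𝟙 W))) (sq (hkl.trans hlm) σ)
      (sq (hkl.trans hlm) (UpSquare.hid p).cell) (sq hlm σ) (sq hlm (UpSquare.hid p).cell)
  cube₂ {k l m : Fin n} (hkl : k < l) (hlm : l < m) {X Y Z W : C} {q : X ⟶ Z} {i : Z ⟶ W}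
    {j : X ⟶ Y} {p : Y ⟶ W} (σ : q ≫ i ⟶ j ≫ p) :
    CommCube (sq hkl σ) (sq hkl (UpSquare.vid i).cell) (sq (hkl.trans hlm) σ)
      (sq (hkl.trans hlm) (UpSquare.vid i).cell) (sq hlm (𝟙 (q ≫ 𝟙 Z))) (sq hlm (𝟙 (p ≫ 𝟙 W)))

variable {n : ℕ} {C : Type u₁} [Bicategory.{w₁, v₁} C] [Strict C]
  {D : Type u₂} [Bicategory.{w₂, v₂} D]

/-- The restriction of a pseudofunctor on `Qⁿ C` to objects, morphisms and squares that come from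
`C`. -/
noncomputable def MixedPseudofunctor.cubical (F : MixedPseudofunctor (Qn n C) D) :
    Cubical n C D where
  obj c := F.obj (qPoint n c)
  map k _ _ f := F.map (mkEdge k f)
  mapId k _ _ h := F.mapIdOf (by rw [h, mkEdge_id])
  mapComp k _ _ _ _ _ _ h := F.mapCompOf (by rw [h, mkEdge_comp])
  mapComp_assoc k _ _ _ _ _ _ _ _ _ _ _ h₁ h₂ h₃ h₄ h₅ := F.mapCompOf_assoc _ _ _ _ (by rw [h₅])
  mapComp_id_left k _ _ _ _ _ _ _ h := F.mapCompOf_id_left _ _ (by rw [h])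
  mapComp_id_right k _ _ _ _ _ _ _ h := F.mapCompOf_id_right _ _ (by rw [h])
  sq hkl _ _ _ _ _ _ _ _ σ := F.sqOf hkl σ
  sq_vid hkl _ _ f := F.sqOf_vid hkl f
  sq_hid hkl _ _ f := F.sqOf_hid hkl f
  sq_hcomp hkl _ _ _ _ _ _ _ _ _ _ _ _ _ _ _ σ τ υ hi hj h := by
    subst hi hj
    simp only [eqToHom_refl, Category.id_comp, Category.comp_id] at h
    subst h
    exact F.sqOf_hcomp hkl σ τ
  sq_vcomp hkl _ _ _ _ _ _ _ _ _ _ _ _ _ _ _ σ τ υ hi hj h := by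
    subst hi hj
    simp only [eqToHom_refl, Category.id_comp, Category.comp_id] at h
    subst h
    exact F.sqOf_vcomp hkl σ τ
  cube₁ hkl hlm _ _ _ _ _ _ _ _ σ := F.sqOf_cube₁ hkl hlm σ
  cube₂ hkl hlm _ _ _ _ _ _ _ _ σ := F.sqOf_cube₂ hkl hlm σ

namespace Cubical

variable (A : Cubical n C D) {k l : Fin n} (hkl : k < l)


/-- By interchange, cancelling the two copies of `m` after `S ▷ m` is the same as cancelling one of
them before `S`. It removes the duplicated right edge in a vertical pasting. -/
theorem whiskerRight_comp_unit {X Y : D} {a t : X ⟶ Y} {m : Y ⟶ Y} (S : a ⟶ t ≫ m) (u : m ⟶ 𝟙 Y) :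
    S ▷ m ≫ (α_ t m m).hom ≫ t ◁ u ▷ m ≫ t ◁ (λ_ m).hom ≫ t ◁ u ≫ (ρ_ t).hom =
      a ◁ u ≫ (ρ_ a).hom ≫ S ≫ t ◁ u ≫ (ρ_ t).hom := by
  calc _ = (S ≫ t ◁ u ≫ (ρ_ t).hom) ▷ m ≫ t ◁ u ≫ (ρ_ t).hom := by simp
    _ = _ := by rw [← whisker_exchange_assoc]; simp

/-- The 2-cell of an up-square whose right edge is an identity. -/
def red {X Y Z : C} {q : X ⟶ Y} {i : Y ⟶ Z} {t : X ⟶ Z} (c : q ≫ i ⟶ t) :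
    A.map l q ≫ A.map k i ⟶ A.map k t :=
  A.sq hkl (c ≫ (ρ_ t).inv) ≫ A.map k t ◁ (A.mapId l rfl).hom ≫ (ρ_ _).hom

/-- Pasting a reduced square on the right leaves the right edge an identity, so the result is again
reduced. -/
theorem red_hcomp {X Y Z W V : C} {q : X ⟶ Z} {i : Z ⟶ W} {j : X ⟶ Y} {p : Y ⟶ W} {i' : W ⟶ V}
    {t : Y ⟶ V} {i₂ : Z ⟶ V} {t₂ : X ⟶ V} (σ : q ≫ i ⟶ j ≫ p) (c : p ≫ i' ⟶ t) (c₂ : q ≫ i₂ ⟶ t₂)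
    (hi : i₂ = i ≫ i') (ht : t₂ = j ≫ t)
    (h : c₂ = eqToHom (by rw [hi]) ≫ (α_ _ _ _).inv ≫ σ ▷ i' ≫ (α_ _ _ _).hom ≫ j ◁ c ≫
      eqToHom (by rw [ht])) :
    A.map l q ◁ (A.mapComp k hi).hom ≫ (α_ _ _ _).inv ≫ A.sq hkl σ ▷ A.map k i' ≫
      (α_ _ _ _).hom ≫ A.map k j ◁ A.red hkl c = A.red hkl c₂ ≫ (A.mapComp k ht).hom := by
  have key := A.sq_hcomp hkl σ (c ≫ (ρ_ t).inv) (c₂ ≫ (ρ_ t₂).inv) hi ht (by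
    subst hi ht h
    simp [pasteH])
  -- The right edge of the pasting is cancelled by the unit constraint, which interchange moves past
  -- the composition constraint of the top edge.
  have key := key =≫ ((A.map k j ≫ A.map k t) ◁ (A.mapId l rfl).hom ≫ (ρ_ _).hom)
  rw [Category.assoc, Category.assoc, ← whisker_exchange_assoc] at key
  simpa [red, pasteH] using key

/-- Both right edges are identities and so is their composite, by strictness. The composition
constraint at `𝟙 ≫ 𝟙` is absorbed by the unit law. -/
theorem red_vcomp {X Y Z W : C} {q : X ⟶ Y} {q' : Y ⟶ Z} {i' : Z ⟶ W} {i : Y ⟶ W} {t : X ⟶ W}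
    {q₂ : X ⟶ Z} (c : q ≫ i ⟶ t) (c' : q' ≫ i' ⟶ i) (c₂ : q₂ ≫ i' ⟶ t) (hq : q₂ = q ≫ q')
    (h : c₂ = eqToHom (by rw [hq]) ≫ (α_ _ _ _).hom ≫ q ◁ c' ≫ c) :
    (A.mapComp l hq).hom ▷ A.map k i' ≫ (α_ _ _ _).hom ≫ A.map l q ◁ A.red hkl c' ≫ A.red hkl c =
      A.red hkl c₂ := by
  have key := A.sq_vcomp hkl (c ≫ (ρ_ t).inv) (c' ≫ (ρ_ i).inv) (c₂ ≫ (ρ_ t).inv) hq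
    (Strict.id_comp _).symm (by
      subst hq h
      simp [pasteV, Strict.rightUnitor_eqToIso, Strict.associator_eqToIso])
  have key := key =≫ (A.map k t ◁ ((A.mapId l rfl).hom ▷ _ ≫ (λ_ _).hom ≫ (A.mapId l rfl).hom) ≫
    (ρ_ _).hom)
  have h₂ := A.mapComp_id_left l (f := 𝟙 W) rfl (Strict.id_comp _).symm rfl
  simp only [Category.assoc, ← whiskerLeft_comp_assoc, reassoc_of% h₂] at key
  simp [pasteV, red] at key ⊢
  rw [whiskerRight_comp_unit] at key
  simpa using key

/-- The action on 2-cells, from the squares with vertical identities in direction `l`. -/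
def map₂ {X Y : C} {f g : X ⟶ Y} (σ : f ⟶ g) : A.map k f ⟶ A.map k g :=
  (λ_ _).inv ≫ (A.mapId l rfl).inv ▷ _ ≫ A.red hkl ((λ_ f).hom ≫ σ)

/-- The comparison of the two images of a morphism in the directions `l` and `k`. -/
def theta {X Y : C} (f : X ⟶ Y) : A.map l f ⟶ A.map k f :=
  (ρ_ _).inv ≫ _ ◁ (A.mapId k rfl).inv ≫ A.red hkl (ρ_ f).hom

/-- A candidate for the inverse of `theta`. -/
def thetaInv {X Y : C} (f : X ⟶ Y) : A.map k f ⟶ A.map l f :=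
  (λ_ _).inv ≫ (A.mapId l rfl).inv ▷ _ ≫ A.sq hkl (𝟙 (𝟙 X ≫ f)) ≫
    (A.mapId k rfl).hom ▷ _ ≫ (λ_ _).hom

theorem red_id_left {X Y : C} {f g : X ⟶ Y} (σ : 𝟙 X ≫ f ⟶ g) :
    A.red hkl σ = (A.mapId l rfl).hom ▷ _ ≫ (λ_ _).hom ≫ A.map₂ hkl ((λ_ f).inv ≫ σ) := by
  simp [map₂]

/-- The square that defines the left side is the identity square on `f`, whose image consists of
unit constraints. -/
theorem map₂_id {X Y : C} (f : X ⟶ Y) : A.map₂ hkl (𝟙 f) = 𝟙 (A.map k f) := by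
  have := A.sq_vid hkl f
  simp only [UpSquare.vid] at this
  simp [map₂, red, this]

theorem map₂_eqToHom {X Y : C} {f g : X ⟶ Y} (h : f = g) :
    A.map₂ hkl (eqToHom h) = eqToHom (by rw [h]) := by
  subst h
  exact A.map₂_id hkl f

/-- Here `K` and `u` play the roles of the composition and unit constraints of `𝟙 X ≫ q`. After
interchange they meet and cancel by `h`; this removes an identity left edge pasted on top of another
one. -/
theorem unit_paste {X Y Z : D} {m : X ⟶ X} {q : X ⟶ Y} {a : Y ⟶ Z} {b : X ⟶ Z} {K : q ⟶ m ≫ q}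
    {u : m ⟶ 𝟙 X} (h : K ≫ u ▷ q ≫ (λ_ q).hom = 𝟙 q) (R : q ≫ a ⟶ b) :
    K ▷ a ≫ (α_ m q a).hom ≫ m ◁ R ≫ u ▷ b ≫ (λ_ b).hom = R := by
  calc _ = (K ≫ u ▷ q ≫ (λ_ q).hom) ▷ a ≫ R := by
        rw [whisker_exchange_assoc]; simp
    _ = R := by simp [h]

/-- Vertical pasting of squares with identity vertical edges is vertical composition of 2-cells. The
doubled vertical identities are removed by the unit law, and whiskering by the unit constraint is
invertible. -/
theorem map₂_comp {X Y : C} {f g h : X ⟶ Y} (σ : f ⟶ g) (τ : g ⟶ h) :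
    A.map₂ hkl (σ ≫ τ) = A.map₂ hkl σ ≫ A.map₂ hkl τ := by
  have key := A.red_vcomp hkl ((λ_ g).hom ≫ τ) ((λ_ f).hom ≫ σ) ((λ_ f).hom ≫ σ ≫ τ)
    (Strict.id_comp _).symm (by
      simp [Strict.leftUnitor_eqToIso, Strict.associator_eqToIso])
  have h₂ := A.mapComp_id_left l (f := 𝟙 X) rfl (Strict.id_comp _).symm rfl
  rw [A.red_id_left hkl ((λ_ g).hom ≫ τ)] at key
  have key := (reassoc_of% unit_paste h₂ (A.red hkl ((λ_ f).hom ≫ σ))) _ |>.symm.trans key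
  rw [A.red_id_left, A.red_id_left] at key
  exact (cancel_epi ((A.mapId l rfl).hom ▷ A.map k f ≫ (λ_ (A.map k f)).hom)).1
    (by simpa using key.symm)

theorem red_rightUnitor {X Y : C} (q : X ⟶ Y) :
    A.red hkl (ρ_ q).hom = A.map l q ◁ (A.mapId k rfl).hom ≫ (ρ_ _).hom ≫ A.theta hkl q := by
  simp [theta]

/-- The whiskered decomposition of reduced 2-cells. -/
theorem red_id {X Y Z : C} (q : X ⟶ Y) (i : Y ⟶ Z) :
    A.red hkl (𝟙 (q ≫ i)) = A.theta hkl q ▷ A.map k i ≫ (A.mapComp k rfl).inv := by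
  -- Paste the companion square of `q` horizontally with the identity square on `i`. Since `𝟙 ≫ i =
  -- i`, the result is the square of the identity 2-cell of `q ≫ i`.
  have key := A.red_hcomp hkl (𝟙 (q ≫ 𝟙 Y)) (λ_ i).hom (𝟙 (q ≫ i)) (Strict.id_comp _).symm rfl
    (by simp [Strict.leftUnitor_eqToIso, Strict.associator_eqToIso])
  have h₂ := A.mapComp_id_left k (f := i) rfl (Strict.id_comp _).symm rfl
  rw [A.red_id_left] at key
  rw [Iso.eq_comp_inv, ← key]
  have h₃ := A.red_rightUnitor hkl q
  have h₄ : A.red hkl (ρ_ q).hom = A.sq hkl (𝟙 (q ≫ 𝟙 Y)) ≫ A.map k q ◁ (A.mapId l rfl).hom ≫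
      (ρ_ _).hom := by simp [red]
  calc _ = A.map l q ◁ (A.mapComp k (Strict.id_comp _).symm).hom ≫ (α_ _ _ _).inv ≫
        A.red hkl (ρ_ q).hom ▷ A.map k i := by
        rw [h₄]; simp [map₂_id]
    _ = A.map l q ◁ ((A.mapComp k (Strict.id_comp _).symm).hom ≫ (A.mapId k rfl).hom ▷ _ ≫ (λ_ _).hom)
        ≫ A.theta hkl q ▷ A.map k i := by rw [h₃]; simp
    _ = _ := by rw [h₂]; simp

/-- Paste the square of the identity 2-cell of `q ≫ i` below the square of `c` with vertical
identities. The former is computed by `red_id` and the latter is `map₂` by definition. -/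
theorem red_eq {X Y Z : C} {q : X ⟶ Y} {i : Y ⟶ Z} {t : X ⟶ Z} (c : q ≫ i ⟶ t) :
    A.red hkl c = A.theta hkl q ▷ A.map k i ≫ (A.mapComp k rfl).inv ≫ A.map₂ hkl c := by
  have key := A.red_vcomp hkl ((λ_ (q ≫ i)).hom ≫ c) (𝟙 (q ≫ i)) c (Strict.id_comp _).symm (by
    simp [Strict.leftUnitor_eqToIso, Strict.associator_eqToIso])
  have h₂ := A.mapComp_id_left l (f := q) rfl (Strict.id_comp _).symm rfl
  rw [A.red_id_left hkl ((λ_ (q ≫ i)).hom ≫ c)] at key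
  have key := (reassoc_of% unit_paste h₂ (A.red hkl (𝟙 (q ≫ i)))) _ |>.symm.trans key
  rw [← key, red_id]
  simp

/-- Horizontal pasting of squares with identity vertical edges is horizontal composition of 2-cells.
The unit constraint of the common vertical identity cancels the one in the definition of `map₂ hkl
τ`; the two whiskering laws follow by taking one of the 2-cells to be an identity. -/
theorem map₂_hcomp {X Y Z : C} {f f' : X ⟶ Y} {g g' : Y ⟶ Z} (σ : f ⟶ f') (τ : g ⟶ g') :
    A.map₂ hkl (σ ▷ g ≫ f' ◁ τ) = (A.mapComp k rfl).hom ≫ A.map₂ hkl σ ▷ A.map k g ≫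
      A.map k f' ◁ A.map₂ hkl τ ≫ (A.mapComp k rfl).inv := by
  have key := A.red_hcomp hkl ((λ_ f).hom ≫ σ ≫ (ρ_ f').inv) ((λ_ g).hom ≫ τ)
    ((λ_ (f ≫ g)).hom ≫ σ ▷ g ≫ f' ◁ τ) rfl rfl (by simp)
  have h₂ : A.sq hkl ((λ_ f).hom ≫ σ ≫ (ρ_ f').inv) ≫ A.map k f' ◁ (A.mapId l rfl).hom ≫
      (ρ_ _).hom = (A.mapId l rfl).hom ▷ _ ≫ (λ_ _).hom ≫ A.map₂ hkl σ := by
    simp [map₂, red]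
  rw [A.red_id_left, A.red_id_left] at key
  have h₃ : A.map l (𝟙 X) ◁ (A.mapComp k rfl).hom ≫ (α_ _ _ _).inv ≫
      (A.sq hkl ((λ_ f).hom ≫ σ ≫ (ρ_ f').inv) ≫ A.map k f' ◁ (A.mapId l rfl).hom ≫
      (ρ_ _).hom) ▷ A.map k g ≫ A.map k f' ◁ A.map₂ hkl τ = 
      (A.mapId l rfl).hom ▷ _ ≫ (λ_ _).hom ≫ A.map₂ hkl (σ ▷ g ≫ f' ◁ τ) ≫
        (A.mapComp k rfl).hom := by simpa using key
  rw [h₂] at h₃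
  have h₅ : (α_ (A.map l (𝟙 X)) (A.map k f) (A.map k g)).inv ≫ (A.mapId l rfl).hom ▷ A.map k f ▷
      A.map k g ≫ (λ_ (A.map k f)).hom ▷ A.map k g = (A.mapId l rfl).hom ▷ _ ≫ (λ_ _).hom := by
    simp
  simp only [comp_whiskerRight, Category.assoc] at h₃
  rw [reassoc_of% h₅, whisker_exchange_assoc] at h₃
  have h₄ := (cancel_epi ((A.mapId l rfl).hom ▷ A.map k (f ≫ g) ≫ (λ_ _).hom)).1
    ((by simpa using h₃.symm :
      ((A.mapId l rfl).hom ▷ A.map k (f ≫ g) ≫ (λ_ _).hom) ≫ A.map₂ hkl (σ ▷ g ≫ f' ◁ τ) ≫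
        (A.mapComp k rfl).hom = ((A.mapId l rfl).hom ▷ A.map k (f ≫ g) ≫ (λ_ _).hom) ≫ 
      ((A.mapComp k rfl).hom ≫ A.map₂ hkl σ ▷ A.map k g ≫ A.map k f' ◁ A.map₂ hkl τ)))
  rw [← cancel_mono (A.mapComp k rfl).hom, h₄]
  simp

theorem map₂_whiskerLeft {X Y Z : C} (f : X ⟶ Y) {g g' : Y ⟶ Z} (τ : g ⟶ g') :
    A.map₂ hkl (f ◁ τ) = (A.mapComp k rfl).hom ≫ A.map k f ◁ A.map₂ hkl τ ≫
      (A.mapComp k rfl).inv := by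
  simpa [map₂_id] using A.map₂_hcomp hkl (𝟙 f) τ

theorem map₂_whiskerRight {X Y Z : C} {f f' : X ⟶ Y} (σ : f ⟶ f') (g : Y ⟶ Z) :
    A.map₂ hkl (σ ▷ g) = (A.mapComp k rfl).hom ≫ A.map₂ hkl σ ▷ A.map k g ≫
      (A.mapComp k rfl).inv := by
  simpa [map₂_id] using A.map₂_hcomp hkl σ (𝟙 g)

/-- The squares in terms of the comparison and the action on 2-cells. -/
theorem sq_theta {X Y Z W : C} {q : X ⟶ Z} {i : Z ⟶ W} {j : X ⟶ Y} {p : Y ⟶ W}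
    (σ : q ≫ i ⟶ j ≫ p) :
    A.sq hkl σ ≫ A.map k j ◁ A.theta hkl p = A.theta hkl q ▷ A.map k i ≫
      (A.mapComp k rfl).inv ≫ A.map₂ hkl σ ≫ (A.mapComp k rfl).hom := by
  -- Paste `σ` on the right with the companion square of `p`. Since `i ≫ 𝟙 = i`, the result is `σ`
  -- again, now regarded as a reduced square with top edge `j ≫ p`, to which `red_eq` applies.
  have key := A.red_hcomp hkl σ (ρ_ p).hom σ (Strict.comp_id _).symm rfl (by
    simp [Strict.rightUnitor_eqToIso, Strict.associator_eqToIso])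
  have h₂ := A.mapComp_id_right k (f := i) rfl (Strict.comp_id _).symm rfl
  rw [A.red_rightUnitor, A.red_eq] at key
  simp only [Category.assoc] at key
  rw [← key]
  calc _ = A.map l q ◁ ((A.mapComp k (Strict.comp_id _).symm).hom ≫ A.map k i ◁ (A.mapId k rfl).hom ≫
          (ρ_ _).hom) ≫ A.sq hkl σ ≫ A.map k j ◁ A.theta hkl p := by rw [h₂]; simp
    _ = A.map l q ◁ (A.mapComp k (Strict.comp_id _).symm).hom ≫ (α_ _ _ _).inv ≫
          ((A.map l q ≫ A.map k i) ◁ (A.mapId k rfl).hom ≫ A.sq hkl σ ▷ _) ≫ (ρ_ _).hom ≫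
            A.map k j ◁ A.theta hkl p := by simp
    _ = _ := by rw [whisker_exchange]; simp

/-- The companion square of an identity is an identity square, whose image is given by unit
constraints. -/
theorem theta_id (X : C) : A.theta hkl (𝟙 X) = (A.mapId l rfl).hom ≫ (A.mapId k rfl).inv := by
  have h' : (UpSquare.hid (𝟙 X)).cell = 𝟙 (𝟙 X ≫ 𝟙 X) := by simp [UpSquare.hid, unitors_equal]
  have h : A.sq hkl (𝟙 (𝟙 X ≫ 𝟙 X)) = A.map l (𝟙 X) ◁ (A.mapId k rfl).hom ≫ (ρ_ _).hom ≫
      (λ_ _).inv ≫ (A.mapId k rfl).inv ▷ A.map l (𝟙 X) :=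
    (congrArg (A.sq hkl) h'.symm).trans (A.sq_hid hkl (𝟙 X))
  have h₂ : (A.mapId k rfl).inv ▷ A.map l (𝟙 X) ≫ A.map k (𝟙 X) ◁ (A.mapId l rfl).hom =
      𝟙 _ ◁ (A.mapId l rfl).hom ≫ (A.mapId k rfl).inv ▷ 𝟙 _ := (whisker_exchange _ _).symm
  simp only [theta, red, Iso.hom_inv_id, h, Category.assoc, reassoc_of% h₂]
  simp [unitors_inv_equal, unitors_equal]

/-- The companion square of `f ≫ g` is that of `g`, pasted below the square with left edge `f`,
bottom edge `g` and identity 2-cell. The latter is the companion square of `f` followed by the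
composition constraint, by `red_id`. -/
theorem theta_comp {X Y Z : C} {f : X ⟶ Y} {g : Y ⟶ Z} {e : X ⟶ Z} (h : e = f ≫ g) :
    A.theta hkl e ≫ (A.mapComp k h).hom =
      (A.mapComp l h).hom ≫ A.map l f ◁ A.theta hkl g ≫ A.theta hkl f ▷ A.map k g := by
  subst h
  have key := A.red_vcomp hkl (𝟙 (f ≫ g)) (ρ_ g).hom (ρ_ (f ≫ g)).hom rfl (by simp)
  rw [A.red_rightUnitor, A.red_rightUnitor, A.red_id] at key
  have h₂ : (A.mapComp l rfl).hom ▷ A.map k (𝟙 Z) ≫ (α_ (A.map l f) (A.map l g) _).hom ≫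
      A.map l f ◁ A.map l g ◁ (A.mapId k rfl).hom ≫ (α_ _ _ _).inv ≫ (ρ_ _).hom =
      A.map l (f ≫ g) ◁ (A.mapId k rfl).hom ≫ (ρ_ _).hom ≫ (A.mapComp l rfl).hom := by
    rw [← rightUnitor_naturality, whisker_exchange_assoc]
    simp
  have h₃ := (cancel_epi (A.map l (f ≫ g) ◁ (A.mapId k rfl).hom ≫ (ρ_ _).hom)).1
    ((by simpa [reassoc_of% h₂] using key.symm :
      (A.map l (f ≫ g) ◁ (A.mapId k rfl).hom ≫ (ρ_ _).hom) ≫ A.theta hkl (f ≫ g) =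
      (A.map l (f ≫ g) ◁ (A.mapId k rfl).hom ≫ (ρ_ _).hom) ≫ (A.mapComp l rfl).hom ≫
        A.map l f ◁ A.theta hkl g ≫ A.theta hkl f ▷ A.map k g ≫ (A.mapComp k rfl).inv))
  rw [h₃]
  simp

/-- The first companion identity. It is `sq_theta` at the square with bottom and right edge `f`,
where `theta` at the left edge `𝟙 X` is known. -/
theorem thetaInv_theta {X Y : C} (f : X ⟶ Y) :
    A.thetaInv hkl f ≫ A.theta hkl f = 𝟙 (A.map k f) := by
  have h := A.sq_theta hkl (𝟙 (𝟙 X ≫ f))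
  rw [theta_id, map₂_id] at h
  simp only [Category.id_comp, Iso.inv_hom_id, Category.comp_id, comp_whiskerRight] at h
  have h₂ := (whisker_exchange (A.mapId k (rfl : 𝟙 X = _)).hom (A.theta hkl f)).symm
  simp only [thetaInv, Category.assoc, ← leftUnitor_naturality]
  rw [reassoc_of% h₂, reassoc_of% h]
  simp

/-- The second companion identity. The square defining `thetaInv`, pasted on top of the one defining
`theta`, is the identity square on `f` in direction `l`. -/
theorem theta_thetaInv {X Y : C} (f : X ⟶ Y) :
    A.theta hkl f ≫ A.thetaInv hkl f = 𝟙 (A.map l f) := by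
  have key := A.sq_vcomp hkl (𝟙 (𝟙 X ≫ f)) (𝟙 (f ≫ 𝟙 Y)) ((ρ_ f).hom ≫ (λ_ f).inv)
    (Strict.id_comp _).symm (Strict.comp_id _).symm (by
      simp [pasteV, Strict.leftUnitor_eqToIso, Strict.rightUnitor_eqToIso,
        Strict.associator_eqToIso])
  have hid := A.sq_hid hkl f
  simp only [UpSquare.hid] at hid
  have h₁ := A.mapComp_id_left l (f := f) rfl (Strict.id_comp _).symm rfl
  have h₂ := A.mapComp_id_right l (f := f) rfl (Strict.comp_id _).symm rfl
  have h₃ := unit_paste h₁ (A.red hkl (ρ_ f).hom) =≫ A.thetaInv hkl f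
  have h₄ : A.red hkl (ρ_ f).hom = A.sq hkl (𝟙 (f ≫ 𝟙 Y)) ≫ A.map k f ◁ (A.mapId l rfl).hom ≫
      (ρ_ _).hom := by simp [red]
  have h₅ : (A.mapId l rfl).hom ▷ A.map k f ≫ (λ_ _).hom ≫ A.thetaInv hkl f =
      A.sq hkl (𝟙 (𝟙 X ≫ f)) ≫ (A.mapId k rfl).hom ▷ A.map l f ≫ (λ_ _).hom := by
    simp [thetaInv]
  have h₆ := key =≫ (A.map k (𝟙 X) ◁ (A.map l f ◁ (A.mapId l rfl).hom ≫ (ρ_ _).hom) ≫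
    (A.mapId k rfl).hom ▷ _ ≫ (λ_ _).hom)
  rw [hid] at h₆
  simp only [Category.assoc, ← whiskerLeft_comp_assoc, h₂] at h₆
  simp only [Category.assoc] at h₃
  rw [h₅] at h₃
  have h₇ := A.red_rightUnitor hkl f
  rw [← cancel_epi (A.map l f ◁ (A.mapId k rfl).hom ≫ (ρ_ _).hom)]
  simp only [Category.assoc]
  rw [← reassoc_of% h₇, ← h₃, h₄]
  -- Interchange moves the unit constraint of the lower right edge past the upper square, to the
  -- place where the pasting law has it.
  have h₈ : A.map l (𝟙 X) ◁ A.map k f ◁ (A.mapId l rfl).hom ≫ (α_ _ _ _).inv ≫ (ρ_ _).hom ≫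
     A.sq hkl (𝟙 (𝟙 X ≫ f)) = (α_ _ _ _).inv ≫ A.sq hkl (𝟙 (𝟙 X ≫ f)) ▷ A.map l (𝟙 Y) ≫ (α_ _ _ _).hom ≫
      A.map k (𝟙 X) ◁ A.map l f ◁ (A.mapId l rfl).hom ≫ (α_ _ _ _).inv ≫ (ρ_ _).hom := by
    calc _ = (α_ _ _ _).inv ≫ ((A.map l (𝟙 X) ≫ A.map k f) ◁ (A.mapId l rfl).hom ≫
        A.sq hkl (𝟙 (𝟙 X ≫ f)) ▷ _) ≫ (ρ_ _).hom := by simp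
      _ = _ := by rw [whisker_exchange]; simp
  simp [pasteV, reassoc_of% h₈] at h₆ ⊢
  exact h₆


/-- The comparison of the directions `l` and `k` as an isomorphism. -/
@[simps]
def thetaIso {X Y : C} (f : X ⟶ Y) : A.map l f ≅ A.map k f where
  hom := A.theta hkl f
  inv := A.thetaInv hkl f
  hom_inv_id := A.theta_thetaInv hkl f
  inv_hom_id := A.thetaInv_theta hkl f

/-- All edges other than `f` and `g` are isomorphic to identities. After cancelling interior units,
`S` and `S'` are surrounded by the same invertible 2-cells in the two sides of the cube. -/
theorem _root_.CommCube.eq_of_units {X Y : D} {f g : X ⟶ Y} {x y : X ⟶ X} {x' y' : Y ⟶ Y} {S S' : f ⟶ g}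
    {u : x ≅ 𝟙 X} {v : y ≅ 𝟙 X} {u' : x' ≅ 𝟙 Y} {v' : y' ≅ 𝟙 Y} {I : x ≫ y ⟶ y ≫ x}
    {I' : x' ≫ y' ⟶ y' ≫ x'} (hI : I = u.hom ▷ y ≫ (λ_ y).hom ≫ (ρ_ y).inv ≫ y ◁ u.inv)
    (hI' : I' = u'.hom ▷ y' ≫ (λ_ y').hom ≫ (ρ_ y').inv ≫ y' ◁ u'.inv)
    (h : CommCube (v.hom ▷ f ≫ (λ_ f).hom ≫ S' ≫ (ρ_ g).inv ≫ g ◁ v'.inv)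
      (v.hom ▷ f ≫ (λ_ f).hom ≫ (ρ_ f).inv ≫ f ◁ v'.inv)
      (u.hom ▷ f ≫ (λ_ f).hom ≫ S ≫ (ρ_ g).inv ≫ g ◁ u'.inv)
      (u.hom ▷ f ≫ (λ_ f).hom ≫ (ρ_ f).inv ≫ f ◁ u'.inv) I I') : S = S' := by
  subst hI hI'
  unfold CommCube at h
  have h₁ : x ◁ (v.hom ▷ f ≫ (λ_ f).hom ≫ (ρ_ f).inv ≫ f ◁ v'.inv) ≫ (α_ _ _ _).inv ≫
      (u.hom ▷ f ≫ (λ_ f).hom ≫ S ≫ (ρ_ g).inv ≫ g ◁ u'.inv) ▷ y' ≫ (α_ _ _ _).hom ≫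
      g ◁ (u'.hom ▷ y' ≫ (λ_ y').hom ≫ (ρ_ y').inv ≫ y' ◁ u'.inv) =
      (u.hom ▷ _ ≫ (λ_ _).hom ≫ v.hom ▷ f ≫ (λ_ f).hom) ≫ S ≫ (ρ_ g).inv ≫ g ◁ v'.inv ≫
        g ◁ (ρ_ _).inv ≫ g ◁ y' ◁ u'.inv := by
    calc _ = 𝟙 _ ⊗≫ x ◁ v.hom ▷ f ⊗≫ ((x ≫ f) ◁ v'.inv ≫
        (u.hom ▷ f ≫ (λ_ f).hom ≫ S ≫ (ρ_ g).inv ≫ g ◁ u'.inv) ▷ y') ⊗≫ g ◁ u'.hom ▷ y' ⊗≫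
          g ◁ y' ◁ u'.inv ⊗≫ 𝟙 _ := by bicategory
      _ = 𝟙 _ ⊗≫ (x ◁ (v.hom ▷ f) ≫ u.hom ▷ _) ⊗≫ S ⊗≫ g ◁ u'.inv ⊗≫ g ◁ (x' ◁ v'.inv ≫ u'.hom ▷ y')
          ⊗≫ g ◁ y' ◁ u'.inv ⊗≫ 𝟙 _ := by rw [whisker_exchange]; bicategory
      _ = 𝟙 _ ⊗≫ (u.hom ▷ _ ≫ 𝟙 _ ◁ (v.hom ▷ f)) ⊗≫ S ⊗≫ g ◁ (u'.inv ≫ u'.hom) ⊗≫ g ◁ v'.inv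
          ⊗≫ g ◁ y' ◁ u'.inv ⊗≫ 𝟙 _ := by rw [whisker_exchange, whisker_exchange]; bicategory
      _ = _ := by rw [Iso.inv_hom_id]; bicategory
  have h₂ : (α_ _ _ _).inv ≫ (u.hom ▷ y ≫ (λ_ y).hom ≫ (ρ_ y).inv ≫ y ◁ u.inv) ▷ f ≫
      (α_ _ _ _).hom ≫ y ◁ (u.hom ▷ f ≫ (λ_ f).hom ≫ (ρ_ f).inv ≫ f ◁ u'.inv) ≫ (α_ _ _ _).inv ≫
      (v.hom ▷ f ≫ (λ_ f).hom ≫ S' ≫ (ρ_ g).inv ≫ g ◁ v'.inv) ▷ x' ≫ (α_ _ _ _).hom =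
      (u.hom ▷ _ ≫ (λ_ _).hom ≫ v.hom ▷ f ≫ (λ_ f).hom) ≫ S' ≫ (ρ_ g).inv ≫ g ◁ v'.inv ≫
        g ◁ (ρ_ _).inv ≫ g ◁ y' ◁ u'.inv := by
    calc _ = 𝟙 _ ⊗≫ u.hom ▷ y ▷ f ⊗≫ y ◁ (u.inv ≫ u.hom) ▷ f ⊗≫ ((y ≫ f) ◁ u'.inv ≫
        (v.hom ▷ f ≫ (λ_ f).hom ≫ S' ≫ (ρ_ g).inv ≫ g ◁ v'.inv) ▷ x') ⊗≫ 𝟙 _ := by bicategory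
      _ = _ := by rw [whisker_exchange, Iso.inv_hom_id]; bicategory
  rw [h₁, h₂, cancel_epi] at h
  exact (cancel_mono _).1 h

/-- The same cancellation of units for a cube with two opposite faces given by comparison 2-cells
`t` and `t'`. What survives is the square of these with `S` and `S'`. -/
theorem _root_.CommCube.eq_of_comparison {X Y Z W : D} {i i' : Z ⟶ W} {j j' : X ⟶ Y} {q : X ⟶ Z} {p : Y ⟶ W}
    {x y : W ⟶ W} {x' y' : Y ⟶ Y} {u : x ≅ 𝟙 W} {v : y ≅ 𝟙 W} {u' : x' ≅ 𝟙 Y} {v' : y' ≅ 𝟙 Y}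
    {t : i ⟶ i'} {t' : j ⟶ j'} {S : q ≫ i' ⟶ j' ≫ p} {S' : q ≫ i ⟶ j ≫ p}
    (h : CommCube (j ◁ u'.hom ≫ (ρ_ _).hom ≫ t' ≫ (ρ_ _).inv ≫ j' ◁ v'.inv)
      (i ◁ u.hom ≫ (ρ_ _).hom ≫ t ≫ (ρ_ _).inv ≫ i' ◁ v.inv) S
      (p ◁ u.hom ≫ (ρ_ _).hom ≫ (λ_ _).inv ≫ u'.inv ▷ p) S'
      (p ◁ v.hom ≫ (ρ_ _).hom ≫ (λ_ _).inv ≫ v'.inv ▷ p)) : q ◁ t ≫ S = S' ≫ t' ▷ p := by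
  unfold CommCube at h
  have h₁ : q ◁ (i ◁ u.hom ≫ (ρ_ _).hom ≫ t ≫ (ρ_ _).inv ≫ i' ◁ v.inv) ≫ (α_ _ _ _).inv ≫
      S ▷ y ≫ (α_ _ _ _).hom ≫ j' ◁ (p ◁ v.hom ≫ (ρ_ _).hom ≫ (λ_ _).inv ≫ v'.inv ▷ p) =
      (q ◁ i ◁ u.hom ≫ q ◁ (ρ_ _).hom) ≫ (q ◁ t ≫ S) ≫ j' ◁ (λ_ _).inv ≫ j' ◁ v'.inv ▷ p := by
    calc _ = 𝟙 _ ⊗≫ q ◁ i ◁ u.hom ⊗≫ q ◁ t ⊗≫ ((q ≫ i') ◁ v.inv ≫ S ▷ y) ⊗≫ j' ◁ p ◁ v.hom ⊗≫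
        j' ◁ v'.inv ▷ p ⊗≫ 𝟙 _ := by bicategory
      _ = 𝟙 _ ⊗≫ q ◁ i ◁ u.hom ⊗≫ q ◁ t ⊗≫ S ⊗≫ (j' ≫ p) ◁ (v.inv ≫ v.hom) ⊗≫
        j' ◁ v'.inv ▷ p ⊗≫ 𝟙 _ := by rw [whisker_exchange]; bicategory
      _ = _ := by rw [Iso.inv_hom_id]; bicategory
  have h₂ : (α_ _ _ _).inv ≫ S' ▷ x ≫ (α_ _ _ _).hom ≫
      j ◁ (p ◁ u.hom ≫ (ρ_ _).hom ≫ (λ_ _).inv ≫ u'.inv ▷ p) ≫ (α_ _ _ _).inv ≫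
      (j ◁ u'.hom ≫ (ρ_ _).hom ≫ t' ≫ (ρ_ _).inv ≫ j' ◁ v'.inv) ▷ p ≫ (α_ _ _ _).hom =
      (q ◁ i ◁ u.hom ≫ q ◁ (ρ_ _).hom) ≫ (S' ≫ t' ▷ p) ≫ j' ◁ (λ_ _).inv ≫ j' ◁ v'.inv ▷ p := by
    calc _ = 𝟙 _ ⊗≫ (S' ▷ x ≫ (j ≫ p) ◁ u.hom) ⊗≫ j ◁ (u'.inv ≫ u'.hom) ▷ p ⊗≫ t' ▷ p ⊗≫
        j' ◁ v'.inv ▷ p ⊗≫ 𝟙 _ := by bicategory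
      _ = _ := by rw [← whisker_exchange, Iso.inv_hom_id]; bicategory
  rw [h₁, h₂, cancel_epi] at h
  exact (cancel_mono _).1 h

theorem sq_vid_cell {X Y : C} (f : X ⟶ Y) : A.sq hkl ((λ_ f).hom ≫ (ρ_ f).inv) =
    (A.mapId l rfl).hom ▷ A.map k f ≫ (λ_ _).hom ≫ (ρ_ _).inv ≫ A.map k f ◁ (A.mapId l rfl).inv :=
  A.sq_vid hkl f

theorem sq_hid_cell {X Y : C} (f : X ⟶ Y) : A.sq hkl ((ρ_ f).hom ≫ (λ_ f).inv) =
    A.map l f ◁ (A.mapId k rfl).hom ≫ (ρ_ _).hom ≫ (λ_ _).inv ≫ (A.mapId k rfl).inv ▷ A.map l f :=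
  A.sq_hid hkl f

/-- Apply the cube with merged vertical directions to a square with identity vertical edges. Its
faces in the directions `l, m` are identity squares, and the faces in `k, l` and `k, m` that carry
`σ` must agree. -/
theorem map₂_eq_map₂ {m : Fin n} (hlm : l < m) {X Y : C} {f g : X ⟶ Y} (σ : f ⟶ g) :
    A.map₂ (hkl.trans hlm) σ = A.map₂ hkl σ := by
  have h : CommCube (A.sq hkl ((λ_ f).hom ≫ σ ≫ (ρ_ g).inv)) (A.sq hkl ((λ_ f).hom ≫ (ρ_ f).inv))
      (A.sq (hkl.trans hlm) ((λ_ f).hom ≫ σ ≫ (ρ_ g).inv))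
      (A.sq (hkl.trans hlm) ((λ_ f).hom ≫ (ρ_ f).inv)) (A.sq hlm (𝟙 (𝟙 X ≫ 𝟙 X)))
      (A.sq hlm (𝟙 (𝟙 Y ≫ 𝟙 Y))) := A.cube₂ hkl hlm _
  have h₀ {k l : Fin n} (hkl : k < l) : A.sq hkl ((λ_ f).hom ≫ σ ≫ (ρ_ g).inv) =
      (A.mapId l rfl).hom ▷ _ ≫ (λ_ _).hom ≫ A.map₂ hkl σ ≫ (ρ_ _).inv ≫ 
        A.map k g ◁ (A.mapId l rfl).inv := by
    simp [map₂, red]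
  have h₁ (X : C) : A.sq hlm (𝟙 (𝟙 X ≫ 𝟙 X)) = (A.mapId m rfl).hom ▷ _ ≫ (λ_ _).hom ≫ (ρ_ _).inv ≫
      A.map l (𝟙 X) ◁ (A.mapId m rfl).inv := by
    have h' : (UpSquare.vid (𝟙 X)).cell = 𝟙 (𝟙 X ≫ 𝟙 X) := by simp [UpSquare.vid, unitors_equal]
    exact (congrArg (A.sq hlm) h'.symm).trans (A.sq_vid hlm (𝟙 X))
  rw [h₀, h₀, A.sq_vid_cell, A.sq_vid_cell] at h
  exact CommCube.eq_of_units (h₁ X) (h₁ Y) h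

/-- In the cube with merged horizontal directions, the faces in `k, l` are companion squares, that
is, `theta`, and two of the others are the two images of `σ`. -/
theorem sq_theta_trans {m : Fin n} (hlm : l < m) {X Y Z W : C} {q : X ⟶ Z} {i : Z ⟶ W} {j : X ⟶ Y}
    {p : Y ⟶ W} (σ : q ≫ i ⟶ j ≫ p) :
    A.sq hlm σ ≫ A.theta hkl j ▷ A.map m p =
      A.map m q ◁ A.theta hkl i ≫ A.sq (hkl.trans hlm) σ := by
  have h : CommCube (A.sq hkl (𝟙 (j ≫ 𝟙 Y))) (A.sq hkl (𝟙 (i ≫ 𝟙 W))) (A.sq (hkl.trans hlm) σ)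
      (A.sq (hkl.trans hlm) ((ρ_ p).hom ≫ (λ_ p).inv)) (A.sq hlm σ)
      (A.sq hlm ((ρ_ p).hom ≫ (λ_ p).inv)) := A.cube₁ hkl hlm σ
  have h₁ {X Y : C} (f : X ⟶ Y) : A.sq hkl (𝟙 (f ≫ 𝟙 Y)) = A.map l f ◁ (A.mapId k rfl).hom ≫
      (ρ_ _).hom ≫ A.theta hkl f ≫ (ρ_ _).inv ≫ A.map k f ◁ (A.mapId l rfl).inv := by
    simp [theta, red]
  rw [A.sq_hid_cell, A.sq_hid_cell, h₁, h₁] at h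
  exact (CommCube.eq_of_comparison h).symm

end Cubical

end Cubical

/-! ### Restriction to one direction as a 2-functor -/

section Restriction

variable {n : ℕ} {C : Type u₁} [Bicategory.{w₁, v₁} C] [Strict C]
  {D : Type u₂} [Bicategory.{w₂, v₂} D] {k l : Fin n}

namespace Cubical

/-- The pseudofunctor on `C` given by the morphisms in direction `k`, with the action on 2-cells that
comes from the squares in the directions `k` and `l`. -/
def toPseudofunctor (A : Cubical n C D) (hkl : k < l) : Pseudofunctor C D where
  obj := A.obj
  map f := A.map k f
  map₂ σ := A.map₂ hkl σ
  map₂_id f := A.map₂_id hkl f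
  map₂_comp σ τ := A.map₂_comp hkl σ τ
  mapId _ := A.mapId k rfl
  mapComp _ _ := A.mapComp k rfl
  map₂_whisker_left f _ _ τ := A.map₂_whiskerLeft hkl f τ
  map₂_whisker_right σ g := A.map₂_whiskerRight hkl σ g
  map₂_associator f g h := by
    -- By strictness the associator of `C` is a transport, and `map₂` sends it to a transport. The
    -- associativity law for equal but differently bracketed composites then gives coherence; the
    -- unitors are treated alike.
    have := A.mapComp_assoc k (rfl : f ≫ g = _) (rfl : g ≫ h = _) rfl rfl (Strict.assoc f g h)
    rw [Strict.associator_eqToIso, eqToIso.hom, map₂_eqToHom]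
    simp [reassoc_of% this]
  map₂_left_unitor f := by
    rw [Strict.leftUnitor_eqToIso, eqToIso.hom, map₂_eqToHom,
      ← A.mapComp_id_left k rfl rfl (Strict.id_comp f)]
  map₂_right_unitor f := by
    rw [Strict.rightUnitor_eqToIso, eqToIso.hom, map₂_eqToHom,
      ← A.mapComp_id_right k rfl rfl (Strict.comp_id f)]

/-- A pseudonatural transformation of pseudofunctors on `Qⁿ C`, in terms of the objects, morphisms
and 2-cells of `C`. -/
structure Hom (A B : Cubical n C D) where
  app (X : C) : A.obj X ⟶ B.obj X
  naturality (k : Fin n) {X Y : C} (f : X ⟶ Y) : A.map k f ≫ app Y ≅ app X ≫ B.map k f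
  naturality_id (k : Fin n) (X : C) :
    (naturality k (𝟙 X)).hom ≫ app X ◁ (B.mapId k rfl).hom =
      (A.mapId k rfl).hom ▷ app X ≫ (λ_ (app X)).hom ≫ (ρ_ (app X)).inv
  naturality_comp (k : Fin n) {X Y Z : C} (f : X ⟶ Y) (g : Y ⟶ Z) :
    (naturality k (f ≫ g)).hom ≫ app X ◁ (B.mapComp k rfl).hom =
      (A.mapComp k rfl).hom ▷ app Z ≫ (α_ _ _ _).hom ≫ A.map k f ◁ (naturality k g).hom ≫
        (α_ _ _ _).inv ≫ (naturality k f).hom ▷ B.map k g ≫ (α_ _ _ _).hom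
  naturality_sq {k l : Fin n} (hkl : k < l) {X Y Z W : C} {q : X ⟶ Z} {i : Z ⟶ W} {j : X ⟶ Y}
    {p : Y ⟶ W} (σ : q ≫ i ⟶ j ≫ p) :
    CommCube (A.sq hkl σ) (B.sq hkl σ) (naturality k j).inv (naturality k i).inv
      (naturality l q).inv (naturality l p).inv

namespace Hom

variable {A B : Cubical n C D} (μ : Hom A B) (hkl : k < l)


/-- Naturality at an identity is given by unit constraints, so an identity edge after `t` can be
removed before or after the naturality 2-cell of `t`. -/
theorem naturality_unit (k l : Fin n) {Y Z : C} (t : Y ⟶ Z) :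
    A.map k t ◁ (μ.naturality l (𝟙 Z)).hom ≫ (α_ _ _ _).inv ≫
        (μ.naturality k t).hom ▷ B.map l (𝟙 Z) ≫ (α_ _ _ _).hom ≫
        μ.app Y ◁ (B.map k t ◁ (B.mapId l rfl).hom ≫ (ρ_ _).hom) =
      (α_ _ _ _).inv ≫ (A.map k t ◁ (A.mapId l rfl).hom ≫ (ρ_ _).hom) ▷ μ.app Z ≫
        (μ.naturality k t).hom := by
  calc _ = A.map k t ◁ (μ.naturality l (𝟙 Z)).hom ≫ (α_ _ _ _).inv ≫
        ((μ.naturality k t).hom ▷ B.map l (𝟙 Z) ≫ _ ◁ (B.mapId l rfl).hom) ≫ (ρ_ _).hom := by simp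
    _ = A.map k t ◁ ((μ.naturality l (𝟙 Z)).hom ≫ μ.app Z ◁ (B.mapId l rfl).hom) ≫ (α_ _ _ _).inv ≫
        (ρ_ _).hom ≫ (μ.naturality k t).hom := by rw [← whisker_exchange]; simp
    _ = _ := by rw [μ.naturality_id]; simp

/-- The cube of `μ` at the square of `c`, with its right edge cancelled on both ends by
`naturality_unit`. -/
theorem naturality_red {X Y Z : C} {q : X ⟶ Y} {i : Y ⟶ Z} {t : X ⟶ Z} (c : q ≫ i ⟶ t) :
    A.red hkl c ▷ μ.app Z ≫ (μ.naturality k t).hom = (α_ _ _ _).hom ≫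
      A.map l q ◁ (μ.naturality k i).hom ≫ (α_ _ _ _).inv ≫
        (μ.naturality l q).hom ▷ B.map k i ≫ (α_ _ _ _).hom ≫ μ.app X ◁ B.red hkl c := by
  have h := μ.naturality_sq hkl (c ≫ (ρ_ t).inv)
  unfold CommCube at h
  have h₁ : A.sq hkl (c ≫ (ρ_ t).inv) ▷ μ.app Z ≫ (α_ _ _ _).hom ≫
      A.map k t ◁ (μ.naturality l (𝟙 Z)).hom ≫ (α_ _ _ _).inv ≫
        (μ.naturality k t).hom ▷ B.map l (𝟙 Z) ≫ (α_ _ _ _).hom =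
      (α_ _ _ _).hom ≫
      A.map l q ◁ (μ.naturality k i).hom ≫ (α_ _ _ _).inv ≫
        (μ.naturality l q).hom ▷ B.map k i ≫ (α_ _ _ _).hom ≫
          μ.app X ◁ B.sq hkl (c ≫ (ρ_ t).inv) := by
    -- The cube is stated with inverse naturality 2-cells. Composing with the 2-cells themselves on
    -- both ends turns it into the desired form.
    have := ((α_ _ _ _).hom ≫ A.map l q ◁ (μ.naturality k i).hom ≫ (α_ _ _ _).inv ≫
        (μ.naturality l q).hom ▷ B.map k i ≫ (α_ _ _ _).hom) ≫= h =≫ 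
          (A.map k t ◁ (μ.naturality l (𝟙 Z)).hom ≫ (α_ _ _ _).inv ≫
        (μ.naturality k t).hom ▷ B.map l (𝟙 Z) ≫ (α_ _ _ _).hom)
    simpa using this.symm
  have h₂ := h₁ =≫ (μ.app X ◁ (B.map k t ◁ (B.mapId l rfl).hom ≫ (ρ_ _).hom))
  simp only [Category.assoc] at h₂
  rw [μ.naturality_unit k l t] at h₂
  simpa [red] using h₂

/-- The case of `naturality_red` with identity left edge. The naturality 2-cell at this edge
consists of unit constraints and can be cancelled. -/
theorem naturality_map₂ {X Y : C} {f g : X ⟶ Y} (σ : f ⟶ g) :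
    A.map₂ hkl σ ▷ μ.app Y ≫ (μ.naturality k g).hom =
      (μ.naturality k f).hom ≫ μ.app X ◁ B.map₂ hkl σ := by
  have h := μ.naturality_red hkl ((λ_ f).hom ≫ σ)
  rw [A.red_id_left, B.red_id_left] at h
  have h₂ : (μ.naturality l (𝟙 X)).hom ▷ B.map k f ≫ (α_ _ _ _).hom ≫
      μ.app X ◁ ((B.mapId l rfl).hom ▷ B.map k f ≫ (λ_ _).hom) =
      (A.mapId l rfl).hom ▷ μ.app X ▷ B.map k f ≫ (λ_ _).hom ▷ B.map k f := by
    calc _ = ((μ.naturality l (𝟙 X)).hom ≫ μ.app X ◁ (B.mapId l rfl).hom) ▷ B.map k f ≫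
          (α_ _ _ _).hom ≫ μ.app X ◁ (λ_ _).hom := by simp
      _ = _ := by rw [μ.naturality_id]; simp
  have h₃ : A.map l (𝟙 X) ◁ (μ.naturality k f).hom ≫ (α_ _ _ _).inv ≫
      (A.mapId l rfl).hom ▷ μ.app X ▷ B.map k f ≫ (λ_ _).hom ▷ B.map k f =
      (A.mapId l rfl).hom ▷ _ ≫ (λ_ _).hom ≫ (μ.naturality k f).hom := by
    rw [← leftUnitor_naturality, ← whisker_exchange_assoc]
    simp
  simp only [Category.assoc, whiskerLeft_comp] at h₂ h
  rw [reassoc_of% h₂, reassoc_of% h₃] at h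
  rw [← cancel_epi ((α_ _ _ _).hom ≫ (A.mapId l rfl).hom ▷ (A.map k f ≫ μ.app Y) ≫ (λ_ _).hom)]
  simpa using h

/-- The case of `naturality_red` with identity bottom edge. It makes the comparison of directions
natural in the pseudofunctor, hence the unit a transformation. -/
theorem naturality_theta {X Y : C} (f : X ⟶ Y) :
    A.theta hkl f ▷ μ.app Y ≫ (μ.naturality k f).hom =
      (μ.naturality l f).hom ≫ μ.app X ◁ B.theta hkl f := by
  have h := μ.naturality_red hkl (ρ_ f).hom
  rw [A.red_rightUnitor, B.red_rightUnitor] at h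
  have h₂ := μ.naturality_unit l k f
  simp only [Category.assoc, whiskerLeft_comp] at h₂ h
  rw [reassoc_of% h₂] at h
  rw [← cancel_epi ((A.map l f ◁ (A.mapId k rfl).hom ≫ (ρ_ _).hom) ▷ μ.app Y)]
  simpa using h

/-- The transformation of pseudofunctors on `C` given by the direction `k`. -/
def toStrongTrans : A.toPseudofunctor hkl ⟶ B.toPseudofunctor hkl where
  app := μ.app
  naturality f := μ.naturality k f
  naturality_naturality σ := μ.naturality_map₂ hkl σ
  naturality_id X := μ.naturality_id k X
  naturality_comp f g := μ.naturality_comp k f g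

end Hom

end Cubical

open NFoldCat

namespace MixedPseudofunctor

variable {F G : MixedPseudofunctor (Qn n C) D} (μ : F ⟶ G)

theorem naturality_mapIdOf {X : (Qn n C).Ob} {e : (Qn n C).Edge k X X} (h : e = Edge.id k X) :
    (μ.naturality e).hom ≫ μ.app X ◁ (G.mapIdOf h).hom =
      (F.mapIdOf h).hom ▷ μ.app X ≫ (λ_ (μ.app X)).hom ≫ (ρ_ (μ.app X)).inv := by
  subst h
  rw [mapIdOf_rfl, mapIdOf_rfl, μ.naturality_id]

theorem naturality_mapCompOf {X Y Z : (Qn n C).Ob} {f : (Qn n C).Edge k X Y}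
    {g : (Qn n C).Edge k Y Z} {e : (Qn n C).Edge k X Z} (h : e = f.comp g) :
    (μ.naturality e).hom ≫ μ.app X ◁ (G.mapCompOf h).hom =
      (F.mapCompOf h).hom ▷ μ.app Z ≫ (α_ _ _ _).hom ≫ F.map f ◁ (μ.naturality g).hom ≫
        (α_ _ _ _).inv ≫ (μ.naturality f).hom ▷ G.map g ≫ (α_ _ _ _).hom := by
  subst h
  rw [mapCompOf_rfl, mapCompOf_rfl, μ.naturality_comp]

/-- The restriction of a pseudonatural transformation to objects, morphisms and squares that come
from `C`. -/
noncomputable def cubicalHom : F.cubical.Hom G.cubical where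
  app c := μ.app (qPoint n c)
  naturality k _ _ f := μ.naturality (mkEdge k f)
  naturality_id k X := naturality_mapIdOf μ (mkEdge_id k X)
  naturality_comp k _ _ _ f g := naturality_mapCompOf μ (mkEdge_comp k f g)
  naturality_sq hkl _ _ _ _ _ _ _ _ σ := μ.naturality_sq hkl _

end MixedPseudofunctor

/-- The restriction to the direction `k` of a transformation. -/
noncomputable abbrev restrictHom (hkl : k < l) {F G : MixedPseudofunctor (Qn n C) D} (μ : F ⟶ G) :
    F.cubical.toPseudofunctor hkl ⟶ G.cubical.toPseudofunctor hkl :=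
  (MixedPseudofunctor.cubicalHom μ).toStrongTrans hkl

/-- The restriction to the direction `k` of a modification. -/
noncomputable abbrev restrictHom₂ (hkl : k < l) {F G : MixedPseudofunctor (Qn n C) D} {μ ν : F ⟶ G}
    (Γ : μ ⟶ ν) : restrictHom hkl μ ⟶ restrictHom hkl ν :=
  ⟨⟨fun c => Γ.app (qPoint n c), fun f => Γ.naturality (mkEdge k f)⟩⟩

variable (C D)

/-- The 2-functor that restricts pseudofunctors on `Qⁿ C` to the direction `k`. -/
noncomputable def restrict (hkl : k < l) :
    StrictPseudofunctor (MixedPseudofunctor (Qn n C) D) (Pseudofunctor C D) :=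
  .mk'
    { obj := fun F => F.cubical.toPseudofunctor hkl
      map := fun μ => restrictHom hkl μ
      map₂ := fun Γ => restrictHom₂ hkl Γ
      map₂_id := fun _ => rfl
      map₂_comp := fun _ _ => rfl
      map_id := fun _ => rfl
      map_comp := fun _ _ => rfl
      -- Both sides agree componentwise by definition. Strictness is phrased with transports on the
      -- outside, and `eq_conj` supplies the trivial ones.
      map₂_whisker_left := fun μ _ _ Γ =>
        eq_conj (restrictHom hkl μ ◁ restrictHom₂ hkl Γ) rfl rfl
      map₂_whisker_right := fun Γ μ =>
        eq_conj (restrictHom₂ hkl Γ ▷ restrictHom hkl μ) rfl rfl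
      map₂_left_unitor := fun μ => eq_eqToHom_comp (λ_ (restrictHom hkl μ)).hom rfl
      map₂_right_unitor := fun μ => eq_eqToHom_comp (ρ_ (restrictHom hkl μ)).hom rfl
      map₂_associator := fun μ ν ξ => eq_conj
        (α_ (restrictHom hkl μ) (restrictHom hkl ν) (restrictHom hkl ξ)).hom rfl rfl }

/-- The constraints of a strict pseudofunctor are transports, hence determined by the underlying
prelax functor. -/
theorem StrictPseudofunctor.ext_toPrelaxFunctor {B : Type u₁} [Bicategory.{w₁, v₁} B]
    {C : Type u₂} [Bicategory.{w₂, v₂} C] {F G : StrictPseudofunctor B C}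
    (h : F.toPrelaxFunctor = G.toPrelaxFunctor) : F = G := by
  obtain ⟨⟨⟨F, m, c, _, _, _, _, _⟩, h₁, h₂⟩, h₃, h₄⟩ := F
  obtain ⟨⟨⟨G, m', c', _, _, _, _, _⟩, h₁', h₂'⟩, h₃', h₄'⟩ := G
  obtain rfl : F = G := h
  obtain rfl : m = m' := funext fun X => (h₂ X).trans (h₂' X).symm
  obtain rfl : @c = @c' := by
    funext X Y Z f g
    exact (h₄ f g).trans (h₄' f g).symm
  rfl

theorem qFunctor_comp_toPower (n : ℕ) :
    (qFunctor C D n).comp (MixedPseudofunctor.toPower (qPoint n)) = toPower C D :=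
  StrictPseudofunctor.ext_toPrelaxFunctor rfl

theorem restrict_comp_toPower (hkl : k < l) :
    (restrict C D hkl).comp (toPower C D) = MixedPseudofunctor.toPower (qPoint n) :=
  StrictPseudofunctor.ext_toPrelaxFunctor rfl

end Restriction

/-! ### Comparison of all directions with the first one -/

section Comparison

variable {m : ℕ} {C : Type u₁} [Bicategory.{w₁, v₁} C] [Strict C]
  {D : Type u₂} [Bicategory.{w₂, v₂} D]

namespace Cubical

variable (A : Cubical (m + 2) C D)

/-- The comparison of the direction `k` with the first direction. -/
def cmp (k : Fin (m + 2)) {X Y : C} (f : X ⟶ Y) : A.map k f ≅ A.map 0 f :=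
  Fin.cases (motive := fun k => A.map k f ≅ A.map 0 f) (Iso.refl _)
    (fun k => A.thetaIso (Fin.succ_pos k) f) k

theorem cmp_id (k : Fin (m + 2)) {X : C} {e : X ⟶ X} (h : e = 𝟙 X) :
    (A.cmp k e).hom ≫ (A.mapId 0 h).hom = (A.mapId k h).hom := by
  subst h
  cases k using Fin.cases with
  | zero => simp [cmp]
  | succ k => simp [cmp, theta_id]

theorem cmp_comp (k : Fin (m + 2)) {X Y Z : C} {f : X ⟶ Y} {g : Y ⟶ Z} {e : X ⟶ Z}
    (h : e = f ≫ g) :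
    (A.cmp k e).hom ≫ (A.mapComp 0 h).hom =
      (A.mapComp k h).hom ≫ A.map k f ◁ (A.cmp k g).hom ≫ (A.cmp k f).hom ▷ A.map 0 g := by
  cases k using Fin.cases with
  | zero => simp [cmp]
  | succ k => simp [cmp, theta_comp]

/-- Every positive direction is `1` or larger than `1`, and in the second case `map₂_eq_map₂`
applies to `0 < 1 < l`. -/
theorem map₂_zero (l : Fin (m + 2)) (h : 0 < l) {X Y : C} {f g : X ⟶ Y} (σ : f ⟶ g) :
    A.map₂ h σ = A.map₂ (Fin.zero_lt_one) σ := by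
  obtain rfl | h' : l = 1 ∨ 1 < l := (Fin.one_le_of_ne_zero h.ne').eq_or_lt.imp Eq.symm id
  · rfl
  · exact A.map₂_eq_map₂ Fin.zero_lt_one h' σ

/-- The 2-cells of all squares are determined by direction `0`. For `k = 0` this is `sq_theta`,
together with the independence of `map₂` of the vertical direction. For `k > 0`, `sq_theta_trans`
first replaces the square in the directions `k, l` by the one in `0, l`. -/
theorem cmp_sq {k l : Fin (m + 2)} (hkl : k < l) {X Y Z W : C} {q : X ⟶ Z} {i : Z ⟶ W}
    {j : X ⟶ Y} {p : Y ⟶ W} (σ : q ≫ i ⟶ j ≫ p) :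
    A.sq hkl σ ≫ (A.cmp k j).hom ▷ A.map l p ≫ A.map 0 j ◁ (A.cmp l p).hom =
      A.map l q ◁ (A.cmp k i).hom ≫ (A.cmp l q).hom ▷ A.map 0 i ≫
        (A.mapComp 0 rfl).inv ≫ A.map₂ Fin.zero_lt_one σ ≫ (A.mapComp 0 rfl).hom := by
  have hl (h : 0 < l) : A.sq h σ ≫ A.map 0 j ◁ (A.cmp l p).hom =
      (A.cmp l q).hom ▷ A.map 0 i ≫ (A.mapComp 0 rfl).inv ≫ A.map₂ Fin.zero_lt_one σ ≫ (A.mapComp 0 rfl).hom := by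
    have := A.sq_theta h σ
    rw [A.map₂_zero l h] at this
    cases l using Fin.cases with
    | zero => exact (h.ne rfl).elim
    | succ l => exact this
  cases k using Fin.cases with
  | zero => simpa [cmp] using hl hkl
  | succ k =>
    have := A.sq_theta_trans (Fin.succ_pos k) hkl σ
    simp only [cmp, Fin.cases_succ, thetaIso_hom] at hl ⊢
    rw [reassoc_of% this, hl]

end Cubical

open NFoldCat

namespace MixedPseudofunctor

variable (F : MixedPseudofunctor (Qn (m + 2) C) D)

/-- The comparison of a morphism of `Qⁿ C` with the corresponding one in the first direction. -/
noncomputable def cmp {k : Fin (m + 2)} {x y : C}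
    {f : (Qn (m + 2) C).Edge k (qPoint _ x) (qPoint _ y)} {g : x ⟶ y} (h : f = mkEdge k g) :
    F.map f ≅ F.cubical.map 0 g :=
  eqToIso (by rw [h]; rfl) ≪≫ F.cubical.cmp k g

theorem cmp_rfl {k : Fin (m + 2)} {x y : C} (g : x ⟶ y) :
    F.cmp (rfl : mkEdge k g = _) = F.cubical.cmp k g := by
  ext
  exact Category.id_comp _

variable {k l : Fin (m + 2)}

theorem cmp_id {x : C} {e : (Qn (m + 2) C).Edge k (qPoint _ x) (qPoint _ x)} {g : x ⟶ x}
    (h : e = mkEdge k g) (he : e = Edge.id k _) (hg : g = 𝟙 x) :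
    (F.cmp h).hom ≫ (F.cubical.mapId 0 hg).hom = (F.mapIdOf he).hom := by
  subst h
  rw [cmp_rfl]
  exact F.cubical.cmp_id k hg

theorem cmp_comp {x y z : C} {f : (Qn (m + 2) C).Edge k (qPoint _ x) (qPoint _ y)}
    {g : (Qn (m + 2) C).Edge k (qPoint _ y) (qPoint _ z)}
    {e : (Qn (m + 2) C).Edge k (qPoint _ x) (qPoint _ z)} {f' : x ⟶ y} {g' : y ⟶ z} {e' : x ⟶ z}
    (hf : f = mkEdge k f') (hg : g = mkEdge k g') (he : e = mkEdge k e') (h : e = f.comp g)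
    (h' : e' = f' ≫ g') :
    (F.cmp he).hom ≫ (F.cubical.mapComp 0 h').hom =
      (F.mapCompOf h).hom ≫ F.map f ◁ (F.cmp hg).hom ≫ (F.cmp hf).hom ▷ F.cubical.map 0 g' := by
  subst hf hg he
  rw [cmp_rfl, cmp_rfl, cmp_rfl]
  exact F.cubical.cmp_comp k h'

/-- The edges and the 2-cell are tied to data of `C` by equations, since an edge equals the one made
from its underlying morphism only propositionally. Substitution reduces to the statement for
`cubical`. -/
theorem cmp_sq (hkl : k < l) {x y z w : C} {j : (Qn (m + 2) C).Edge k (qPoint _ x) (qPoint _ y)}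
    {q : (Qn (m + 2) C).Edge l (qPoint _ x) (qPoint _ z)}
    {i : (Qn (m + 2) C).Edge k (qPoint _ z) (qPoint _ w)}
    {p : (Qn (m + 2) C).Edge l (qPoint _ y) (qPoint _ w)} {s : (Qn (m + 2) C).cell {k, l}}
    (hs : IsSquare k l j q i p s) {q' : x ⟶ z} {i' : z ⟶ w} {j' : x ⟶ y} {p' : y ⟶ w}
    {σ : q' ≫ i' ⟶ j' ≫ p'} (hj : j = mkEdge k j') (hq : q = mkEdge l q') (hi : i = mkEdge k i')
    (hp : p = mkEdge l p') (hσ : HEq (sqCell hkl hs) σ) :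
    F.sq hkl hs ≫ (F.cmp hj).hom ▷ F.map p ≫ F.cubical.map 0 j' ◁ (F.cmp hp).hom =
      F.map q ◁ (F.cmp hi).hom ≫ (F.cmp hq).hom ▷ F.cubical.map 0 i' ≫
        mapSq (F.cubical.toPseudofunctor Fin.zero_lt_one) σ := by
  subst hj hq hi hp
  rw [cmp_rfl, cmp_rfl, cmp_rfl, cmp_rfl, F.sq_eq_sqOf hkl hs hσ]
  exact F.cubical.cmp_sq hkl σ

end MixedPseudofunctor

end Comparison

/-! ### Transformations with identity components -/

section Icons

variable {D : Type u₂} [Bicategory.{w₂, v₂} D]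

/-- An invertible 2-cell as a naturality constraint for identity components. -/
@[simps!]
def icon {X Y : D} {f g : X ⟶ Y} (e : f ≅ g) : f ≫ 𝟙 Y ≅ 𝟙 X ≫ g := ρ_ f ≪≫ e ≪≫ (λ_ g).symm

theorem icon_id {X : D} {a b : X ⟶ X} (e : a ≅ b) {u : a ⟶ 𝟙 X} {v : b ⟶ 𝟙 X} (h : e.hom ≫ v = u) :
    (icon e).hom ≫ 𝟙 X ◁ v = u ▷ 𝟙 X ≫ (λ_ (𝟙 X)).hom ≫ (ρ_ (𝟙 X)).inv := by
  subst h
  simp [unitors_equal, unitors_inv_equal]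

theorem icon_id_symm {X : D} {a b : X ⟶ X} (e : a ≅ b) {u : a ⟶ 𝟙 X} {v : b ⟶ 𝟙 X}
    (h : e.hom ≫ v = u) :
    (icon e.symm).hom ≫ 𝟙 X ◁ u = v ▷ 𝟙 X ≫ (λ_ (𝟙 X)).hom ≫ (ρ_ (𝟙 X)).inv :=
  icon_id e.symm (by simp [← h])

/-- With identity components the composition axiom loses all its whiskerings by components, and
compatibility of the invertible 2-cells with the composition constraints is what remains. -/
theorem icon_comp {X Y Z : D} {f f' : X ⟶ Y} {g g' : Y ⟶ Z} {h h' : X ⟶ Z} (ef : f ≅ f')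
    (eg : g ≅ g') (eh : h ≅ h') {c : h ⟶ f ≫ g} {c' : h' ⟶ f' ≫ g'}
    (H : eh.hom ≫ c' = c ≫ f ◁ eg.hom ≫ ef.hom ▷ g') :
    (icon eh).hom ≫ 𝟙 X ◁ c' = c ▷ 𝟙 Z ≫ (α_ _ _ _).hom ≫ f ◁ (icon eg).hom ≫ (α_ _ _ _).inv ≫
      (icon ef).hom ▷ g' ≫ (α_ _ _ _).hom := by
  simp only [icon_hom, Category.assoc, ← leftUnitor_inv_naturality, reassoc_of% H]
  simp

/-- The compatibility `H` can be inverted, so that the inverse family defines a transformation in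
the other direction. -/
theorem icon_comp_symm {X Y Z : D} {f f' : X ⟶ Y} {g g' : Y ⟶ Z} {h h' : X ⟶ Z} (ef : f ≅ f')
    (eg : g ≅ g') (eh : h ≅ h') {c : h ⟶ f ≫ g} {c' : h' ⟶ f' ≫ g'}
    (H : eh.hom ≫ c' = c ≫ f ◁ eg.hom ≫ ef.hom ▷ g') :
    (icon eh.symm).hom ≫ 𝟙 X ◁ c = c' ▷ 𝟙 Z ≫ (α_ _ _ _).hom ≫ f' ◁ (icon eg.symm).hom ≫
      (α_ _ _ _).inv ≫ (icon ef.symm).hom ▷ g ≫ (α_ _ _ _).hom := by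
  refine icon_comp _ _ _ ?_
  rw [Iso.symm_hom, Iso.inv_comp_eq, Iso.symm_hom, Iso.symm_hom, reassoc_of% H,
    ← whisker_exchange_assoc]
  simp

theorem sq_inv {X Y Z W : D} {t t' : X ⟶ Y} {q q' : X ⟶ Z} {b b' : Z ⟶ W} {r r' : Y ⟶ W}
    (et : t ≅ t') (eq : q ≅ q') (eb : b ≅ b') (er : r ≅ r') {S : q ≫ b ⟶ t ≫ r}
    {S' : q' ≫ b' ⟶ t' ≫ r'}
    (H : S ≫ et.hom ▷ r ≫ t' ◁ er.hom = q ◁ eb.hom ≫ eq.hom ▷ b' ≫ S') :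
    S' ≫ t' ◁ er.inv ≫ et.inv ▷ r = eq.inv ▷ b' ≫ q ◁ eb.inv ≫ S := by
  have := (eq.inv ▷ b' ≫ q ◁ eb.inv) ≫= H =≫ (t' ◁ er.inv ≫ et.inv ▷ r)
  simpa using this.symm

/-- With identity components the cube on a square reduces to `H`, read with inverses because the
cube uses inverse naturality 2-cells. -/
theorem icon_sq {X Y Z W : D} {t t' : X ⟶ Y} {q q' : X ⟶ Z} {b b' : Z ⟶ W} {r r' : Y ⟶ W}
    (et : t ≅ t') (eq : q ≅ q') (eb : b ≅ b') (er : r ≅ r') {S : q ≫ b ⟶ t ≫ r}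
    {S' : q' ≫ b' ⟶ t' ≫ r'}
    (H : S ≫ et.hom ▷ r ≫ t' ◁ er.hom = q ◁ eb.hom ≫ eq.hom ▷ b' ≫ S') :
    CommCube S S' (icon et).inv (icon eb).inv (icon eq).inv (icon er).inv := by
  have H' := sq_inv et eq eb er H
  rw [whisker_exchange] at H'
  unfold CommCube
  simp only [icon_inv]
  calc _ = (λ_ _).hom ≫ (S' ≫ et.inv ▷ r' ≫ t ◁ er.inv) ≫ t ◁ (ρ_ _).inv := by simp
    _ = _ := by rw [H']; simp

theorem icon_sq_symm {X Y Z W : D} {t t' : X ⟶ Y} {q q' : X ⟶ Z} {b b' : Z ⟶ W} {r r' : Y ⟶ W}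
    (et : t ≅ t') (eq : q ≅ q') (eb : b ≅ b') (er : r ≅ r') {S : q ≫ b ⟶ t ≫ r}
    {S' : q' ≫ b' ⟶ t' ≫ r'}
    (H : S ≫ et.hom ▷ r ≫ t' ◁ er.hom = q ◁ eb.hom ≫ eq.hom ▷ b' ≫ S') :
    CommCube S' S (icon et.symm).inv (icon eb.symm).inv (icon eq.symm).inv (icon er.symm).inv := by
  refine icon_sq _ _ _ _ ?_
  have H' := sq_inv et eq eb er H
  rwa [whisker_exchange, ← whisker_exchange_assoc] at H'

end Icons

/-! ### Elimination of objects of `Qⁿ C` to objects of `C` -/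

section Points

open NFoldCat

variable {n : ℕ} {C : Type u₁} [Bicategory.{w₁, v₁} C] [Strict C]
  {D : Type u₂} [Bicategory.{w₂, v₂} D]

/-- Elimination of the objects of `Qⁿ C` into families over the objects of `C`. -/
def pointElim {P : (Qn n C).Ob → Sort*} (h : ∀ x, P (qPoint n x)) (X : (Qn n C).Ob) : P X :=
  Eq.rec (motive := fun X _ => P X) (h (pointObj X)) (qPoint_pointObj n X)

/-- Elimination of the morphisms of `Qⁿ C` into families over morphisms between objects of `C`. -/
def edgeElim {k : Fin n} {P : ∀ X Y, (Qn n C).Edge k X Y → Sort*}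
    (h : ∀ x y (f : (Qn n C).Edge k (qPoint n x) (qPoint n y)), P _ _ f) {X Y : (Qn n C).Ob}
    (f : (Qn n C).Edge k X Y) : P X Y f :=
  Eq.rec (motive := fun X _ => ∀ f : (Qn n C).Edge k X Y, P X Y f)
    (Eq.rec (motive := fun Y _ => ∀ f : (Qn n C).Edge k (qPoint n (pointObj X)) Y, P _ Y f)
      (h (pointObj X) (pointObj Y)) (qPoint_pointObj n Y)) (qPoint_pointObj n X) f

theorem exists_qPoint (X : (Qn n C).Ob) : ∃ x, X = qPoint n x := ⟨_, (qPoint_pointObj n X).symm⟩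

namespace MixedPseudofunctor

variable {F G : MixedPseudofunctor (Qn n C) D}

/-- A transformation of pseudofunctors on `Qⁿ C` from its components at the objects of `C`. -/
noncomputable def transOfPoints (app : ∀ x : C, F.obj (qPoint n x) ⟶ G.obj (qPoint n x))
    (naturality : ∀ {k : Fin n} {x y : C} (f : (Qn n C).Edge k (qPoint n x) (qPoint n y)),
      F.map f ≫ app y ≅ app x ≫ G.map f)
    (naturality_id : ∀ (k : Fin n) (x : C),
      (naturality (Edge.id k (qPoint n x))).hom ≫ app x ◁ (G.mapId k _).hom =
        (F.mapId k _).hom ▷ app x ≫ (λ_ (app x)).hom ≫ (ρ_ (app x)).inv)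
    (naturality_comp : ∀ {k : Fin n} {x y z : C} (f : (Qn n C).Edge k (qPoint n x) (qPoint n y))
      (g : (Qn n C).Edge k (qPoint n y) (qPoint n z)),
      (naturality (f.comp g)).hom ≫ app x ◁ (G.mapComp f g).hom =
        (F.mapComp f g).hom ▷ app z ≫ (α_ _ _ _).hom ≫ F.map f ◁ (naturality g).hom ≫
          (α_ _ _ _).inv ≫ (naturality f).hom ▷ G.map g ≫ (α_ _ _ _).hom)
    (naturality_sq : ∀ {k l : Fin n} (hkl : k < l) {x y z w : C}
      {top : (Qn n C).Edge k (qPoint n x) (qPoint n y)}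
      {left : (Qn n C).Edge l (qPoint n x) (qPoint n z)}
      {bottom : (Qn n C).Edge k (qPoint n z) (qPoint n w)}
      {right : (Qn n C).Edge l (qPoint n y) (qPoint n w)} {s : (Qn n C).cell {k, l}}
      (hs : IsSquare k l top left bottom right s),
      CommCube (F.sq hkl hs) (G.sq hkl hs) (naturality top).inv (naturality bottom).inv
        (naturality left).inv (naturality right).inv) : F ⟶ G where
  app := pointElim (P := fun X => F.obj X ⟶ G.obj X) app
  naturality {k _ _} f := edgeElim (P := fun X Y f =>
    F.map f ≫ pointElim (P := fun X => F.obj X ⟶ G.obj X) app Y ≅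
      pointElim (P := fun X => F.obj X ⟶ G.obj X) app X ≫ G.map f) (fun _ _ f => naturality f) f
  naturality_id k X := by
    -- At `qPoint n x` the eliminators compute: `pointObj (qPoint n x)` is `x` by definition, and
    -- recursion along a reflexive equation is the identity by definition.
    obtain ⟨x, rfl⟩ := exists_qPoint X
    exact naturality_id k x
  naturality_comp {k X Y Z} f g := by
    obtain ⟨x, rfl⟩ := exists_qPoint X
    obtain ⟨y, rfl⟩ := exists_qPoint Y
    obtain ⟨z, rfl⟩ := exists_qPoint Z
    exact naturality_comp f g
  naturality_sq hkl X Y Z W _ _ _ _ _ hs := by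
    obtain ⟨x, rfl⟩ := exists_qPoint X
    obtain ⟨y, rfl⟩ := exists_qPoint Y
    obtain ⟨z, rfl⟩ := exists_qPoint Z
    obtain ⟨w, rfl⟩ := exists_qPoint W
    exact naturality_sq hkl hs

/-- An invertible modification from its components at the objects of `C`. -/
noncomputable def isoOfPoints {μ ν : F ⟶ G} (e : ∀ x : C, μ.app (qPoint n x) ≅ ν.app (qPoint n x))
    (h : ∀ {k : Fin n} {x y : C} (f : (Qn n C).Edge k (qPoint n x) (qPoint n y)),
      F.map f ◁ (e y).hom ≫ (ν.naturality f).hom =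
        (μ.naturality f).hom ≫ (e x).hom ▷ G.map f) : μ ≅ ν :=
  isoMk (fun X => pointElim (P := fun X => μ.app X ≅ ν.app X) e X) fun {k X Y} f => by
    obtain ⟨x, rfl⟩ := exists_qPoint X
    obtain ⟨y, rfl⟩ := exists_qPoint Y
    exact h f

theorem modif_ext {μ ν : F ⟶ G} {Γ Γ' : μ ⟶ ν}
    (h : ∀ x, Γ.app (qPoint n x) = Γ'.app (qPoint n x)) : Γ = Γ' :=
  Modif.ext (funext fun X => by
    obtain ⟨x, rfl⟩ := exists_qPoint X
    exact h x)

end MixedPseudofunctor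

end Points

/-! ### The comparison of a pseudofunctor with the extension of its first direction -/

section Unit

open NFoldCat

variable {m : ℕ} {C : Type u₁} [Bicategory.{w₁, v₁} C] [Strict C]
  {D : Type u₂} [Bicategory.{w₂, v₂} D]

namespace Cubical

variable {n : ℕ} (A : Cubical n C D) {k l : Fin n} (hkl : k < l)

theorem mapIdOf_toPseudofunctor {X : C} {e : X ⟶ X} (h : e = 𝟙 X) :
    mapIdOf (A.toPseudofunctor hkl) h = A.mapId k h := by
  subst h
  exact mapIdOf_rfl _ _ _

theorem mapCompOf_toPseudofunctor {X Y Z : C} {f : X ⟶ Y} {g : Y ⟶ Z} {e : X ⟶ Z} (h : e = f ≫ g) :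
    mapCompOf (A.toPseudofunctor hkl) h = A.mapComp k h := by
  subst h
  exact mapCompOf_rfl _ _ _ _

end Cubical

namespace MixedPseudofunctor

variable (F : MixedPseudofunctor (Qn (m + 2) C) D) {k l : Fin (m + 2)}

/-- The pseudofunctor on `Qⁿ C` that comes from the restriction of `F` to the first direction. -/
noncomputable abbrev extend : MixedPseudofunctor (Qn (m + 2) C) D :=
  qObj (F.cubical.toPseudofunctor Fin.zero_lt_one) (m + 2)


variable {x y z w : C}

/-- The comparison of `F` with the extension of its first direction on a morphism. -/
noncomputable def extendIso (f : (Qn (m + 2) C).Edge k (qPoint _ x) (qPoint _ y)) :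
    F.map f ≅ F.extend.map f := F.cmp (mkEdge_edgeHom f).symm

/-- The constraint of the extension is the one of the restricted pseudofunctor, transported along an
equation; `mapIdOf_toPseudofunctor` identifies it with the one in `cmp_id`. -/
theorem extendIso_id (k : Fin (m + 2)) (x : C) :
    (F.extendIso (Edge.id k (qPoint _ x))).hom ≫ (F.extend.mapId k (qPoint _ x)).hom =
      (F.mapId k (qPoint _ x)).hom := by
  have h := F.cmp_id (mkEdge_edgeHom (Edge.id k (qPoint (m + 2) x))).symm rfl (edgeHom_id _)
  rw [mapIdOf_rfl] at h
  refine Eq.trans ?_ h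
  congr 2
  exact F.cubical.mapIdOf_toPseudofunctor _ _

theorem extendIso_comp (f : (Qn (m + 2) C).Edge k (qPoint _ x) (qPoint _ y))
    (g : (Qn (m + 2) C).Edge k (qPoint _ y) (qPoint _ z)) :
    (F.extendIso (f.comp g)).hom ≫ (F.extend.mapComp f g).hom =
      (F.mapComp f g).hom ≫ F.map f ◁ (F.extendIso g).hom ≫ (F.extendIso f).hom ▷ F.extend.map g := by
  have h := F.cmp_comp (mkEdge_edgeHom f).symm (mkEdge_edgeHom g).symm (mkEdge_edgeHom (f.comp g)).symm
    rfl (edgeHom_comp f g)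
  rw [mapCompOf_rfl] at h
  refine Eq.trans ?_ h
  congr 2
  exact F.cubical.mapCompOf_toPseudofunctor _ _

theorem extendIso_sq (hkl : k < l) {t : (Qn (m + 2) C).Edge k (qPoint _ x) (qPoint _ y)}
    {q : (Qn (m + 2) C).Edge l (qPoint _ x) (qPoint _ z)}
    {b : (Qn (m + 2) C).Edge k (qPoint _ z) (qPoint _ w)}
    {r : (Qn (m + 2) C).Edge l (qPoint _ y) (qPoint _ w)} {s : (Qn (m + 2) C).cell {k, l}}
    (hs : IsSquare k l t q b r s) :
    F.sq hkl hs ≫ (F.extendIso t).hom ▷ F.map r ≫ F.extend.map t ◁ (F.extendIso r).hom =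
      F.map q ◁ (F.extendIso b).hom ≫ (F.extendIso q).hom ▷ F.extend.map b ≫ F.extend.sq hkl hs :=
  -- The 2-cell of `C` is taken to be the one underlying the square, to which `qObj` applies the
  -- restricted pseudofunctor.
  F.cmp_sq hkl hs _ _ _ _ HEq.rfl

/-- The comparison of `F` with the extension of its first direction. -/
noncomputable def toExtend : F ⟶ F.extend :=
  transOfPoints (fun x => 𝟙 (F.obj (qPoint _ x))) (fun f => icon (F.extendIso f))
    (fun k x => icon_id _ (F.extendIso_id k x))
    (fun f g => icon_comp _ _ _ (F.extendIso_comp f g))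
    (fun hkl _ _ _ _ _ _ _ _ _ hs => icon_sq _ _ _ _ (F.extendIso_sq hkl hs))

/-- The comparison of the extension of the first direction of `F` with `F`. -/
noncomputable def ofExtend : F.extend ⟶ F :=
  transOfPoints (fun x => 𝟙 (F.obj (qPoint _ x))) (fun f => icon (F.extendIso f).symm)
    (fun k x => icon_id_symm _ (F.extendIso_id k x))
    (fun f g => icon_comp_symm _ _ _ (F.extendIso_comp f g))
    (fun hkl _ _ _ _ _ _ _ _ _ hs => icon_sq_symm _ _ _ _ (F.extendIso_sq hkl hs))

end MixedPseudofunctor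

end Unit

/-! ### Modification axioms for identity components -/

section Icons

variable {D : Type u₂} [Bicategory.{w₂, v₂} D]

/-- The constraint for the compatibility of identity components with a 1-cell. -/
@[simps!]
def idSwap {X Y : D} (a : X ⟶ Y) : a ≫ 𝟙 Y ≅ 𝟙 X ≫ a := ρ_ a ≪≫ (λ_ a).symm

/-- The shape of the modification axiom for the naturality constraint of a transformation with
identity components. After removal of unitors only the naturality `h` of the comparison is left. -/
theorem idSwap_icon {X Y X' Y' : D} {f g : X ⟶ Y} {f' g' : X' ⟶ Y'} {a : X ⟶ X'} {b : Y ⟶ Y'}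
    (e : f ≅ g) (e' : f' ≅ g') {N : f ≫ b ⟶ a ≫ f'} {N' : g ≫ b ⟶ a ≫ g'}
    (h : e.hom ▷ b ≫ N' = N ≫ a ◁ e'.hom) :
    f ◁ (idSwap b).hom ≫ (α_ _ _ _).inv ≫ (icon e).hom ▷ b ≫ (α_ _ _ _).hom ≫ 𝟙 X ◁ N' ≫
      (α_ _ _ _).inv = ((α_ _ _ _).inv ≫ N ▷ 𝟙 Y' ≫ (α_ _ _ _).hom ≫ a ◁ (icon e').hom ≫
        (α_ _ _ _).inv) ≫ (idSwap a).hom ▷ g' := by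
  simp [reassoc_of% h]

theorem inv_whisker_eq {X Y X' Y' : D} {f g : X ⟶ Y} {f' g' : X' ⟶ Y'} {a : X ⟶ X'} {b : Y ⟶ Y'}
    {e : f ≅ g} {e' : f' ≅ g'} {N : f ≫ b ⟶ a ≫ f'} {N' : g ≫ b ⟶ a ≫ g'}
    (h : e.hom ▷ b ≫ N' = N ≫ a ◁ e'.hom) : e.inv ▷ b ≫ N = N' ≫ a ◁ e'.inv := by
  have := e.inv ▷ b ≫= h =≫ a ◁ e'.inv
  simpa using this.symm

theorem idSwap_naturality {X Y : D} {a b : X ⟶ Y} (s : a ⟶ b) :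
    s ▷ 𝟙 Y ≫ (idSwap b).hom = (idSwap a).hom ≫ 𝟙 X ◁ s := by
  simp

/-- The 2-cells `s` and `t` stand for components of unit constraints of strict 2-functors, which are
known to be identities only by an equation. -/
theorem idSwap_id (X : D) {s t : 𝟙 X ⟶ 𝟙 X} (hs : s = 𝟙 _) (ht : t = 𝟙 _) :
    (idSwap (𝟙 X)).hom ≫ 𝟙 X ◁ t = s ▷ 𝟙 X ≫ (λ_ (𝟙 X)).hom ≫ (ρ_ (𝟙 X)).inv := by
  simp [hs, ht, unitors_equal, unitors_inv_equal]

theorem idSwap_comp {X Y Z : D} (a : X ⟶ Y) (b : Y ⟶ Z) {s t : a ≫ b ⟶ a ≫ b} (hs : s = 𝟙 _)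
    (ht : t = 𝟙 _) : (idSwap (a ≫ b)).hom ≫ 𝟙 X ◁ t = s ▷ 𝟙 Z ≫ (α_ _ _ _).hom ≫
      a ◁ (idSwap b).hom ≫ (α_ _ _ _).inv ≫ (idSwap a).hom ▷ b ≫ (α_ _ _ _).hom := by
  simp [hs, ht]

theorem idSwap_comp_idSwap {X Y : D} (a : X ⟶ Y) :
    a ◁ (λ_ (𝟙 Y)).hom ≫ (ρ_ a).hom ≫ (λ_ a).inv =
      ((α_ _ _ _).inv ≫ (idSwap a).hom ▷ 𝟙 Y ≫ (α_ _ _ _).hom ≫ 𝟙 X ◁ (idSwap a).hom ≫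
        (α_ _ _ _).inv) ≫ (λ_ (𝟙 X)).hom ▷ a := by
  simp [unitors_equal]

/-- The strictness of `D` enters here and in `leftUnitor_eq`: unitors become transports, hence
identities over the base. -/
theorem idSwap_eq [Strict D] {X Y : D} (a : X ⟶ Y) : ∃ h, (idSwap a).hom = eqToHom h :=
  ⟨(Strict.comp_id a).trans (Strict.id_comp a).symm, by
    simp [Strict.rightUnitor_eqToIso, Strict.leftUnitor_eqToIso]⟩

theorem leftUnitor_eq [Strict D] {X Y : D} (a : X ⟶ Y) : ∃ h, (λ_ a).hom = eqToHom h :=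
  ⟨Strict.id_comp a, by simp [Strict.leftUnitor_eqToIso]⟩

/-- The naturality constraints of the composite of two inverse icons cancel, so the unitors of the
identity components form a modification to the identity. -/
theorem icon_comp_icon_symm {X Y : D} {f g : X ⟶ Y} (e : f ≅ g) :
    f ◁ (λ_ (𝟙 Y)).hom ≫ (ρ_ f).hom ≫ (λ_ f).inv =
      ((α_ _ _ _).inv ≫ (icon e).hom ▷ 𝟙 Y ≫ (α_ _ _ _).hom ≫ 𝟙 X ◁ (icon e.symm).hom ≫
        (α_ _ _ _).inv) ≫ (λ_ (𝟙 X)).hom ▷ f := by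
  simp [icon, unitors_equal]

end Icons

/-! ### The unit of the equivalence -/

section Unit

open NFoldCat

variable {m : ℕ} {C : Type u₁} [Bicategory.{w₁, v₁} C] [Strict C]
  {D : Type u₂} [Bicategory.{w₂, v₂} D]

/-- Trivial for `k = 0`, and otherwise the naturality of `theta`. -/
theorem Cubical.Hom.naturality_cmp {A B : Cubical (m + 2) C D} (μ : A.Hom B) (k : Fin (m + 2))
    {X Y : C} (f : X ⟶ Y) :
    (A.cmp k f).hom ▷ μ.app Y ≫ (μ.naturality 0 f).hom =
      (μ.naturality k f).hom ≫ μ.app X ◁ (B.cmp k f).hom := by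
  cases k using Fin.cases with
  | zero => simp [cmp]
  | succ k => exact μ.naturality_theta (Fin.succ_pos k) f

namespace MixedPseudofunctor

variable {F G : MixedPseudofunctor (Qn (m + 2) C) D} (μ : F ⟶ G) {k : Fin (m + 2)} {x y : C}

theorem naturality_cmp {f : (Qn (m + 2) C).Edge k (qPoint _ x) (qPoint _ y)} {g : x ⟶ y}
    (h : f = mkEdge k g) :
    (F.cmp h).hom ▷ μ.app _ ≫ (μ.naturality (mkEdge 0 g)).hom =
      (μ.naturality f).hom ≫ μ.app _ ◁ (G.cmp h).hom := by
  subst h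
  rw [cmp_rfl, cmp_rfl]
  exact (cubicalHom μ).naturality_cmp k g

/-- The extension of the restriction of a transformation to the first direction. -/
noncomputable abbrev extendHom : F.extend ⟶ G.extend :=
  qMap (m + 2) (restrictHom Fin.zero_lt_one μ)

/-- The compatibility of `toExtend` with a transformation. -/
noncomputable def toExtendNaturality : μ ≫ G.toExtend ≅ F.toExtend ≫ extendHom μ :=
  isoOfPoints (fun x => idSwap (μ.app (qPoint _ x))) fun f =>
    idSwap_icon (F.extendIso f) (G.extendIso f) (naturality_cmp μ (mkEdge_edgeHom f).symm)

/-- The compatibility of `ofExtend` with a transformation. -/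
noncomputable def ofExtendNaturality : extendHom μ ≫ G.ofExtend ≅ F.ofExtend ≫ μ :=
  isoOfPoints (fun x => idSwap (μ.app (qPoint _ x))) fun {k x y} f =>
    idSwap_icon (F.extendIso f).symm (G.extendIso f).symm (by
      have h : (F.extendIso f).hom ▷ μ.app (qPoint _ y) ≫ (μ.naturality (mkEdge 0 (edgeHom f))).hom =
        (μ.naturality f).hom ≫ μ.app (qPoint _ x) ◁ (G.extendIso f).hom :=
        naturality_cmp μ (mkEdge_edgeHom f).symm
      exact inv_whisker_eq h)

/-- `toExtend` and `ofExtend` are mutually inverse. -/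
noncomputable def toExtendOfExtend (F : MixedPseudofunctor (Qn (m + 2) C) D) :
    F.toExtend ≫ F.ofExtend ≅ 𝟙 F :=
  isoOfPoints (fun x => λ_ (𝟙 (F.obj (qPoint _ x)))) fun f => icon_comp_icon_symm (F.extendIso f)

/-- `ofExtend` and `toExtend` are mutually inverse. -/
noncomputable def ofExtendToExtend (F : MixedPseudofunctor (Qn (m + 2) C) D) :
    F.ofExtend ≫ F.toExtend ≅ 𝟙 F.extend :=
  isoOfPoints (fun x => λ_ (𝟙 (F.obj (qPoint _ x)))) fun f =>
    icon_comp_icon_symm (F.extendIso f).symm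

variable (C D m)

/-- The unit of the equivalence, from a pseudofunctor on `Qⁿ C` to the extension of its first
direction. -/
noncomputable def unit : (StrictPseudofunctor.id (MixedPseudofunctor (Qn (m + 2) C) D)).toPseudofunctor ⟶
    ((restrict C D (Fin.zero_lt_one (n := m))).comp (qFunctor C D (m + 2))).toPseudofunctor where
  app F := F.toExtend
  naturality μ := toExtendNaturality μ
  -- Equations between modifications are checked at the objects `qPoint _ x`, where the components
  -- of the unit are identities by computation.
  naturality_naturality Γ := modif_ext fun x => idSwap_naturality (Γ.app (qPoint _ x))
  naturality_id F := modif_ext fun x => idSwap_id (F.obj (qPoint _ x)) rfl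
    -- The unit constraint of a strict 2-functor is a transport along an equation that holds by
    -- definition here, so its component is an identity.
    (congrArg (fun e => Modif.app (Iso.hom e) (qPoint (m + 2) x))
      (((restrict C D (Fin.zero_lt_one (n := m))).comp (qFunctor C D (m + 2))).mapId_eq_eqToIso F))
  naturality_comp μ ν := modif_ext fun x =>
    idSwap_comp (μ.app (qPoint _ x)) (ν.app (qPoint _ x)) rfl
    (congrArg (fun e => Modif.app (Iso.hom e) (qPoint (m + 2) x))
      (((restrict C D (Fin.zero_lt_one (n := m))).comp
        (qFunctor C D (m + 2))).mapComp_eq_eqToIso μ ν))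

/-- The inverse of the unit of the equivalence. -/
noncomputable def unitInv :
    ((restrict C D (Fin.zero_lt_one (n := m))).comp (qFunctor C D (m + 2))).toPseudofunctor ⟶
      (StrictPseudofunctor.id (MixedPseudofunctor (Qn (m + 2) C) D)).toPseudofunctor where
  app F := F.ofExtend
  naturality μ := ofExtendNaturality μ
  naturality_naturality Γ := modif_ext fun x => idSwap_naturality (Γ.app (qPoint _ x))
  naturality_id F := modif_ext fun x => idSwap_id (F.obj (qPoint _ x))
    (congrArg (fun e => Modif.app (Iso.hom e) (qPoint (m + 2) x))
      (((restrict C D (Fin.zero_lt_one (n := m))).comp (qFunctor C D (m + 2))).mapId_eq_eqToIso F))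
    rfl
  naturality_comp μ ν := modif_ext fun x =>
    idSwap_comp (μ.app (qPoint _ x)) (ν.app (qPoint _ x))
    (congrArg (fun e => Modif.app (Iso.hom e) (qPoint (m + 2) x))
      (((restrict C D (Fin.zero_lt_one (n := m))).comp
        (qFunctor C D (m + 2))).mapComp_eq_eqToIso μ ν)) rfl

/-- `unit` followed by `unitInv` is isomorphic to the identity. -/
noncomputable def unitUnitInv : unit m C D ≫ unitInv m C D ≅ 𝟙 _ :=
  Pseudofunctor.StrongTrans.isoMk (fun F => F.toExtendOfExtend) fun {F G} μ =>
    modif_ext fun x => idSwap_comp_idSwap (μ.app (qPoint _ x))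

/-- `unitInv` followed by `unit` is isomorphic to the identity. -/
noncomputable def unitInvUnit : unitInv m C D ≫ unit m C D ≅ 𝟙 _ :=
  Pseudofunctor.StrongTrans.isoMk (fun F => F.ofExtendToExtend) fun {F G} μ =>
    modif_ext fun x => idSwap_comp_idSwap (μ.app (qPoint _ x))

end MixedPseudofunctor

/-- The pointwise equations of 1-cells combine to one equation; after substituting it, each
component is the identity. -/
theorem Power.eq_eqToHom {ι : Type t} {X Y : Power ι D} {a b : X ⟶ Y} (s : a ⟶ b)
    (H : ∀ i, ∃ h, s i = eqToHom h) : ∃ h, s = eqToHom h := by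
  obtain rfl : a = b := funext fun i => (H i).1
  exact ⟨rfl, funext fun i => (H i).2⟩

variable (C D m)

/-- The components of the unit and its inverse are identities at the objects of `C`. The naturality
constraints and the modifications have composites of unitors of `D` as components. -/
theorem isVerticalEquivalence_unit [Strict D] :
    IsVerticalEquivalence (MixedPseudofunctor.toPower (D := D) (qPoint (C := C) (m + 2)))
      (MixedPseudofunctor.unit m C D) := by
  refine ⟨⟨fun F => ⟨rfl, rfl⟩, fun F G μ => ?_⟩, MixedPseudofunctor.unitInv m C D,
    ⟨fun F => ⟨rfl, rfl⟩, fun F G μ => ?_⟩,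
    ⟨MixedPseudofunctor.unitUnitInv m C D, fun F => ?_⟩,
    ⟨MixedPseudofunctor.unitInvUnit m C D, fun F => ?_⟩⟩
  · exact Power.eq_eqToHom _ fun x => idSwap_eq (μ.app (qPoint _ x))
  · exact Power.eq_eqToHom _ fun x => idSwap_eq (μ.app (qPoint _ x))
  · exact Power.eq_eqToHom _ fun x => leftUnitor_eq (𝟙 (F.obj (qPoint _ x)))
  · exact Power.eq_eqToHom _ fun x => leftUnitor_eq (𝟙 (F.obj (qPoint _ x)))

end Unit

/-! ### Naturality of comparisons on 2-cells -/

section Icons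

variable {D : Type u₂} [Bicategory.{w₂, v₂} D]

theorem icon_naturality {X Y : D} {f f' g g' : X ⟶ Y} (e : f ≅ f') (e' : g ≅ g') {s : f ⟶ g}
    {s' : f' ⟶ g'} (h : s ≫ e'.hom = e.hom ≫ s') :
    s ▷ 𝟙 Y ≫ (icon e').hom = (icon e).hom ≫ 𝟙 X ◁ s' := by
  simp [reassoc_of% h]

theorem iso_naturality_symm {X Y : D} {f f' g g' : X ⟶ Y} (e : f ≅ f') (e' : g ≅ g')
    {s : f ⟶ g} {s' : f' ⟶ g'} (h : s ≫ e'.hom = e.hom ≫ s') :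
    s' ≫ e'.symm.hom = e.symm.hom ≫ s := by
  simp [Iso.comp_inv_eq, h]

/-- Stated for arbitrary 2-cells so that it can be applied by `exact`, up to unfolding of the values
of `qObj` and its restriction. -/
theorem comp_assoc_five {X Y : D} {f₀ f₁ f₂ f₃ f₄ f₅ f₆ : X ⟶ Y} (a : f₀ ⟶ f₁) (b : f₁ ⟶ f₂)
    (c : f₂ ⟶ f₃) (d : f₃ ⟶ f₄) (e : f₄ ⟶ f₅) (g : f₅ ⟶ f₆) :
    (a ≫ b ≫ c ≫ d ≫ e) ≫ g = a ≫ b ≫ c ≫ d ≫ e ≫ g := by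
  simp only [Category.assoc]

end Icons

/-! ### The counit of the equivalence -/

section Counit

open NFoldCat

variable {n : ℕ} {C : Type u₁} [Bicategory.{w₁, v₁} C] [Strict C]
  {D : Type u₂} [Bicategory.{w₂, v₂} D] {k l : Fin n} (hkl : k < l)

namespace CategoryTheory.Pseudofunctor

variable (F : Pseudofunctor C D)

/-- The comparison of the two images of equal morphisms. -/
def mapEq {X Y : C} {f g : X ⟶ Y} (h : f = g) : F.map f ≅ F.map g := eqToIso (by rw [h])

theorem mapEq_rfl {X Y : C} (f : X ⟶ Y) : F.mapEq (rfl : f = f) = Iso.refl _ := rfl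

theorem mapEq_mapIdOf {X : C} {e : X ⟶ X} (h : e = 𝟙 X) :
    (F.mapEq h).hom ≫ (F.mapId X).hom = (mapIdOf F h).hom := by
  subst h
  rw [mapIdOf_rfl, mapEq_rfl, Iso.refl_hom, Category.id_comp]

theorem mapEq_mapCompOf {X Y Z : C} {f f' : X ⟶ Y} {g g' : Y ⟶ Z} {e : X ⟶ Z} (hf : f = f')
    (hg : g = g') (he : e = f' ≫ g') (h : e = f ≫ g) :
    (F.mapEq he).hom ≫ (F.mapComp f' g').hom =
      (mapCompOf F h).hom ≫ F.map f ◁ (F.mapEq hg).hom ≫ (F.mapEq hf).hom ▷ F.map g' := by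
  subst hf hg he
  simp [mapCompOf_rfl, mapEq_rfl]

theorem mapEq_naturality {G : Pseudofunctor C D} (μ : F ⟶ G) {X Y : C} {f g : X ⟶ Y} (h : f = g) :
    (F.mapEq h).hom ▷ μ.app Y ≫ (μ.naturality g).hom =
      (μ.naturality f).hom ≫ μ.app X ◁ (G.mapEq h).hom := by
  subst h
  simp [mapEq_rfl]

/-- After substitution `s` is the 2-cell of the square with vertical identities on `σ`, and its
image is `F.map₂ σ` surrounded by unit constraints. The heterogeneous hypothesis accommodates edges
that equal `f'`, `g'` and identities only propositionally. -/
theorem mapSq_mapEq {X Y : C} {f f' g g' : X ⟶ Y} {i : X ⟶ X} {j : Y ⟶ Y} (hf : f = f')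
    (hg : g = g') (hi : i = 𝟙 X) (hj : j = 𝟙 Y) {s : i ≫ f ⟶ g ≫ j} {σ : f' ⟶ g'}
    (h : HEq s (((λ_ f').hom ≫ σ) ≫ (ρ_ g').inv)) :
    (λ_ _).inv ≫ (mapIdOf F hi).inv ▷ F.map f ≫ mapSq F s ≫ F.map g ◁ (mapIdOf F hj).hom ≫
      (ρ_ _).hom ≫ (F.mapEq hg).hom = (F.mapEq hf).hom ≫ F.map₂ σ := by
  subst hf hg hi hj
  obtain rfl := eq_of_heq h
  simp [mapIdOf_rfl, mapEq_rfl, mapSq, F.map₂_left_unitor, map₂_right_inv]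

theorem mixed_mapIdOf {X : (Qn n C).Ob} {e : (Qn n C).Edge k X X} (h : e = Edge.id k X) :
    (qObj F n).mapIdOf h = mapIdOf F (by rw [h, edgeHom_id]) := by
  subst h
  exact MixedPseudofunctor.mapIdOf_rfl _ _ _

theorem mixed_mapCompOf {X Y Z : (Qn n C).Ob} {f : (Qn n C).Edge k X Y}
    {g : (Qn n C).Edge k Y Z} {e : (Qn n C).Edge k X Z} (h : e = f.comp g) :
    (qObj F n).mapCompOf h = mapCompOf F (by rw [h, edgeHom_comp]) := by
  subst h
  exact MixedPseudofunctor.mapCompOf_rfl _ _ _ _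

/-- The restriction of `Q F` to the direction `k`. -/
noncomputable abbrev restricted : Pseudofunctor C D := (qObj F n).cubical.toPseudofunctor hkl

/-- The comparison of the restriction of `Q F` with `F` on a morphism. -/
noncomputable def restrictedIso {X Y : C} (f : X ⟶ Y) : (F.restricted hkl).map f ≅ F.map f :=
  F.mapEq (edgeHom_mkEdge k f)

theorem restrictedIso_id (X : C) : (F.restrictedIso hkl (𝟙 X)).hom ≫ (F.mapId X).hom =
    ((F.restricted hkl).mapId X).hom := by
  refine (F.mapEq_mapIdOf (edgeHom_mkEdge k (𝟙 X))).trans ?_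
  exact congrArg Iso.hom (F.mixed_mapIdOf (mkEdge_id k X)).symm

theorem restrictedIso_comp {X Y Z : C} (f : X ⟶ Y) (g : Y ⟶ Z) :
    (F.restrictedIso hkl (f ≫ g)).hom ≫ (F.mapComp f g).hom =
      ((F.restricted hkl).mapComp f g).hom ≫ (F.restricted hkl).map f ◁ (F.restrictedIso hkl g).hom ≫
        (F.restrictedIso hkl f).hom ▷ F.map g := by
  have h : ((F.restricted hkl).mapComp f g).hom = (mapCompOf F _).hom :=
    congrArg Iso.hom (F.mixed_mapCompOf (mkEdge_comp k f g))
  rw [h]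
  exact F.mapEq_mapCompOf (edgeHom_mkEdge k f) (edgeHom_mkEdge k g) (edgeHom_mkEdge k (f ≫ g)) _

/-- The action of the restriction on `σ` is the image under `F` of the square with vertical
identities on `σ`, with the unit constraints removed, so `mapSq_mapEq` returns `F.map₂ σ`. -/
theorem restrictedIso_naturality {X Y : C} {f g : X ⟶ Y} (σ : f ⟶ g) :
    (F.restricted hkl).map₂ σ ≫ (F.restrictedIso hkl g).hom =
      (F.restrictedIso hkl f).hom ≫ F.map₂ σ := by
  have h := F.mapSq_mapEq (edgeHom_mkEdge k f) (edgeHom_mkEdge k g) (edgeHom_mkEdge l (𝟙 X))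
    (edgeHom_mkEdge l (𝟙 Y))
    -- This is the square from which `Cubical.map₂` is defined.
    (exists_isSquare hkl ⟨g, 𝟙 X, f, 𝟙 Y, ((λ_ f).hom ≫ σ) ≫ (ρ_ g).inv⟩).2
  have e (X : C) : (qObj F n).cubical.mapId l (rfl : 𝟙 X = 𝟙 X) =
    mapIdOf F (edgeHom_mkEdge l (𝟙 X)) := F.mixed_mapIdOf (mkEdge_id l X)
  refine Eq.trans ?_ h
  change (qObj F n).cubical.map₂ hkl σ ≫ _ = _
  rw [Cubical.map₂, Cubical.red, e, e]
  exact comp_assoc_five _ _ _ _ _ _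

/-- The comparison of the restriction of `Q F` with `F`. -/
noncomputable def ofRestricted : F.restricted hkl ⟶ F where
  app X := 𝟙 (F.obj X)
  naturality f := icon (F.restrictedIso hkl f)
  naturality_naturality σ := icon_naturality _ _ (F.restrictedIso_naturality hkl σ)
  naturality_id X := icon_id _ (F.restrictedIso_id hkl X)
  naturality_comp f g := icon_comp _ _ _ (F.restrictedIso_comp hkl f g)

/-- The comparison of `F` with the restriction of `Q F`. -/
noncomputable def toRestricted : F ⟶ F.restricted hkl where
  app X := 𝟙 (F.obj X)
  naturality f := icon (F.restrictedIso hkl f).symm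
  naturality_naturality σ := icon_naturality _ _
    (iso_naturality_symm _ _ (F.restrictedIso_naturality hkl σ))
  naturality_id X := icon_id_symm _ (F.restrictedIso_id hkl X)
  naturality_comp f g := icon_comp_symm _ _ _ (F.restrictedIso_comp hkl f g)

variable {F} {G : Pseudofunctor C D} (μ : F ⟶ G)

/-- The restriction of `Q μ` to the direction `k`. -/
noncomputable abbrev restrictedHom : F.restricted hkl ⟶ G.restricted hkl :=
  restrictHom hkl (qMap n μ)

/-- The compatibility of `ofRestricted` with a transformation. -/
noncomputable def ofRestrictedNaturality :
    restrictedHom hkl μ ≫ G.ofRestricted hkl ≅ F.ofRestricted hkl ≫ μ :=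
  StrongTrans.isoMk (fun X => idSwap (μ.app X)) fun f =>
    idSwap_icon (F.restrictedIso hkl f) (G.restrictedIso hkl f)
      (F.mapEq_naturality μ (edgeHom_mkEdge k f))

/-- The compatibility of `toRestricted` with a transformation. -/
noncomputable def toRestrictedNaturality :
    μ ≫ G.toRestricted hkl ≅ F.toRestricted hkl ≫ restrictedHom hkl μ :=
  StrongTrans.isoMk (fun X => idSwap (μ.app X)) fun f =>
    idSwap_icon (F.restrictedIso hkl f).symm (G.restrictedIso hkl f).symm
      (inv_whisker_eq (F.mapEq_naturality μ (edgeHom_mkEdge k f)))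

variable (F)

/-- `ofRestricted` followed by `toRestricted` is isomorphic to the identity. -/
noncomputable def ofRestrictedToRestricted : F.ofRestricted hkl ≫ F.toRestricted hkl ≅ 𝟙 _ :=
  StrongTrans.isoMk (fun X => λ_ (𝟙 (F.obj X))) fun f => icon_comp_icon_symm (F.restrictedIso hkl f)

/-- `toRestricted` followed by `ofRestricted` is isomorphic to the identity. -/
noncomputable def toRestrictedOfRestricted : F.toRestricted hkl ≫ F.ofRestricted hkl ≅ 𝟙 _ :=
  StrongTrans.isoMk (fun X => λ_ (𝟙 (F.obj X))) fun f =>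
    icon_comp_icon_symm (F.restrictedIso hkl f).symm

theorem modif_ext {F G : Pseudofunctor C D} {μ ν : F ⟶ G} {Γ Γ' : μ ⟶ ν}
    (h : ∀ x, Γ.as.app x = Γ'.as.app x) : Γ = Γ' := by
  ext x
  exact h x

theorem iso_app_congr {F G : Pseudofunctor C D} {μ ν : F ⟶ G} {e e' : μ ≅ ν} (h : e = e')
    (x : C) : e.hom.as.app x = e'.hom.as.app x := by
  rw [h]

variable (C D)

/-- The counit of the equivalence, from the restriction of `Q F` to `F`. -/
noncomputable def counit : ((qFunctor C D n).comp (restrict C D hkl)).toPseudofunctor ⟶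
    (StrictPseudofunctor.id (Pseudofunctor C D)).toPseudofunctor where
  app F := F.ofRestricted hkl
  naturality μ := ofRestrictedNaturality hkl μ
  naturality_naturality Γ := modif_ext fun x => idSwap_naturality (Γ.as.app x)
  naturality_id F := modif_ext fun x => idSwap_id (F.obj x)
    (iso_app_congr
      (((qFunctor C D n).comp (restrict C D hkl)).mapId_eq_eqToIso F) x) rfl
  naturality_comp μ ν := modif_ext fun x => idSwap_comp (μ.app x) (ν.app x)
    (iso_app_congr
      (((qFunctor C D n).comp (restrict C D hkl)).mapComp_eq_eqToIso μ ν) x) rfl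

/-- The inverse of the counit of the equivalence. -/
noncomputable def counitInv : (StrictPseudofunctor.id (Pseudofunctor C D)).toPseudofunctor ⟶
    ((qFunctor C D n).comp (restrict C D hkl)).toPseudofunctor where
  app F := F.toRestricted hkl
  naturality μ := toRestrictedNaturality hkl μ
  naturality_naturality Γ := modif_ext fun x => idSwap_naturality (Γ.as.app x)
  naturality_id F := modif_ext fun x => idSwap_id (F.obj x) rfl
    (iso_app_congr
      (((qFunctor C D n).comp (restrict C D hkl)).mapId_eq_eqToIso F) x)
  naturality_comp μ ν := modif_ext fun x => idSwap_comp (μ.app x) (ν.app x) rfl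
    (iso_app_congr
      (((qFunctor C D n).comp (restrict C D hkl)).mapComp_eq_eqToIso μ ν) x)

/-- `counit` followed by `counitInv` is isomorphic to the identity. -/
noncomputable def counitCounitInv : counit C D hkl ≫ counitInv C D hkl ≅ 𝟙 _ :=
  StrongTrans.isoMk (fun F => F.ofRestrictedToRestricted hkl) fun {F G} μ =>
    modif_ext fun x => idSwap_comp_idSwap (μ.app x)

/-- `counitInv` followed by `counit` is isomorphic to the identity. -/
noncomputable def counitInvCounit : counitInv C D hkl ≫ counit C D hkl ≅ 𝟙 _ :=
  StrongTrans.isoMk (fun F => F.toRestrictedOfRestricted hkl) fun {F G} μ =>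
    modif_ext fun x => idSwap_comp_idSwap (μ.app x)

end CategoryTheory.Pseudofunctor

variable (C D)

/-- As for the unit, all components are identities, and the constraints and modifications have
composites of unitors of `D` as components. -/
theorem isVerticalEquivalence_counit [Strict D] :
    IsVerticalEquivalence (toPower C D) (Pseudofunctor.counit C D hkl) := by
  refine ⟨⟨fun F => ⟨rfl, rfl⟩, fun F G μ => ?_⟩, Pseudofunctor.counitInv C D hkl,
    ⟨fun F => ⟨rfl, rfl⟩, fun F G μ => ?_⟩,
    ⟨Pseudofunctor.counitCounitInv C D hkl, fun F => ?_⟩,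
    ⟨Pseudofunctor.counitInvCounit C D hkl, fun F => ?_⟩⟩
  · exact Power.eq_eqToHom _ fun x => idSwap_eq (μ.app x)
  · exact Power.eq_eqToHom _ fun x => idSwap_eq (μ.app x)
  · exact Power.eq_eqToHom _ fun x => leftUnitor_eq (𝟙 (F.obj x))
  · exact Power.eq_eqToHom _ fun x => leftUnitor_eq (𝟙 (F.obj x))

end Counit

theorem mainTheorem8 {C : Type u₁} [Bicategory.{w₁, v₁} C] [Bicategory.Strict C]
    {D : Type u₂} [Bicategory.{w₂, v₂} D] [Bicategory.Strict D] (n : ℕ) (hn : 2 ≤ n) :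
    IsOverEquivalence (toPower C D) (MixedPseudofunctor.toPower (qPoint n)) (qFunctor C D n) := by
  -- The bound on `n` provides two directions `0 < 1`: the first carries the morphisms of the
  -- restriction, and squares in both carry its 2-cells.
  obtain ⟨m, rfl⟩ : ∃ m, n = m + 2 := ⟨n - 2, by omega⟩
  exact ⟨qFunctor_comp_toPower C D (m + 2), restrict C D Fin.zero_lt_one,
    restrict_comp_toPower C D Fin.zero_lt_one, ⟨_, isVerticalEquivalence_unit m C D⟩,
    ⟨_, isVerticalEquivalence_counit C D Fin.zero_lt_one⟩⟩
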